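/- **Setting.** Let $K$ be a two-dimensional local field with finite last residue field $\mathbb F_q$: $K$ is a complete discrete valuation field with valuation ring $\mathcal O_K$, uniformizer $t_K$ and valuation $\nu_K$, and its residue field $\bar K$ is a complete discrete valuation field (with valuation $\nu_{\bar K}$) whose residue field is $\mathbb F_q$. Let $K$ carry its natural topology. Only the following properties of this topology are used, and the result holds for every topology on $K$ with them: $(K,+)$ is a topological group, $x\mapsto ax$ is continuous for every $a\in K$, $\mathcal O_K$ is closed in $K$, the groups $\mathcal O_K/a\mathcal O_K$ ($0\ne a\in\mathcal O_K$) with the quotient topology are locally compact, and the quotient topology on $\bar K$ is the topology of its discrete valuation. For $l\ge 1$ let $\mathbb C_0=GL_l(\mathcal O_K)$ and $\mathbb C_m=1+t_K^mM_l(\mathcal O_K)$ for $m\ge 1$, subgroups of $GL_l(K)$. **Group actions on categories.** An action of a group $G$ on a $k$-linear category $\mathcal B$ consists of $k$-linear functors $\tau(g):\mathcal B\to\mathcal B$ ($g\in G$), isomorphisms $\psi_{g,h}:\tau(g)\tau(h)\Rightarrow\tau(gh)$ satisfying the associativity condition and an isomorphism $\psi_1:\tau(1)\Rightarrow\mathrm{Id}$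 with $\psi_{1,g}=\psi_1\circ\tau(g)$, $\psi_{g,1}=\tau(g)\circ\psi_1$. The category $\mathcal B^G$ of $G$-equivariant objects has as objects the pairs $(E,\theta)$ of an object $E$ and isomorphisms $\theta_g:E\to\tau(g)(E)$ ($g \in G$) with $\psi_{g,h,E}\circ\tau(g)(\theta_h)\circ\theta_g=\theta_{gh}$; a morphism $(E,\theta)\to(D,\vartheta)$ is a morphism $f:E\to D$ with $\tau(g)(f)\,\theta_g=\vartheta_g f$ for all $g$. A $G$-linear functor $\mathcal B\to\mathcal C$ is a $k$-linear functor $T$ with isomorphisms $\varepsilon_g:T\circ\tau_{\mathcal B}(g)\Rightarrow\tau_{\mathcal C}(g)\circ T$ compatible with $\psi$ and $\psi_1$. An action of $GL_l(K)$ on a $k$-linear abelian category $\mathcal B$ is called smooth if for every morphism $f:E\to D$ in $\mathcal B$ there are $m\ge 0$ and $\mathbb C_m$-equivariant structures on $E$ and on $D$ such that $f$ is a morphism of $\mathbb C_m$-equivariant objects. $\mathrm{Vect}^{\rm fin}_{\mathbb C}$ denotes the category of finite-dimensional complex vector spaces. If $1\to A\to E\to G\to 1$ is a central extension with projection $\pi: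 E\to G$, and $\chi:A\to\mathbb C^*$ is a character, then the lines $L_g=\pi^{-1}(g)\times_{\chi}\mathbb C$ (the quotient of $\pi^{-1}(g)\times\mathbb C$ by $(ax,z)\sim(x,\chi(a)z)$) with the isomorphisms $L_g\otimes L_h\cong L_{gh}$ given by the product of $E$ define an action of $G$ on $\mathrm{Vect}^{\rm fin}_{\mathbb C}$: $g$ acts by $Y\mapsto L_g\otimes_{\mathbb C} Y$. **The central extension by $\mathbb R_+^*$.** For lattices $N\subset\Lambda$ of the form $g\mathcal O_K^2$ ($g\in GL_2(K)$) let $\mu(N\mid\Lambda)$ be the $\mathbb R_+^*$-torsor of nonzero Haar measures on the locally compact group $\Lambda/N$. It is extended to all pairs of lattices by $\mu(\Lambda_1\mid\Lambda_2)\otimes\mu(\Lambda_2\mid\Lambda_3)=\mu(\Lambda_1\mid\Lambda_3)$, and $GL_2(K)$ acts on these torsors. Let $\widetilde{GL_2(K)}$ be the group of all pairs $(g,\mu)$ with $g\in GL_2(K)$, $\mu\in\mu(\mathcal O_K^2\mid g\mathcal O_K^2)$, with the product $(g_1,\mu_1)(g_2,\mu_2)=(g_1g_2,\mu_1\otimes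 g_1(\mu_2))$. Let $K^*$ be embedded in $GL_2(K)$ by $u\mapsto\mathrm{diag}(u,1)$; it acts by inner automorphisms of $\widetilde{GL_2(K)}$ on the preimage $\widetilde{SL_2(K)}$ of $SL_2(K)$. Put $\widehat{GL_2(K)}_{\mathbb R_+^*}=\widetilde{SL_2(K)}\rtimes K^*$, a central extension $1\to\mathbb R_+^*\to\widehat{GL_2(K)}_{\mathbb R_+^*}\xrightarrow{\pi}GL_2(K)\to 1$. For $g\in GL_2(K)$ and $b\in\mathbb C$ let $(A_g)^b$ be the complex line $L_g$ defined as above by this extension and the character $x\mapsto x^b$ of $\mathbb R_+^*$. **The category $\mathcal V_{a_1,\dots,a_n}$.** Let $n\ge 1$, $(a_1,\dots,a_n)\in\mathbb C^n/\bigl(\tfrac{2\pi i}{\ln q}\bigr)\mathbb Z^n$ (represented by any element of $\mathbb C^n$), and let $P\subset GL_{2n}(K)$ be the subgroup of block upper triangular matrices with diagonal blocks $g_1,\dots,g_n\in GL_2(K)$. $P$ acts on $\mathrm{Vect}^{\rm fin}_{\mathbb C}$ by $$\tau(g)(Y)=(A_{g_1})^{a_1}\otimes_{\mathbb C}\cdots\otimes_{\mathbb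 C}(A_{g_n})^{a_n}\otimes_{\mathbb C}Y .$$ For $m\ge 0$ let $\mathcal V_m=\prod_{GL_{2n}(K)/\mathbb C_m}\mathrm{Vect}^{\rm fin}_{\mathbb C}$ be the category of families $f$ of finite-dimensional complex vector spaces indexed by $GL_{2n}(K)/\mathbb C_m$, with the action of $P$ given by $\xi(p)(f)(x)=\tau(p)(f(p^{-1}x))$. Pull-back along $GL_{2n}(K)/\mathbb C_{m_2}\to GL_{2n}(K)/\mathbb C_{m_1}$ gives functors $Q_{m_1,m_2}:(\mathcal V_{m_1})^P\to(\mathcal V_{m_2})^P$ for $m_1\le m_2$. Let $\mathcal V_{a_1,\dots,a_n}=\varinjlim_m(\mathcal V_m)^P$ be the 2-colimit: its objects are the pairs $(m,f)$ with $f\in(\mathcal V_m)^P$, and $$\mathrm{Hom}((m_1,f_1),(m_2,f_2))=\varinjlim_{m\ge\max(m_1,m_2)}\mathrm{Hom}_{(\mathcal V_m)^P}(Q_{m_1,m}f_1,Q_{m_2,m}f_2).$$ The group $GL_{2n}(K)$ acts on $\mathcal V_{a_1,\dots,a_n}$ by right translations: $\sigma(g)(m,f)=(l,\,x\mapsto f(xg))$,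 where $l\ge 0$ is the smallest integer with $\mathbb C_l\subset g\,\mathbb C_m\,g^{-1}$, the isomorphisms of the $P$-equivariant structure being translated in the same way. **The action defined by an unramified character.** Let $1\to K_2(K)\to\mathrm{St}(K)\to SL(K)\to 1$ be the Steinberg extension, $SL(K)=\varinjlim_n SL_n(K)$. Its pull-back to $SL_2(K)$ carries the lift of the conjugation action of $K^*$ (embedded by $u\mapsto\mathrm{diag}(u,1)$), and the semidirect product with $K^*$ is a central extension $1\to K_2(K)\to\widehat{GL_2(K)}\to GL_2(K)\to 1$; the symbol $(x,y)\in K_2(K)$ is the commutator of arbitrary lifts of $\mathrm{diag}(y,1)$ and $\mathrm{diag}(1,x)$. Let $\nu_K(x,y)=\nu_{\bar K}\bigl(\overline{x^{\nu_K(y)}/y^{\nu_K(x)}}\bigr)$ for $x,y\in K^*$. For $a\in\mathbb C/\tfrac{2\pi i}{\ln q}\mathbb Z$ let $\chi_a:K_2(K)\to\mathbb C^*$ be the character with $\chi_a((x,y))=q^{-a\,\nu_K(x,y)}$ for all $x,y\in K^*$; it corresponds to the unramified character $\mathrm{Fr}\mapsto q^{-a}$ of the Weil group under the reciprocity map $(x,y)\mapsto\mathrm{Fr}^{\nu_K(x,y)}$.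 Then $GL_2(K)$ acts on $\mathrm{Vect}^{\rm fin}_{\mathbb C}$ through the lines defined by $\widehat{GL_2(K)}$ and $\chi_a$. **Theorem 2.** 1. For all $n\ge 1$ and $(a_1,\dots,a_n)$, the $\mathbb C$-linear category $\mathcal V_{a_1,\dots,a_n}$ is abelian, and the action $\sigma$ of $GL_{2n}(K)$ on it is smooth. 2. The $\mathbb C$-linear category $(\mathcal V_{a_1,\dots,a_n})^{GL_{2n}(\mathcal O_K)}$ of $GL_{2n}(\mathcal O_K)$-equivariant objects is abelian and contains a full subcategory that is equivalent, as a $\mathbb C$-linear category, to $\mathrm{Vect}^{\rm fin}_{\mathbb C}$. 3. Let $n=1$ and $a_1\in\mathbb C/\tfrac{2\pi i}{\ln q}\mathbb Z$. The character $\chi_{a_1}$ exists, and there is a $GL_2(K)$-linear functor $(T,\varepsilon)$ from $\mathrm{Vect}^{\rm fin}_{\mathbb C}$, with the action of $GL_2(K)$ defined by $\chi_{a_1}$, to $\mathcal V_{a_1}$, with the action $\sigma$, such that $T$ is fully faithful. -/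

import Mathlib

open CategoryTheory

universe w v u v' u'

namespace TwoDim

/-- An action of a group on a `k`-linear category: `k`-linear functors `τ g`, coherent
isomorphisms `τ g ∘ τ h ≅ τ (g h)` and an isomorphism `τ 1 ≅ Id`.  (The isomorphism
`ψ` is indexed by triples with `g * h = l`, which only means that the target `τ (g * h)` may be
written as `τ l`; recall that `τ h ⋙ τ g` is the composite "first `τ h`, then `τ g`".) -/
structure GAction (k : Type*) [Field k] (G : Type*) [Group G] (B : Type u) [Category.{v} B]
    [Preadditive B] [Linear k B] where
  τ : G → B ⥤ B
  additive : ∀ g, (τ g).Additive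
  linear : ∀ g, (τ g).Linear k
  ψ : ∀ {g h l : G}, g * h = l → (τ h ⋙ τ g ≅ τ l)
  ψ₁ : τ 1 ≅ 𝟭 B
  assoc : ∀ {g h m gh hm ghm : G} (e₁ : g * h = gh) (e₂ : gh * m = ghm) (e₃ : h * m = hm)
    (e₄ : g * hm = ghm) (E : B),
    (ψ e₁).hom.app ((τ m).obj E) ≫ (ψ e₂).hom.app E =
      (τ g).map ((ψ e₃).hom.app E) ≫ (ψ e₄).hom.app E
  unit_left : ∀ (g : G) (E : B), (ψ (one_mul g)).hom.app E = ψ₁.hom.app ((τ g).obj E)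
  unit_right : ∀ (g : G) (E : B), (ψ (mul_one g)).hom.app E = (τ g).map (ψ₁.hom.app E)

attribute [instance] GAction.additive GAction.linear

section Action

variable {k : Type*} [Field k] {G : Type*} [Group G]
  {B : Type u} [Category.{v} B] [Preadditive B] [Linear k B]
  {C : Type u'} [Category.{v'} C] [Preadditive C] [Linear k C]

/-- Restriction of an action along a group homomorphism (for instance to a subgroup). -/
def GAction.comap {H : Type*} [Group H] (α : GAction k G B) (f : H →* G) : GAction k H B where
  τ h := α.τ (f h)
  additive h := α.additive (f h)
  linear h := α.linear (f h)
  ψ {g h l} e := α.ψ (by rw [← map_mul, e])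
  ψ₁ := eqToIso (by rw [map_one]) ≪≫ α.ψ₁
  assoc _ _ _ _ E := α.assoc _ _ _ _ E
  unit_left g E := by
    have key : ∀ (a : G) (ha : a = 1) (b : G) (e : a * b = b) (p : α.τ a = α.τ 1),
        (α.ψ e).hom.app E = (eqToIso p ≪≫ α.ψ₁).hom.app ((α.τ b).obj E) := by
      rintro a rfl b e p
      simpa using α.unit_left b E
    exact key _ (map_one f) _ _ _
  unit_right g E := by
    have key : ∀ (a : G) (ha : a = 1) (b : G) (e : b * a = b) (p : α.τ a = α.τ 1),
        (α.ψ e).hom.app E = (α.τ b).map ((eqToIso p ≪≫ α.ψ₁).hom.app E) := by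
      rintro a rfl b e p
      simpa using α.unit_right b E
    exact key _ (map_one f) _ _ _

/-- A `G`-linear functor between `k`-linear categories with an action of `G`. -/
structure GLinearFunctor (α : GAction k G B) (β : GAction k G C) where
  T : B ⥤ C
  additive : T.Additive
  linear : T.Linear k
  ε : ∀ g : G, α.τ g ⋙ T ≅ T ⋙ β.τ g
  ε_mul : ∀ {g h l : G} (e : g * h = l) (E : B),
    T.map ((α.ψ e).hom.app E) ≫ (ε l).hom.app E =
      (ε g).hom.app ((α.τ h).obj E) ≫ (β.τ g).map ((ε h).hom.app E) ≫
        (β.ψ e).hom.app (T.obj E)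
  ε_one : ∀ E : B, (ε 1).hom.app E ≫ β.ψ₁.hom.app (T.obj E) = T.map (α.ψ₁.hom.app E)

attribute [instance] GLinearFunctor.additive GLinearFunctor.linear

/-- The objects of the category of `G`-equivariant objects `B^G`. -/
structure GAction.Equivariant (α : GAction k G B) where
  obj : B
  θ : ∀ g : G, obj ≅ (α.τ g).obj obj
  comm : ∀ {g h l : G} (e : g * h = l),
    (θ g).hom ≫ (α.τ g).map (θ h).hom ≫ (α.ψ e).hom.app obj = (θ l).hom

namespace GAction

variable {α : GAction k G B} {β : GAction k G C}

/-- The `k`-space of morphisms of equivariant objects `E ⟶ D`: the morphisms `f` of the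
underlying objects with `τ g (f) ∘ θ g = ϑ g ∘ f` for all `g`. -/
def Equivariant.homSubmodule (E D : α.Equivariant) : Submodule k (E.obj ⟶ D.obj) where
  carrier := {f | ∀ g : G, (E.θ g).hom ≫ (α.τ g).map f = f ≫ (D.θ g).hom}
  add_mem' {a b} ha hb g := by
    simp only [Set.mem_ofPred_eq] at ha hb
    rw [Functor.map_add, Preadditive.comp_add, Preadditive.add_comp, ha g, hb g]
  zero_mem' g := by simp
  smul_mem' c f hf g := by
    simp only [Set.mem_ofPred_eq] at hf
    rw [Functor.map_smul, Linear.comp_smul, Linear.smul_comp, hf g]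

instance : Category.{v} α.Equivariant where
  Hom E D := E.homSubmodule D
  id E := ⟨𝟙 E.obj, fun g => by simp⟩
  comp {E D F} f f' := ⟨f.1 ≫ f'.1, fun g => by
    have h1 := f.2 g
    have h2 := f'.2 g
    rw [Functor.map_comp, reassoc_of% h1, h2, Category.assoc]⟩
  id_comp f := Subtype.ext (Category.id_comp _)
  comp_id f := Subtype.ext (Category.comp_id _)
  assoc f g h := Subtype.ext (Category.assoc _ _ _)

instance (E D : α.Equivariant) : AddCommGroup (E ⟶ D) :=
  inferInstanceAs (AddCommGroup (E.homSubmodule D))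

instance (E D : α.Equivariant) : Module k (E ⟶ D) :=
  inferInstanceAs (Module k (E.homSubmodule D))

instance : Preadditive α.Equivariant where
  add_comp _ _ _ _ _ _ := Subtype.ext (Preadditive.add_comp _ _ _ _ _ _)
  comp_add _ _ _ _ _ _ := Subtype.ext (Preadditive.comp_add _ _ _ _ _ _)

instance : Linear k α.Equivariant where
  smul_comp _ _ _ _ _ _ := Subtype.ext (Linear.smul_comp _ _ _ _ _ _)
  comp_smul _ _ _ _ _ _ := Subtype.ext (Linear.comp_smul _ _ _ _ _ _)

theorem Equivariant.hom_ext {E D : α.Equivariant} {f g : E ⟶ D} (h : f.1 = g.1) : f = g :=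
  Subtype.ext h

@[simp] theorem Equivariant.comp_val {E D F : α.Equivariant} (f : E ⟶ D) (g : D ⟶ F) :
    (f ≫ g).1 = f.1 ≫ g.1 := rfl

@[simp] theorem Equivariant.id_val (E : α.Equivariant) : (𝟙 E : E ⟶ E).1 = 𝟙 E.obj := rfl

end GAction

/-- The functor `B^G ⥤ C^G` induced by a `G`-linear functor from `B` to `C`. -/
def GLinearFunctor.onEquivariant {α : GAction k G B} {β : GAction k G C}
    (F : GLinearFunctor α β) : α.Equivariant ⥤ β.Equivariant where
  obj E :=
    { obj := F.T.obj E.obj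
      θ := fun g => F.T.mapIso (E.θ g) ≪≫ (F.ε g).app E.obj
      comm := fun {g h l} e => by
        have h1 := F.ε_mul e E.obj
        have h2 := (F.ε g).hom.naturality (E.θ h).hom
        have h3 := E.comm e
        simp only [Functor.comp_map] at h2
        simp only [Iso.trans_hom, Functor.mapIso_hom, Iso.app_hom, Functor.map_comp,
          Category.assoc, ← h3]
        rw [h1, reassoc_of% h2] }
  map {E D} f := ⟨F.T.map f.1, fun g => by
    have h1 := f.2 g
    have h2 := (F.ε g).hom.naturality f.1
    simp only [Functor.comp_map] at h2
    simp only [Iso.trans_hom, Functor.mapIso_hom, Iso.app_hom, Category.assoc]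
    rw [← h2, ← Functor.map_comp_assoc, h1, Functor.map_comp_assoc]⟩
  map_id E := Subtype.ext (F.T.map_id _)
  map_comp f g := Subtype.ext (F.T.map_comp _ _)

end Action

/-! ### Families of objects -/

/-- The objects of the category `∏_{x ∈ X} B`: families of objects of `B` indexed by `X`. -/
structure Fam (X : Type w) (B : Type u) where
  fam : X → B

namespace Fam

variable {X : Type w} {Y : Type w} {Z : Type w} {B : Type u} [Category.{v} B]

/-- Morphisms of families are families of morphisms. -/
@[ext] structure Hom (f g : Fam X B) where
  app : ∀ x : X, f.fam x ⟶ g.fam x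

instance : Category.{max w v} (Fam X B) where
  Hom f g := Fam.Hom f g
  id f := ⟨fun x => 𝟙 (f.fam x)⟩
  comp φ χ := ⟨fun x => φ.app x ≫ χ.app x⟩

@[ext] theorem hom_ext {f g : Fam X B} {φ χ : f ⟶ g} (h : ∀ x, φ.app x = χ.app x) : φ = χ :=
  Hom.ext (funext h)

@[simp] theorem comp_app {f g h : Fam X B} (φ : f ⟶ g) (χ : g ⟶ h) (x : X) :
    (φ ≫ χ).app x = φ.app x ≫ χ.app x := rfl

@[simp] theorem id_app (f : Fam X B) (x : X) : (𝟙 f : f ⟶ f).app x = 𝟙 (f.fam x) := rfl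

/-- The identification of the members of a family at equal indices. -/
def tr (f : X → B) {x y : X} (h : x = y) : f x ⟶ f y := eqToHom (congrArg f h)

theorem tr_rfl (f : X → B) {x : X} (h : x = x) : tr f h = 𝟙 (f x) := rfl

@[simp] theorem tr_tr (f : X → B) {x y z : X} (h : x = y) (h' : y = z) :
    tr f h ≫ tr f h' = tr f (h.trans h') := eqToHom_trans _ _

theorem tr_naturality {f g : X → B} (φ : ∀ x, f x ⟶ g x) {x y : X} (h : x = y) :
    tr f h ≫ φ y = φ x ≫ tr g h := by
  subst h; simp [tr]

theorem map_tr {C : Type u'} [Category.{v'} C] (F : B ⥤ C) (f : X → B) {x y : X} (h : x = y) :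
    tr (fun x => F.obj (f x)) h = F.map (tr f h) := by
  subst h; simp [tr]

theorem tr_comp (f : Y → B) (r : X → Y) {x y : X} (h : x = y) :
    tr (fun x => f (r x)) h = tr f (congrArg r h) := rfl

/-- `tr` as an isomorphism. -/
@[simps] def trIso (f : X → B) {x y : X} (h : x = y) : f x ≅ f y where
  hom := tr f h
  inv := tr f h.symm
  hom_inv_id := by simp [tr]
  inv_hom_id := by simp [tr]

/-- An isomorphism of families from isomorphisms of the members. -/
@[simps] def mkIso {f g : Fam X B} (e : ∀ x, f.fam x ≅ g.fam x) : f ≅ g where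
  hom := ⟨fun x => (e x).hom⟩
  inv := ⟨fun x => (e x).inv⟩
  hom_inv_id := by ext x; simp
  inv_hom_id := by ext x; simp

variable [Preadditive B] {k : Type*} [Field k] [Linear k B]

/-- Morphisms of families as functions. -/
def homEquiv (f g : Fam X B) : (f ⟶ g) ≃ (∀ x : X, f.fam x ⟶ g.fam x) where
  toFun φ := φ.app
  invFun a := ⟨a⟩

instance (f g : Fam X B) : AddCommGroup (f ⟶ g) := (homEquiv f g).addCommGroup

instance (f g : Fam X B) : Module k (f ⟶ g) := (homEquiv f g).module k

@[simp] theorem add_app {f g : Fam X B} (φ χ : f ⟶ g) (x : X) :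
    (φ + χ).app x = φ.app x + χ.app x := rfl

@[simp] theorem smul_app {f g : Fam X B} (c : k) (φ : f ⟶ g) (x : X) :
    (c • φ).app x = c • φ.app x := rfl

instance : Preadditive (Fam X B) where
  add_comp _ _ _ _ _ _ := by ext; simp
  comp_add _ _ _ _ _ _ := by ext; simp

instance : Linear k (Fam X B) where
  smul_comp _ _ _ _ _ _ := by ext; simp
  comp_smul _ _ _ _ _ _ := by ext; simp

end Fam

section FamAction

variable {k : Type*} [Field k] {P : Type*} [Group P]
  {B : Type u} [Category.{v} B] [Preadditive B] [Linear k B]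

open Fam

/-- Given an action of `P` on a category `B` and on a set `X`, the action of `P` on the
category of families: `ξ(p)(f)(x) = τ(p)(f(p⁻¹ x))`. -/
def GAction.onFam (α : GAction k P B) (X : Type w) [MulAction P X] :
    GAction k P (Fam X B) where
  τ p :=
    { obj := fun f => ⟨fun x => (α.τ p).obj (f.fam (p⁻¹ • x))⟩
      map := fun φ => ⟨fun x => (α.τ p).map (φ.app (p⁻¹ • x))⟩
      map_id := fun f => Fam.hom_ext fun x => (α.τ p).map_id _
      map_comp := fun φ χ => Fam.hom_ext fun x => (α.τ p).map_comp _ _ }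
  additive p := ⟨fun {_ _ _ _} => Fam.hom_ext fun x => (α.τ p).map_add⟩
  linear p := ⟨fun _ _ => Fam.hom_ext fun x => (α.τ p).map_smul _ _⟩
  ψ {g h l} e := NatIso.ofComponents
    (fun f => Fam.mkIso fun x => (α.ψ e).app (f.fam (h⁻¹ • g⁻¹ • x)) ≪≫
      (α.τ l).mapIso (trIso f.fam (by rw [← e, mul_inv_rev, mul_smul])))
    (fun {f f'} φ => Fam.hom_ext fun x => by
      have h1 := (α.ψ e).hom.naturality (φ.app (h⁻¹ • g⁻¹ • x))
      have q : h⁻¹ • g⁻¹ • x = l⁻¹ • x := by rw [← e, mul_inv_rev, mul_smul]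
      have h2 := tr_naturality φ.app q
      change (α.τ g).map ((α.τ h).map (φ.app _)) ≫ (α.ψ e).hom.app _ ≫ (α.τ l).map (tr f'.fam q) =
        ((α.ψ e).hom.app _ ≫ (α.τ l).map (tr f.fam q)) ≫ (α.τ l).map (φ.app _)
      rw [Category.assoc, ← Functor.map_comp, h2, Functor.map_comp]
      exact (reassoc_of% h1) _)
  ψ₁ := NatIso.ofComponents
    (fun f => Fam.mkIso fun x => α.ψ₁.app (f.fam ((1 : P)⁻¹ • x)) ≪≫ trIso f.fam (by simp))
    (fun {f f'} φ => Fam.hom_ext fun x => by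
      have h1 := α.ψ₁.hom.naturality (φ.app ((1 : P)⁻¹ • x))
      have q : (1 : P)⁻¹ • x = x := by simp
      have h2 := tr_naturality φ.app q
      change (α.τ 1).map (φ.app _) ≫ α.ψ₁.hom.app _ ≫ tr f'.fam q =
        (α.ψ₁.hom.app _ ≫ tr f.fam q) ≫ φ.app x
      rw [Category.assoc, h2]
      exact (reassoc_of% h1) _)
  assoc {g h m gh hm ghm} e₁ e₂ e₃ e₄ f := Fam.hom_ext fun x => by
    have h1 := α.assoc e₁ e₂ e₃ e₄ (f.fam (m⁻¹ • h⁻¹ • g⁻¹ • x))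
    have q : h⁻¹ • g⁻¹ • x = gh⁻¹ • x := by rw [← e₁, mul_inv_rev, mul_smul]
    have q' : m⁻¹ • h⁻¹ • g⁻¹ • x = hm⁻¹ • g⁻¹ • x := by rw [← e₃, mul_inv_rev, mul_smul]
    have q'' : m⁻¹ • gh⁻¹ • x = ghm⁻¹ • x := by rw [← e₂, mul_inv_rev, mul_smul]
    have q3 : hm⁻¹ • g⁻¹ • x = ghm⁻¹ • x := by rw [← e₄, mul_inv_rev, mul_smul]
    have h2 : (α.τ gh).map ((α.τ m).map (tr f.fam (congrArg (m⁻¹ • ·) q))) ≫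
        (α.ψ e₂).hom.app (f.fam (m⁻¹ • gh⁻¹ • x)) = _ :=
      (α.ψ e₂).hom.naturality (tr f.fam (congrArg (m⁻¹ • ·) q))
    have h3 : (α.τ g).map ((α.τ hm).map (tr f.fam q')) ≫
        (α.ψ e₄).hom.app (f.fam (hm⁻¹ • g⁻¹ • x)) = _ := (α.ψ e₄).hom.naturality (tr f.fam q')
    have h4 : tr (fun x => (α.τ m).obj (f.fam (m⁻¹ • x))) q
        = (α.τ m).map (tr f.fam (congrArg (m⁻¹ • ·) q)) := by
      rw [← map_tr]; rfl
    have key : ((α.ψ e₁).hom.app ((α.τ m).obj (f.fam (m⁻¹ • h⁻¹ • g⁻¹ • x))) ≫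
          (α.τ gh).map ((α.τ m).map (tr f.fam (congrArg (m⁻¹ • ·) q)))) ≫
          (α.ψ e₂).hom.app (f.fam (m⁻¹ • gh⁻¹ • x)) ≫ (α.τ ghm).map (tr f.fam q'') =
        (α.τ g).map ((α.ψ e₃).hom.app (f.fam (m⁻¹ • h⁻¹ • g⁻¹ • x)) ≫
          (α.τ hm).map (tr f.fam q')) ≫ (α.ψ e₄).hom.app (f.fam (hm⁻¹ • g⁻¹ • x)) ≫
          (α.τ ghm).map (tr f.fam q3) := by
      simp only [Category.assoc, Functor.map_comp]
      rw [reassoc_of% h2, reassoc_of% h3, reassoc_of% h1]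
      simp only [Functor.comp_obj]
      rw [← Functor.map_comp, ← Functor.map_comp, tr_tr, tr_tr]
    rw [← h4] at key
    exact key
  unit_left g f := Fam.hom_ext fun x => by
    have h1 := α.unit_left g (f.fam (g⁻¹ • (1 : P)⁻¹ • x))
    have q : (1 : P)⁻¹ • x = x := by simp
    have key : (α.ψ (one_mul g)).hom.app (f.fam (g⁻¹ • (1 : P)⁻¹ • x)) ≫
        (α.τ g).map (tr f.fam (congrArg (g⁻¹ • ·) q)) =
        α.ψ₁.hom.app ((α.τ g).obj (f.fam (g⁻¹ • (1 : P)⁻¹ • x))) ≫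
          tr (fun x => (α.τ g).obj (f.fam (g⁻¹ • x))) q := by
      rw [h1, ← map_tr]
      rfl
    exact key
  unit_right g f := Fam.hom_ext fun x => by
    have h1 := α.unit_right g (f.fam ((1 : P)⁻¹ • g⁻¹ • x))
    have q : (1 : P)⁻¹ • g⁻¹ • x = g⁻¹ • x := by simp
    have key : (α.ψ (mul_one g)).hom.app (f.fam ((1 : P)⁻¹ • g⁻¹ • x)) ≫
        (α.τ g).map (tr f.fam q) =
        (α.τ g).map (α.ψ₁.hom.app (f.fam ((1 : P)⁻¹ • g⁻¹ • x)) ≫ tr f.fam q) := by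
      rw [h1, Functor.map_comp]
    exact key

/-- Pull-back of families along a map of index sets. -/
def Fam.pull {X Y : Type w} (r : X → Y) : Fam Y B ⥤ Fam X B where
  obj f := ⟨fun x => f.fam (r x)⟩
  map φ := ⟨fun x => φ.app (r x)⟩

/-- Pull-back of families along a map of `P`-sets `r : X → Y` is a `P`-linear functor. -/
def GAction.pullFam (α : GAction k P B) {X Y : Type w} [MulAction P X] [MulAction P Y]
    (r : X →[P] Y) : GLinearFunctor (α.onFam Y) (α.onFam X) where
  T := Fam.pull r
  additive := ⟨rfl⟩
  linear := ⟨fun _ _ => rfl⟩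
  ε p := NatIso.ofComponents
    (fun f => Fam.mkIso fun x => (α.τ p).mapIso (trIso f.fam (map_smul r p⁻¹ x).symm))
    (fun {f f'} φ => Fam.hom_ext fun x => by
      have q := (map_smul r p⁻¹ x).symm
      have h2 := tr_naturality φ.app q
      change (α.τ p).map (φ.app _) ≫ (α.τ p).map (tr f'.fam q) =
        (α.τ p).map (tr f.fam q) ≫ (α.τ p).map (φ.app _)
      rw [← Functor.map_comp, ← h2, Functor.map_comp])
  ε_mul {g h l} e f := Fam.hom_ext fun x => by
    have q := (map_smul r g⁻¹ x).symm
    have q' := (map_smul r h⁻¹ (g⁻¹ • x)).symm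
    have q0 : h⁻¹ • g⁻¹ • r x = l⁻¹ • r x := by rw [← e, mul_inv_rev, mul_smul]
    have q1 : h⁻¹ • g⁻¹ • x = l⁻¹ • x := by rw [← e, mul_inv_rev, mul_smul]
    have h1 : (α.τ g).map ((α.τ h).map (tr f.fam (congrArg (h⁻¹ • ·) q))) ≫
        (α.ψ e).hom.app (f.fam (h⁻¹ • r (g⁻¹ • x))) = _ :=
      (α.ψ e).hom.naturality (tr f.fam (congrArg (h⁻¹ • ·) q))
    have h4 : tr (fun x => (α.τ h).obj (f.fam (h⁻¹ • x))) q
        = (α.τ h).map (tr f.fam (congrArg (h⁻¹ • ·) q)) := by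
      rw [← map_tr]; rfl
    have h5 : (α.τ g).map ((α.τ h).map (tr f.fam q')) ≫
        (α.ψ e).hom.app (f.fam (r (h⁻¹ • g⁻¹ • x))) = _ := (α.ψ e).hom.naturality (tr f.fam q')
    have key : ((α.ψ e).hom.app (f.fam (h⁻¹ • g⁻¹ • r x)) ≫ (α.τ l).map (tr f.fam q0)) ≫
        (α.τ l).map (tr f.fam (map_smul r l⁻¹ x).symm) =
        (α.τ g).map (tr (fun x => (α.τ h).obj (f.fam (h⁻¹ • x))) q) ≫
        (α.τ g).map ((α.τ h).map (tr f.fam q')) ≫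
        (α.ψ e).hom.app (f.fam (r (h⁻¹ • g⁻¹ • x))) ≫
        (α.τ l).map (tr f.fam (congrArg r q1)) := by
      rw [h4, reassoc_of% h5, reassoc_of% h1]
      simp only [Functor.comp_obj, ← Functor.map_comp, tr_tr, Category.assoc]
    exact key
  ε_one f := Fam.hom_ext fun x => by
    have q := (map_smul r (1 : P)⁻¹ x).symm
    have h1 : (α.τ 1).map (tr f.fam q) ≫ α.ψ₁.hom.app (f.fam (r ((1 : P)⁻¹ • x))) = _ :=
      α.ψ₁.hom.naturality (tr f.fam q)
    have key : (α.τ 1).map (tr f.fam q) ≫ α.ψ₁.hom.app (f.fam (r ((1 : P)⁻¹ • x))) ≫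
        tr f.fam (congrArg r (by simp : (1 : P)⁻¹ • x = x)) =
        α.ψ₁.hom.app (f.fam ((1 : P)⁻¹ • r x)) ≫ tr f.fam (by simp) := by
      rw [reassoc_of% h1]
      simp only [Functor.id_obj, tr_tr]
    exact key

end FamAction


section Induction

variable {k : Type*} [Field k] {G : Type w} [Group G] {P : Subgroup G}
  {B : Type u} [Category.{v} B] [Preadditive B] [Linear k B]

open Fam

/-- A decreasing sequence of subgroups such that every conjugate of a member contains a member. -/
structure SubgroupFiltration (G : Type w) [Group G] where
  C : ℕ → Subgroup G
  anti : Antitone C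
  conj : ∀ (g : G) (m : ℕ), ∃ l, ∀ u ∈ C l, g⁻¹ * u * g ∈ C m

/-- The map of left `P`-sets `G ⧸ H → G ⧸ H'` induced by a map `f : G → G`. -/
def cosetMap (P : Subgroup G) {H H' : Subgroup G} (f : G → G)
    (hP : ∀ p ∈ P, ∀ x, f (p * x) = p * f x)
    (hH : ∀ x, ∀ u ∈ H, (f x)⁻¹ * f (x * u) ∈ H') : (G ⧸ H) →[P] (G ⧸ H') where
  toFun := Quotient.map' f fun x y h => by
    have h' := QuotientGroup.leftRel_apply.1 h
    have := hH x _ h'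
    rw [mul_inv_cancel_left] at this
    exact QuotientGroup.leftRel_apply.2 this
  map_smul' p x := by
    induction x using QuotientGroup.induction_on with
    | H x => exact congrArg (QuotientGroup.mk (s := H')) (hP p p.2 x)

/-- The projection `G ⧸ H → G ⧸ H'` for `H ≤ H'`. -/
def cosetProj (P : Subgroup G) {H H' : Subgroup G} (h : H ≤ H') : (G ⧸ H) →[P] (G ⧸ H') :=
  cosetMap P id (fun _ _ _ => rfl) (fun x u hu => by simpa using h hu)

/-- The right translation `G ⧸ H → G ⧸ H'`, `x ↦ x g`, for `H ≤ g H' g⁻¹`. -/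
def cosetRight (P : Subgroup G) {H H' : Subgroup G} (g : G) (h : ∀ u ∈ H, g⁻¹ * u * g ∈ H') :
    (G ⧸ H) →[P] (G ⧸ H') :=
  cosetMap P (fun x => x * g) (fun _ _ _ => mul_assoc _ _ _)
    (fun x u hu => by have := h u hu; simpa [mul_assoc] using this)

/-- The category `(V_m)^P` of `P`-equivariant objects in `V_m = ∏_{G ⧸ C} B`. -/
abbrev EqFam (α : GAction k P B) (C : Subgroup G) := (α.onFam (G ⧸ C)).Equivariant

/-- The functor between categories of `P`-equivariant objects given by pull-back along a map
of `P`-sets. -/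
abbrev pullEq (α : GAction k P B) {C C' : Subgroup G} (r : (G ⧸ C) →[P] (G ⧸ C')) :
    EqFam α C' ⥤ EqFam α C :=
  (α.pullFam r).onEquivariant

/-- The functor `Q : (V_{m₁})^P ⥤ (V_{m₂})^P` for `C_{m₂} ≤ C_{m₁}`. -/
abbrev eqQ (α : GAction k P B) {C C' : Subgroup G} (h : C ≤ C') : EqFam α C' ⥤ EqFam α C :=
  pullEq α (cosetProj P h)

namespace EqFam

variable {α : GAction k P B} {C C' C'' : Subgroup G}

/-- The value of a family at (the coset of) a point. -/
def at' (E : EqFam α C) (g : G) : B := E.obj.fam (QuotientGroup.mk g)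

/-- The component at a point of the equivariant structure. -/
def th (E : EqFam α C) (p : P) (g : G) : E.at' g ⟶ (α.τ p).obj (E.at' ((p : G)⁻¹ * g)) :=
  (E.θ p).hom.app (QuotientGroup.mk g)

/-- The component at a point of a morphism. -/
def ev {E D : EqFam α C} (χ : E ⟶ D) (g : G) : E.at' g ⟶ D.at' g :=
  χ.1.app (QuotientGroup.mk g)

theorem at_mul (E : EqFam α C) (g : G) {u : G} (hu : u ∈ C) : E.at' (g * u) = E.at' g :=
  congrArg E.obj.fam (QuotientGroup.mk_mul_of_mem g hu)

theorem ev_th {E D : EqFam α C} (χ : E ⟶ D) (p : P) (g : G) :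
    E.th p g ≫ (α.τ p).map (ev χ ((p : G)⁻¹ * g)) = ev χ g ≫ D.th p g :=
  congrArg (fun φ => Fam.Hom.app φ (QuotientGroup.mk g)) (χ.2 p)

theorem ev_mul {E D : EqFam α C} (χ : E ⟶ D) (g : G) {u : G} (hu : u ∈ C) :
    ev χ (g * u) = eqToHom (E.at_mul g hu) ≫ ev χ g ≫ eqToHom (D.at_mul g hu).symm := by
  have h := tr_naturality χ.1.app (QuotientGroup.mk_mul_of_mem g hu)
  have h' : eqToHom (E.at_mul g hu) ≫ ev χ g = ev χ (g * u) ≫ eqToHom (D.at_mul g hu) := h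
  rw [reassoc_of% h']
  simp

theorem ev_ext {E D : EqFam α C} {χ χ' : E ⟶ D} (h : ∀ g, ev χ g = ev χ' g) : χ = χ' :=
  Subtype.ext (Fam.hom_ext fun x => by
    induction x using QuotientGroup.induction_on with
    | H x => exact h x)

/-- A morphism of equivariant families from its components at the points of `G`. -/
noncomputable def mkHom {E D : EqFam α C} (φ : ∀ g, E.at' g ⟶ D.at' g)
    (h₁ : ∀ g, ∀ u (hu : u ∈ C),
      φ (g * u) = eqToHom (E.at_mul g hu) ≫ φ g ≫ eqToHom (D.at_mul g hu).symm)
    (h₂ : ∀ (p : P) (g : G), E.th p g ≫ (α.τ p).map (φ ((p : G)⁻¹ * g)) = φ g ≫ D.th p g) :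
    { χ : E ⟶ D // ∀ g, ev χ g = φ g } := by
  let ψ : E.obj ⟶ D.obj := ⟨fun x =>
    eqToHom (congrArg E.obj.fam x.out_eq'.symm) ≫ φ x.out ≫
      eqToHom (congrArg D.obj.fam x.out_eq')⟩
  have hψ : ∀ g, ψ.app (QuotientGroup.mk g) = φ g := fun g => by
    obtain ⟨u, hu⟩ := QuotientGroup.mk_out_eq_mul C g
    have key : ∀ g' (hg : g' = g * (u : G)) (e₁ : E.at' g = E.at' g') (e₂ : D.at' g' = D.at' g),
        eqToHom e₁ ≫ φ g' ≫ eqToHom e₂ = φ g := by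
      rintro g' rfl e₁ e₂
      rw [h₁ g u u.2]
      simp
    exact key _ hu _ _
  refine ⟨⟨ψ, fun p => Fam.hom_ext fun x => ?_⟩, hψ⟩
  induction x using QuotientGroup.induction_on with
  | H g =>
    have key : E.th p g ≫ (α.τ p).map (ψ.app (QuotientGroup.mk ((p : G)⁻¹ * g))) =
        ψ.app (QuotientGroup.mk g) ≫ D.th p g := by
      rw [hψ, hψ]
      exact h₂ p g
    exact key

theorem pull_th (E : EqFam α C') (f : G → G) (hP hH) (p : P) (g : G) :
    ((pullEq α (cosetMap (H := C) P f hP hH)).obj E).th p g =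
      E.th p (f g) ≫ (α.τ p).map (eqToHom (congrArg E.at' (hP _ (P.inv_mem p.2) g).symm)) := rfl

end EqFam

/-- The objects `(m, f)`, `f ∈ (V_m)^P`, of the 2-colimit of the categories `(V_m)^P`. -/
structure Ind (F : SubgroupFiltration G) (α : GAction k P B) where
  lev : ℕ
  obj : EqFam α (F.C lev)

namespace Ind

variable {F : SubgroupFiltration G} {α : GAction k P B}

/-- The value at a point of `G`. -/
def at' (E : Ind F α) (g : G) : B := E.obj.at' g

/-- The isomorphisms of the equivariant structure. -/
def th (E : Ind F α) (p : P) (g : G) : E.at' g ⟶ (α.τ p).obj (E.at' ((p : G)⁻¹ * g)) :=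
  E.obj.th p g

theorem at_mul (E : Ind F α) {m : ℕ} (h : E.lev ≤ m) (g : G) {u : G} (hu : u ∈ F.C m) :
    E.at' (g * u) = E.at' g := E.obj.at_mul g (F.anti h hu)

/-- The numbers `m ≥ max (m₁, m₂)`. -/
abbrev Idx (m₁ m₂ : ℕ) := {m : ℕ // m₁ ≤ m ∧ m₂ ≤ m}

instance (m₁ m₂ : ℕ) : IsDirectedOrder (Idx m₁ m₂) :=
  ⟨fun a b => ⟨⟨max a.1 b.1, by have := a.2; omega, by have := a.2; omega⟩,
    le_max_left a.1 b.1, le_max_right a.1 b.1⟩⟩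

instance (m₁ m₂ : ℕ) : Nonempty (Idx m₁ m₂) := ⟨⟨max m₁ m₂, le_max_left _ _, le_max_right _ _⟩⟩

/-- The morphisms `Q_{m₁,m}(f₁) ⟶ Q_{m₂,m}(f₂)` in `(V_m)^P`. -/
abbrev LevHom (E D : Ind F α) (m : Idx E.lev D.lev) :=
  (eqQ α (F.anti m.2.1)).obj E.obj ⟶ (eqQ α (F.anti m.2.2)).obj D.obj

theorem eqQ_th {C C' : Subgroup G} (h : C ≤ C') (E : EqFam α C') (p : P) (g : G) :
    ((eqQ α h).obj E).th p g = E.th p g := by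
  have : E.th p g ≫ (α.τ p).map (𝟙 _) = E.th p g := by simp
  exact (EqFam.pull_th E id (fun _ _ _ => rfl) (fun x u hu => by simpa using h hu) p g).trans this

/-- The image of a morphism under `Q_{m,m'}`, see `trans`. -/
noncomputable def transAux {E D : Ind F α} {m m' : Idx E.lev D.lev} (h : m ≤ m')
    (χ : LevHom E D m) : { χ' : LevHom E D m' // ∀ g, EqFam.ev χ' g = EqFam.ev χ g } :=
  EqFam.mkHom (E := (eqQ α (F.anti m'.2.1)).obj E.obj) (D := (eqQ α (F.anti m'.2.2)).obj D.obj)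
    (fun g => EqFam.ev (E := (eqQ α (F.anti m.2.1)).obj E.obj)
      (D := (eqQ α (F.anti m.2.2)).obj D.obj) χ g) (fun g u hu => EqFam.ev_mul χ g (F.anti h hu))
    (fun p g => by
      have := EqFam.ev_th χ p g
      rw [eqQ_th, eqQ_th] at this ⊢
      exact this)

/-- The transition maps `Q_{m,m'}` between the spaces of morphisms, taking into account that
`Q_{m,m'} ∘ Q_{m₁,m} = Q_{m₁,m'}`; the components of the morphism at the points of `G` do not
change. -/
noncomputable def trans (E D : Ind F α) (m m' : Idx E.lev D.lev) (h : m ≤ m') :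
    LevHom E D m →ₗ[k] LevHom E D m' where
  toFun χ := (transAux h χ).1
  map_add' χ χ' := EqFam.ev_ext fun g => ((transAux h (χ + χ')).2 g).trans
    (congrArg₂ (· + ·) ((transAux h χ).2 g) ((transAux h χ').2 g)).symm
  map_smul' c χ := EqFam.ev_ext fun g => ((transAux h (c • χ)).2 g).trans
    (congrArg (c • ·) ((transAux h χ).2 g)).symm

theorem ev_trans (E D : Ind F α) (m m' : Idx E.lev D.lev) (h : m ≤ m') (χ : LevHom E D m) (g : G) :
    EqFam.ev (trans E D m m' h χ) g = EqFam.ev χ g := (transAux h χ).2 g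

/-- The space of morphisms: the colimit of `Hom (Q_{m₁,m}(f₁), Q_{m₂,m}(f₂))` over all
`m ≥ max (m₁, m₂)`. -/
def Hom (E D : Ind F α) := Module.DirectLimit (LevHom E D) (trans E D)

noncomputable instance (E D : Ind F α) : AddCommGroup (Hom E D) :=
  inferInstanceAs (AddCommGroup (Module.DirectLimit (LevHom E D) (trans E D)))

noncomputable instance (E D : Ind F α) : Module k (Hom E D) :=
  inferInstanceAs (Module k (Module.DirectLimit (LevHom E D) (trans E D)))

/-- The components of a morphism, at one stage of the colimit. -/
def levEv (E D : Ind F α) (m : Idx E.lev D.lev) :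
    LevHom E D m →ₗ[k] (∀ g : G, E.at' g ⟶ D.at' g) where
  toFun χ g := EqFam.ev χ g
  map_add' _ _ := rfl
  map_smul' _ _ := rfl

/-- The components of a morphism at the points of `G`. -/
noncomputable def ev (E D : Ind F α) : Hom E D →ₗ[k] (∀ g : G, E.at' g ⟶ D.at' g) :=
  Module.DirectLimit.lift k _ _ _ (levEv E D)
    (fun m m' h χ => funext fun g => ev_trans E D m m' h χ g)

theorem ev_injective (E D : Ind F α) : Function.Injective (ev E D) :=
  Module.DirectLimit.lift_injective _ _ fun _ _ _ h => EqFam.ev_ext fun g => congrFun h g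

theorem exists_lev {E D : Ind F α} (f : Hom E D) :
    ∃ (m : Idx E.lev D.lev) (χ : LevHom E D m), ∀ g, ev E D f g = EqFam.ev χ g := by
  obtain ⟨m, χ, rfl⟩ := Module.DirectLimit.exists_of f
  exact ⟨m, χ, fun g => congrFun (Module.DirectLimit.lift_of _ _ χ) g⟩

theorem ev_th {E D : Ind F α} (f : Hom E D) (p : P) (g : G) :
    E.th p g ≫ (α.τ p).map (ev E D f ((p : G)⁻¹ * g)) = ev E D f g ≫ D.th p g := by
  obtain ⟨m, χ, h⟩ := exists_lev f
  have := EqFam.ev_th χ p g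
  rw [eqQ_th, eqQ_th] at this
  rw [h, h]
  exact this

theorem ev_mul {E D : Ind F α} (f : Hom E D) :
    ∃ m : Idx E.lev D.lev, ∀ (g u : G) (hu : u ∈ F.C m.1), ev E D f (g * u) =
      eqToHom (E.at_mul m.2.1 g hu) ≫ ev E D f g ≫ eqToHom (D.at_mul m.2.2 g hu).symm := by
  obtain ⟨m, χ, h⟩ := exists_lev f
  refine ⟨m, fun g u hu => ?_⟩
  rw [h, h]
  exact EqFam.ev_mul χ g hu

theorem exists_hom {E D : Ind F α} (φ : ∀ g, E.at' g ⟶ D.at' g) (m : ℕ)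
    (hE : E.lev ≤ m) (hD : D.lev ≤ m)
    (h₁ : ∀ (g u : G) (hu : u ∈ F.C m), φ (g * u) =
      eqToHom (E.at_mul hE g hu) ≫ φ g ≫ eqToHom (D.at_mul hD g hu).symm)
    (h₂ : ∀ (p : P) (g : G), E.th p g ≫ (α.τ p).map (φ ((p : G)⁻¹ * g)) = φ g ≫ D.th p g) :
    ∃ f : Hom E D, ∀ g, ev E D f g = φ g := by
  let χ := EqFam.mkHom (E := (eqQ α (F.anti hE)).obj E.obj) (D := (eqQ α (F.anti hD)).obj D.obj)
    φ h₁ (fun p g => by rw [eqQ_th, eqQ_th]; exact h₂ p g)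
  let n : Idx E.lev D.lev := ⟨m, hE, hD⟩
  let χ' : LevHom E D n := χ.1
  refine ⟨Module.DirectLimit.of k _ (LevHom E D) (trans E D) n χ', fun g => ?_⟩
  exact (congrFun (Module.DirectLimit.lift_of (levEv E D)
    (fun m m' h χ => funext fun g => ev_trans E D m m' h χ g) χ') g).trans (χ.2 g)

theorem exists_id (E : Ind F α) : ∃ f : Hom E E, ∀ g, ev E E f g = 𝟙 (E.at' g) :=
  exists_hom _ E.lev le_rfl le_rfl (by intros; simp) (by intros; simp)

/-- Composition of morphisms is computed at any sufficiently high stage of the colimit, hence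
pointwise. -/
theorem exists_comp {E D M : Ind F α} (f : Hom E D) (f' : Hom D M) :
    ∃ f'' : Hom E M, ∀ g, ev E M f'' g = ev E D f g ≫ ev D M f' g := by
  obtain ⟨m, hm⟩ := ev_mul f
  obtain ⟨m', hm'⟩ := ev_mul f'
  refine exists_hom _ (max m.1 m'.1) (m.2.1.trans (le_max_left _ _))
    (m'.2.2.trans (le_max_right _ _)) (fun g u hu => ?_) (fun p g => ?_)
  · rw [hm g u (F.anti (le_max_left _ _) hu), hm' g u (F.anti (le_max_right _ _) hu)]
    simp
  · rw [Functor.map_comp, ← Category.assoc, ev_th f, Category.assoc, ev_th f', Category.assoc]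

/-- The identity morphism. -/
@[irreducible] noncomputable def idHom (E : Ind F α) : Hom E E := (exists_id E).choose

theorem ev_idHom (E : Ind F α) (g : G) : ev E E (idHom E) g = 𝟙 (E.at' g) := by
  rw [idHom]; exact (exists_id E).choose_spec g

/-- The composition of morphisms. -/
@[irreducible] noncomputable def compHom {E D M : Ind F α} (f : Hom E D) (f' : Hom D M) :
    Hom E M := (exists_comp f f').choose

theorem ev_compHom {E D M : Ind F α} (f : Hom E D) (f' : Hom D M) (g : G) :
    ev E M (compHom f f') g = ev E D f g ≫ ev D M f' g := by
  rw [compHom]; exact (exists_comp f f').choose_spec g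

noncomputable instance : Category.{max w v} (Ind F α) where
  Hom := Hom
  id := idHom
  comp := compHom
  id_comp {E D} f := ev_injective _ _ <| funext fun g => by
    rw [ev_compHom, ev_idHom, Category.id_comp]
  comp_id f := ev_injective _ _ <| funext fun g => by
    rw [ev_compHom, ev_idHom, Category.comp_id]
  assoc f f' f'' := ev_injective _ _ <| funext fun g => by
    rw [ev_compHom, ev_compHom, ev_compHom, ev_compHom, Category.assoc]

noncomputable instance (E D : Ind F α) : AddCommGroup (E ⟶ D) :=
  inferInstanceAs (AddCommGroup (Hom E D))

noncomputable instance (E D : Ind F α) : Module k (E ⟶ D) :=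
  inferInstanceAs (Module k (Hom E D))

/-- The component of a morphism at a point of `G`. -/
noncomputable def app {E D : Ind F α} (f : E ⟶ D) (g : G) : E.at' g ⟶ D.at' g := ev E D f g

theorem hom_ext {E D : Ind F α} {f f' : E ⟶ D} (h : ∀ g, app f g = app f' g) : f = f' :=
  ev_injective _ _ (funext h)

@[simp] theorem id_app (E : Ind F α) (g : G) : app (𝟙 E) g = 𝟙 (E.at' g) :=
  ev_idHom E g

@[simp] theorem comp_app {E D M : Ind F α} (f : E ⟶ D) (f' : D ⟶ M) (g : G) :
    app (f ≫ f') g = app f g ≫ app f' g := ev_compHom f f' g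

@[simp] theorem add_app {E D : Ind F α} (f f' : E ⟶ D) (g : G) :
    app (f + f') g = app f g + app f' g := congrFun (map_add (ev E D) f f') g

@[simp] theorem smul_app {E D : Ind F α} (c : k) (f : E ⟶ D) (g : G) :
    app (c • f) g = c • app f g := congrFun (map_smul (ev E D) c f) g

noncomputable instance : Preadditive (Ind F α) where
  add_comp _ _ _ _ _ _ := hom_ext fun g => by simp
  comp_add _ _ _ _ _ _ := hom_ext fun g => by simp

noncomputable instance : Linear k (Ind F α) where
  smul_comp _ _ _ _ _ _ := hom_ext fun g => by simp
  comp_smul _ _ _ _ _ _ := hom_ext fun g => by simp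

theorem app_congr {E D : Ind F α} (f : E ⟶ D) {g g' : G} (h : g = g') :
    app f g = eqToHom (congrArg E.at' h) ≫ app f g' ≫ eqToHom (congrArg D.at' h.symm) := by
  subst h; simp

theorem th_congr (E : Ind F α) (p : P) {g g' : G} (h : g = g') :
    E.th p g = eqToHom (congrArg E.at' h) ≫ E.th p g' ≫
      eqToHom (congrArg (fun x => (α.τ p).obj (E.at' ((p : G)⁻¹ * x))) h.symm) := by
  subst h; simp

/-! The action of `G` by right translations. -/

open Classical in
/-- The smallest `l` with `C_l ≤ g C_m g⁻¹`. -/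
noncomputable def shift (F : SubgroupFiltration G) (g : G) (m : ℕ) : ℕ := Nat.find (F.conj g m)

theorem shift_spec (F : SubgroupFiltration G) (g : G) (m : ℕ) :
    ∀ u ∈ F.C (shift F g m), g⁻¹ * u * g ∈ F.C m := by
  classical exact Nat.find_spec (F.conj g m)

/-- Right translation of an object: `(m, f) ↦ (l, x ↦ f (x g))`. -/
noncomputable def right (g : G) (E : Ind F α) : Ind F α where
  lev := shift F g E.lev
  obj := (pullEq α (cosetRight P g (shift_spec F g E.lev))).obj E.obj

theorem right_th (w : G) (E : Ind F α) (p : P) (g : G) : (right w E).th p g = E.th p (g * w) ≫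
    (α.τ p).map (eqToHom (congrArg E.at' (mul_assoc (p : G)⁻¹ g w).symm)) := rfl

theorem exists_right (w : G) {E D : Ind F α} (f : E ⟶ D) :
    ∃ f' : right w E ⟶ right w D, ∀ g, app f' g = app f (g * w) := by
  obtain ⟨m, hm⟩ := ev_mul f
  obtain ⟨l, hl⟩ := F.conj w m.1
  refine exists_hom (E := right w E) (D := right w D) (fun g => app f (g * w))
    (max l (max (right w E).lev (right w D).lev)) (by simp) (by simp) (fun g u hu => ?_)
    (fun p g => ?_)
  · have e : g * u * w = g * w * (w⁻¹ * u * w) := by group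
    have h1 := hm (g * w) _ (hl u (F.anti (le_max_left _ _) hu))
    change app f (g * u * w) = _
    rw [app_congr f e]
    change _ ≫ ev E D f _ ≫ _ = _
    rw [h1]
    simp only [eqToHom_trans_assoc, Category.assoc, eqToHom_trans]
    rfl
  · have e : (p : G)⁻¹ * g * w = (p : G)⁻¹ * (g * w) := mul_assoc _ _ _
    have h1 := ev_th f p (g * w)
    change (right w E).th p g ≫ (α.τ p).map (app f ((p : G)⁻¹ * g * w)) =
      app f (g * w) ≫ (right w D).th p g
    rw [right_th, right_th, app_congr f e]
    change _ = ev E D f _ ≫ _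
    have key2 : (E.th p (g * w) ≫ (α.τ p).map (eqToHom (congrArg E.at' e.symm))) ≫
        (α.τ p).map (eqToHom (congrArg E.at' e) ≫ app f ((p : G)⁻¹ * (g * w)) ≫
          eqToHom (congrArg D.at' e.symm)) = (E.th p (g * w) ≫
          (α.τ p).map (app f ((p : G)⁻¹ * (g * w)))) ≫
          (α.τ p).map (eqToHom (congrArg D.at' e.symm)) := by
      simp only [Category.assoc, ← Functor.map_comp]
      simp
    refine key2.trans ?_
    refine (congrArg (· ≫ (α.τ p).map (eqToHom (congrArg D.at' e.symm))) h1).trans ?_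
    exact Category.assoc _ _ _

/-- Right translation of a morphism. -/
@[irreducible] noncomputable def rightMap (w : G) {E D : Ind F α} (f : E ⟶ D) :
    right w E ⟶ right w D := (exists_right w f).choose

theorem rightMap_app (w : G) {E D : Ind F α} (f : E ⟶ D) (g : G) :
    app (rightMap w f) g = app f (g * w) := by
  rw [rightMap]; exact (exists_right w f).choose_spec g

/-- The functor of right translation. -/
noncomputable def rightFunctor (F : SubgroupFiltration G) (α : GAction k P B) (w : G) :
    Ind F α ⥤ Ind F α where
  obj := right w
  map f := rightMap w f
  map_id E := hom_ext fun g => by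
    rw [rightMap_app, id_app, id_app]; rfl
  map_comp f f' := hom_ext fun g => by
    rw [rightMap_app, comp_app, comp_app, rightMap_app, rightMap_app]
    rfl

theorem right_map_app (w : G) {E D : Ind F α} (f : E ⟶ D) (g : G) :
    app ((rightFunctor F α w).map f) g = app f (g * w) := rightMap_app w f g

/-- A morphism whose components are identifications of equal objects. -/
theorem exists_eqToHom {E D : Ind F α} (e : ∀ g, E.at' g = D.at' g)
    (h : ∀ (p : P) (g : G), E.th p g ≫ (α.τ p).map (eqToHom (e ((p : G)⁻¹ * g))) =
      eqToHom (e g) ≫ D.th p g) :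
    ∃ i : E ≅ D, ∀ g, app i.hom g = eqToHom (e g) := by
  obtain ⟨a, ha⟩ := exists_hom (E := E) (D := D) (fun g => eqToHom (e g)) (max E.lev D.lev)
    (le_max_left _ _) (le_max_right _ _) (by intros; simp) h
  obtain ⟨b, hb⟩ := exists_hom (E := D) (D := E) (fun g => eqToHom (e g).symm) (max E.lev D.lev)
    (le_max_right _ _) (le_max_left _ _) (by intros; simp) (fun p g => by
      have h' := eqToHom (e g).symm ≫= h p g =≫ (α.τ p).map (eqToHom (e ((p : G)⁻¹ * g)).symm)
      simpa [← Functor.map_comp] using h'.symm)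
  refine ⟨⟨a, b, hom_ext fun g => ?_, hom_ext fun g => ?_⟩, ha⟩
  · have : app a g ≫ app b g = 𝟙 _ := by
      rw [app, app, ha, hb]; simp
    simpa using this
  · have : app b g ≫ app a g = 𝟙 _ := by
      rw [app, app, ha, hb]; simp
    simpa using this

theorem exists_rightMul {g h l : G} (e : g * h = l) (E : Ind F α) :
    ∃ i : right g (right h E) ≅ right l E, ∀ x,
      ∀ e' : (right g (right h E)).at' x = (right l E).at' x, app i.hom x = eqToHom e' := by
  have e' : ∀ x, x * g * h = x * l := fun x => by rw [← e, mul_assoc]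
  have e'' : ∀ x, (right g (right h E)).at' x = (right l E).at' x := fun x => congrArg E.at' (e' x)
  obtain ⟨i, hi⟩ := exists_eqToHom e'' fun p x => by
    have key : ((E.th p (x * g * h) ≫
        (α.τ p).map (eqToHom (congrArg E.at' (mul_assoc (p : G)⁻¹ (x * g) h).symm))) ≫
        (α.τ p).map (eqToHom (congrArg (fun y => E.at' (y * h)) (mul_assoc (p : G)⁻¹ x g).symm))) ≫
        (α.τ p).map (eqToHom (congrArg E.at' (e' ((p : G)⁻¹ * x)))) =
        eqToHom (congrArg E.at' (e' x)) ≫ E.th p (x * l) ≫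
          (α.τ p).map (eqToHom (congrArg E.at' (mul_assoc (p : G)⁻¹ x l).symm)) := by
      rw [th_congr E p (e' x)]
      simp [eqToHom_map]
    exact key
  exact ⟨i, fun x _ => hi x⟩

theorem exists_rightOne (E : Ind F α) : ∃ i : right 1 E ≅ E, ∀ x,
    ∀ e' : (right 1 E).at' x = E.at' x, app i.hom x = eqToHom e' := by
  have e'' : ∀ x, (right 1 E).at' x = E.at' x := fun x => congrArg E.at' (mul_one x)
  obtain ⟨i, hi⟩ := exists_eqToHom e'' fun p x => by
    have key : (E.th p (x * 1) ≫
        (α.τ p).map (eqToHom (congrArg E.at' (mul_assoc (p : G)⁻¹ x 1).symm))) ≫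
        (α.τ p).map (eqToHom (congrArg E.at' (mul_one ((p : G)⁻¹ * x)))) =
        eqToHom (congrArg E.at' (mul_one x)) ≫ E.th p x := by
      rw [th_congr E p (mul_one x)]
      simp [eqToHom_map]
    exact key
  exact ⟨i, fun x _ => hi x⟩

/-- The canonical isomorphism `σ(g)(σ(h)(E)) ≅ σ(gh)(E)`: both objects have the values
`f (x g h)`. -/
noncomputable def rightMul {g h l : G} (e : g * h = l) (E : Ind F α) :
    (rightFunctor F α g).obj ((rightFunctor F α h).obj E) ≅ (rightFunctor F α l).obj E :=
  (exists_rightMul e E).choose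

/-- The canonical isomorphism `σ(1)(E) ≅ E`. -/
noncomputable def rightOne (E : Ind F α) : (rightFunctor F α 1).obj E ≅ E :=
  (exists_rightOne E).choose

theorem rightMul_app {g h l : G} (e : g * h = l) (E : Ind F α) (x : G)
    (e' : (right g (right h E)).at' x = (right l E).at' x) :
    app (rightMul e E).hom x = eqToHom e' := (exists_rightMul e E).choose_spec x e'

theorem rightOne_app (E : Ind F α) (x : G) (e' : (right 1 E).at' x = E.at' x) :
    app (rightOne E).hom x = eqToHom e' := (exists_rightOne E).choose_spec x e'

theorem rightMul_naturality {g h l : G} (e : g * h = l) {E D : Ind F α} (f : E ⟶ D) :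
    (rightFunctor F α g).map ((rightFunctor F α h).map f) ≫ (rightMul e D).hom =
      (rightMul e E).hom ≫ (rightFunctor F α l).map f := hom_ext fun x => by
  have e' : x * g * h = x * l := by rw [← e, mul_assoc]
  have key : app f (x * g * h) ≫ eqToHom (congrArg D.at' e') =
      eqToHom (congrArg E.at' e') ≫ app f (x * l) := by
    rw [app_congr f e']; simp
  have h1 : app ((rightFunctor F α g).map ((rightFunctor F α h).map f)) x =
      app f (x * g * h) := by rw [right_map_app, right_map_app]
  have h2 := rightMul_app e E x (congrArg E.at' e')
  have h3 := rightMul_app e D x (congrArg D.at' e')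
  have h4 := right_map_app l f x
  have c1 := comp_app ((rightFunctor F α g).map ((rightFunctor F α h).map f)) (rightMul e D).hom x
  have c2 := comp_app (rightMul e E).hom ((rightFunctor F α l).map f) x
  exact c1.trans ((congrArg₂ (· ≫ ·) h1 h3).trans
    (key.trans ((congrArg₂ (· ≫ ·) h2 h4).symm.trans c2.symm)))

theorem rightOne_naturality {E D : Ind F α} (f : E ⟶ D) :
    (rightFunctor F α 1).map f ≫ (rightOne D).hom = (rightOne E).hom ≫ f := hom_ext fun x => by
  have e' := mul_one x
  have key : app f (x * 1) ≫ eqToHom (congrArg D.at' e') =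
      eqToHom (congrArg E.at' e') ≫ app f x := by
    rw [app_congr f e']; simp
  have h1 := right_map_app 1 f x
  have h2 := rightOne_app E x (congrArg E.at' e')
  have h3 := rightOne_app D x (congrArg D.at' e')
  have c1 := comp_app ((rightFunctor F α 1).map f) (rightOne D).hom x
  have c2 := comp_app (rightOne E).hom f x
  exact c1.trans ((congrArg₂ (· ≫ ·) h1 h3).trans
    (key.trans ((congrArg₂ (· ≫ ·) h2 rfl).symm.trans c2.symm)))

theorem rightMul_assoc {g h m gh hm ghm : G} (e₁ : g * h = gh) (e₂ : gh * m = ghm)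
    (e₃ : h * m = hm) (e₄ : g * hm = ghm) (E : Ind F α) :
    (rightMul e₁ ((rightFunctor F α m).obj E)).hom ≫ (rightMul e₂ E).hom =
      (rightFunctor F α g).map (rightMul e₃ E).hom ≫ (rightMul e₄ E).hom := hom_ext fun x => by
  have key : ∀ {a b c d : B} (h₁ : a = b) (h₂ : b = c) (h₃ : a = d) (h₄ : d = c),
      eqToHom h₁ ≫ eqToHom h₂ = eqToHom h₃ ≫ eqToHom h₄ := by intros; simp
  have q₁ : x * g * h * m = x * gh * m := by rw [← e₁, mul_assoc x g h]
  have q₂ : x * gh * m = x * ghm := by rw [← e₂, mul_assoc]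
  have q₃ : x * g * h * m = x * g * hm := by rw [← e₃, mul_assoc (x * g)]
  have q₄ : x * g * hm = x * ghm := by rw [← e₄, mul_assoc]
  have h1 := rightMul_app e₁ (right m E) x (congrArg E.at' q₁)
  have h2 := rightMul_app e₂ E x (congrArg E.at' q₂)
  have h3 := (right_map_app g (rightMul e₃ E).hom x).trans
    (rightMul_app e₃ E (x * g) (congrArg E.at' q₃))
  have h4 := rightMul_app e₄ E x (congrArg E.at' q₄)
  have c1 := comp_app (rightMul e₁ ((rightFunctor F α m).obj E)).hom (rightMul e₂ E).hom x
  have c2 := comp_app ((rightFunctor F α g).map (rightMul e₃ E).hom) (rightMul e₄ E).hom x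
  exact c1.trans ((congrArg₂ (· ≫ ·) h1 h2).trans
    ((key _ _ _ _).trans ((congrArg₂ (· ≫ ·) h3 h4).symm.trans c2.symm)))

theorem rightMul_one_left (g : G) (E : Ind F α) :
    (rightMul (one_mul g) E).hom = (rightOne ((rightFunctor F α g).obj E)).hom := hom_ext fun x => by
  have q : x * 1 * g = x * g := by rw [mul_one]
  exact (rightMul_app (one_mul g) E x (congrArg E.at' q)).trans
    (rightOne_app (right g E) x (congrArg E.at' q)).symm

theorem rightMul_one_right (g : G) (E : Ind F α) :
    (rightMul (mul_one g) E).hom = (rightFunctor F α g).map (rightOne E).hom := hom_ext fun x => by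
  have q : x * g * 1 = x * g := mul_one _
  exact (rightMul_app (mul_one g) E x (congrArg E.at' q)).trans
    ((right_map_app g (rightOne E).hom x).trans
      (rightOne_app E (x * g) (congrArg E.at' q))).symm

instance (w : G) : (rightFunctor F α w).Additive :=
  ⟨fun {_ _ f f'} => hom_ext fun g =>
    ((right_map_app w (f + f') g).trans (add_app f f' (g * w))).trans
      ((add_app _ _ g).trans
        (congrArg₂ (· + ·) (right_map_app w f g) (right_map_app w f' g))).symm⟩

instance (w : G) : (rightFunctor F α w).Linear k :=
  ⟨fun {_ _} f c => hom_ext fun g =>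
    ((right_map_app w (c • f) g).trans (smul_app c f (g * w))).trans
      ((smul_app c _ g).trans (congrArg (c • ·) (right_map_app w f g))).symm⟩

theorem rightMul_naturality' {g h l : G} (e : g * h = l) {E D : Ind F α} (f : E ⟶ D) :
    (rightFunctor F α h ⋙ rightFunctor F α g).map f ≫ (rightMul e D).hom =
      (rightMul e E).hom ≫ (rightFunctor F α l).map f := by
  rw [Functor.comp_map, rightMul_naturality e f]

/-- The isomorphism of functors `σ(g) ∘ σ(h) ≅ σ(gh)`. -/
noncomputable def rightMulIso {g h l : G} (e : g * h = l) :
    rightFunctor F α h ⋙ rightFunctor F α g ≅ rightFunctor F α l :=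
  NatIso.ofComponents (fun E => rightMul e E) (fun f => rightMul_naturality' e f)

/-- The isomorphism of functors `σ(1) ≅ Id`. -/
noncomputable def rightOneIso : rightFunctor F α 1 ≅ 𝟭 (Ind F α) :=
  NatIso.ofComponents (fun E => rightOne E) (fun f => rightOne_naturality f)

/-- The action `σ` of `G` by right translations: `σ(g)(m, f) = (l, x ↦ f (x g))`. -/
noncomputable def σ (F : SubgroupFiltration G) (α : GAction k P B) : GAction k G (Ind F α) where
  τ w := rightFunctor F α w
  additive w := inferInstance
  linear w := inferInstance
  ψ {g h l} e := rightMulIso e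
  ψ₁ := rightOneIso
  assoc e₁ e₂ e₃ e₄ E := rightMul_assoc e₁ e₂ e₃ e₄ E
  unit_left g E := rightMul_one_left g E
  unit_right g E := rightMul_one_right g E

end Ind

end Induction

section Lines

variable {A : Type v} {E G : Type u} [CommGroup A] [Group E] [Group G]

/-- Let `π : E → G` be a central extension of `G` by `A` and `χ : A → ℂˣ` a character.
For `g ∈ G` the set `π⁻¹(g)` is an `A`-torsor and gives rise to the complex line
`L_g = (π⁻¹(g) ×_χ ℂ)`, the quotient of `π⁻¹(g) × ℂ` by `(a x, z) ∼ (x, χ(a) z)`. The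
space `L_g ⊗ Y` is realized as the space of functions `φ : π⁻¹(g) → Y` with
`φ(a x) = χ(a)⁻¹ φ(x)`: the vector `[x, z] ⊗ y` corresponds to the function with
value `z y` at `x`. -/
def lineTensor (S : GroupExtension A E G) (χ : A →* ℂˣ) (g : G) (Y : Type u) [AddCommGroup Y]
    [Module ℂ Y] : Submodule ℂ ({e : E // S.rightHom e = g} → Y) where
  carrier := {φ | ∀ (a : A) (x y : {e : E // S.rightHom e = g}), y.1 = S.inl a * x.1 →
    φ y = ((χ a)⁻¹ : ℂˣ) • φ x}
  add_mem' {φ φ'} h h' a x y e := by simp [h a x y e, h' a x y e]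
  zero_mem' a x y e := by simp
  smul_mem' c φ h a x y e := by simp [h a x y e, smul_comm c]

namespace lineTensor

variable {S : GroupExtension A E G} {χ : A →* ℂˣ} {Y : Type u} [AddCommGroup Y] [Module ℂ Y]
  {Y' : Type u} [AddCommGroup Y'] [Module ℂ Y']

theorem exists_inl {x y : E} (h : S.rightHom x = S.rightHom y) : ∃ a, y = S.inl a * x := by
  have : y * x⁻¹ ∈ S.inl.range := by
    rw [S.range_inl_eq_ker_rightHom, MonoidHom.mem_ker, map_mul, map_inv, h, mul_inv_cancel]
  obtain ⟨a, ha⟩ := this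
  exact ⟨a, by rw [ha, inv_mul_cancel_right]⟩

theorem ext_at {g : G} {φ φ' : lineTensor S χ g Y} (x : {e : E // S.rightHom e = g})
    (h : φ.1 x = φ'.1 x) : φ = φ' := Subtype.ext <| funext fun y => by
  obtain ⟨a, ha⟩ := exists_inl (x.2.trans y.2.symm)
  rw [φ.2 a x y ha, φ'.2 a x y ha, h]

/-- Functoriality in `Y`. -/
def map (g : G) (f : Y →ₗ[ℂ] Y') : lineTensor S χ g Y →ₗ[ℂ] lineTensor S χ g Y' where
  toFun φ := ⟨fun x => f (φ.1 x), fun a x y e =>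
    (congrArg f (φ.2 a x y e)).trans (map_smul f ((χ a)⁻¹ : ℂˣ).1 (φ.1 x))⟩
  map_add' _ _ := Subtype.ext (funext fun _ => map_add f _ _)
  map_smul' _ _ := Subtype.ext (funext fun _ => map_smul f _ _)

theorem nonempty (S : GroupExtension A E G) (g : G) : Nonempty {e : E // S.rightHom e = g} :=
  let ⟨e, he⟩ := S.rightHom_surjective g
  ⟨⟨e, he⟩⟩

instance (g : G) [Module.Finite ℂ Y] : Module.Finite ℂ (lineTensor S χ g Y) := by
  obtain ⟨x⟩ := nonempty S g
  exact Module.Finite.of_injective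
    ((LinearMap.proj x).comp (lineTensor S χ g Y).subtype) fun φ φ' h => ext_at x h

/-- The map `L_{gh} ⊗ Y → L_g ⊗ L_h ⊗ Y` which is inverse to the map induced by the
multiplication `π⁻¹(g) × π⁻¹(h) → π⁻¹(gh)`: a function `φ` goes to `x ↦ y ↦ φ (x y)`. -/
def mulMap (hS : ∀ a e, S.inl a * e = e * S.inl a) {g h l : G} (e : g * h = l)
    (Y : Type u) [AddCommGroup Y] [Module ℂ Y] :
    lineTensor S χ l Y →ₗ[ℂ] lineTensor S χ g (lineTensor S χ h Y) where
  toFun φ :=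
    ⟨fun x => ⟨fun y => φ.1 ⟨x.1 * y.1, by rw [map_mul, x.2, y.2, e]⟩,
      fun a y y' hy => φ.2 a _ _ (by
        change x.1 * y'.1 = S.inl a * (x.1 * y.1)
        rw [hy, ← mul_assoc, ← mul_assoc, hS])⟩,
      fun a x x' hx => Subtype.ext <| funext fun y => φ.2 a _ _ (by
        change x'.1 * y.1 = S.inl a * (x.1 * y.1)
        rw [hx, mul_assoc])⟩
  map_add' _ _ := rfl
  map_smul' _ _ := rfl

theorem mulMap_bijective (hS : ∀ a e, S.inl a * e = e * S.inl a) {g h l : G} (e : g * h = l) :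
    Function.Bijective (mulMap (χ := χ) hS e Y) := by
  obtain ⟨x⟩ := nonempty S g
  obtain ⟨y⟩ := nonempty S h
  refine ⟨fun φ φ' h => ext_at ⟨x.1 * y.1, by rw [map_mul, x.2, y.2, e]⟩ ?_, fun Φ => ?_⟩
  · exact congrFun (congrArg Subtype.val (congrFun (congrArg Subtype.val h) x)) y
  · refine ⟨⟨fun z => (Φ.1 x).1 ⟨x.1⁻¹ * z.1, ?_⟩, fun a z z' hz => (Φ.1 x).2 a _ _ ?_⟩, ?_⟩
    · rw [map_mul, map_inv, x.2, z.2, ← e, inv_mul_cancel_left]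
    · change x.1⁻¹ * z'.1 = S.inl a * (x.1⁻¹ * z.1)
      rw [hz, ← mul_assoc, ← mul_assoc, hS]
    · refine ext_at x (Subtype.ext <| funext fun y => ?_)
      exact congrArg (Φ.1 x).1 (Subtype.ext (inv_mul_cancel_left x.1 y.1))

/-- The isomorphism `L_g ⊗ L_h ⊗ Y ≅ L_{gh} ⊗ Y`. -/
noncomputable def mulEquiv (hS : ∀ a e, S.inl a * e = e * S.inl a) {g h l : G} (e : g * h = l)
    (Y : Type u) [AddCommGroup Y] [Module ℂ Y] :
    lineTensor S χ g (lineTensor S χ h Y) ≃ₗ[ℂ] lineTensor S χ l Y :=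
  (LinearEquiv.ofBijective (mulMap hS e Y) (mulMap_bijective hS e)).symm

theorem mulEquiv_eq_iff (hS : ∀ a e, S.inl a * e = e * S.inl a) {g h l : G} (e : g * h = l)
    (Φ : lineTensor S χ g (lineTensor S χ h Y)) (φ : lineTensor S χ l Y) :
    mulEquiv hS e Y Φ = φ ↔ Φ = mulMap hS e Y φ :=
  LinearEquiv.symm_apply_eq (LinearEquiv.ofBijective (mulMap hS e Y) (mulMap_bijective hS e))

theorem mulMap_mulEquiv (hS : ∀ a e, S.inl a * e = e * S.inl a) {g h l : G} (e : g * h = l)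
    (Φ : lineTensor S χ g (lineTensor S χ h Y)) : mulMap hS e Y (mulEquiv hS e Y Φ) = Φ :=
  ((mulEquiv_eq_iff hS e Φ _).1 rfl).symm

theorem mulEquiv_naturality (hS : ∀ a e, S.inl a * e = e * S.inl a) {g h l : G} (e : g * h = l)
    (f : Y →ₗ[ℂ] Y') (Φ : lineTensor S χ g (lineTensor S χ h Y)) :
    mulEquiv hS e Y' (map g (map h f) Φ) = map l f (mulEquiv hS e Y Φ) := by
  rw [mulEquiv_eq_iff]
  obtain ⟨φ, rfl⟩ := (mulMap_bijective hS e).2 Φ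
  rw [(mulEquiv_eq_iff hS e _ φ).2 rfl]
  rfl

theorem mulEquiv_assoc (hS : ∀ a e, S.inl a * e = e * S.inl a) {g h m gh hm ghm : G}
    (e₁ : g * h = gh) (e₂ : gh * m = ghm) (e₃ : h * m = hm) (e₄ : g * hm = ghm)
    (Φ : lineTensor S χ g (lineTensor S χ h (lineTensor S χ m Y))) :
    mulEquiv hS e₂ Y (mulEquiv hS e₁ _ Φ) =
      mulEquiv hS e₄ Y (map g (mulEquiv hS e₃ Y).toLinearMap Φ) := by
  rw [mulEquiv_eq_iff, mulEquiv_eq_iff]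
  obtain ⟨φ, hφ⟩ : ∃ φ, mulEquiv hS e₄ Y (map g (mulEquiv hS e₃ Y).toLinearMap Φ) = φ := ⟨_, rfl⟩
  rw [hφ]
  rw [mulEquiv_eq_iff] at hφ
  refine Subtype.ext <| funext fun x => ?_
  have h1 : mulEquiv hS e₃ Y (Φ.1 x) = (mulMap hS e₄ Y φ).1 x :=
    congrFun (congrArg Subtype.val hφ) x
  rw [mulEquiv_eq_iff] at h1
  rw [h1]
  refine Subtype.ext <| funext fun y => Subtype.ext <| funext fun z => ?_
  exact congrArg φ.1 (Subtype.ext (mul_assoc x.1 y.1 z.1).symm)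

/-- The isomorphism `L_1 ⊗ Y ≅ Y`, `φ ↦ φ(1)`. -/
noncomputable def oneEquiv (S : GroupExtension A E G) (χ : A →* ℂˣ) (Y : Type u) [AddCommGroup Y]
    [Module ℂ Y] : lineTensor S χ 1 Y ≃ₗ[ℂ] Y :=
  LinearEquiv.ofBijective
    ((LinearMap.proj ⟨1, map_one _⟩).comp (lineTensor S χ 1 Y).subtype)
    ⟨fun φ φ' h => ext_at _ h, fun y => by
      have h : ∀ x : {e : E // S.rightHom e = 1}, ∃ a, x.1 = S.inl a := fun x => by
        obtain ⟨a, ha⟩ := exists_inl (S := S) (x := 1) (y := x.1) (by rw [x.2, map_one])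
        exact ⟨a, by rw [ha, mul_one]⟩
      choose c hc using h
      have hc' : ∀ x a, x.1 = S.inl a → c x = a := fun x a ha =>
        S.inl_injective ((hc x).symm.trans ha)
      refine ⟨⟨fun x => ((χ (c x))⁻¹ : ℂˣ) • y, fun a x x' hx => ?_⟩, ?_⟩
      · change ((χ (c x'))⁻¹ : ℂˣ) • y = ((χ a)⁻¹ : ℂˣ) • ((χ (c x))⁻¹ : ℂˣ) • y
        rw [hc' x' (a * c x) (by rw [hx, map_mul, ← hc x]), map_mul, mul_inv, mul_smul]
      · change ((χ (c _))⁻¹ : ℂˣ) • y = y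
        rw [hc' _ 1 (map_one _).symm, map_one, inv_one, one_smul]⟩

theorem mulEquiv_one_left (hS : ∀ a e, S.inl a * e = e * S.inl a) (g : G)
    (Φ : lineTensor S χ 1 (lineTensor S χ g Y)) :
    mulEquiv hS (one_mul g) Y Φ = oneEquiv S χ _ Φ := by
  obtain ⟨φ, rfl⟩ := (mulMap_bijective hS (one_mul g)).2 Φ
  rw [(mulEquiv_eq_iff hS _ _ φ).2 rfl]
  exact Subtype.ext <| funext fun y => congrArg φ.1 (Subtype.ext (one_mul y.1).symm)

theorem mulEquiv_one_right (hS : ∀ a e, S.inl a * e = e * S.inl a) (g : G)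
    (Φ : lineTensor S χ g (lineTensor S χ 1 Y)) :
    mulEquiv hS (mul_one g) Y Φ = map g (oneEquiv S χ Y).toLinearMap Φ := by
  obtain ⟨φ, rfl⟩ := (mulMap_bijective hS (mul_one g)).2 Φ
  rw [(mulEquiv_eq_iff hS _ _ φ).2 rfl]
  exact Subtype.ext <| funext fun y => congrArg φ.1 (Subtype.ext (mul_one y.1).symm)

end lineTensor

open lineTensor

/-- The functor `Y ↦ L_g ⊗ Y`. -/
def lineFunctor (S : GroupExtension A E G) (χ : A →* ℂˣ) (g : G) :
    FGModuleCat.{u} ℂ ⥤ FGModuleCat.{u} ℂ where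
  obj Y := FGModuleCat.of ℂ (lineTensor S χ g Y)
  map f := FGModuleCat.ofHom (lineTensor.map g f.hom.hom)

/-- The isomorphism `L_g ⊗ L_h ⊗ Y ≅ L_{gh} ⊗ Y`. -/
noncomputable def lineMul (S : GroupExtension A E G) (hS : ∀ a e, S.inl a * e = e * S.inl a)
    (χ : A →* ℂˣ) {g h l : G} (e : g * h = l) (Y : FGModuleCat.{u} ℂ) :
    FGModuleCat.of ℂ (lineTensor S χ g (lineTensor S χ h Y)) ≅
      FGModuleCat.of ℂ (lineTensor S χ l Y) :=
  (mulEquiv hS e Y.carrier).toFGModuleCatIso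

/-- The action of `G` on finite-dimensional vector spaces associated with a central extension
`1 → A → E → G → 1` and a character `χ` of `A`: `τ(g)(Y) = L_g ⊗ Y`. -/
noncomputable def lineAction (S : GroupExtension A E G) (hS : ∀ a e, S.inl a * e = e * S.inl a)
    (χ : A →* ℂˣ) : GAction ℂ G (FGModuleCat.{u} ℂ) where
  τ g := lineFunctor S χ g
  additive g := ⟨rfl⟩
  linear g := ⟨fun _ _ => rfl⟩
  ψ e := NatIso.ofComponents (fun Y => lineMul S hS χ e Y)
    (fun f => FGModuleCat.hom_ext <| LinearMap.ext fun Φ =>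
      mulEquiv_naturality hS e f.hom.hom Φ)
  ψ₁ := NatIso.ofComponents (fun Y => (oneEquiv S χ Y.carrier).toFGModuleCatIso) (fun _ => rfl)
  assoc e₁ e₂ e₃ e₄ _ := FGModuleCat.hom_ext <| LinearMap.ext fun Φ =>
    mulEquiv_assoc hS e₁ e₂ e₃ e₄ Φ
  unit_left g _ := FGModuleCat.hom_ext <| LinearMap.ext fun Φ => mulEquiv_one_left hS g Φ
  unit_right g _ := FGModuleCat.hom_ext <| LinearMap.ext fun Φ => mulEquiv_one_right hS g Φ

end Lines

open IsLocalRing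

/-- A two-dimensional local field whose last residue field is finite: a complete discrete
valuation field `K` with valuation ring `O` whose residue field is a complete discrete valuation
field with valuation ring `O₁` and a finite residue field. -/
structure TwoDimLocalField (K : Type u) [Field K] where
  O : ValuationSubring K
  dvr : IsDiscreteValuationRing O
  complete : IsAdicComplete (maximalIdeal O) O
  O₁ : ValuationSubring (ResidueField O)
  dvr₁ : IsDiscreteValuationRing O₁
  complete₁ : IsAdicComplete (maximalIdeal O₁) O₁
  finite : Finite (ResidueField O₁)

attribute [instance] TwoDimLocalField.dvr TwoDimLocalField.dvr₁

/-- The normalized additive valuation of a field with a given discrete valuation ring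
(only used for nonzero elements). -/
noncomputable def ord {K : Type u} [Field K] (A : ValuationSubring K) [IsDiscreteValuationRing A]
    (x : K) : ℤ :=
  -WithZero.log ((IsDiscreteValuationRing.maximalIdeal A).valuation K x)

namespace TwoDimLocalField

variable {K : Type u} [Field K] (F : TwoDimLocalField K)

/-- The number of elements of the last residue field. -/
noncomputable def q : ℕ := Nat.card (ResidueField F.O₁)

open Classical in
/-- The residue of an element of the valuation ring (and `0` for all other elements). -/
noncomputable def res (x : K) : ResidueField F.O :=
  if h : x ∈ F.O then residue F.O ⟨x, h⟩ else 0

/-- The map `ν_K(f, g)`: the valuation of the residue of `f ^ ν_K(g) / g ^ ν_K(f)`. -/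
noncomputable def nu (f g : Kˣ) : ℤ :=
  ord F.O₁ (F.res ((f : K) ^ ord F.O (g : K) / (g : K) ^ ord F.O (f : K)))

/-! ### Congruence subgroups -/

/-- The matrices with entries in the ideal `t^m O` of `O`. -/
def matIdeal (I : Type w) (m : ℕ) : AddSubgroup (Matrix I I K) where
  carrier := {X | ∀ i j, ∃ a ∈ maximalIdeal F.O ^ m, (a : K) = X i j}
  add_mem' {X Y} hX hY i j := by
    obtain ⟨a, ha, h⟩ := hX i j
    obtain ⟨b, hb, h'⟩ := hY i j
    exact ⟨a + b, add_mem ha hb, by simp [h, h']⟩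
  zero_mem' i j := ⟨0, zero_mem _, by simp⟩
  neg_mem' {X} hX i j := by
    obtain ⟨a, ha, h⟩ := hX i j
    exact ⟨-a, neg_mem ha, by simp [h]⟩

variable {I : Type w} [Fintype I] [DecidableEq I]

theorem matIdeal_mul {m m' : ℕ} {X Y : Matrix I I K} (hX : X ∈ F.matIdeal I m)
    (hY : Y ∈ F.matIdeal I m') : X * Y ∈ F.matIdeal I (m + m') := fun i j => by
  choose a ha h using hX
  choose b hb h' using hY
  refine ⟨∑ k, a i k * b k j, sum_mem fun k _ => ?_, ?_⟩
  · rw [pow_add]; exact Ideal.mul_mem_mul (ha i k) (hb k j)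
  · simp [Matrix.mul_apply, h, h']

theorem matIdeal_anti {m m' : ℕ} (h : m ≤ m') : F.matIdeal I m' ≤ F.matIdeal I m :=
  fun _ hX i j => let ⟨a, ha, h'⟩ := hX i j; ⟨a, Ideal.pow_le_pow_right h ha, h'⟩

/-- The congruence subgroup `1 + t^m M(O)` of `GL(O)` for `m ≥ 1`, and the group `GL(O)` for
`m = 0`: the invertible matrices `g` such that the entries of `g - 1` and `g⁻¹ - 1` are
in `t^m O`.  (For `m ≥ 1` the condition on `g⁻¹` is automatic.) -/
def congr (I : Type w) [Fintype I] [DecidableEq I] (m : ℕ) : Subgroup (GL I K) where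
  carrier := {g | g.1 - 1 ∈ F.matIdeal I m ∧ (g⁻¹).1 - 1 ∈ F.matIdeal I m}
  one_mem' := by simp [zero_mem]
  mul_mem' := by
    have key : ∀ X Y : Matrix I I K, X - 1 ∈ F.matIdeal I m → Y - 1 ∈ F.matIdeal I m →
        X * Y - 1 ∈ F.matIdeal I m := fun X Y hX hY => by
      have : X * Y - 1 = (X - 1) * (Y - 1) + (X - 1) + (Y - 1) := by noncomm_ring
      rw [this]
      exact add_mem (add_mem (F.matIdeal_anti (Nat.le_add_right m m) (F.matIdeal_mul hX hY)) hX) hY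
    rintro g h ⟨h1, h2⟩ ⟨h3, h4⟩
    exact ⟨key _ _ h1 h3, by rw [mul_inv_rev]; exact key _ _ h4 h2⟩
  inv_mem' := by
    rintro g ⟨h1, h2⟩
    exact ⟨h2, by rwa [inv_inv]⟩

theorem exists_scale (X : Matrix I I K) :
    ∃ l, ∀ m, ∀ Y ∈ F.matIdeal I (l + m), X * Y ∈ F.matIdeal I m ∧ Y * X ∈ F.matIdeal I m := by
  have h1 : ∀ x : K, ∃ l, ∀ m, ∀ a ∈ maximalIdeal F.O ^ (l + m),
      ∃ b ∈ maximalIdeal F.O ^ m, (b : K) = x * a := fun x => by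
    obtain ⟨⟨c, d⟩, e⟩ := IsLocalization.surj (nonZeroDivisors F.O) x
    obtain ⟨ϖ, hϖ⟩ := IsDiscreteValuationRing.exists_irreducible F.O
    obtain ⟨k, hk⟩ := IsDiscreteValuationRing.associated_pow_irreducible
      (nonZeroDivisors.ne_zero d.2) hϖ
    refine ⟨k, fun m a ha => ?_⟩
    rw [hϖ.maximalIdeal_eq, Ideal.span_singleton_pow, Ideal.mem_span_singleton, pow_add] at ha
    obtain ⟨a', rfl⟩ := ha
    obtain ⟨v, hv⟩ := hk
    refine ⟨c * v * ϖ ^ m * a', ?_, ?_⟩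
    · rw [hϖ.maximalIdeal_eq, Ideal.span_singleton_pow, Ideal.mem_span_singleton]
      exact ⟨c * v * a', by ring⟩
    · have e' : x * (d : F.O) = c := e
      rw [← hv]
      push_cast
      rw [← e']
      ring
  choose l hl using h1
  refine ⟨∑ i, ∑ j, l (X i j), fun m Y hY => ?_⟩
  have hle : ∀ i j, l (X i j) ≤ ∑ i, ∑ j, l (X i j) := fun i j =>
    (Finset.single_le_sum (f := fun j => l (X i j)) (fun _ _ => Nat.zero_le _)
      (Finset.mem_univ j)).trans (Finset.single_le_sum (f := fun i => ∑ j, l (X i j))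
        (fun _ _ => Nat.zero_le _) (Finset.mem_univ i))
  have h2 : ∀ i j i' j', ∃ b ∈ maximalIdeal F.O ^ m, (b : K) = X i j * Y i' j' :=
    fun i j i' j' => by
      obtain ⟨a, ha, e⟩ := hY i' j'
      rw [← e]
      exact hl _ m a (Ideal.pow_le_pow_right (Nat.add_le_add_right (hle i j) m) ha)
  choose b hb hb' using h2
  refine ⟨fun i j => ⟨∑ k, b i k k j, sum_mem fun k _ => hb _ _ _ _, ?_⟩,
    fun i j => ⟨∑ k, b k j i k, sum_mem fun k _ => hb _ _ _ _, ?_⟩⟩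
  · simp [Matrix.mul_apply, hb']
  · simp [Matrix.mul_apply, hb', mul_comm]

/-- The filtration of `GL(K)` by the congruence subgroups. -/
def filtration (I : Type) [Fintype I] [DecidableEq I] : SubgroupFiltration (GL I K) where
  C := F.congr I
  anti _ _ h _ hg := ⟨F.matIdeal_anti h hg.1, F.matIdeal_anti h hg.2⟩
  conj g m := by
    obtain ⟨l, hl⟩ := F.exists_scale g.1
    obtain ⟨l', hl'⟩ := F.exists_scale (g⁻¹).1
    have key : ∀ v : GL I K, v.1 - 1 ∈ F.matIdeal I (l + (l' + m)) →
        (g⁻¹ * v * g).1 - 1 ∈ F.matIdeal I m := fun v hv => by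
      have : (g⁻¹ * v * g).1 - 1 = (g⁻¹).1 * ((v.1 - 1) * g.1) := by
        have : (g⁻¹).1 * g.1 = 1 := by rw [← Units.val_mul, inv_mul_cancel, Units.val_one]
        rw [Units.val_mul, Units.val_mul, sub_mul, mul_sub, one_mul, this, mul_assoc]
      rw [this]
      exact (hl' _ _ (hl _ _ hv).2).1
    refine ⟨l + (l' + m), fun v hv => ⟨key v hv.1, ?_⟩⟩
    have := key v⁻¹ hv.2
    rwa [show (g⁻¹ * v * g)⁻¹ = g⁻¹ * v⁻¹ * g by group]

end TwoDimLocalField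

/-! ### The parabolic subgroup -/

/-- The subgroup `P` of block upper triangular matrices with `2 × 2`-blocks in `GL_{2n}(K)`;
rows and columns are indexed by pairs (number of the block, position in the block). -/
def parabolic (n : ℕ) (K : Type u) [Field K] : Subgroup (GL (Fin n × Fin 2) K) where
  carrier := {g | g.1.BlockTriangular Prod.fst}
  one_mem' := Matrix.blockTriangular_one
  mul_mem' ha hb := Matrix.BlockTriangular.mul ha hb
  inv_mem' {g} hg := by
    have : (g⁻¹).1 = (g.1)⁻¹ := Matrix.coe_units_inv g
    have h := Matrix.blockTriangular_inv_of_blockTriangular hg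
    rw [Set.mem_ofPred_eq, this]
    exact h

theorem blockDiag_mul {n : ℕ} {K : Type u} [Field K] {X Y : Matrix (Fin n × Fin 2) (Fin n × Fin 2) K}
    (hX : X.BlockTriangular Prod.fst) (hY : Y.BlockTriangular Prod.fst) (i : Fin n) :
    (X * Y).submatrix (Prod.mk i) (Prod.mk i) =
      X.submatrix (Prod.mk i) (Prod.mk i) * Y.submatrix (Prod.mk i) (Prod.mk i) := by
  ext a b
  rw [Matrix.submatrix_apply, Matrix.mul_apply, Matrix.mul_apply, Fintype.sum_prod_type,
    Finset.sum_eq_single i]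
  · rfl
  · intro k _ hk
    refine Finset.sum_eq_zero fun c _ => ?_
    rcases lt_or_gt_of_ne hk with h | h
    · rw [hX h, zero_mul]
    · rw [hY h, mul_zero]
  · simp

/-- The homomorphism `P → GL_2(K) × ⋯ × GL_2(K)`, `g ↦ (g_1, …, g_n)`. -/
def diagBlocks (n : ℕ) (K : Type u) [Field K] : parabolic n K →* (Fin n → GL (Fin 2) K) where
  toFun g i :=
    { val := g.1.1.submatrix (Prod.mk i) (Prod.mk i)
      inv := (g⁻¹).1.1.submatrix (Prod.mk i) (Prod.mk i)
      val_inv := by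
        rw [← blockDiag_mul g.2 (g⁻¹).2, ← Units.val_mul, ← Subgroup.coe_mul, mul_inv_cancel]
        ext a b; simp [Matrix.one_apply]
      inv_val := by
        rw [← blockDiag_mul (g⁻¹).2 g.2, ← Units.val_mul, ← Subgroup.coe_mul, inv_mul_cancel]
        ext a b; simp [Matrix.one_apply] }
  map_one' := by ext i a b; simp [Matrix.one_apply]
  map_mul' g h := funext fun i => Units.ext (blockDiag_mul g.2 h.2 i)


section Torsors

/-- A `Γ`-equivariant system of torsors over an abelian group `A`, one for each pair `N ≤ Λ` in a
partially ordered set `L`, with associative products for triples `N' ≤ N ≤ Λ`. -/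
structure TorsorSystem (A : Type v) (Γ : Type u) (L : Type w) [CommGroup A] [Group Γ]
    [PartialOrder L] [MulAction Γ L] where
  H : ∀ {N Λ : L}, N ≤ Λ → Type v'
  act : ∀ {N Λ : L} (h : N ≤ Λ), MulAction A (H h)
  nonempty : ∀ {N Λ : L} (h : N ≤ Λ), Nonempty (H h)
  free : ∀ {N Λ : L} (h : N ≤ Λ) (a : A) (x : H h), a • x = x → a = 1
  trans : ∀ {N Λ : L} (h : N ≤ Λ) (x y : H h), ∃ a : A, y = a • x
  mul : ∀ {M N Λ : L} (h : M ≤ N) (h' : N ≤ Λ), H h → H h' → H (h.trans h')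
  smul_mul' : ∀ {M N Λ : L} (h : M ≤ N) (h' : N ≤ Λ) (a : A) (x : H h) (y : H h'),
    mul h h' (a • x) y = a • mul h h' x y
  mul_smul' : ∀ {M N Λ : L} (h : M ≤ N) (h' : N ≤ Λ) (a : A) (x : H h) (y : H h'),
    mul h h' x (a • y) = a • mul h h' x y
  assoc : ∀ {M₁ M₂ M₃ M₄ : L} (h : M₁ ≤ M₂) (h' : M₂ ≤ M₃) (h'' : M₃ ≤ M₄) (x : H h) (y : H h')
    (z : H h''), mul (h.trans h') h'' (mul h h' x y) z = mul h (h'.trans h'') x (mul h' h'' y z)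
  smul_le : ∀ (g : Γ) {N Λ : L}, N ≤ Λ → g • N ≤ g • Λ
  map : ∀ (g : Γ) {N Λ N' Λ' : L} (h : N ≤ Λ) (h' : N' ≤ Λ'), g • N = N' → g • Λ = Λ' → H h → H h'
  map_smul : ∀ (g : Γ) {N Λ N' Λ' : L} (h : N ≤ Λ) (h' : N' ≤ Λ') (e : g • N = N') (e' : g • Λ = Λ')
    (a : A) (x : H h), map g h h' e e' (a • x) = a • map g h h' e e' x
  map_mul : ∀ (g : Γ) {M N Λ M' N' Λ' : L} (h₁ : M ≤ N) (h₂ : N ≤ Λ) (h₁' : M' ≤ N') (h₂' : N' ≤ Λ')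
    (e : g • M = M') (e' : g • N = N') (e'' : g • Λ = Λ') (x : H h₁) (y : H h₂),
    map g _ (h₁'.trans h₂') e e'' (mul h₁ h₂ x y) =
      mul h₁' h₂' (map g h₁ h₁' e e' x) (map g h₂ h₂' e' e'' y)
  map_one : ∀ {N Λ : L} (h : N ≤ Λ) (e : (1 : Γ) • N = N) (e' : (1 : Γ) • Λ = Λ) (x : H h),
    map 1 h h e e' x = x
  map_map : ∀ (g g' : Γ) {N Λ N' Λ' N'' Λ'' : L} (h : N ≤ Λ) (h' : N' ≤ Λ') (h'' : N'' ≤ Λ'')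
    (e₁ : g • N = N') (e₂ : g • Λ = Λ') (e₁' : g' • N' = N'') (e₂' : g' • Λ' = Λ'')
    (e₁'' : (g' * g) • N = N'') (e₂'' : (g' * g) • Λ = Λ'') (x : H h),
    map g' h' h'' e₁' e₂' (map g h h' e₁ e₂ x) = map (g' * g) h h'' e₁'' e₂'' x
  directed : ∀ N Λ : L, ∃ M, M ≤ N ∧ M ≤ Λ

namespace TorsorSystem

variable {A : Type v} {Γ : Type u} {L : Type w} [CommGroup A] [Group Γ] [PartialOrder L]
  [MulAction Γ L] (T : TorsorSystem.{w, v, u, v'} A Γ L)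

attribute [instance] TorsorSystem.act

variable {T} in
theorem smul_cancel {N Λ : L} {h : N ≤ Λ} {a b : A} {x : T.H h} (e : a • x = b • x) : a = b := by
  have := T.free h (b⁻¹ * a) x (by rw [mul_smul, e, inv_smul_smul])
  rwa [inv_mul_eq_one, eq_comm] at this

variable {T} in
theorem cancel_right {M N Λ : L} {h : M ≤ N} {h' : N ≤ Λ} {x x' : T.H h} {y : T.H h'}
    (e : T.mul h h' x y = T.mul h h' x' y) : x = x' := by
  obtain ⟨a, rfl⟩ := T.trans h x x'
  rw [T.smul_mul'] at e
  rw [T.free _ a _ e.symm, one_smul]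

variable {T} in
theorem cancel_left {M N Λ : L} {h : M ≤ N} {h' : N ≤ Λ} {x : T.H h} {y y' : T.H h'}
    (e : T.mul h h' x y = T.mul h h' x y') : y = y' := by
  obtain ⟨a, rfl⟩ := T.trans h' y y'
  rw [T.mul_smul'] at e
  rw [T.free _ a _ e.symm, one_smul]

theorem exists_mul_left {M N Λ : L} (h : M ≤ N) (h' : N ≤ Λ) (y : T.H h') (z : T.H (h.trans h')) :
    ∃ x, T.mul h h' x y = z := by
  obtain ⟨x⟩ := T.nonempty h
  obtain ⟨a, rfl⟩ := T.trans _ (T.mul h h' x y) z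
  exact ⟨a • x, T.smul_mul' ..⟩

theorem exists_mul_right {M N Λ : L} (h : M ≤ N) (h' : N ≤ Λ) (x : T.H h) (z : T.H (h.trans h')) :
    ∃ y, T.mul h h' x y = z := by
  obtain ⟨y⟩ := T.nonempty h'
  obtain ⟨a, rfl⟩ := T.trans _ (T.mul h h' x y) z
  exact ⟨a • y, T.mul_smul' ..⟩

/-- The compatible systems of elements of all the torsors of a torsor system, i.e. the
simultaneous trivializations of these torsors that respect the products. -/
@[ext]
structure Triv where
  val : ∀ {N Λ : L} (h : N ≤ Λ), T.H h
  mul : ∀ {M N Λ : L} (h : M ≤ N) (h' : N ≤ Λ), T.mul h h' (val h) (val h') = val (h.trans h')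

variable {T}

theorem Triv.map_eq (s : T.Triv) {N Λ N' Λ' : L} (h : N ≤ Λ) (h' : N' ≤ Λ') (e : (1 : Γ) • N = N')
    (e' : (1 : Γ) • Λ = Λ') : T.map 1 h h' e e' (s.1 h) = s.1 h' := by
  have e1 : N = N' := by rw [← e, one_smul]
  have e2 : Λ = Λ' := by rw [← e', one_smul]
  subst e1 e2
  exact T.map_one ..

theorem Triv.map_congr (s : T.Triv) (g : Γ) {N Λ N' Λ' M M' : L} (h : N ≤ Λ) (h' : N' ≤ Λ')
    (h'' : M ≤ M') (e₁ : g • N = M) (e₁' : g • Λ = M') (e₂ : g • N' = M) (e₂' : g • Λ' = M') :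
    T.map g h h'' e₁ e₁' (s.1 h) = T.map g h' h'' e₂ e₂' (s.1 h') := by
  have e1 : N = N' := smul_left_cancel g (e₁.trans e₂.symm)
  have e2 : Λ = Λ' := smul_left_cancel g (e₁'.trans e₂'.symm)
  subst e1 e2
  rfl

/-- The action of `Γ` on the set of trivializations. -/
instance : MulAction Γ T.Triv where
  smul g s := ⟨fun h => T.map g (T.smul_le g⁻¹ h) h (smul_inv_smul _ _) (smul_inv_smul _ _) (s.1 _),
    fun h h' => by
      rw [← s.2 (T.smul_le g⁻¹ h) (T.smul_le g⁻¹ h'), T.map_mul g]⟩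
  one_smul s := Triv.ext <| funext fun N => funext fun Λ => funext fun h => s.map_eq ..
  mul_smul g g' s := Triv.ext <| funext fun N => funext fun Λ => funext fun h => by
    change T.map _ _ _ _ _ _ = T.map _ _ _ _ _ (T.map _ _ _ _ _ _)
    rw [T.map_map g' g (e₁'' := by
      rw [smul_smul, smul_smul, mul_inv_cancel_right, mul_inv_cancel, one_smul]) (e₂'' := by
      rw [smul_smul, smul_smul, mul_inv_cancel_right, mul_inv_cancel, one_smul])]
    exact s.map_congr ..

/-- The quotient `s' / s` of two trivializations. -/
noncomputable def ratio (s' s : T.Triv) {N Λ : L} (h : N ≤ Λ) : A :=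
  (T.trans h (s.1 h) (s'.1 h)).choose

theorem ratio_spec (s' s : T.Triv) {N Λ : L} (h : N ≤ Λ) : ratio s' s h • s.1 h = s'.1 h :=
  (T.trans h (s.1 h) (s'.1 h)).choose_spec.symm

theorem ratio_eq {s' s : T.Triv} {N Λ : L} {h : N ≤ Λ} {a : A} (e : a • s.1 h = s'.1 h) :
    ratio s' s h = a :=
  smul_cancel ((ratio_spec s' s h).trans e.symm)

theorem ratio_mul (s' s : T.Triv) {M N Λ : L} (h : M ≤ N) (h' : N ≤ Λ) :
    ratio s' s h * ratio s' s h' = ratio s' s (h.trans h') := by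
  refine (ratio_eq ?_).symm
  rw [← s.2 h h', ← s'.2 h h', ← ratio_spec s' s h, ← ratio_spec s' s h', T.smul_mul', T.mul_smul',
    smul_smul]

theorem ratio_smul (g : Γ) (s' s : T.Triv) {N Λ : L} (h : N ≤ Λ) :
    ratio (g • s') (g • s) h = ratio s' s (T.smul_le g⁻¹ h) := by
  refine ratio_eq ?_
  change _ • T.map _ _ _ _ _ _ = T.map _ _ _ _ _ _
  rw [← T.map_smul, ratio_spec]

theorem ratio_congr (s' s : T.Triv) {N Λ N' Λ' : L} (h : N ≤ Λ) (h' : N' ≤ Λ') (e : N = N')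
    (e' : Λ = Λ') : ratio s' s h = ratio s' s h' := by subst e e'; rfl

theorem nonempty_triv [Nonempty L] (T : TorsorSystem.{w, v, u, v'} A Γ L) : Nonempty T.Triv := by
  obtain ⟨L₁⟩ := ‹Nonempty L›
  choose P hP hP' using fun Λ => T.directed Λ L₁
  have m := fun Λ => (T.nonempty (hP Λ)).some
  have l := fun Λ => (T.nonempty (hP' Λ)).some
  -- the condition on an element of a torsor, expressed on the level of a smaller `R`
  let C : ∀ {N Λ : L} (h : N ≤ Λ) (R : L), R ≤ P N → R ≤ P Λ → T.H h → Prop :=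
    fun {N Λ} h R h₁ h₂ x => ∀ (ν : T.H h₁) (ρ : T.H h₂),
      T.mul h₁ (hP' N) ν (l N) = T.mul h₂ (hP' Λ) ρ (l Λ) →
      T.mul (h₁.trans (hP N)) h (T.mul h₁ (hP N) ν (m N)) x = T.mul h₂ (hP Λ) ρ (m Λ)
  have hC : ∀ {N Λ : L} (h : N ≤ Λ) (R : L) (h₁ : R ≤ P N) (h₂ : R ≤ P Λ) (x : T.H h) (ν : T.H h₁)
      (ρ : T.H h₂), T.mul h₁ (hP' N) ν (l N) = T.mul h₂ (hP' Λ) ρ (l Λ) →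
      T.mul (h₁.trans (hP N)) h (T.mul h₁ (hP N) ν (m N)) x = T.mul h₂ (hP Λ) ρ (m Λ) →
      ∀ S (h₁' : S ≤ P N) (h₂' : S ≤ P Λ), S ≤ R → C h S h₁' h₂' x := by
    intro N Λ h R h₁ h₂ x ν ρ e1 e2 S h₁' h₂' hS ν' ρ' e3
    obtain ⟨α, rfl⟩ := T.exists_mul_left hS h₁ ν ν'
    have : ρ' = T.mul hS h₂ α ρ := by
      refine cancel_right (h' := hP' Λ) (y := l Λ) ?_
      rw [← e3, T.assoc, T.assoc, e1]
    rw [this, T.assoc, T.assoc, T.assoc, ← e2, T.assoc]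
  have hC' : ∀ {N Λ : L} (h : N ≤ Λ) (R S : L) (h₁ : R ≤ P N) (h₂ : R ≤ P Λ) (x : T.H h)
      (h₁' : S ≤ P N) (h₂' : S ≤ P Λ), S ≤ R → C h S h₁' h₂' x → C h R h₁ h₂ x := by
    intro N Λ h R S h₁ h₂ x h₁' h₂' hS e ν ρ e1
    obtain ⟨α⟩ := T.nonempty hS
    have := e (T.mul hS h₁ α ν) (T.mul hS h₂ α ρ) (by rw [T.assoc, T.assoc, e1])
    rw [T.assoc, T.assoc, T.assoc] at this
    rw [T.assoc]
    exact cancel_left this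
  have ex : ∀ {N Λ : L} (h : N ≤ Λ), ∃ x : T.H h, ∀ R h₁ h₂, C h R h₁ h₂ x := by
    intro N Λ h
    obtain ⟨R, h₁, h₂⟩ := T.directed (P N) (P Λ)
    obtain ⟨ν⟩ := T.nonempty h₁
    obtain ⟨ρ, hρ⟩ := T.exists_mul_left h₂ (hP' Λ) (l Λ) (T.mul h₁ (hP' N) ν (l N))
    obtain ⟨x, hx⟩ := T.exists_mul_right (h₁.trans (hP N)) h (T.mul h₁ (hP N) ν (m N))
      (T.mul h₂ (hP Λ) ρ (m Λ))
    refine ⟨x, fun R' h₁' h₂' => ?_⟩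
    obtain ⟨S, hS, hS'⟩ := T.directed R R'
    exact hC' h R' S h₁' h₂' x (hS.trans h₁) (hS.trans h₂) hS'
      (hC h R h₁ h₂ x ν ρ hρ.symm hx S _ _ hS)
  choose s hs using @ex
  refine ⟨⟨@s, @fun M N Λ h h' => ?_⟩⟩
  obtain ⟨R₀, h₁, h₂⟩ := T.directed (P M) (P N)
  obtain ⟨R, h₀, h₃⟩ := T.directed R₀ (P Λ)
  replace h₁ := h₀.trans h₁
  replace h₂ := h₀.trans h₂
  obtain ⟨ν⟩ := T.nonempty h₁
  obtain ⟨ρ, hρ⟩ := T.exists_mul_left h₂ (hP' N) (l N) (T.mul h₁ (hP' M) ν (l M))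
  obtain ⟨τ, hτ⟩ := T.exists_mul_left h₃ (hP' Λ) (l Λ) (T.mul h₁ (hP' M) ν (l M))
  have e1 := hs h R h₁ h₂ ν ρ hρ.symm
  have e2 := hs h' R h₂ h₃ ρ τ (hρ.trans hτ.symm)
  have e3 := hs (h.trans h') R h₁ h₃ ν τ hτ.symm
  refine cancel_left (x := T.mul h₁ (hP M) ν (m M)) ?_
  rw [e3, ← T.assoc, e1, e2]

/-! ### The central extension -/

variable (T) (L₀ : L)

/-- The group of all pairs `(c, g)`, where `g ∈ Γ` and `c` is a function on the set of
trivializations. -/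
abbrev Pairs : Type _ := (T.Triv → A) ⋊[mulAutArrow] Γ

/-- The torsor `T(L₀ ∣ g L₀)` is defined by `T(N ∣ L₀) ⊗ T(L₀ ∣ g L₀) = T(N ∣ g L₀)` for all
`N` below `L₀` and `g L₀`.  A trivialization `s` defines the element `s(N ∣ L₀)⁻¹ s(N ∣ g L₀)` of
this torsor, hence an element of the torsor is a function `c` (its coordinate with respect to
`s`) with the stated dependence on `s`.  The extension is the group of pairs
`(g, μ)`, `μ ∈ T(L₀ ∣ g L₀)`, with the product `(g, μ) (g', μ') = (g g', μ ⊗ g(μ'))`. -/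
def ext : Subgroup T.Pairs where
  carrier := {x | ∀ (s s' : T.Triv) (N : L) (h : N ≤ L₀) (h' : N ≤ x.right • L₀),
    x.left s * ratio s' s h = x.left s' * ratio s' s h'}
  one_mem' s s' N h h' := by
    rw [ratio_congr s' s h' h rfl (one_smul _ _)]; rfl
  mul_mem' {x y} hx hy s s' N h h' := by
    obtain ⟨M₀, hM₀, hM₀'⟩ := T.directed N (x.right • L₀)
    have e1 := hx s s' M₀ (hM₀.trans h) hM₀'
    have h3 : x.right⁻¹ • M₀ ≤ L₀ := by
      have := T.smul_le x.right⁻¹ hM₀'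
      rwa [inv_smul_smul] at this
    have h4 : x.right⁻¹ • M₀ ≤ y.right • L₀ := by
      have := T.smul_le x.right⁻¹ (hM₀.trans h')
      rwa [SemidirectProduct.mul_right, smul_smul, inv_mul_cancel_left] at this
    have e2 := hy (x.right⁻¹ • s) (x.right⁻¹ • s') _ h3 h4
    have e3 : ∀ {N Λ Λ' : L} (h : N ≤ Λ) (h' : x.right⁻¹ • N ≤ Λ') (e : x.right • Λ' = Λ),
        ratio (x.right⁻¹ • s') (x.right⁻¹ • s) h' = ratio s' s h := fun h h' e => by
      rw [ratio_smul]
      exact ratio_congr _ _ _ _ (by rw [inv_inv, smul_inv_smul]) (by rw [inv_inv, e])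
    rw [e3 hM₀' h3 rfl, e3 (hM₀.trans h') h4 (by
      rw [SemidirectProduct.mul_right, smul_smul])] at e2
    change (x.left s * y.left (x.right⁻¹ • s)) * _ = (x.left s' * y.left (x.right⁻¹ • s')) * _
    rw [← mul_right_inj (ratio s' s hM₀)]
    calc _ = (x.left s * (ratio s' s hM₀ * ratio s' s h)) * y.left (x.right⁻¹ • s) := by
          simp only [mul_assoc, mul_comm, mul_left_comm]
      _ = x.left s' * (y.left (x.right⁻¹ • s) * ratio s' s hM₀') := by
          rw [ratio_mul, e1]; simp only [mul_assoc, mul_comm, mul_left_comm]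
      _ = _ := by
          rw [e2, ← ratio_mul s' s hM₀ h']
          simp only [mul_assoc, mul_left_comm]
  inv_mem' {x} hx s s' N h h' := by
    have h1 : x.right • N ≤ L₀ := by
      have := T.smul_le x.right h'
      rwa [SemidirectProduct.inv_right, smul_inv_smul] at this
    have e := hx (x.right • s) (x.right • s') _ h1 (T.smul_le x.right h)
    have e3 : ∀ {N Λ Λ' : L} (h : N ≤ Λ) (h' : x.right • N ≤ Λ') (e : x.right • Λ = Λ'),
        ratio (x.right • s') (x.right • s) h' = ratio s' s h := fun h h' e => by
      rw [ratio_smul]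
      exact ratio_congr _ _ _ _ (by rw [inv_smul_smul]) (by rw [← e, inv_smul_smul])
    rw [e3 h' h1 (smul_inv_smul _ _), e3 h _ rfl] at e
    change (x.left (x.right⁻¹⁻¹ • s))⁻¹ * _ = (x.left (x.right⁻¹⁻¹ • s'))⁻¹ * _
    rw [inv_inv, inv_mul_eq_iff_eq_mul, mul_left_comm, eq_comm, inv_mul_eq_iff_eq_mul, e]

/-- The homomorphism `(g, μ) ↦ g`. -/
def extHom : T.ext L₀ →* Γ := SemidirectProduct.rightHom.comp (T.ext L₀).subtype

/-- The embedding of `A`, the constant functions `c`. -/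
def extInl : A →* T.ext L₀ where
  toFun a := ⟨⟨fun _ => a, 1⟩, fun s s' N h h' => by
    rw [ratio_congr s' s h' h rfl (one_smul _ _)]⟩
  map_one' := rfl
  map_mul' a b := Subtype.ext <| SemidirectProduct.ext rfl (mul_one _).symm

theorem extInl_injective : Function.Injective (T.extInl L₀) := fun a b h => by
  have : Nonempty L := ⟨L₀⟩
  obtain ⟨s⟩ := T.nonempty_triv
  exact congrFun (congrArg (fun x => x.1.left) h) s

theorem extInl_comm (a : A) (x : T.ext L₀) : T.extInl L₀ a * x = x * T.extInl L₀ a := by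
  refine Subtype.ext <| SemidirectProduct.ext (funext fun s => ?_) ?_
  · change a * x.1.left ((1 : Γ)⁻¹ • s) = x.1.left s * a
    rw [inv_one, one_smul, mul_comm]
  · exact (one_mul _).trans (mul_one _).symm

theorem extInl_range : (T.extInl L₀).range = (T.extHom L₀).ker := by
  ext x
  constructor
  · rintro ⟨a, rfl⟩; rfl
  · rintro (hx : x.1.right = 1)
    have : Nonempty L := ⟨L₀⟩
    obtain ⟨s⟩ := T.nonempty_triv
    refine ⟨x.1.left s, Subtype.ext <| SemidirectProduct.ext (funext fun s' => ?_) hx.symm⟩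
    have := x.2 s s' L₀ le_rfl (by rw [hx, one_smul])
    rw [ratio_congr s' s (Λ' := L₀) _ le_rfl rfl
      ((congrArg (· • L₀) hx).trans (one_smul _ _))] at this
    exact mul_right_cancel this

theorem extHom_surjective : Function.Surjective (T.extHom L₀) := fun g => by
  obtain ⟨N, h, h'⟩ := T.directed L₀ (g • L₀)
  have : Nonempty L := ⟨L₀⟩
  obtain ⟨s₀⟩ := T.nonempty_triv
  refine ⟨⟨⟨fun s => ratio s s₀ h * (ratio s s₀ h')⁻¹, g⟩, fun s s' N' k k' => ?_⟩, rfl⟩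
  have e1 : ∀ {N Λ : L} (h : N ≤ Λ), ratio s' s h = ratio s' s₀ h * (ratio s s₀ h)⁻¹ := fun h => by
    refine ratio_eq ?_
    rw [mul_smul, ← ratio_spec s s₀, inv_smul_smul, ratio_spec]
  have e2 : ∀ s : T.Triv, ratio s s₀ h * (ratio s s₀ h')⁻¹ = ratio s s₀ k * (ratio s s₀ k')⁻¹ := by
    intro s
    obtain ⟨M, hM, hM'⟩ := T.directed N N'
    have a1 := (ratio_mul s s₀ hM h).trans (ratio_mul s s₀ hM' k).symm
    have a2 := (ratio_mul s s₀ hM h').trans (ratio_mul s s₀ hM' k').symm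
    rw [← div_eq_mul_inv, ← div_eq_mul_inv, ← mul_div_mul_left_eq_div _ _ (ratio s s₀ hM), a1, a2,
      mul_div_mul_left_eq_div]
  change ratio s s₀ h * (ratio s s₀ h')⁻¹ * ratio s' s k =
    ratio s' s₀ h * (ratio s' s₀ h')⁻¹ * ratio s' s k'
  rw [e2, e2, e1, e1]
  generalize ratio s s₀ k' = a, ratio s s₀ k = b, ratio s' s₀ k = c, ratio s' s₀ k' = d
  rw [mul_comm, show c * b⁻¹ * (b * a⁻¹) = c * a⁻¹ by group,
    show c * d⁻¹ * (d * a⁻¹) = c * a⁻¹ by group]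

end TorsorSystem
end Torsors


section Haar

open MeasureTheory MeasureTheory.Measure
open scoped NNReal CompactlySupported

variable {V : Type v} [AddCommGroup V] [TopologicalSpace V]

/-- The quotient `Λ / N` for subgroups `N ≤ Λ` of a topological abelian group, with the quotient
topology of the induced topology and the Borel `σ`-algebra. -/
def LQuot (N Λ : AddSubgroup V) : Type v := Λ ⧸ N.addSubgroupOf Λ

namespace LQuot

instance (N Λ : AddSubgroup V) : AddCommGroup (LQuot N Λ) :=
  inferInstanceAs (AddCommGroup (Λ ⧸ N.addSubgroupOf Λ))

instance (N Λ : AddSubgroup V) : TopologicalSpace (LQuot N Λ) :=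
  inferInstanceAs (TopologicalSpace (Λ ⧸ N.addSubgroupOf Λ))

instance (N Λ : AddSubgroup V) : MeasurableSpace (LQuot N Λ) := borel _

instance (N Λ : AddSubgroup V) : BorelSpace (LQuot N Λ) := ⟨rfl⟩

/-- The projection `Λ → Λ / N`. -/
def mk (N Λ : AddSubgroup V) : Λ →+ LQuot N Λ := QuotientAddGroup.mk' (N.addSubgroupOf Λ)

theorem mk_surjective (N Λ : AddSubgroup V) : Function.Surjective (mk N Λ) :=
  QuotientAddGroup.mk'_surjective _

theorem mk_eq_zero {N Λ : AddSubgroup V} (x : Λ) : mk N Λ x = 0 ↔ (x : V) ∈ N :=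
  QuotientAddGroup.eq_zero_iff x

theorem mk_eq {N Λ : AddSubgroup V} (x y : Λ) : mk N Λ x = mk N Λ y ↔ (x - y : V) ∈ N := by
  rw [← sub_eq_zero, ← map_sub, mk_eq_zero, AddSubgroup.coe_sub]

/-- The homomorphism `Λ / N → Λ' / N'` induced by an endomorphism of `V`. -/
def map (f : V →+ V) {N Λ N' Λ' : AddSubgroup V} (hN : N ≤ N'.comap f) (hΛ : Λ ≤ Λ'.comap f) :
    LQuot N Λ →+ LQuot N' Λ' :=
  QuotientAddGroup.map _ _ ((f.comp Λ.subtype).codRestrict Λ' fun x => hΛ x.2) fun _ hx => hN hx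

theorem map_mk (f : V →+ V) {N Λ N' Λ' : AddSubgroup V} (hN : N ≤ N'.comap f)
    (hΛ : Λ ≤ Λ'.comap f) (x : Λ) : map f hN hΛ (mk N Λ x) = mk N' Λ' ⟨f x, hΛ x.2⟩ := rfl

variable [IsTopologicalAddGroup V]

instance (N Λ : AddSubgroup V) : IsTopologicalAddGroup (LQuot N Λ) :=
  inferInstanceAs (IsTopologicalAddGroup (Λ ⧸ N.addSubgroupOf Λ))

theorem isOpenQuotientMap_mk (N Λ : AddSubgroup V) : IsOpenQuotientMap (mk N Λ) :=
  QuotientAddGroup.isOpenQuotientMap_mk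

theorem continuous_map {f : V →+ V} (hf : Continuous f) {N Λ N' Λ' : AddSubgroup V}
    (hN : N ≤ N'.comap f) (hΛ : Λ ≤ Λ'.comap f) : Continuous (map f hN hΛ) := by
  rw [(isOpenQuotientMap_mk N Λ).continuous_comp_iff.symm]
  exact (isOpenQuotientMap_mk N' Λ').continuous.comp
    ((hf.comp continuous_subtype_val).subtype_mk _)

theorem t2 {N Λ : AddSubgroup V} (hN : IsClosed (N : Set V)) : T2Space (LQuot N Λ) := by
  have : IsClosed (N.addSubgroupOf Λ : Set Λ) := hN.preimage continuous_subtype_val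
  exact inferInstanceAs (T2Space (Λ ⧸ N.addSubgroupOf Λ))

/-- The embedding `N / N' → Λ / N'`. -/
def incl {N' N Λ : AddSubgroup V} (h' : N ≤ Λ) : LQuot N' N →+ LQuot N' Λ :=
  map (AddMonoidHom.id V) (N' := N') le_rfl h'

/-- The projection `Λ / N' → Λ / N`. -/
def proj {N' N Λ : AddSubgroup V} (h : N' ≤ N) : LQuot N' Λ →+ LQuot N Λ :=
  map (AddMonoidHom.id V) h le_rfl

theorem proj_surjective {N' N Λ : AddSubgroup V} (h : N' ≤ N) :
    Function.Surjective (proj (Λ := Λ) h) := fun x => by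
  obtain ⟨x, rfl⟩ := mk_surjective _ _ x
  exact ⟨mk N' Λ x, rfl⟩

theorem isSES {N' N Λ : AddSubgroup V} (h : N' ≤ N) (h' : N ≤ Λ) (hN : IsClosed (N : Set V)) :
    TopologicalAddGroup.IsSES (incl (N' := N') h') (proj (Λ := Λ) h) where
  isClosedEmbedding := by
    refine .of_continuous_injective_isClosedMap (continuous_map continuous_id _ _) ?_ fun Z hZ => ?_
    · rw [injective_iff_map_eq_zero]
      intro x hx
      obtain ⟨x, rfl⟩ := mk_surjective _ _ x
      exact (mk_eq_zero x).2 ((mk_eq_zero (N := N') (Λ := Λ) _).1 hx)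
    · rw [← (isOpenQuotientMap_mk N' Λ).isQuotientMap.isClosed_preimage]
      have h1 : IsClosed (mk N' N ⁻¹' Z) := hZ.preimage (isOpenQuotientMap_mk N' N).continuous
      have h2 : IsClosed (Subtype.val '' (mk N' N ⁻¹' Z)) :=
        hN.isClosedEmbedding_subtypeVal.isClosedMap _ h1
      convert h2.preimage (continuous_subtype_val (p := fun x => x ∈ Λ)) using 1
      ext x
      constructor
      · rintro ⟨y, hy, e⟩
        obtain ⟨y, rfl⟩ := mk_surjective _ _ y
        have e1 : (y - x : V) ∈ N' := (mk_eq (N := N') (Λ := Λ) _ x).1 e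
        have hx : (x : V) ∈ N := by
          have := sub_mem y.2 (h e1)
          rwa [sub_sub_cancel] at this
        refine ⟨⟨x, hx⟩, ?_, rfl⟩
        have : mk N' N ⟨x, hx⟩ = mk N' N y := by
          rw [eq_comm, mk_eq]; exact e1
        rwa [Set.mem_preimage, this]
      · rintro ⟨y, hy, e⟩
        exact ⟨mk N' N y, hy, congrArg (mk N' Λ) (Subtype.ext e)⟩
  isOpenQuotientMap := by
    exact .of_comp (f := mk N' Λ) (isOpenQuotientMap_mk _ _).continuous (mk_surjective _ _)
      (continuous_map (f := AddMonoidHom.id V) continuous_id _ _) (isOpenQuotientMap_mk N Λ)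
  exact x := by
    obtain ⟨x, rfl⟩ := mk_surjective _ _ x
    constructor
    · intro hx
      have hx : (x : V) ∈ N := (mk_eq_zero (N := N) (Λ := Λ) x).1 hx
      exact ⟨mk N' N ⟨x, hx⟩, rfl⟩
    · rintro ⟨y, e⟩
      obtain ⟨y, rfl⟩ := mk_surjective _ _ y
      have e1 : (y - x : V) ∈ N' := (mk_eq (N := N') (Λ := Λ) _ x).1 e
      refine (mk_eq_zero (N := N) (Λ := Λ) x).2 ?_
      have := sub_mem y.2 (h e1)
      rwa [sub_sub_cancel] at this

end LQuot

open LQuot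

variable [IsTopologicalAddGroup V]

/-- The set of all nonzero (regular) Haar measures on `Λ / N`. -/
@[ext]
structure HaarMeas (N Λ : AddSubgroup V) where
  val : Measure (LQuot N Λ)
  isAddHaarMeasure : val.IsAddHaarMeasure
  regular : val.Regular

namespace HaarMeas

attribute [instance] HaarMeas.isAddHaarMeasure HaarMeas.regular

noncomputable instance (N Λ : AddSubgroup V) : MulAction ℝ≥0ˣ (HaarMeas N Λ) where
  smul c μ := ⟨(c : ℝ≥0) • μ.1, IsAddHaarMeasure.nnreal_smul μ.1 c.ne_zero, inferInstance⟩
  one_smul μ := HaarMeas.ext (one_smul ℝ≥0 μ.1)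
  mul_smul c d μ := HaarMeas.ext (mul_smul (c : ℝ≥0) (d : ℝ≥0) μ.1)

theorem smul_val {N Λ : AddSubgroup V} (c : ℝ≥0ˣ) (μ : HaarMeas N Λ) :
    (c • μ).1 = (c : ℝ≥0) • μ.1 := rfl

theorem ext_integral {N Λ : AddSubgroup V} [LocallyCompactSpace (LQuot N Λ)] [T2Space (LQuot N Λ)]
    {μ ν : HaarMeas N Λ} (h : ∀ f : C_c(LQuot N Λ, ℝ), ∫ x, f x ∂μ.1 = ∫ x, f x ∂ν.1) : μ = ν :=
  HaarMeas.ext (ext_of_integral_eq_on_compactlySupported h)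

theorem nonempty {N Λ : AddSubgroup V} [LocallyCompactSpace (LQuot N Λ)] :
    Nonempty (HaarMeas N Λ) :=
  ⟨⟨addHaar, inferInstance, inferInstance⟩⟩

theorem free {N Λ : AddSubgroup V} [LocallyCompactSpace (LQuot N Λ)] (c : ℝ≥0ˣ)
    (μ : HaarMeas N Λ) (h : c • μ = μ) : c = 1 := by
  obtain ⟨K, hK⟩ := exists_compact_mem_nhds (0 : LQuot N Λ)
  have h1 : μ.1 K ≠ 0 := (measure_pos_of_mem_nhds _ hK.2).ne'
  have h2 : μ.1 K ≠ ⊤ := hK.1.measure_lt_top.ne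
  have h3 := congrArg (fun μ : HaarMeas N Λ => (μ.1 K).toNNReal) h
  simp only [smul_val, Measure.smul_apply, ENNReal.smul_def, smul_eq_mul, ENNReal.toNNReal_mul,
    ENNReal.toNNReal_coe] at h3
  refine Units.ext (mul_right_cancel₀ (b := (μ.1 K).toNNReal) ?_ (by rw [h3, Units.val_one, one_mul]))
  simp [ENNReal.toNNReal_eq_zero_iff, h1, h2]

theorem trans {N Λ : AddSubgroup V} [LocallyCompactSpace (LQuot N Λ)] (μ ν : HaarMeas N Λ) :
    ∃ c : ℝ≥0ˣ, ν = c • μ :=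
  ⟨Units.mk0 (addHaarScalarFactor ν.1 μ.1) (addHaarScalarFactor_pos_of_isAddHaarMeasure _ _).ne',
    HaarMeas.ext (isAddLeftInvariant_eq_smul_of_regular ν.1 μ.1)⟩

/-- The Haar measure on `Λ / N'` defined by Haar measures on `N / N'` and `Λ / N`
(for `N' ≤ N ≤ Λ`, `N` closed). -/
noncomputable def mul {N' N Λ : AddSubgroup V} [LocallyCompactSpace (LQuot N' Λ)]
    [T2Space (LQuot N' Λ)] (h : N' ≤ N) (h' : N ≤ Λ) (hN : IsClosed (N : Set V))
    (μ : HaarMeas N' N) (ν : HaarMeas N Λ) : HaarMeas N' Λ :=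
  ⟨(isSES h h' hN).inducedMeasure μ.1 ν.1, inferInstance, inferInstance⟩

section

variable {N' N Λ : AddSubgroup V} [LocallyCompactSpace (LQuot N' Λ)] [T2Space (LQuot N' Λ)]
    (h : N' ≤ N) (h' : N ≤ Λ) (hN : IsClosed (N : Set V)) (μ : HaarMeas N' N) (ν : HaarMeas N Λ)

/-- The function on `Λ / N` obtained from a function on `Λ / N'` by integration over the cosets
of `N / N'`. -/
noncomputable def push (f : C_c(LQuot N' Λ, ℝ)) : C_c(LQuot N Λ, ℝ) :=
  (isSES h h' hN).pushforward μ.1 f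

theorem push_proj (f : C_c(LQuot N' Λ, ℝ)) (b : LQuot N' Λ) :
    push h h' hN μ f (proj h b) = ∫ a, f (b + incl h' a) ∂μ.1 :=
  (isSES h h' hN).pushforward_apply_apply μ.1 f b

theorem integral_mul (f : C_c(LQuot N' Λ, ℝ)) :
    ∫ x, f x ∂(mul h h' hN μ ν).1 = ∫ x, push h h' hN μ f x ∂ν.1 :=
  (isSES h h' hN).integral_inducedMeasure μ.1 ν.1 f

theorem push_eq (f : C_c(LQuot N' Λ, ℝ)) (F : LQuot N Λ → ℝ)
    (hF : ∀ b, F (proj h b) = ∫ a, f (b + incl h' a) ∂μ.1) (x : LQuot N Λ) :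
    push h h' hN μ f x = F x := by
  obtain ⟨b, rfl⟩ := proj_surjective h x
  rw [push_proj, hF]

theorem smul_mul (c : ℝ≥0ˣ) : mul h h' hN (c • μ) ν = c • mul h h' hN μ ν := by
  refine ext_integral fun f => ?_
  rw [smul_val, integral_smul_nnreal_measure, integral_mul, integral_mul, NNReal.smul_def,
    ← integral_smul]
  refine integral_congr_ae (.of_forall fun x => ?_)
  refine push_eq h h' hN (c • μ) f (fun x => ((c : ℝ≥0) : ℝ) • push h h' hN μ f x) (fun b => ?_) x
  rw [smul_val, integral_smul_nnreal_measure, push_proj, NNReal.smul_def]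

theorem mul_smul (c : ℝ≥0ˣ) : mul h h' hN μ (c • ν) = c • mul h h' hN μ ν := by
  refine ext_integral fun f => ?_
  rw [smul_val, integral_smul_nnreal_measure, integral_mul, integral_mul, smul_val,
    integral_smul_nnreal_measure]

end

theorem mul_assoc {M₁ M₂ M₃ M₄ : AddSubgroup V} [LocallyCompactSpace (LQuot M₁ M₃)]
    [LocallyCompactSpace (LQuot M₁ M₄)] [LocallyCompactSpace (LQuot M₂ M₄)]
    [T2Space (LQuot M₁ M₃)] [T2Space (LQuot M₁ M₄)] [T2Space (LQuot M₂ M₄)]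
    (h : M₁ ≤ M₂) (h' : M₂ ≤ M₃) (h'' : M₃ ≤ M₄) (hM₂ : IsClosed (M₂ : Set V))
    (hM₃ : IsClosed (M₃ : Set V)) (x : HaarMeas M₁ M₂) (y : HaarMeas M₂ M₃) (z : HaarMeas M₃ M₄) :
    mul (h.trans h') h'' hM₃ (mul h h' hM₂ x y) z =
      mul h (h'.trans h'') hM₂ x (mul h' h'' hM₃ y z) := by
  refine ext_integral fun f => ?_
  rw [integral_mul, integral_mul, integral_mul]
  refine integral_congr_ae (.of_forall fun c => ?_)
  refine push_eq _ _ hM₃ _ f _ (fun b => ?_) c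
  have e1 : proj (h.trans h') b = proj h' (proj h b) := by
    obtain ⟨b, rfl⟩ := mk_surjective _ _ b; rfl
  rw [e1, push_proj]
  have e2 := integral_mul h h' hM₂ x y ((isSES (h.trans h') h'' hM₃).pullback f b)
  refine Eq.trans ?_ e2.symm
  refine integral_congr_ae (.of_forall fun d => ?_)
  refine (push_eq h h' hM₂ x _ (fun d => push h (h'.trans h'') hM₂ x f (proj h b + incl h'' d))
    (fun d => ?_) d).symm
  have e3 : proj h b + incl h'' (proj h d) = proj h (b + incl h'' d) := by
    obtain ⟨b, rfl⟩ := mk_surjective _ _ b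
    obtain ⟨d, rfl⟩ := mk_surjective _ _ d
    rfl
  rw [e3, push_proj]
  refine integral_congr_ae (.of_forall fun a => ?_)
  refine congrArg f ?_
  rw [add_assoc]
  congr 1
  obtain ⟨d, rfl⟩ := mk_surjective _ _ d
  obtain ⟨a, rfl⟩ := mk_surjective _ _ a
  rfl

/-- The image of a Haar measure under an isomorphism. -/
noncomputable def map {N Λ N' Λ' : AddSubgroup V} (e : LQuot N Λ ≃ₜ+ LQuot N' Λ')
    (μ : HaarMeas N Λ) : HaarMeas N' Λ' :=
  ⟨μ.1.map e, inferInstance, Regular.map e.toHomeomorph⟩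

theorem integral_map {N Λ N' Λ' : AddSubgroup V} (e : LQuot N Λ ≃ₜ+ LQuot N' Λ')
    (μ : HaarMeas N Λ) (f : LQuot N' Λ' → ℝ) : ∫ x, f x ∂(map e μ).1 = ∫ x, f (e x) ∂μ.1 :=
  e.toHomeomorph.isClosedEmbedding.measurableEmbedding.integral_map f

theorem map_smul {N Λ N' Λ' : AddSubgroup V} (e : LQuot N Λ ≃ₜ+ LQuot N' Λ') (c : ℝ≥0ˣ)
    (μ : HaarMeas N Λ) : map e (c • μ) = c • map e μ :=
  HaarMeas.ext (Measure.map_smul _ _ _)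

theorem map_mul {N₁ N₂ N₃ M₁ M₂ M₃ : AddSubgroup V}
    [LocallyCompactSpace (LQuot N₁ N₃)] [T2Space (LQuot N₁ N₃)]
    [LocallyCompactSpace (LQuot M₁ M₃)] [T2Space (LQuot M₁ M₃)]
    (h₁ : N₁ ≤ N₂) (h₂ : N₂ ≤ N₃) (h₁' : M₁ ≤ M₂) (h₂' : M₂ ≤ M₃) (hN : IsClosed (N₂ : Set V))
    (hM : IsClosed (M₂ : Set V)) (e : LQuot N₁ N₃ ≃ₜ+ LQuot M₁ M₃) (i : LQuot N₁ N₂ ≃ₜ+ LQuot M₁ M₂)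
    (p : LQuot N₂ N₃ ≃ₜ+ LQuot M₂ M₃) (hi : ∀ x, e (incl h₂ x) = incl h₂' (i x))
    (hp : ∀ x, p (proj h₁ x) = proj h₁' (e x)) (x : HaarMeas N₁ N₂) (y : HaarMeas N₂ N₃) :
    map e (mul h₁ h₂ hN x y) = mul h₁' h₂' hM (map i x) (map p y) := by
  refine ext_integral fun f => ?_
  rw [integral_map, integral_mul, integral_map]
  refine (integral_mul h₁ h₂ hN x y (f.comp e.toHomeomorph.toCocompactMap)).trans ?_
  refine integral_congr_ae (.of_forall fun c => ?_)
  refine push_eq _ _ hN _ _ (fun c => push h₁' h₂' hM (map i x) f (p c)) (fun b => ?_) c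
  rw [hp, push_proj, integral_map]
  refine integral_congr_ae (.of_forall fun a => ?_)
  refine congrArg f ?_
  rw [← hi, ← map_add]
  rfl

end HaarMeas

/-- A system of closed subgroups ("lattices") of a topological abelian group `V`, permuted by a
group `Γ` of automorphisms of `V`, with locally compact quotients. -/
structure LatticeSystem (Γ : Type u) [Group Γ] (V : Type v) [AddCommGroup V] [TopologicalSpace V] where
  ρ : Γ → V →+ V
  ρ_one : ρ 1 = AddMonoidHom.id V
  ρ_mul : ∀ g h, ρ (g * h) = (ρ g).comp (ρ h)
  continuous : ∀ g, Continuous (ρ g)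
  Lat : Set (AddSubgroup V)
  map_mem : ∀ g, ∀ Λ ∈ Lat, Λ.map (ρ g) ∈ Lat
  closed : ∀ Λ ∈ Lat, IsClosed (Λ : Set V)
  locallyCompact : ∀ N ∈ Lat, ∀ Λ ∈ Lat, N ≤ Λ → LocallyCompactSpace (LQuot N Λ)
  directed : ∀ N ∈ Lat, ∀ Λ ∈ Lat, ∃ M ∈ Lat, M ≤ N ∧ M ≤ Λ

namespace LatticeSystem

variable {Γ : Type u} [Group Γ] (D : LatticeSystem Γ V)

instance : MulAction Γ D.Lat where
  smul g Λ := ⟨Λ.1.map (D.ρ g), D.map_mem g _ Λ.2⟩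
  one_smul Λ := Subtype.ext <| by
    change Λ.1.map (D.ρ 1) = Λ.1
    rw [D.ρ_one, AddSubgroup.map_id]
  mul_smul g h Λ := Subtype.ext <| by
    change Λ.1.map (D.ρ (g * h)) = (Λ.1.map (D.ρ h)).map (D.ρ g)
    rw [D.ρ_mul, AddSubgroup.map_map]

theorem smul_val (g : Γ) (Λ : D.Lat) : (g • Λ).1 = Λ.1.map (D.ρ g) := rfl

theorem le_comap {g : Γ} {Λ Λ' : D.Lat} (h : g • Λ = Λ') : Λ.1 ≤ Λ'.1.comap (D.ρ g) := by
  rw [← h]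
  exact AddSubgroup.le_comap_map _ _

theorem ρ_inv_apply (g : Γ) (x : V) : D.ρ g⁻¹ (D.ρ g x) = x := by
  rw [← AddMonoidHom.comp_apply, ← D.ρ_mul, inv_mul_cancel, D.ρ_one]
  rfl

/-- The isomorphism `Λ / N → gΛ / gN`. -/
def equiv (g : Γ) {N Λ N' Λ' : D.Lat} (hN : g • N = N') (hΛ : g • Λ = Λ') :
    LQuot N.1 Λ.1 ≃ₜ+ LQuot N'.1 Λ'.1 where
  toFun := LQuot.map (D.ρ g) (D.le_comap hN) (D.le_comap hΛ)
  invFun := LQuot.map (D.ρ g⁻¹) (D.le_comap (by rw [← hN, inv_smul_smul]))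
    (D.le_comap (by rw [← hΛ, inv_smul_smul]))
  left_inv x := by
    obtain ⟨x, rfl⟩ := mk_surjective _ _ x
    rw [map_mk, map_mk]
    exact congrArg _ (Subtype.ext (D.ρ_inv_apply g x))
  right_inv x := by
    obtain ⟨x, rfl⟩ := mk_surjective _ _ x
    rw [map_mk, map_mk]
    refine congrArg _ (Subtype.ext ?_)
    have := D.ρ_inv_apply g⁻¹ x
    rwa [inv_inv] at this
  map_add' := map_add _
  continuous_toFun := continuous_map (D.continuous g) _ _
  continuous_invFun := continuous_map (D.continuous g⁻¹) _ _

theorem equiv_mk (g : Γ) {N Λ N' Λ' : D.Lat} (hN : g • N = N') (hΛ : g • Λ = Λ') (x : Λ.1) :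
    D.equiv g hN hΛ (LQuot.mk N.1 Λ.1 x) = LQuot.mk N'.1 Λ'.1 ⟨D.ρ g x, D.le_comap hΛ x.2⟩ := rfl

theorem lc {N Λ : D.Lat} (h : N ≤ Λ) : LocallyCompactSpace (LQuot N.1 Λ.1) :=
  D.locallyCompact _ N.2 _ Λ.2 h

theorem t2 (N Λ : D.Lat) : T2Space (LQuot N.1 Λ.1) := LQuot.t2 (D.closed _ N.2)

/-- The torsors of Haar measures on the groups `Λ / N`. -/
noncomputable def torsors : TorsorSystem.{v, 0, u, v} ℝ≥0ˣ Γ D.Lat where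
  H {N Λ} _ := HaarMeas N.1 Λ.1
  act _ := inferInstance
  nonempty h := by have := D.lc h; exact HaarMeas.nonempty
  free h a x e := by have := D.lc h; exact HaarMeas.free a x e
  trans h x y := by have := D.lc h; exact HaarMeas.trans x y
  mul {M N Λ} h h' μ ν :=
    have := D.lc (h.trans h')
    have := D.t2 M Λ
    HaarMeas.mul h h' (D.closed _ N.2) μ ν
  smul_mul' {M N Λ} h h' a x y := by
    have := D.lc (h.trans h')
    have := D.t2 M Λ
    exact HaarMeas.smul_mul h h' _ x y a
  mul_smul' {M N Λ} h h' a x y := by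
    have := D.lc (h.trans h')
    have := D.t2 M Λ
    exact HaarMeas.mul_smul h h' _ x y a
  assoc {M₁ M₂ M₃ M₄} h h' h'' x y z := by
    have := D.lc (h.trans h')
    have := D.lc ((h.trans h').trans h'')
    have := D.lc (h'.trans h'')
    have := D.t2 M₁ M₃
    have := D.t2 M₁ M₄
    have := D.t2 M₂ M₄
    exact HaarMeas.mul_assoc h h' h'' (D.closed _ M₂.2) (D.closed _ M₃.2) x y z
  smul_le g _ _ h := AddSubgroup.map_mono h
  map g _ _ _ _ _ _ e e' x := HaarMeas.map (D.equiv g e e') x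
  map_smul g _ _ _ _ _ _ e e' a x := HaarMeas.map_smul _ _ _
  map_mul g M N Λ M' N' Λ' h₁ h₂ h₁' h₂' e e' e'' x y := by
    have := D.lc (h₁.trans h₂)
    have := D.lc (h₁'.trans h₂')
    have := D.t2 M Λ
    have := D.t2 M' Λ'
    refine HaarMeas.map_mul h₁ h₂ h₁' h₂' _ _ _ _ _ (fun x => ?_) (fun x => ?_) x y
    · obtain ⟨x, rfl⟩ := mk_surjective _ _ x
      rfl
    · obtain ⟨x, rfl⟩ := mk_surjective _ _ x
      rfl
  map_one {N Λ} h e e' x := by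
    refine HaarMeas.ext ?_
    have : (D.equiv 1 e e' : LQuot N.1 Λ.1 → LQuot N.1 Λ.1) = id := funext fun y => by
      obtain ⟨y, rfl⟩ := mk_surjective _ _ y
      rw [equiv_mk]
      refine congrArg _ (Subtype.ext ?_)
      change D.ρ 1 y = y
      rw [D.ρ_one]
      rfl
    change Measure.map (D.equiv 1 e e') x.1 = x.1
    rw [this, Measure.map_id]
  map_map g g' N Λ N' Λ' N'' Λ'' h h' h'' e₁ e₂ e₁' e₂' e₁'' e₂'' x := by
    refine HaarMeas.ext ?_
    change Measure.map (D.equiv g' e₁' e₂') (Measure.map (D.equiv g e₁ e₂) x.1) =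
      Measure.map (D.equiv (g' * g) e₁'' e₂'') x.1
    have h1 : Measurable (D.equiv g' e₁' e₂') := (D.equiv g' e₁' e₂').continuous_toFun.measurable
    have h2 : Measurable (D.equiv g e₁ e₂) := (D.equiv g e₁ e₂).continuous_toFun.measurable
    rw [Measure.map_map h1 h2]
    congr 1
    funext y
    obtain ⟨y, rfl⟩ := mk_surjective _ _ y
    rw [Function.comp_apply, equiv_mk, equiv_mk, equiv_mk]
    refine congrArg _ (Subtype.ext ?_)
    change D.ρ g' (D.ρ g y) = D.ρ (g' * g) y
    rw [D.ρ_mul]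
    rfl
  directed N Λ := by
    obtain ⟨M, hM, h⟩ := D.directed _ N.2 _ Λ.2
    exact ⟨⟨M, hM⟩, h⟩

end LatticeSystem

end Haar


section Natural

open IsLocalRing Topology

namespace TwoDimLocalField

variable {K : Type u} [Field K] (F : TwoDimLocalField K)

/-- The properties of the natural topology of a two-dimensional local field that are used: `K` is
a topological group under addition, the multiplications by constants are continuous, the valuation
ring `O` is closed, the groups `O / aO` are locally compact, and the quotient topology on the
residue field of `O` is the topology of its discrete valuation. -/
structure IsNaturalTopology [TopologicalSpace K] : Prop where
  isTopologicalAddGroup : IsTopologicalAddGroup K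
  continuous_mul : ∀ a : K, Continuous fun x => a * x
  isClosed : IsClosed (F.O : Set K)
  locallyCompact : ∀ a ∈ F.O, a ≠ 0 → LocallyCompactSpace
    (LQuot (F.O.toSubring.toAddSubgroup.map (AddMonoidHom.mulLeft a)) F.O.toSubring.toAddSubgroup)
  residue : ∀ S : Set (ResidueField F.O), {x : F.O | IsLocalRing.residue F.O x ∈ S} ∈ 𝓝 (0 : F.O) ↔
    ∃ j : ℕ, ∀ y ∈ maximalIdeal F.O₁ ^ j, (y : ResidueField F.O) ∈ S

variable (I : Type) [Fintype I] [DecidableEq I]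

/-- The standard lattice `O^I` in `K^I`. -/
def stdLattice : AddSubgroup (I → K) where
  carrier := {v | ∀ i, v i ∈ F.O}
  zero_mem' _ := zero_mem _
  add_mem' hv hw i := add_mem (hv i) (hw i)
  neg_mem' hv i := neg_mem (hv i)

/-- The automorphism of `K^I` defined by a matrix. -/
def matAct (I : Type) [Fintype I] [DecidableEq I] (g : GL I K) : (I → K) →+ (I → K) :=
  g.1.mulVecLin.toAddMonoidHom

theorem matAct_apply (g : GL I K) (v : I → K) : matAct I g v = g.1.mulVec v := rfl

theorem matAct_one : matAct I (1 : GL I K) = AddMonoidHom.id (I → K) :=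
  AddMonoidHom.ext fun v => Matrix.one_mulVec v

theorem matAct_mul (g h : GL I K) : matAct I (g * h) = (matAct I g).comp (matAct I h) :=
  AddMonoidHom.ext fun v => (Matrix.mulVec_mulVec v g.1 h.1).symm

theorem matAct_inv (g : GL I K) (v : I → K) : matAct I g⁻¹ (matAct I g v) = v := by
  rw [← AddMonoidHom.comp_apply, ← matAct_mul, inv_mul_cancel, matAct_one]; rfl

theorem matAct_inv' (g : GL I K) (v : I → K) : matAct I g (matAct I g⁻¹ v) = v := by
  rw [← AddMonoidHom.comp_apply, ← matAct_mul, mul_inv_cancel, matAct_one]; rfl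

/-- The lattices `g O^I`, `g ∈ GL(K)`. -/
def lattices : Set (AddSubgroup (I → K)) := {Λ | ∃ g : GL I K, Λ = (F.stdLattice I).map (matAct I g)}

theorem mem_map_iff (g : GL I K) (v : I → K) :
    v ∈ (F.stdLattice I).map (matAct I g) ↔ matAct I g⁻¹ v ∈ F.stdLattice I := by
  constructor
  · rintro ⟨w, hw, rfl⟩
    rwa [matAct_inv]
  · intro h
    exact ⟨_, h, matAct_inv' ..⟩

theorem exists_denom (X : Matrix I I K) : ∃ a ∈ F.O, a ≠ 0 ∧ ∀ i j, a * X i j ∈ F.O := by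
  obtain ⟨b, hb⟩ := IsLocalization.exist_integer_multiples_of_finite (nonZeroDivisors F.O)
    (fun p : I × I => X p.1 p.2)
  refine ⟨b.1, b.1.2, fun h => nonZeroDivisors.ne_zero b.2 (Subtype.ext h), fun i j => ?_⟩
  obtain ⟨c, hc⟩ := hb (i, j)
  have : (c : K) = b.1 * X i j := hc
  rw [← this]
  exact c.2

theorem matAct_mem (g : GL I K) {a : K} (ha : ∀ i j, a * g.1 i j ∈ F.O) {v : I → K}
    (hv : v ∈ F.stdLattice I) : a • matAct I g v ∈ F.stdLattice I := fun i => by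
  rw [matAct_apply, Pi.smul_apply, Matrix.mulVec, dotProduct, smul_eq_mul, Finset.mul_sum]
  refine sum_mem fun j _ => ?_
  rw [← mul_assoc]
  exact mul_mem (ha i j) (hv j)

variable {F} [TopologicalSpace K]

theorem continuous_matAct (hF : F.IsNaturalTopology) (g : GL I K) : Continuous (matAct I g) := by
  have := hF.isTopologicalAddGroup
  refine continuous_pi fun i => ?_
  exact continuous_finsetSum _ fun j _ => (hF.continuous_mul _).comp (continuous_apply j)

theorem isClosed_lattice (hF : F.IsNaturalTopology) {Λ : AddSubgroup (I → K)} (h : Λ ∈ F.lattices I) :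
    IsClosed (Λ : Set (I → K)) := by
  obtain ⟨g, rfl⟩ := h
  have h1 : IsClosed (F.stdLattice I : Set (I → K)) := by
    have : (F.stdLattice I : Set (I → K)) = ⋂ i, (fun v => v i) ⁻¹' (F.O : Set K) := by
      ext v; simp [stdLattice]
    rw [this]
    exact isClosed_iInter fun i => hF.isClosed.preimage (continuous_apply i)
  convert h1.preimage (continuous_matAct I hF g⁻¹) using 1
  ext v
  exact F.mem_map_iff I g v

theorem locallyCompact_lattice (hF : F.IsNaturalTopology) {N Λ : AddSubgroup (I → K)} (hN : N ∈ F.lattices I)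
    (hΛ : Λ ∈ F.lattices I) (h : N ≤ Λ) : LocallyCompactSpace (LQuot N Λ) := by
  have := hF.isTopologicalAddGroup
  obtain ⟨n, rfl⟩ := hN
  obtain ⟨l, rfl⟩ := hΛ
  obtain ⟨a, ha, ha0, hX⟩ := F.exists_denom I (n⁻¹ * l).1
  have := hF.locallyCompact a ha ha0
  have hmem : ∀ x : I → F.O.toSubring.toAddSubgroup, (fun i => (x i : K)) ∈ F.stdLattice I :=
    fun x i => (x i).2
  -- the open quotient map `O^I → Λ / N`
  let f₁ : (I → F.O.toSubring.toAddSubgroup) ≃ₜ (F.stdLattice I).map (matAct I l) :=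
    { toFun := fun x => ⟨matAct I l fun i => x i, (F.mem_map_iff I l _).2 (by
        rw [matAct_inv]; exact hmem x)⟩
      invFun := fun v i => ⟨matAct I l⁻¹ v.1 i, (F.mem_map_iff I l _).1 v.2 i⟩
      left_inv := fun x => funext fun i => Subtype.ext (congrFun (matAct_inv I l _) i)
      right_inv := fun v => Subtype.ext (matAct_inv' I l _)
      continuous_toFun := ((continuous_matAct I hF l).comp (continuous_pi fun i =>
        continuous_subtype_val.comp (continuous_apply i))).subtype_mk _
      continuous_invFun := continuous_pi fun i => ((continuous_apply i).comp
        ((continuous_matAct I hF l⁻¹).comp continuous_subtype_val)).subtype_mk _ }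
  let f : (I → F.O.toSubring.toAddSubgroup) →
      LQuot ((F.stdLattice I).map (matAct I n)) ((F.stdLattice I).map (matAct I l)) :=
    LQuot.mk _ _ ∘ f₁
  have hf : IsOpenQuotientMap f := (LQuot.isOpenQuotientMap_mk _ _).comp f₁.isOpenQuotientMap
  let Oa := F.O.toSubring.toAddSubgroup.map (AddMonoidHom.mulLeft a)
  let p : (I → F.O.toSubring.toAddSubgroup) → I → LQuot Oa F.O.toSubring.toAddSubgroup :=
    Pi.map fun _ => LQuot.mk Oa _
  have hp : IsOpenQuotientMap p := .piMap fun _ => LQuot.isOpenQuotientMap_mk _ _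
  have hpf : ∀ x y, p x = p y → f x = f y := fun x y e => by
    have h1 : ∀ i, ∃ z ∈ F.O, a * z = x i - y i := fun i =>
      (LQuot.mk_eq (x i) (y i)).1 (congrFun e i)
    choose z hz hz' using h1
    refine (LQuot.mk_eq _ _).2 ((F.mem_map_iff I n _).2 ?_)
    change matAct I n⁻¹ (matAct I l (fun i => x i) - matAct I l (fun i => y i)) ∈ _
    have h2 : (fun i => (x i : K)) - (fun i => (y i : K)) = a • z := funext fun i => (hz' i).symm
    rw [← map_sub, h2, ← AddMonoidHom.comp_apply, ← matAct_mul, matAct_apply, Matrix.mulVec_smul]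
    exact F.matAct_mem I (n⁻¹ * l) hX hz
  let f' : (I → LQuot Oa F.O.toSubring.toAddSubgroup) → _ := fun y => f (Function.surjInv hp.surjective y)
  have hf' : f' ∘ p = f := funext fun x => hpf _ _ (Function.surjInv_eq hp.surjective _)
  have : IsOpenQuotientMap f' := by
    rw [← hp.of_comp_iff, hf']
    exact hf
  exact this.locallyCompactSpace

/-- The scalar matrix `a`. -/
def scalarGL (a : Kˣ) : GL I K := Units.map (Matrix.scalar I).toMonoidHom a

theorem matAct_scalarGL (a : Kˣ) (v : I → K) : matAct I (scalarGL I a) v = (a : K) • v := by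
  rw [matAct_apply]
  change (Matrix.scalar I (a : K)).mulVec v = _
  ext i
  simp [Matrix.scalar_apply, Matrix.mulVec_diagonal]

theorem directed_lattices {N Λ : AddSubgroup (I → K)} (hN : N ∈ F.lattices I)
    (hΛ : Λ ∈ F.lattices I) : ∃ M ∈ F.lattices I, M ≤ N ∧ M ≤ Λ := by
  obtain ⟨n, rfl⟩ := hN
  obtain ⟨l, rfl⟩ := hΛ
  obtain ⟨a, ha, ha0, hX⟩ := F.exists_denom I (n⁻¹).1
  obtain ⟨b, hb, hb0, hY⟩ := F.exists_denom I (l⁻¹).1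
  have key : ∀ g : GL I K, (∀ i j, (a * b) * (g⁻¹).1 i j ∈ F.O) →
      (F.stdLattice I).map (matAct I (scalarGL I (Units.mk0 _ (mul_ne_zero ha0 hb0)))) ≤
        (F.stdLattice I).map (matAct I g) := by
    rintro g hg _ ⟨v, hv, rfl⟩
    rw [F.mem_map_iff, matAct_scalarGL, matAct_apply, Matrix.mulVec_smul]
    exact F.matAct_mem I g⁻¹ hg hv
  refine ⟨_, ⟨_, rfl⟩, key n fun i j => ?_, key l fun i j => ?_⟩
  · rw [mul_comm a, mul_assoc]; exact mul_mem hb (hX i j)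
  · rw [mul_assoc]; exact mul_mem ha (hY i j)

/-- The lattices in `K^I`, with the action of `GL(K)`. -/
def latticeSystem (hF : F.IsNaturalTopology) : LatticeSystem (GL I K) (I → K) where
  ρ := matAct I
  ρ_one := matAct_one I
  ρ_mul := matAct_mul I
  continuous := continuous_matAct I hF
  Lat := F.lattices I
  map_mem g Λ := by
    rintro ⟨h, rfl⟩
    exact ⟨g * h, by rw [matAct_mul, AddSubgroup.map_map]⟩
  closed _ h := isClosed_lattice I hF h
  locallyCompact _ hN _ hΛ h := locallyCompact_lattice I hF hN hΛ h
  directed _ hN _ hΛ := directed_lattices I hN hΛ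

/-- The lattice `O^I` as an element of the set of lattices. -/
def baseLattice (hF : F.IsNaturalTopology) : (latticeSystem I hF).Lat := ⟨F.stdLattice I, 1, by
  rw [matAct_one, AddSubgroup.map_id]⟩

end TwoDimLocalField
end Natural

/-! ### Central extensions of `GL₂(K)` which split over `Kˣ` -/

section Hat

variable {K : Type u} [Field K]

/-- The diagonal matrices. -/
def diagGL (d : Fin 2 → Kˣ) : GL (Fin 2) K where
  val := Matrix.diagonal fun i => (d i : K)
  inv := Matrix.diagonal fun i => ((d i)⁻¹ : Kˣ)
  val_inv := by simp [Matrix.diagonal_mul_diagonal]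
  inv_val := by simp [Matrix.diagonal_mul_diagonal]

/-- The embedding `Kˣ → GL₂(K)` in the upper left corner, `u ↦ diag(u, 1)`. -/
def corner : Kˣ →* GL (Fin 2) K where
  toFun u := diagGL ![u, 1]
  map_one' := by ext i j; fin_cases i <;> fin_cases j <;> simp [diagGL]
  map_mul' u v := by ext i j; fin_cases i <;> fin_cases j <;> simp [diagGL]

theorem det_corner (u : Kˣ) : (corner u).det = u := by
  ext
  simp [corner, diagGL, Matrix.det_diagonal]

/-- A central extension `ρ : T → SL₂(K)` of `SL₂(K)` (as a subgroup of `GL₂(K)`) by `A` together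
with a lift of the action of `Kˣ` on `SL₂(K)` by conjugation with `diag(u, 1)`, which is trivial
on `A`. -/
structure HatData (A : Type v) [CommGroup A] (T : Type w) [Group T] (K : Type u) [Field K] where
  ρ : T →* GL (Fin 2) K
  range_ρ : ∀ g, g ∈ ρ.range ↔ g.det = 1
  inl : A →* T
  inl_injective : Function.Injective inl
  range_inl : inl.range = ρ.ker
  comm : ∀ a t, inl a * t = t * inl a
  φ : Kˣ →* MulAut T
  ρ_φ : ∀ u t, ρ (φ u t) = corner u * ρ t * (corner u)⁻¹
  φ_inl : ∀ u a, φ u (inl a) = inl a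

namespace HatData

variable {A : Type v} [CommGroup A] {T : Type w} [Group T] (H : HatData A T K)

/-- The homomorphism `π : T ⋊ Kˣ → GL₂(K)`. -/
def π : T ⋊[H.φ] Kˣ →* GL (Fin 2) K :=
  SemidirectProduct.lift H.ρ corner fun u => MonoidHom.ext fun t => H.ρ_φ u t

theorem π_apply (x : T ⋊[H.φ] Kˣ) : H.π x = H.ρ x.left * corner x.right := rfl

theorem det_ρ (t : T) : (H.ρ t).det = 1 := (H.range_ρ _).1 ⟨t, rfl⟩

/-- The central extension `1 → A → T ⋊ Kˣ → GL₂(K) → 1`. -/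
def ext : GroupExtension A (T ⋊[H.φ] Kˣ) (GL (Fin 2) K) where
  inl := SemidirectProduct.inl.comp H.inl
  rightHom := H.π
  inl_injective := SemidirectProduct.inl_injective.comp H.inl_injective
  range_inl_eq_ker_rightHom := by
    ext x
    constructor
    · rintro ⟨a, rfl⟩
      have : H.inl a ∈ H.ρ.ker := H.range_inl ▸ ⟨a, rfl⟩
      rw [MonoidHom.mem_ker, π_apply]
      change H.ρ (H.inl a) * corner 1 = 1
      rw [this, map_one, one_mul]
    · intro hx
      rw [MonoidHom.mem_ker, π_apply] at hx
      have h1 : x.right = 1 := by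
        have := congrArg Matrix.GeneralLinearGroup.det hx
        rwa [map_mul, H.det_ρ, det_corner, one_mul, map_one] at this
      rw [h1, map_one, mul_one] at hx
      obtain ⟨a, ha⟩ : x.left ∈ H.inl.range := H.range_inl ▸ hx
      exact ⟨a, SemidirectProduct.ext ha h1.symm⟩
  rightHom_surjective g := by
    obtain ⟨t, ht⟩ := (H.range_ρ (g * (corner g.det)⁻¹)).2 (by
      rw [map_mul, map_inv, det_corner, mul_inv_cancel])
    exact ⟨⟨t, g.det⟩, by rw [π_apply, ht, inv_mul_cancel_right]⟩

theorem ext_comm (a : A) (x : T ⋊[H.φ] Kˣ) : H.ext.inl a * x = x * H.ext.inl a := by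
  refine SemidirectProduct.ext ?_ ?_
  · change H.inl a * H.φ 1 x.left = x.left * H.φ x.right (H.inl a)
    rw [map_one, H.φ_inl, MulAut.one_apply, H.comm]
  · exact (one_mul _).trans (mul_one _).symm

end HatData

/-- Let `θ : E → GL₂(K)` be a central extension.  Then `Kˣ` acts on `θ⁻¹(SL₂(K))` by inner
automorphisms of `E`. -/
noncomputable def HatData.ofExtension {A : Type v} [CommGroup A] {E : Type w} [Group E]
    (θ : E →* GL (Fin 2) K) (hθ : Function.Surjective θ) (inl : A →* E)
    (hinl : Function.Injective inl) (hrange : inl.range = θ.ker)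
    (hcomm : ∀ a x, inl a * x = x * inl a) :
    HatData A (Matrix.GeneralLinearGroup.det.comp θ).ker K where
  ρ := θ.comp (Subgroup.subtype _)
  range_ρ g := by
    constructor
    · rintro ⟨t, rfl⟩
      exact t.2
    · intro hg
      obtain ⟨x, rfl⟩ := hθ g
      exact ⟨⟨x, hg⟩, rfl⟩
  inl := inl.codRestrict _ fun a => by
    have : inl a ∈ θ.ker := hrange ▸ ⟨a, rfl⟩
    rw [MonoidHom.mem_ker] at this ⊢
    rw [MonoidHom.comp_apply, this, map_one]
  inl_injective a b h := hinl (congrArg Subtype.val h)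
  range_inl := by
    ext x
    constructor
    · rintro ⟨a, rfl⟩
      have : inl a ∈ θ.ker := hrange ▸ ⟨a, rfl⟩
      exact this
    · intro hx
      obtain ⟨a, ha⟩ : x.1 ∈ inl.range := hrange ▸ hx
      exact ⟨a, Subtype.ext ha⟩
  comm a t := Subtype.ext (hcomm a t)
  φ := MonoidHom.mk' (fun u => MulAut.conjNormal (Function.surjInv hθ (corner u))) fun u v => by
    have h1 : Function.surjInv hθ (corner (u * v)) *
        (Function.surjInv hθ (corner u) * Function.surjInv hθ (corner v))⁻¹ ∈ inl.range := by
      rw [hrange, MonoidHom.mem_ker, map_mul, map_inv, map_mul corner, Function.surjInv_eq hθ,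
        map_mul θ, Function.surjInv_eq hθ, Function.surjInv_eq hθ, mul_inv_cancel]
    obtain ⟨a, ha⟩ := h1
    rw [eq_mul_inv_iff_mul_eq] at ha
    ext x
    change Function.surjInv hθ (corner (u * v)) * x.1 * (Function.surjInv hθ (corner (u * v)))⁻¹ =
      Function.surjInv hθ (corner u) * (Function.surjInv hθ (corner v) * x.1 *
        (Function.surjInv hθ (corner v))⁻¹) * (Function.surjInv hθ (corner u))⁻¹
    rw [← ha]
    generalize Function.surjInv hθ (corner u) = p, Function.surjInv hθ (corner v) = q
    calc _ = inl a * (p * q * x.1 * (p * q)⁻¹) * (inl a)⁻¹ := by group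
      _ = p * q * x.1 * (p * q)⁻¹ := by rw [hcomm, mul_inv_cancel_right]
      _ = _ := by group
  ρ_φ u t := by
    change θ (Function.surjInv hθ (corner u) * t.1 * (Function.surjInv hθ (corner u))⁻¹) = _
    rw [map_mul, map_mul, map_inv, Function.surjInv_eq hθ]
    rfl
  φ_inl u a := Subtype.ext <| by
    change Function.surjInv hθ (corner u) * inl a * (Function.surjInv hθ (corner u))⁻¹ = inl a
    rw [← hcomm, mul_inv_cancel_right]

end Hat

/-- The product of copies of a group extension. -/
def piExt {A : Type v} {E : Type u} {G : Type w} [CommGroup A] [Group E] [Group G]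
    (S : GroupExtension A E G) (ι : Type) : GroupExtension (ι → A) (ι → E) (ι → G) where
  inl := MonoidHom.pi fun i => S.inl.comp (Pi.evalMonoidHom _ i)
  rightHom := MonoidHom.pi fun i => S.rightHom.comp (Pi.evalMonoidHom _ i)
  inl_injective a b h := funext fun i => S.inl_injective (congrFun h i)
  range_inl_eq_ker_rightHom := by
    ext x
    constructor
    · rintro ⟨a, rfl⟩
      exact funext fun i => S.rightHom_inl (a i)
    · intro hx
      have h : ∀ i, ∃ a, S.inl a = x i := fun i => by
        have : x i ∈ S.rightHom.ker := congrFun hx i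
        rwa [← S.range_inl_eq_ker_rightHom] at this
      choose a ha using h
      exact ⟨a, funext ha⟩
  rightHom_surjective g := by
    choose x hx using fun i => S.rightHom_surjective (g i)
    exact ⟨x, funext hx⟩

theorem piExt_comm {A : Type v} {E : Type u} {G : Type w} [CommGroup A] [Group E] [Group G]
    {S : GroupExtension A E G} (hS : ∀ a e, S.inl a * e = e * S.inl a) {ι : Type} (a : ι → A)
    (e : ι → E) : (piExt S ι).inl a * e = e * (piExt S ι).inl a := funext fun i => hS (a i) (e i)

open scoped NNReal in
/-- The homomorphism `r ↦ r ^ b` from positive real numbers to nonzero complex numbers. -/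
noncomputable def cpowHom (b : ℂ) : ℝ≥0ˣ →* ℂˣ :=
  MonoidHom.mk' (fun r : ℝ≥0ˣ => Units.mk0 ((((r : ℝ≥0) : ℝ) : ℂ) ^ b)
    (Complex.cpow_ne_zero_iff.2 (Or.inl (by simp)))) fun r s => Units.ext <| by
      simp only [Units.val_mk0, Units.val_mul, NNReal.coe_mul, Complex.ofReal_mul]
      exact Complex.mul_cpow_ofReal_nonneg r.1.2 s.1.2 b

open scoped NNReal in
/-- The homomorphism `(r_1, …, r_n) ↦ r_1 ^ a_1 ⋯ r_n ^ a_n`. -/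
noncomputable def cpowProd {n : ℕ} (a : Fin n → ℂ) : (Fin n → ℝ≥0ˣ) →* ℂˣ :=
  ∏ i, (cpowHom (a i)).comp (Pi.evalMonoidHom _ i)

namespace TwoDimLocalField

open scoped NNReal

variable {K : Type u} [Field K] {F : TwoDimLocalField K} [TopologicalSpace K]
  (hF : F.IsNaturalTopology)

/-- The torsors of Haar measures on the quotients `Λ / N` of lattices in `K^I`. -/
noncomputable def haarTorsors (I : Type) [Fintype I] [DecidableEq I] :
    TorsorSystem.{u, 0, u, u} ℝ≥0ˣ (GL I K) (latticeSystem I hF).Lat :=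
  haveI := hF.isTopologicalAddGroup
  (latticeSystem I hF).torsors

/-- The central extension `1 → ℝ_{>0} → E → GL₂(K) → 1`, where `E` is the group of pairs `(g, μ)`
with `g ∈ GL₂(K)` and `μ` in the torsor `μ(O² ∣ gO²)` of relative Haar measures, restricted to
`SL₂(K)`, with the action of `Kˣ`. -/
noncomputable def haarHatData := HatData.ofExtension
  ((haarTorsors hF (Fin 2)).extHom (baseLattice (Fin 2) hF))
  ((haarTorsors hF (Fin 2)).extHom_surjective _)
  ((haarTorsors hF (Fin 2)).extInl _)
  ((haarTorsors hF (Fin 2)).extInl_injective _)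
  ((haarTorsors hF (Fin 2)).extInl_range _)
  ((haarTorsors hF (Fin 2)).extInl_comm _)

/-- The action `τ_{a_1, …, a_n}` of the group `P` on the category of finite-dimensional complex
vector spaces. -/
noncomputable def parabolicAction {n : ℕ} (a : Fin n → ℂ) :
    GAction ℂ (parabolic n K) (FGModuleCat.{u} ℂ) :=
  (lineAction (piExt (haarHatData hF).ext (Fin n)) (piExt_comm (haarHatData hF).ext_comm)
    (cpowProd a)).comap (diagBlocks n K)

/-- The category `V_{a_1, …, a_n}`. -/
abbrev PrincipalSeries {n : ℕ} (a : Fin n → ℂ) : Type _ :=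
  Ind (F.filtration (Fin n × Fin 2)) (parabolicAction hF a)

/-- The action of `GL_{2n}(K)` on the category `V_{a_1, …, a_n}`. -/
noncomputable abbrev principalSeriesAction {n : ℕ} (a : Fin n → ℂ) :
    GAction ℂ (GL (Fin n × Fin 2) K) (PrincipalSeries hF a) :=
  Ind.σ (F.filtration (Fin n × Fin 2)) (parabolicAction hF a)

end TwoDimLocalField

/-- A preadditive category is abelian. -/
def IsAbelianCat (C : Type u) [Category.{v} C] [hC : Preadditive C] : Prop :=
  ∃ A : Abelian C, A.toPreadditive = hC

/-- An action of a group on a category is smooth, relative to a decreasing sequence of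
subgroups `C_m`, if every morphism is a morphism of `C_m`-equivariant objects for some `m` and some
equivariant structures on the source and the target. -/
def IsSmoothAction {k : Type*} [Field k] {G : Type*} [Group G] (F : SubgroupFiltration G)
    {B : Type u} [Category.{v} B] [Preadditive B] [Linear k B] (α : GAction k G B) : Prop :=
  ∀ (E D : B) (f : E ⟶ D), ∃ (m : ℕ) (E' D' : (α.comap (F.C m).subtype).Equivariant) (f' : E' ⟶ D')
    (hE : E'.obj = E) (hD : D'.obj = D), f'.1 = eqToHom hE ≫ f ≫ eqToHom hD.symm

/-- A preadditive `k`-linear category contains a full subcategory which is equivalent, as a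
`k`-linear category, to the category of finite-dimensional `k`-vector spaces. -/
def ContainsVect (k : Type w) [Field k] (C : Type u) [Category.{v} C] [Preadditive C] [Linear k C] :
    Prop :=
  ∃ (S : ObjectProperty C) (e : S.FullSubcategory ≌ FGModuleCat.{w} k),
    e.functor.Additive ∧ e.functor.Linear k

/-- The isomorphism of `GL₂(K)` with the group of invertible `1 × 1`-block matrices with
`2 × 2`-blocks. -/
def oneBlock (K : Type u) [Field K] : GL (Fin 2) K →* GL (Fin 1 × Fin 2) K :=
  (Units.mapEquiv (Matrix.reindexAlgEquiv K K (Equiv.uniqueProd (Fin 2) (Fin 1)).symm).toMulEquiv :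
    GL (Fin 2) K ≃* GL (Fin 1 × Fin 2) K).toMonoidHom

namespace Steinberg

open scoped commutatorElement

variable (K : Type u) [Field K]

/-- The relations of the Steinberg group: it is generated by `x_ij(a)` for `i ≠ j` (the superfluous
generators with `i = j` are set equal to `1`). -/
inductive Rel : FreeGroup (ℕ × ℕ × K) → Prop
  | diag (i : ℕ) (a : K) : Rel (FreeGroup.of (i, i, a))
  | add (i j : ℕ) (a b : K) : i ≠ j →
      Rel (FreeGroup.of (i, j, a) * FreeGroup.of (i, j, b) * (FreeGroup.of (i, j, a + b))⁻¹)
  | comm (i j k : ℕ) (a b : K) : i ≠ j → j ≠ k → i ≠ k →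
      Rel (⁅FreeGroup.of (i, j, a), FreeGroup.of (j, k, b)⁆ * (FreeGroup.of (i, k, a * b))⁻¹)
  | comm' (i j k l : ℕ) (a b : K) : i ≠ j → k ≠ l → j ≠ k → i ≠ l →
      Rel ⁅FreeGroup.of (i, j, a), FreeGroup.of (k, l, b)⁆

/-- The Steinberg group `St(K)`. -/
abbrev St : Type u := PresentedGroup {r | Rel K r}

variable {K}

/-- The generators of the Steinberg group. -/
def x (i j : ℕ) (a : K) : St K := PresentedGroup.of (i, j, a)

theorem x_self (i : ℕ) (a : K) : x i i a = 1 :=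
  PresentedGroup.one_of_mem (Rel.diag i a)

theorem x_add (i j : ℕ) (a b : K) : x i j a * x i j b = x i j (a + b) := by
  rcases eq_or_ne i j with rfl | h
  · simp [x_self]
  · exact mul_inv_eq_one.1 (PresentedGroup.one_of_mem (Rel.add i j a b h))

theorem x_comm {i j k : ℕ} (h : i ≠ j) (h' : j ≠ k) (h'' : i ≠ k) (a b : K) :
    ⁅x i j a, x j k b⁆ = x i k (a * b) := by
  have := PresentedGroup.one_of_mem (Rel.comm i j k a b h h' h'')
  exact mul_inv_eq_one.1 this

theorem x_comm' {i j k l : ℕ} (h' : j ≠ k) (h'' : i ≠ l) (a b : K) :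
    ⁅x i j a, x k l b⁆ = 1 := by
  rcases eq_or_ne i j with rfl | h
  · rw [x_self, commutatorElement_one_left]
  rcases eq_or_ne k l with rfl | h0
  · rw [x_self, commutatorElement_one_right]
  · exact PresentedGroup.one_of_mem (Rel.comm' i j k l a b h h0 h' h'')

theorem x_zero (i j : ℕ) : x i j (0 : K) = 1 := by
  have := x_add i j (0 : K) 0
  rwa [add_zero, mul_eq_left] at this

theorem x_inv (i j : ℕ) (a : K) : (x i j a)⁻¹ = x i j (-a) :=
  inv_eq_of_mul_eq_one_right (by rw [x_add, add_neg_cancel, x_zero])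

/-- A homomorphism from the Steinberg group. -/
def lift {G : Type w} [Group G] (y : ℕ → ℕ → K → G) (h1 : ∀ i a, y i i a = 1)
    (h2 : ∀ i j a b, i ≠ j → y i j a * y i j b = y i j (a + b))
    (h3 : ∀ i j k a b, i ≠ j → j ≠ k → i ≠ k → ⁅y i j a, y j k b⁆ = y i k (a * b))
    (h4 : ∀ i j k l a b, i ≠ j → k ≠ l → j ≠ k → i ≠ l → ⁅y i j a, y k l b⁆ = 1) : St K →* G :=
  PresentedGroup.toGroup (f := fun p => y p.1 p.2.1 p.2.2) <| by
    rintro _ (⟨i, a⟩ | ⟨i, j, a, b, h⟩ | ⟨i, j, k, a, b, h, h', h''⟩ | ⟨i, j, k, l, a, b, h, h0, h', h''⟩)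
    · simpa using h1 i a
    · simpa [mul_inv_eq_one] using h2 i j a b h
    · simpa [mul_inv_eq_one, map_commutatorElement] using h3 i j k a b h h' h''
    · simpa [map_commutatorElement] using h4 i j k l a b h h0 h' h''

theorem lift_x {G : Type w} [Group G] (y : ℕ → ℕ → K → G) (h1 h2 h3 h4) (i j : ℕ) (a : K) :
    lift y h1 h2 h3 h4 (x i j a) = y i j a := PresentedGroup.toGroup.of _

theorem induction {p : St K → Prop} (h : ∀ i j a, p (x i j a)) (hmul : ∀ s t, p s → p t → p (s * t))
    (hinv : ∀ s, p s → p s⁻¹) (s : St K) : p s := by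
  have : s ∈ Subgroup.closure (Set.range (PresentedGroup.of (rels := {r | Rel K r}))) := by
    rw [PresentedGroup.closure_range_of]; trivial
  induction this using Subgroup.closure_induction with
  | mem s hs =>
    obtain ⟨⟨i, j, a⟩, rfl⟩ := hs
    exact h i j a
  | one => exact x_zero (K := K) 0 0 ▸ h 0 0 0
  | mul s t _ _ hs ht => exact hmul s t hs ht
  | inv s _ hs => exact hinv s hs

theorem hom_ext {G : Type w} [Group G] {f g : St K →* G} (h : ∀ i j a, f (x i j a) = g (x i j a)) :
    f = g := MonoidHom.ext fun s => by
  induction s using induction with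
  | h i j a => exact h i j a
  | hmul s t hs ht => rw [map_mul, map_mul, hs, ht]
  | hinv s hs => rw [map_inv, map_inv, hs]

/-! ### The homomorphism to infinite matrices -/

/-- The linear endomorphisms of the space of finite sequences in `K`. -/
abbrev Mat (K : Type u) [Field K] : Type u := Module.End K (ℕ →₀ K)

/-- The matrix unit `E_ij`. -/
noncomputable def el (i j : ℕ) : Mat K := Finsupp.lsingle i ∘ₗ Finsupp.lapply j

theorem el_apply (i j : ℕ) (v : ℕ →₀ K) : el i j v = Finsupp.single i (v j) := rfl

theorem el_mul (i j k l : ℕ) : (el i j * el k l : Mat K) = if j = k then el i l else 0 := by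
  ext m : 2
  rw [LinearMap.comp_apply, LinearMap.comp_apply, Module.End.mul_apply]
  split_ifs with h
  · subst h; simp [el_apply]
  · simp [el_apply, Finsupp.single_apply, Ne.symm h]

section Elementary

variable {R : Type u} [Ring R] [Algebra K R] {E : ℕ → ℕ → R}

/-- The element `1 + a E_ij` for `i ≠ j` (and `1` for `i = j`) of a ring with matrix units. -/
noncomputable def elemOf (hE : ∀ i j k l, E i j * E k l = if j = k then E i l else 0) (i j : ℕ)
    (a : K) : Rˣ :=
  if h : i = j then 1 else
    { val := 1 + a • E i j
      inv := 1 - a • E i j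
      val_inv := by simp [mul_sub, add_mul, hE, Ne.symm h]
      inv_val := by simp [sub_mul, mul_add, hE, Ne.symm h] }

variable (hE : ∀ i j k l, E i j * E k l = if j = k then E i l else 0)

theorem elemOf_self (i : ℕ) (a : K) : elemOf hE i i a = 1 := dif_pos rfl

theorem elemOf_val {i j : ℕ} (h : i ≠ j) (a : K) : (elemOf hE i j a).1 = 1 + a • E i j := by
  rw [elemOf, dif_neg h]

theorem elemOf_add (i j : ℕ) (a b : K) (h : i ≠ j) :
    elemOf hE i j a * elemOf hE i j b = elemOf hE i j (a + b) := by
  ext1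
  rw [Units.val_mul, elemOf_val hE h, elemOf_val hE h, elemOf_val hE h]
  simp [mul_add, add_mul, hE, h.symm, add_smul]
  abel

/-- The homomorphism from the Steinberg group to a ring with matrix units. -/
noncomputable def toUnits : St K →* Rˣ :=
  lift (elemOf hE) (elemOf_self hE) (elemOf_add hE)
    (fun i j k a b h h' h'' => by
      rw [commutatorElement_def, mul_inv_eq_iff_eq_mul, mul_inv_eq_iff_eq_mul]
      ext1
      simp only [Units.val_mul, elemOf_val hE h, elemOf_val hE h', elemOf_val hE h'']
      simp [mul_add, add_mul, hE, h.symm, h', h'.symm, h'', h''.symm, smul_smul, mul_comm]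
      abel)
    (fun i j k l a b h h0 h' h'' => by
      rw [commutatorElement_eq_one_iff_mul_comm]
      ext1
      simp only [Units.val_mul, elemOf_val hE h, elemOf_val hE h0]
      simp [mul_add, add_mul, hE, h', h''.symm]
      abel)

end Elementary

/-- The elementary matrix `1 + a E_ij` for `i ≠ j` (and `1` for `i = j`). -/
noncomputable def elem (i j : ℕ) (a : K) : (Mat K)ˣ := elemOf (R := Mat K) el_mul i j a

theorem elem_apply {i j : ℕ} (h : i ≠ j) (a : K) (v : ℕ →₀ K) :
    (elem i j a).1 v = v + Finsupp.single i (a * v j) := by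
  rw [elem, elemOf_val (R := Mat K) el_mul h]
  simp [el_apply]

/-- The canonical homomorphism from the Steinberg group to infinite invertible matrices. -/
noncomputable def toMat : St K →* (Mat K)ˣ := toUnits (R := Mat K) el_mul

theorem toMat_x (i j : ℕ) (a : K) : toMat (x i j a) = elem i j a := by
  rw [toMat, toUnits, lift_x]; rfl

theorem toMat_mul_apply (s t : St K) (v : ℕ →₀ K) :
    (toMat (s * t)).1 v = (toMat s).1 ((toMat t).1 v) := by
  rw [map_mul]; rfl

theorem toMat_inv_apply (s : St K) (v : ℕ →₀ K) : (toMat s).1 ((toMat s⁻¹).1 v) = v := by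
  rw [← toMat_mul_apply, mul_inv_cancel, map_one]; rfl

theorem toMat_x_apply {i j : ℕ} (h : i ≠ j) (a : K) (v : ℕ →₀ K) :
    (toMat (x i j a)).1 v = v + Finsupp.single i (a * v j) := by
  rw [toMat_x, elem_apply h]

variable (K) in
/-- The group `K₂(K)`, the kernel of the canonical homomorphism. -/
noncomputable def K₂ : Subgroup (St K) := toMat.ker

/-! ### The group `K₂(K)` is central -/

variable (K) in
/-- The subgroup generated by the `x_in(a)` for a fixed `n`. -/
def colSubgroup (n : ℕ) : Subgroup (St K) := Subgroup.closure {y | ∃ i a, y = x i n a}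

theorem x_mem_col (i n : ℕ) (a : K) : x i n a ∈ colSubgroup K n :=
  Subgroup.subset_closure ⟨i, a, rfl⟩

theorem col_comm (i j n : ℕ) (a b : K) : x i n a * x j n b = x j n b * x i n a := by
  rcases eq_or_ne i n with rfl | hi
  · simp [x_self]
  rcases eq_or_ne j n with rfl | hj
  · simp [x_self]
  · exact commutatorElement_eq_one_iff_mul_comm.1 (x_comm' hj.symm hi a b)

variable (K) in
/-- The commutative group `colSubgroup K n`. -/
def ColGroup (n : ℕ) : Type u := colSubgroup K n

instance (n : ℕ) : Group (ColGroup K n) := inferInstanceAs (Group (colSubgroup K n))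

instance (n : ℕ) : CommGroup (ColGroup K n) where
  mul_comm := (Subgroup.isMulCommutative_closure (k := {y : St K | ∃ i a, y = x i n a}) (by
    rintro _ ⟨i, a, rfl⟩ _ ⟨j, b, rfl⟩
    exact col_comm i j n a b)).is_comm.comm

/-- The product `∏ x_in(v_i)` for a finite sequence `v`. -/
noncomputable def colHom (n : ℕ) : (ℕ →₀ K) →+ Additive (ColGroup K n) :=
  Finsupp.liftAddHom fun i =>
    { toFun := fun a => Additive.ofMul ⟨x i n a, x_mem_col i n a⟩
      map_zero' := congrArg Additive.ofMul (Subtype.ext (x_zero i n))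
      map_add' := fun a b => congrArg Additive.ofMul (Subtype.ext (x_add i n a b).symm) }

/-- The product `∏ x_in(v_i)` for a finite sequence `v`. -/
noncomputable def col (n : ℕ) (v : ℕ →₀ K) : St K := (colHom n v).toMul.1

theorem col_single (n i : ℕ) (a : K) : col n (Finsupp.single i a) = x i n a := by
  rw [col, colHom, Finsupp.liftAddHom_apply_single]
  rfl

theorem col_add (n : ℕ) (v w : ℕ →₀ K) : col n (v + w) = col n v * col n w := by
  rw [col, map_add]
  rfl

theorem col_zero (n : ℕ) : col n (0 : ℕ →₀ K) = 1 := by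
  rw [col, map_zero]
  rfl

theorem conj_col_x {i j n : ℕ} (hi : i ≠ n) (hj : j ≠ n) (b : K) (v : ℕ →₀ K) :
    x i j b * col n v * (x i j b)⁻¹ = col n ((toMat (x i j b)).1 v) := by
  rcases eq_or_ne i j with rfl | h
  · rw [x_self, map_one, one_mul, inv_one, mul_one]
    rfl
  induction v using Finsupp.induction_linear with
  | zero => rw [map_zero, col_zero, mul_one, mul_inv_cancel]
  | add v w hv hw =>
    rw [map_add, col_add, col_add, ← hv, ← hw]
    group
  | single l a =>
    rw [toMat_x_apply h, col_add, col_single, col_single]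
    rcases eq_or_ne l j with rfl | hl
    · have := x_comm h hj hi b a
      rw [commutatorElement_def, mul_inv_eq_iff_eq_mul] at this
      rw [this, Finsupp.single_eq_same, col_comm]
    · rw [Finsupp.single_apply, if_neg hl, mul_zero, x_zero, mul_one]
      rcases eq_or_ne l n with rfl | hl'
      · rw [x_self, mul_one, mul_inv_cancel]
      · rw [mul_inv_eq_iff_eq_mul]
        exact commutatorElement_eq_one_iff_mul_comm.1 (x_comm' hl.symm hi b a)

theorem conj_col (s : St K) : ∃ N, ∀ n, N ≤ n → ∀ v,
    s * col n v * s⁻¹ = col n ((toMat s).1 v) := by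
  induction s using induction with
  | h i j a =>
    exact ⟨i + j + 1, fun n hn v => conj_col_x (by lia) (by lia) a v⟩
  | hmul s t hs ht =>
    obtain ⟨N, hN⟩ := hs
    obtain ⟨M, hM⟩ := ht
    refine ⟨max N M, fun n hn v => ?_⟩
    rw [toMat_mul_apply, ← hN n (le_of_max_le_left hn), ← hM n (le_of_max_le_right hn)]
    group
  | hinv s hs =>
    obtain ⟨N, hN⟩ := hs
    refine ⟨N, fun n hn v => ?_⟩
    have := hN n hn ((toMat s⁻¹).1 v)
    rw [toMat_inv_apply] at this
    rw [← this]
    group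

theorem K₂_comm_col {s : St K} (hs : s ∈ K₂ K) : ∃ N, ∀ n, N ≤ n → ∀ i a,
    s * x i n a = x i n a * s := by
  obtain ⟨N, hN⟩ := conj_col s
  refine ⟨N, fun n hn i a => ?_⟩
  have := hN n hn (Finsupp.single i a)
  rw [show toMat s = 1 from hs, Units.val_one, Module.End.one_apply, col_single] at this
  rw [← mul_inv_eq_iff_eq_mul, this]

/-- The automorphism `x_ij(a) ↦ x_ji(-a)` (on matrices: inverse transpose). -/
noncomputable def contra : St K →* St K :=
  lift (fun i j a => x j i (-a)) (fun i a => x_self i _)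
    (fun i j a b _ => by rw [x_add, ← neg_add])
    (fun i j k a b h h' h'' => by
      have := x_comm h'.symm h.symm h''.symm (-b) (-a)
      rw [← commutatorElement_inv, this, x_inv, neg_mul_neg, mul_comm b a])
    (fun i j k l a b h h0 h' h'' => x_comm' h'' h' _ _)

theorem contra_x (i j : ℕ) (a : K) : contra (x i j a) = x j i (-a) := by
  rw [contra, lift_x]

theorem contra_contra (s : St K) : contra (contra s) = s := by
  have : (contra (K := K)).comp contra = MonoidHom.id _ := hom_ext fun i j a => by
    rw [MonoidHom.comp_apply, contra_x, contra_x, neg_neg]; rfl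
  exact DFunLike.congr_fun this s

/-- The standard pairing. -/
noncomputable def pair (u v : ℕ →₀ K) : K := Finsupp.linearCombination K v u

theorem pair_contra (s : St K) (u v : ℕ →₀ K) :
    pair ((toMat (contra s)).1 u) ((toMat s).1 v) = pair u v := by
  induction s using induction generalizing u v with
  | h i j a =>
    rcases eq_or_ne i j with rfl | h
    · rw [x_self, map_one, map_one]; rfl
    · rw [contra_x, toMat_x_apply h, toMat_x_apply h.symm]
      have h1 : ∀ u v w : ℕ →₀ K, pair u (v + w) = pair u v + pair u w := fun u v w => by
        simp [pair, Finsupp.linearCombination_apply, Finsupp.sum, mul_add, Finset.sum_add_distrib]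
      have h2 : ∀ u v w : ℕ →₀ K, pair (u + v) w = pair u w + pair v w := fun u v w => by
        simp [pair]
      have h3 : ∀ (i : ℕ) (c : K) (v : ℕ →₀ K), pair (Finsupp.single i c) v = c * v i := by
        intro i c v; simp [pair]
      have h4 : ∀ (i : ℕ) (c : K) (u : ℕ →₀ K), pair u (Finsupp.single i c) = u i * c := by
        intro i c u
        rw [pair, Finsupp.linearCombination_apply, Finsupp.sum]
        simp only [Finsupp.single_apply, smul_eq_mul]
        rw [Finset.sum_eq_single i]
        · simp
        · intro j _ hj; simp [hj.symm]
        · intro hi; simp [Finsupp.notMem_support_iff.1 hi]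
      rw [h1, h2, h2, h3, h3, h4, Finsupp.single_apply, if_neg h]
      ring
  | hmul s t hs ht => rw [map_mul, toMat_mul_apply, toMat_mul_apply, hs, ht]
  | hinv s hs =>
    have := hs ((toMat (contra s⁻¹)).1 u) ((toMat s⁻¹).1 v)
    rw [toMat_inv_apply, map_inv, toMat_inv_apply] at this
    rw [this, map_inv]

theorem contra_mem {s : St K} (hs : s ∈ K₂ K) : contra s ∈ K₂ K := by
  refine Units.ext <| LinearMap.ext fun u => Finsupp.ext fun i => ?_
  have := pair_contra s u (Finsupp.single i 1)
  rw [show toMat s = 1 from hs, Units.val_one, Module.End.one_apply] at this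
  have h4 : ∀ (u : ℕ →₀ K), pair u (Finsupp.single i 1) = u i := by
    intro u
    rw [pair, Finsupp.linearCombination_apply, Finsupp.sum]
    simp only [Finsupp.single_apply, smul_eq_mul]
    rw [Finset.sum_eq_single i]
    · simp
    · intro j _ hj; simp [hj.symm]
    · intro hi; simp [Finsupp.notMem_support_iff.1 hi]
  rwa [h4, h4] at this

theorem K₂_central {s : St K} (hs : s ∈ K₂ K) (t : St K) : s * t = t * s := by
  obtain ⟨N, hN⟩ := K₂_comm_col hs
  obtain ⟨M, hM⟩ := K₂_comm_col (contra_mem hs)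
  induction t using induction with
  | h i j a =>
    rcases eq_or_ne i j with rfl | h
    · rw [x_self, mul_one, one_mul]
    let n := N + M + i + j + 1
    have h1 : Commute s (x i n a) := hN n (by lia) i a
    have h2 : Commute s (x n j 1) := by
      have := congrArg contra (hM n (by lia) j (-1))
      rw [map_mul, map_mul, contra_contra, contra_x, neg_neg] at this
      exact this
    have h3 := x_comm (show i ≠ n by lia) (show n ≠ j by lia) h a 1
    rw [mul_one, commutatorElement_def] at h3
    rw [← h3]
    exact ((h1.mul_right h2).mul_right h1.inv_right).mul_right h2.inv_right
  | hmul s t hs ht => exact Commute.mul_right hs ht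
  | hinv s hs => exact Commute.inv_right hs

noncomputable instance : CommGroup (K₂ K) where
  mul_comm a b := Subtype.ext (K₂_central a.2 b.1)

/-! ### Diagonal automorphisms -/

/-- The endomorphism `x_ij(a) ↦ x_ij(d_i a d_j⁻¹)`. -/
noncomputable def diagEnd (d : ℕ → Kˣ) : St K →* St K :=
  lift (fun i j a => x i j (d i * a * ((d j)⁻¹ : Kˣ))) (fun i a => x_self i _)
    (fun i j a b _ => by rw [x_add, mul_add, add_mul])
    (fun i j k a b h h' h'' => by
      rw [x_comm h h' h'']
      congr 1
      have : (((d j)⁻¹ : Kˣ) : K) * d j = 1 := Units.inv_mul _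
      linear_combination (d i * a * b * ((d k)⁻¹ : Kˣ)) * this)
    (fun i j k l a b h h0 h' h'' => x_comm' h' h'' _ _)

theorem diagEnd_x (d : ℕ → Kˣ) (i j : ℕ) (a : K) :
    diagEnd d (x i j a) = x i j (d i * a * ((d j)⁻¹ : Kˣ)) := by
  rw [diagEnd, lift_x]

theorem diagEnd_one (s : St K) : diagEnd 1 s = s := by
  have : diagEnd (1 : ℕ → Kˣ) = MonoidHom.id _ := hom_ext fun i j a => by
    rw [diagEnd_x]; simp
  rw [this]; rfl

theorem diagEnd_mul (d d' : ℕ → Kˣ) (s : St K) : diagEnd (d * d') s = diagEnd d (diagEnd d' s) := by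
  have : diagEnd (d * d') = (diagEnd d).comp (diagEnd d') := hom_ext fun i j a => by
    rw [MonoidHom.comp_apply, diagEnd_x, diagEnd_x, diagEnd_x]
    congr 1
    simp
    ring
  rw [this]; rfl

theorem toMat_diagEnd (d : ℕ → Kˣ) (m : (Mat K)ˣ) (hm : ∀ v i, m.1 v i = d i * v i) (s : St K) :
    toMat (diagEnd d s) * m = m * toMat s := by
  induction s using induction with
  | h i j a =>
    rcases eq_or_ne i j with rfl | h
    · rw [diagEnd_x, x_self, x_self, map_one, mul_one, one_mul]
    refine Units.ext <| LinearMap.ext fun v => Finsupp.ext fun k => ?_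
    rw [diagEnd_x]
    rw [Units.val_mul, Units.val_mul, Module.End.mul_apply, Module.End.mul_apply,
      toMat_x_apply h, hm v j, toMat_x_apply h, Finsupp.add_apply, hm v k, hm _ k, Finsupp.add_apply,
      Finsupp.single_apply, Finsupp.single_apply]
    split_ifs with hk
    · subst hk
      have : (((d j)⁻¹ : Kˣ) : K) * d j = 1 := Units.inv_mul _
      linear_combination (d i * a * v j) * this
    · ring
  | hmul s t hs ht => rw [map_mul, map_mul, mul_assoc, ht, ← mul_assoc, hs, mul_assoc, map_mul]
  | hinv s hs =>
    rw [map_inv, map_inv, inv_mul_eq_iff_eq_mul, ← mul_assoc, hs, mul_assoc, map_inv,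
      mul_inv_cancel, mul_one]

theorem conj_eq_diagEnd (d : ℕ → Kˣ) (h : St K) (hm : ∀ v i, (toMat h).1 v i = d i * v i)
    (s : St K) : h * s * h⁻¹ = diagEnd d s := by
  have h1 : ∀ s, ∃ c ∈ K₂ K, h * s * h⁻¹ = c * diagEnd d s := fun s => by
    refine ⟨h * s * h⁻¹ * (diagEnd d s)⁻¹, ?_, by group⟩
    have := toMat_diagEnd d (toMat h) hm s
    rw [K₂, MonoidHom.mem_ker, map_mul, map_mul, map_mul, ← this]
    simp
  induction s using induction with
  | h i j a =>
    rcases eq_or_ne i j with rfl | hij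
    · rw [x_self, map_one, mul_one, mul_inv_cancel]
    let m := i + j + 1
    have e1 := x_comm (show i ≠ m by lia) (show m ≠ j by lia) hij a 1
    rw [mul_one] at e1
    obtain ⟨c, hc, e2⟩ := h1 (x i m a)
    obtain ⟨c', hc', e3⟩ := h1 (x m j 1)
    have e4 : ∀ y z, h * ⁅y, z⁆ * h⁻¹ = ⁅h * y * h⁻¹, h * z * h⁻¹⁆ := fun y z => by
      rw [commutatorElement_def, commutatorElement_def]; group
    rw [← e1, e4, e2, e3, map_commutatorElement]
    have h5 := K₂_central hc
    have h6 := K₂_central hc'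
    generalize diagEnd d (x i m a) = p, diagEnd d (x m j 1) = q
    rw [commutatorElement_def, commutatorElement_def, mul_inv_rev, mul_inv_rev]
    calc c * p * (c' * q) * (p⁻¹ * c⁻¹) * (q⁻¹ * c'⁻¹)
        = c * (p * (c' * (q * p⁻¹))) * c⁻¹ * q⁻¹ * c'⁻¹ := by group
      _ = p * (c' * (q * p⁻¹)) * q⁻¹ * c'⁻¹ := by rw [h5, mul_inv_cancel_right]
      _ = p * (c' * (q * p⁻¹ * q⁻¹)) * c'⁻¹ := by group
      _ = p * q * p⁻¹ * q⁻¹ := by rw [h6]; group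
  | hmul s t hs ht => rw [map_mul, ← hs, ← ht]; group
  | hinv s hs => rw [map_inv, ← hs]; group

theorem diagEnd_congr (s : St K) : ∃ N, ∀ d d' : ℕ → Kˣ, (∀ i < N, d i = d' i) →
    diagEnd d s = diagEnd d' s := by
  induction s using induction with
  | h i j a =>
    exact ⟨i + j + 1, fun d d' h => by
      rw [diagEnd_x, diagEnd_x, h i (by lia), h j (by lia)]⟩
  | hmul s t hs ht =>
    obtain ⟨N, hN⟩ := hs
    obtain ⟨M, hM⟩ := ht
    exact ⟨max N M, fun d d' h => by
      rw [map_mul, map_mul, hN d d' fun i hi => h i (lt_max_of_lt_left hi),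
        hM d d' fun i hi => h i (lt_max_of_lt_right hi)]⟩
  | hinv s hs =>
    obtain ⟨N, hN⟩ := hs
    exact ⟨N, fun d d' h => by rw [map_inv, map_inv, hN d d' h]⟩

/-! ### The embeddings of `GL₂(K)` -/

/-- The embedding of `2 × 2`-matrices into infinite matrices, with the identity matrix outside of
the rows and columns `e 0`, `e 1`. -/
noncomputable def blockHom (e : Fin 2 ↪ ℕ) : Matrix (Fin 2) (Fin 2) K →* Mat K where
  toFun M := 1 + ∑ i, ∑ j, (M - 1) i j • el (e i) (e j)
  map_one' := by simp
  map_mul' M N := by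
    have key : ∀ (R : Type u) [Ring R] [Algebra K R] (E : ℕ → ℕ → R)
        (_ : ∀ i j k l, E i j * E k l = if j = k then E i l else 0),
        1 + ∑ i, ∑ j, (M * N - 1) i j • E (e i) (e j) =
          (1 + ∑ i, ∑ j, (M - 1) i j • E (e i) (e j)) *
            (1 + ∑ i, ∑ j, (N - 1) i j • E (e i) (e j)) := by
      intro R _ _ E hE
      have h : M * N - 1 = (M - 1) * (N - 1) + (M - 1) + (N - 1) := by noncomm_ring
      rw [h]
      generalize M - 1 = M, N - 1 = N
      have : e 0 ≠ e 1 := fun h => by simpa using e.injective h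
      simp [Fin.sum_univ_two, mul_add, add_mul, hE, this, this.symm, Matrix.mul_apply, add_smul,
        smul_smul]
      simp only [mul_comm]
      abel
    exact key (Mat K) el el_mul

theorem blockHom_apply (e : Fin 2 ↪ ℕ) (M : Matrix (Fin 2) (Fin 2) K) (v : ℕ →₀ K) :
    blockHom e M v = v + ∑ i, ∑ j, Finsupp.single (e i) ((M - 1) i j * v (e j)) := by
  have : blockHom e M = 1 + ∑ i, ∑ j, (M - 1) i j • el (e i) (e j) := rfl
  rw [this]
  simp [LinearMap.sum_apply, el_apply]

/-- The embedding of `GL₂(K)` into infinite invertible matrices. -/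
noncomputable def block (e : Fin 2 ↪ ℕ) : GL (Fin 2) K →* (Mat K)ˣ := Units.map (blockHom e)

theorem block_apply (e : Fin 2 ↪ ℕ) (g : GL (Fin 2) K) (v : ℕ →₀ K) :
    (block e g).1 v = v + ∑ i, ∑ j, Finsupp.single (e i) ((g.1 - 1) i j * v (e j)) :=
  blockHom_apply e g.1 v

theorem block_diag (e : Fin 2 ↪ ℕ) (a b : Kˣ) (d : ℕ → Kˣ) (h0 : d (e 0) = a) (h1 : d (e 1) = b)
    (h : ∀ i, i ≠ e 0 → i ≠ e 1 → d i = 1) (v : ℕ →₀ K) (i : ℕ) :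
    (block e (diagGL ![a, b])).1 v i = d i * v i := by
  rw [block_apply]
  have h01 : e 0 ≠ e 1 := fun h => by simpa using e.injective h
  rcases eq_or_ne i (e 0) with rfl | hi0
  · simp [Fin.sum_univ_two, diagGL, h0, Finsupp.single_apply, h01.symm]
    ring
  rcases eq_or_ne i (e 1) with rfl | hi1
  · simp [Fin.sum_univ_two, diagGL, h1, Finsupp.single_apply, h01]
    ring
  · simp [Fin.sum_univ_two, h i hi0 hi1, Finsupp.single_apply, hi0.symm, hi1.symm]

theorem exists_lift (e : Fin 2 ↪ ℕ) (g : GL (Fin 2) K) (hg : g.det = 1) :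
    ∃ s, toMat s = block e g := by
  have h01 : e 0 ≠ e 1 := fun h => by simpa using e.injective h
  have hU : ∀ (X : GL (Fin 2) K) (b : K), X.1 = !![1, b; 0, 1] → X ∈ toMat.range.comap (block e) :=
    fun X b hX => ⟨x (e 0) (e 1) b, Units.ext <| LinearMap.ext fun v => by
      rw [toMat_x_apply h01, block_apply, hX]
      simp [Fin.sum_univ_two]⟩
  have hL : ∀ (X : GL (Fin 2) K) (b : K), X.1 = !![1, 0; b, 1] → X ∈ toMat.range.comap (block e) :=
    fun X b hX => ⟨x (e 1) (e 0) b, Units.ext <| LinearMap.ext fun v => by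
      rw [toMat_x_apply h01.symm, block_apply, hX]
      simp [Fin.sum_univ_two]⟩
  let U : K → GL (Fin 2) K := fun b => Matrix.GeneralLinearGroup.mk'' !![1, b; 0, 1] (by
    simp [Matrix.det_fin_two])
  let L : K → GL (Fin 2) K := fun b => Matrix.GeneralLinearGroup.mk'' !![1, 0; b, 1] (by
    simp [Matrix.det_fin_two])
  have h1 : ∀ g : GL (Fin 2) K, g.det = 1 → g.1 1 0 ≠ 0 → g ∈ toMat.range.comap (block e) := by
    intro g hg hc
    have hd : g.1 0 0 * g.1 1 1 - g.1 0 1 * g.1 1 0 = 1 := by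
      have := congrArg Units.val hg
      rwa [Matrix.GeneralLinearGroup.val_det_apply, Matrix.det_fin_two] at this
    have : g = U ((g.1 0 0 - 1) / g.1 1 0) * L (g.1 1 0) * U ((g.1 1 1 - 1) / g.1 1 0) := by
      refine Units.ext ?_
      change g.1 = !![1, (g.1 0 0 - 1) / g.1 1 0; 0, 1] * !![1, 0; g.1 1 0, 1] *
        !![1, (g.1 1 1 - 1) / g.1 1 0; 0, 1]
      generalize g.1 = M at hd hc
      ext i j
      fin_cases i <;> fin_cases j <;> simp <;> field_simp <;> first | done | ring1 | linear_combination -hd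
    rw [this]
    exact mul_mem (mul_mem (hU _ _ rfl) (hL _ _ rfl)) (hU _ _ rfl)
  suffices g ∈ toMat.range.comap (block e) from this
  by_cases hc : g.1 1 0 = 0
  · have hd : g.1 0 0 * g.1 1 1 = 1 := by
      have := congrArg Units.val hg
      rwa [Matrix.GeneralLinearGroup.val_det_apply, Matrix.det_fin_two, hc, mul_zero, sub_zero] at this
    have h2 : g * L 1 ∈ toMat.range.comap (block e) := by
      refine h1 _ ?_ ?_
      · have : (L 1).det = 1 := Units.ext (by
          rw [Matrix.GeneralLinearGroup.val_det_apply, Matrix.det_fin_two]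
          change (1 : K) * 1 - 0 * 1 = 1
          ring)
        rw [map_mul, hg, this, one_mul]
      · have : (g * L 1).1 1 0 = g.1 1 0 + g.1 1 1 := by
          change ((g.1 : Matrix (Fin 2) (Fin 2) K) * (!![1, 0; 1, 1] : Matrix (Fin 2) (Fin 2) K)) 1 0 = _
          simp [Matrix.mul_apply, Fin.sum_univ_two]
        rw [this, hc, zero_add]
        exact right_ne_zero_of_mul_eq_one hd
    have := mul_mem h2 (inv_mem (hL (L 1) 1 rfl))
    rwa [mul_inv_cancel_right] at this
  · exact h1 g hg hc

theorem diagEnd_K₂ (u : Kˣ) {k : St K} (hk : k ∈ K₂ K) : diagEnd (Pi.mulSingle 0 u) k = k := by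
  obtain ⟨N, hN⟩ := diagEnd_congr k
  let e : Fin 2 ↪ ℕ := ⟨![0, N + 1], fun i j h => by
    fin_cases i <;> fin_cases j <;> simp at h ⊢⟩
  obtain ⟨h, hh⟩ := exists_lift e (diagGL ![u, u⁻¹]) (Units.ext (by
    rw [Matrix.GeneralLinearGroup.val_det_apply]
    simp [diagGL, Matrix.det_diagonal]))
  let d : ℕ → Kˣ := Pi.mulSingle 0 u * Pi.mulSingle (N + 1) u⁻¹
  have h1 := conj_eq_diagEnd d h (fun v i => by
    rw [hh]
    refine block_diag e u u⁻¹ d ?_ ?_ (fun i h h' => ?_) v i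
    · change d 0 = u
      simp [d, Pi.mulSingle_apply]
    · change d (N + 1) = u⁻¹
      simp [d, Pi.mulSingle_apply]
    · have h : i ≠ 0 := h
      have h' : i ≠ N + 1 := h'
      simp [d, Pi.mulSingle_apply, h, h']) k
  rw [← K₂_central hk, mul_inv_cancel_right] at h1
  rw [hN _ d fun i hi => ?_, ← h1]
  simp [d, Pi.mulSingle_apply, show i ≠ N + 1 by lia]

end Steinberg
namespace Steinberg

variable {K : Type u} [Field K]

/-- The first two coordinates. -/
def firstTwo : Fin 2 ↪ ℕ := ⟨Fin.val, Fin.val_injective⟩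

variable (K) in
/-- The pull-back of the Steinberg group to `SL₂(K)`. -/
noncomputable def tildeSL₂ : Subgroup (St K × GL (Fin 2) K) where
  carrier := {p | toMat p.1 = block firstTwo p.2 ∧ p.2.det = 1}
  one_mem' := ⟨by rw [Prod.fst_one, Prod.snd_one, map_one, map_one], map_one _⟩
  mul_mem' {p p'} hp hp' := ⟨by rw [Prod.fst_mul, Prod.snd_mul, map_mul, map_mul, hp.1, hp'.1],
    by rw [Prod.snd_mul, map_mul, hp.2, hp'.2, one_mul]⟩
  inv_mem' {p} hp := ⟨by rw [Prod.fst_inv, Prod.snd_inv, map_inv, map_inv, hp.1],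
    by rw [Prod.snd_inv, map_inv, hp.2, inv_one]⟩

theorem diagEnd_mem (u : Kˣ) {p : St K × GL (Fin 2) K} (hp : p ∈ tildeSL₂ K) :
    (diagEnd (Pi.mulSingle 0 u) p.1, corner u * p.2 * (corner u)⁻¹) ∈ tildeSL₂ K := by
  constructor
  · have h := toMat_diagEnd (Pi.mulSingle 0 u) (block firstTwo (corner u))
      (block_diag firstTwo u 1 _ (Pi.mulSingle_eq_same _ _) (Pi.mulSingle_eq_of_ne one_ne_zero _)
        fun i hi _ => Pi.mulSingle_eq_of_ne hi _) p.1
    rw [map_mul, map_mul, map_inv, ← hp.1, ← h, mul_inv_cancel_right]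
  · change Matrix.GeneralLinearGroup.det (corner u * p.2 * (corner u)⁻¹) = 1
    rw [map_mul, map_mul, hp.2, mul_one, map_inv, mul_inv_cancel]

/-- The action of an element of `Kˣ` on the pull-back. -/
noncomputable def tildeEnd (u : Kˣ) : tildeSL₂ K →* tildeSL₂ K where
  toFun p := ⟨_, diagEnd_mem u p.2⟩
  map_one' := Subtype.ext (Prod.ext (map_one _) (by
    change corner u * 1 * (corner u)⁻¹ = 1
    rw [mul_one, mul_inv_cancel]))
  map_mul' p p' := Subtype.ext (Prod.ext (map_mul _ _ _) (by
    change corner u * (p.1.2 * p'.1.2) * (corner u)⁻¹ =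
      corner u * p.1.2 * (corner u)⁻¹ * (corner u * p'.1.2 * (corner u)⁻¹)
    group))

theorem tildeEnd_one (p : tildeSL₂ K) : tildeEnd 1 p = p := by
  refine Subtype.ext (Prod.ext ?_ ?_)
  · change diagEnd (Pi.mulSingle 0 1) p.1.1 = p.1.1
    rw [Pi.mulSingle_one, diagEnd_one]
  · change corner 1 * p.1.2 * (corner 1)⁻¹ = p.1.2
    rw [map_one, one_mul, inv_one, mul_one]

theorem tildeEnd_mul (u u' : Kˣ) (p : tildeSL₂ K) :
    tildeEnd (u * u') p = tildeEnd u (tildeEnd u' p) := by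
  refine Subtype.ext (Prod.ext ?_ ?_)
  · change diagEnd (Pi.mulSingle 0 (u * u')) p.1.1 = diagEnd _ (diagEnd _ p.1.1)
    rw [Pi.mulSingle_mul, diagEnd_mul]
  · change corner (u * u') * p.1.2 * (corner (u * u'))⁻¹ =
      corner u * (corner u' * p.1.2 * (corner u')⁻¹) * (corner u)⁻¹
    rw [map_mul]
    group

/-- The action of `Kˣ` on the pull-back. -/
noncomputable def tildeAct : Kˣ →* MulAut (tildeSL₂ K) where
  toFun u :=
    { toFun := tildeEnd u
      invFun := tildeEnd u⁻¹
      left_inv := fun p => by rw [← tildeEnd_mul, inv_mul_cancel, tildeEnd_one]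
      right_inv := fun p => by rw [← tildeEnd_mul, mul_inv_cancel, tildeEnd_one]
      map_mul' := map_mul _ }
  map_one' := MulEquiv.ext tildeEnd_one
  map_mul' u u' := MulEquiv.ext (tildeEnd_mul u u')

variable (K) in
/-- The central extension `1 → K₂(K) → T → SL₂(K) → 1` with the action of `Kˣ`. -/
noncomputable def hatData : HatData (K₂ K) (tildeSL₂ K) K where
  ρ := (MonoidHom.snd _ _).comp (Subgroup.subtype _)
  range_ρ g := by
    constructor
    · rintro ⟨p, rfl⟩
      exact p.2.2
    · intro hg
      obtain ⟨s, hs⟩ := exists_lift firstTwo g hg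
      exact ⟨⟨(s, g), hs, hg⟩, rfl⟩
  inl := ((MonoidHom.inl _ _).comp (K₂ K).subtype).codRestrict _ fun k =>
    ⟨(show toMat k.1 = 1 from k.2).trans (map_one _).symm, map_one _⟩
  inl_injective a b h := Subtype.ext (congrArg (fun p => p.1.1) h)
  range_inl := by
    ext p
    constructor
    · rintro ⟨k, rfl⟩
      rfl
    · intro hp
      have h2 : p.1.2 = 1 := hp
      have h1 : p.1.1 ∈ K₂ K := by
        have := p.2.1
        rwa [h2, map_one] at this
      exact ⟨⟨_, h1⟩, Subtype.ext (Prod.ext rfl h2.symm)⟩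
  comm k p := Subtype.ext (Prod.ext (K₂_central k.2 p.1.1) ((one_mul _).trans (mul_one _).symm))
  φ := tildeAct
  ρ_φ u p := rfl
  φ_inl u k := Subtype.ext (Prod.ext (diagEnd_K₂ u k.2) (by
    change corner u * 1 * (corner u)⁻¹ = 1
    rw [mul_one, mul_inv_cancel]))

end Steinberg

variable {K : Type u} [Field K]

/-- The character of `K₂(K)` which corresponds to the unramified character of the Weil group that
takes the value `q ^ (-a)` on the Frobenius automorphism: the character with
`(x, y) ↦ (q ^ (-a)) ^ ν_K(x, y)`, where the symbol `(x, y)` is the commutator of arbitrary lifts of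
the matrices `diag(y, 1)` and `diag(1, x)` to the central extension of `GL₂(K)` by `K₂(K)`. -/
def IsUnramifiedCharacter (F : TwoDimLocalField K) (a : ℂ) (χ : Steinberg.K₂ K →* ℂˣ) : Prop :=
  ∀ (x y : Kˣ) (A B : Steinberg.tildeSL₂ K ⋊[(Steinberg.hatData K).φ] Kˣ) (k : Steinberg.K₂ K),
    (Steinberg.hatData K).ext.rightHom A = diagGL ![y, 1] →
    (Steinberg.hatData K).ext.rightHom B = diagGL ![1, x] →
    (Steinberg.hatData K).ext.inl k = A * B * A⁻¹ * B⁻¹ →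
    (χ k : ℂ) = ((F.q : ℂ) ^ (-a)) ^ F.nu x y

/-- The action of `GL₂(K)` on the category of finite-dimensional complex vector spaces defined by
a character of `K₂(K)`. -/
noncomputable def steinbergAction (χ : Steinberg.K₂ K →* ℂˣ) :
    GAction ℂ (GL (Fin 2) K) (FGModuleCat.{u} ℂ) :=
  lineAction (Steinberg.hatData K).ext (Steinberg.hatData K).ext_comm χ

end TwoDim

/-! Abelian and smooth. An object of the 2-colimit has values at the points of the group, and a
morphism is determined by its components there. Each morphism already exists at some finite level,
where kernels, cokernels and biproducts can be formed point by point; the functors of a group action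
are equivalences, so these constructions inherit the equivariant structure. The evaluations at
points preserve kernels and cokernels and jointly detect isomorphisms, so the coimage-image
comparison is invertible because it is so for vector spaces (`isAbelianCat_of_evaluations`).
Equivariant objects are treated in the same way, with the forgetful functor as the only evaluation.
Smoothness is nearly tautological: an object of level m has literally the same value at g and at gu
for u in the m-th congruence group, hence a canonical equivariant structure for that group, and a
morphism respects these structures exactly when it is constant on cosets (`Ind.fixed_hom_iff`).

The copy of the category of vector spaces. Since GL_2(O) stabilizes O^2, the extension by Haar
measures splits over it, and with it the extension of P over its integral points
(`parabolicSplitting`). A splitting turns a vector space Y into an induced object: over a coset x it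
consists of the Y-valued functions on the part of the pulled back extension above x which are
twisted by the character and right invariant under the splitting. Over the trivial coset this space
is Y, and over a coset that does not meet P it is zero. The action of P carries everything to the
trivial coset, so a morphism compatible with the largest congruence group is the same as a linear
map (`exists_map_eq`).

The linear functor for n = 1. Now P is the whole group, and compatibility with the largest
congruence group is automatic for morphisms between induced objects (`inducedFunctor_full`). The
right translate by g of the object induced from Y is isomorphic to the object induced from L_g ⊗ Y
(`ExtMorphism.push`). This is locally constant because conjugation by an element of the extension
respects the splitting over a deep congruence group: such a group acts trivially on the relevant
quotients of lattices and does not move their Haar measures (`exists_conj_integralHatHom`). To use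
the lines of the Steinberg extension, a morphism Φ from it to the Haar extension over GL_2(K) is
needed, with some κ from K_2(K) to the positive reals on the kernels.

Construction of Φ. The Haar extension also exists for matrices of arbitrary finite size acting on
lattices of finite sequences, and it splits over the stabilizer of each lattice. Any two elementary
matrices that occur in a Steinberg relation stabilize a common diagonal lattice. Each elementary
matrix is a commutator with a diagonal unit, so it has a lift independent of the lattice, and the
relations hold since they hold inside one splitting (`Steinberg.exists_lift_of_splittings`,
`exists_steinberg_lift`). A lift of the Steinberg group to a central extension is unique, which
yields compatibility with the action of the multiplicative group (`Steinberg.exists_hatHom`).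

The character. The image under κ of a symbol (x, y) is a commutator in the Haar extension, hence a
quotient of two bimultiplicative commutator pairings. It is enough to evaluate them on units and on
a uniformizer t. The only nontrivial value measures how diag(v, 1) scales a Haar measure on O^2 /
diag(t, 1) O^2, which is the residue field; there the modulus of y is q to the power minus the
valuation of y (`modulus_eq`, `ratio_corner`). Thus κ takes the value q to the power minus ν_K(x,
y), and the a-th power of κ is the required unramified character. -/

namespace TwoDim

open Limits

/-! ### Abelian categories detected by evaluation functors. -/

section Abelian

variable {C : Type u} [Category.{v} C] [Preadditive C]

/-- A preadditive category with zero object, binary biproducts, kernels and cokernels is abelian if it has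
a family of additive functors to abelian categories which preserve these kernels and cokernels and
jointly reflect isomorphisms. -/
theorem isAbelianCat_of_evaluations {ι : Type w} {B : ι → Type u'} [∀ i, Category.{v'} (B i)]
    [∀ i, Abelian (B i)] (e : ∀ i, C ⥤ B i) [∀ i, (e i).Additive]
    (hiso : ∀ {X Y : C} (f : X ⟶ Y), (∀ i, IsIso ((e i).map f)) → IsIso f)
    [HasZeroObject C] [HasBinaryBiproducts C]
    (hker : ∀ {X Y : C} (f : X ⟶ Y), ∃ (Z : C) (j : Z ⟶ X) (h : j ≫ f = 0),
      Nonempty (IsLimit (KernelFork.ofι j h)) ∧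
      ∀ i, ∃ h', Nonempty (IsLimit (KernelFork.ofι (f := (e i).map f) ((e i).map j) h')))
    (hcok : ∀ {X Y : C} (f : X ⟶ Y), ∃ (Z : C) (j : Y ⟶ Z) (h : f ≫ j = 0),
      Nonempty (IsColimit (CokernelCofork.ofπ j h)) ∧
      ∀ i, ∃ h', Nonempty (IsColimit (CokernelCofork.ofπ (f := (e i).map f) ((e i).map j) h'))) :
    IsAbelianCat C := by
  have hK : HasKernels C := ⟨fun {X Y} f => by
    obtain ⟨Z, j, h, ⟨l⟩, -⟩ := hker f
    exact ⟨⟨_, l⟩⟩⟩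
  have hQ : HasCokernels C := ⟨fun {X Y} f => by
    obtain ⟨Z, j, h, ⟨l⟩, -⟩ := hcok f
    exact ⟨⟨_, l⟩⟩⟩
  have hP : HasFiniteProducts C := hasFiniteProducts_of_has_binary_and_terminal
  have pk : ∀ {X Y : C} (f : X ⟶ Y) (i : ι), PreservesLimit (parallelPair f 0) (e i) :=
    fun {X Y} f i => by
      obtain ⟨Z, j, h, ⟨l⟩, h2⟩ := hker f
      obtain ⟨h', ⟨l'⟩⟩ := h2 i
      exact preservesLimit_of_preserves_limit_cone l
        ((KernelFork.isLimitMapConeEquiv _ _).2 l')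
  have pc : ∀ {X Y : C} (f : X ⟶ Y) (i : ι), PreservesColimit (parallelPair f 0) (e i) :=
    fun {X Y} f i => by
      obtain ⟨Z, j, h, ⟨l⟩, h2⟩ := hcok f
      obtain ⟨h', ⟨l'⟩⟩ := h2 i
      exact preservesColimit_of_preserves_colimit_cocone l
        ((CokernelCofork.isColimitMapCoconeEquiv _ _).2 l')
  -- A functor preserving all kernels and cokernels carries the coimage-image comparison, up to
  -- isomorphism, to the comparison in an abelian category, which is invertible.
  have : ∀ {X Y : C} (f : X ⟶ Y), IsIso (Abelian.coimageImageComparison f) := fun {X Y} f =>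
    hiso _ fun i => by
      exact IsIso.of_isIso_fac_right (Abelian.PreservesCoimage.hom_coimageImageComparison (e i) f).symm
  -- The abelian structure is built on the given preadditive structure, so the required equality is
  -- definitional.
  exact ⟨Abelian.ofCoimageImageComparisonIsIso, rfl⟩

end Abelian

/-! ### Kernels, cokernels and biproducts of families. -/

section Fam

variable {X : Type w} {B : Type u} [Category.{v} B] [Preadditive B]

namespace Fam

/-- The functor which takes the member of a family at an index. -/
def eval (B : Type u) [Category.{v} B] (x : X) : Fam X B ⥤ B where
  obj f := f.fam x
  map φ := φ.app x

instance (x : X) : (eval B x).Additive := ⟨rfl⟩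

/-- Limits in a product of categories are formed member by member. The second half is kept because
it says that evaluation at an index preserves this kernel. -/
theorem exists_kernel [HasKernels B] {f g : Fam X B} (φ : f ⟶ g) :
    ∃ (z : Fam X B) (j : z ⟶ f) (h : j ≫ φ = 0), Nonempty (IsLimit (KernelFork.ofι j h)) ∧
      ∀ x, ∃ h', Nonempty (IsLimit (KernelFork.ofι (f := φ.app x) (j.app x) h')) :=
  ⟨⟨fun x => kernel (φ.app x)⟩, ⟨fun x => kernel.ι (φ.app x)⟩,
    hom_ext fun x => kernel.condition (φ.app x),
    ⟨KernelFork.IsLimit.ofι _ _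
      (fun k hk => ⟨fun x => kernel.lift _ (k.app x) (congrArg (fun a => Hom.app a x) hk)⟩)
      (fun k hk => hom_ext fun x => kernel.lift_ι _ _ _)
      (fun k hk m hm => hom_ext fun x => by
        rw [← cancel_mono (kernel.ι (φ.app x))]
        exact (congrArg (fun a => Hom.app a x) hm).trans (kernel.lift_ι _ _ _).symm)⟩,
    fun x => ⟨kernel.condition _, ⟨kernelIsKernel _⟩⟩⟩

theorem exists_cokernel [HasCokernels B] {f g : Fam X B} (φ : f ⟶ g) :
    ∃ (z : Fam X B) (j : g ⟶ z) (h : φ ≫ j = 0), Nonempty (IsColimit (CokernelCofork.ofπ j h)) ∧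
      ∀ x, ∃ h', Nonempty (IsColimit (CokernelCofork.ofπ (f := φ.app x) (j.app x) h')) :=
  ⟨⟨fun x => cokernel (φ.app x)⟩, ⟨fun x => cokernel.π (φ.app x)⟩,
    hom_ext fun x => cokernel.condition (φ.app x),
    ⟨CokernelCofork.IsColimit.ofπ _ _
      (fun k hk => ⟨fun x => cokernel.desc _ (k.app x) (congrArg (fun a => Hom.app a x) hk)⟩)
      (fun k hk => hom_ext fun x => cokernel.π_desc _ _ _)
      (fun k hk m hm => hom_ext fun x => by
        rw [← cancel_epi (cokernel.π (φ.app x))]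
        exact (congrArg (fun a => Hom.app a x) hm).trans (cokernel.π_desc _ _ _).symm)⟩,
    fun x => ⟨cokernel.condition _, ⟨cokernelIsCokernel _⟩⟩⟩

instance [HasKernels B] : HasKernels (Fam X B) := ⟨fun φ => by
  obtain ⟨z, j, h, ⟨l⟩, -⟩ := exists_kernel φ
  exact ⟨⟨_, l⟩⟩⟩

instance [HasCokernels B] : HasCokernels (Fam X B) := ⟨fun φ => by
  obtain ⟨z, j, h, ⟨l⟩, -⟩ := exists_cokernel φ
  exact ⟨⟨_, l⟩⟩⟩

theorem exists_biprod [HasBinaryBiproducts B] (f g : Fam X B) :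
    ∃ b : BinaryBicone f g, b.fst ≫ b.inl + b.snd ≫ b.inr = 𝟙 b.pt :=
  ⟨{ pt := ⟨fun x => f.fam x ⊞ g.fam x⟩
     fst := ⟨fun _ => biprod.fst⟩
     snd := ⟨fun _ => biprod.snd⟩
     inl := ⟨fun _ => biprod.inl⟩
     inr := ⟨fun _ => biprod.inr⟩
     inl_fst := hom_ext fun _ => biprod.inl_fst
     inl_snd := hom_ext fun _ => biprod.inl_snd
     inr_fst := hom_ext fun _ => biprod.inr_fst
     inr_snd := hom_ext fun _ => biprod.inr_snd }, hom_ext fun _ => biprod.total⟩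

instance [HasBinaryBiproducts B] : HasBinaryBiproducts (Fam X B) := ⟨fun f g => by
  obtain ⟨b, hb⟩ := exists_biprod f g
  exact HasBinaryBiproduct.mk ⟨b, isBinaryBilimitOfTotal b hb⟩⟩

open ZeroObject in
instance [HasZeroObject B] : HasZeroObject (Fam X B) :=
  ⟨⟨⟨fun _ => 0⟩, (IsZero.iff_id_eq_zero _).2 (hom_ext fun _ => (isZero_zero B).eq_of_src _ _)⟩⟩

end Fam

end Fam

/-! ### Equivariant objects in an abelian category. -/

section Equivariant

variable {k : Type*} [Field k] {G : Type*} [Group G] {B : Type u} [Category.{v} B] [Preadditive B]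
  [Linear k B] (α : GAction k G B)

namespace GAction

/-- The functor of the inverse element is a quasi-inverse. This gives preservation of kernels and
cokernels with no exactness assumption on the action. -/
theorem isEquivalence (g : G) : (α.τ g).IsEquivalence :=
  (CategoryTheory.Equivalence.mk (α.τ g) (α.τ g⁻¹) (α.ψ₁.symm ≪≫ (α.ψ (inv_mul_cancel g)).symm)
    (α.ψ (mul_inv_cancel g) ≪≫ α.ψ₁)).isEquivalence_functor

variable {α}

namespace Equivariant

/-- The functor which forgets the equivariant structure. -/
def forget (α : GAction k G B) : α.Equivariant ⥤ B where
  obj E := E.obj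
  map f := f.1

instance : (forget α).Additive := ⟨rfl⟩

theorem isIso_of_val {E D : α.Equivariant} (f : E ⟶ D) (h : IsIso f.1) : IsIso f :=
  ⟨⟨inv f.1, fun g => by
    have := f.2 g
    rw [Functor.map_inv, IsIso.eq_inv_comp, ← Category.assoc, IsIso.comp_inv_eq]
    exact this.symm⟩, hom_ext (by simp), hom_ext (by simp)⟩

/-- As an equivalence, each `α.τ g` preserves the kernel, so the isomorphisms of the equivariant
structure restrict to it. All compatibilities are checked after composition with the image of
`kernel.ι`, which is again a monomorphism. -/
theorem exists_kernel [HasKernels B] {E D : α.Equivariant} (f : E ⟶ D) :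
    ∃ (Z : α.Equivariant) (j : Z ⟶ E) (h : j ≫ f = 0), Nonempty (IsLimit (KernelFork.ofι j h)) ∧
      ∃ h', Nonempty (IsLimit (KernelFork.ofι (f := f.1) j.1 h')) := by
  have := α.isEquivalence
  let θ : ∀ g, kernel f.1 ≅ (α.τ g).obj (kernel f.1) := fun g =>
    kernel.mapIso f.1 ((α.τ g).map f.1) (E.θ g) (D.θ g) (f.2 g).symm ≪≫
      (PreservesKernel.iso (α.τ g) f.1).symm
  have hθ : ∀ g, (θ g).hom ≫ (α.τ g).map (kernel.ι f.1) = kernel.ι f.1 ≫ (E.θ g).hom := fun g => by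
    simp [θ, PreservesKernel.iso_inv_ι]
  let Z : α.Equivariant :=
    { obj := kernel f.1
      θ := θ
      comm := fun {g h l} e => by
        have h1 := (α.ψ e).hom.naturality (kernel.ι f.1)
        rw [← cancel_mono ((α.τ l).map (kernel.ι f.1)), hθ, ← E.comm e]
        simp only [Functor.comp_map, Category.assoc] at h1 ⊢
        rw [← h1, ← Functor.map_comp_assoc, hθ, Functor.map_comp, Category.assoc, ← Category.assoc,
          hθ, Category.assoc] }
  let j : Z ⟶ E := ⟨kernel.ι f.1, hθ⟩
  have hj : j ≫ f = 0 := hom_ext (kernel.condition f.1)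
  refine ⟨Z, j, hj, ⟨KernelFork.IsLimit.ofι _ _ (fun {W} a ha => ⟨kernel.lift f.1 a.1
    (congrArg Subtype.val ha), fun g => ?_⟩) (fun a ha => hom_ext (kernel.lift_ι _ _ _))
    (fun a ha m hm => hom_ext ?_)⟩, kernel.condition f.1, ⟨kernelIsKernel _⟩⟩
  · rw [← cancel_mono ((α.τ g).map (kernel.ι f.1)), Category.assoc, Category.assoc,
      ← Functor.map_comp, kernel.lift_ι]
    change _ = _ ≫ (θ g).hom ≫ _
    rw [hθ, kernel.lift_ι_assoc]
    exact a.2 g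
  · rw [← cancel_mono (kernel.ι f.1)]
    exact (congrArg Subtype.val hm).trans (kernel.lift_ι _ _ _).symm

/-- Dual to the case of kernels: the structure of the target descends to the cokernel, and
compatibilities are checked after precomposition with `cokernel.π`. -/
theorem exists_cokernel [HasCokernels B] {E D : α.Equivariant} (f : E ⟶ D) :
    ∃ (Z : α.Equivariant) (j : D ⟶ Z) (h : f ≫ j = 0),
      Nonempty (IsColimit (CokernelCofork.ofπ j h)) ∧
      ∃ h', Nonempty (IsColimit (CokernelCofork.ofπ (f := f.1) j.1 h')) := by
  have := α.isEquivalence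
  let θ : ∀ g, cokernel f.1 ≅ (α.τ g).obj (cokernel f.1) := fun g =>
    cokernel.mapIso f.1 ((α.τ g).map f.1) (E.θ g) (D.θ g) (f.2 g).symm ≪≫
      (PreservesCokernel.iso (α.τ g) f.1).symm
  have hθ : ∀ g, cokernel.π f.1 ≫ (θ g).hom = (D.θ g).hom ≫ (α.τ g).map (cokernel.π f.1) :=
    fun g => by
      rw [← cancel_mono (PreservesCokernel.iso (α.τ g) f.1).hom]
      simp only [θ, Iso.trans_hom, Iso.symm_hom, Category.assoc, Iso.inv_hom_id, Category.comp_id,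
        PreservesCokernel.π_iso_hom]
      simp
  let Z : α.Equivariant :=
    { obj := cokernel f.1
      θ := θ
      comm := fun {g h l} e => by
        have h1 := (α.ψ e).hom.naturality (cokernel.π f.1)
        rw [← cancel_epi (cokernel.π f.1), hθ, ← D.comm e]
        simp only [Functor.comp_map, Category.assoc] at h1 ⊢
        rw [← h1, ← Functor.map_comp_assoc, ← hθ, reassoc_of% (hθ g), Functor.map_comp,
          Category.assoc] }
  let j : D ⟶ Z := ⟨cokernel.π f.1, fun g => (hθ g).symm⟩
  have hj : f ≫ j = 0 := hom_ext (cokernel.condition f.1)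
  refine ⟨Z, j, hj, ⟨CokernelCofork.IsColimit.ofπ _ _ (fun {W} a ha => ⟨cokernel.desc f.1 a.1
    (congrArg Subtype.val ha), fun g => ?_⟩) (fun a ha => hom_ext (cokernel.π_desc _ _ _))
    (fun a ha m hm => hom_ext ?_)⟩, cokernel.condition f.1, ⟨cokernelIsCokernel _⟩⟩
  · rw [← cancel_epi (cokernel.π f.1), cokernel.π_desc_assoc]
    change _ ≫ (θ g).hom ≫ _ = _
    rw [reassoc_of% (hθ g), ← Functor.map_comp, cokernel.π_desc]
    exact a.2 g
  · rw [← cancel_epi (cokernel.π f.1)]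
    exact (congrArg Subtype.val hm).trans (cokernel.π_desc _ _ _).symm

/-- The structure on the sum acts on each summand separately. Its inverse is assembled from the
images of the two projections, and additivity of the functors makes the two composites identities.
-/
theorem exists_biprod [HasBinaryBiproducts B] (E D : α.Equivariant) :
    ∃ b : BinaryBicone E D, b.fst ≫ b.inl + b.snd ≫ b.inr = 𝟙 b.pt := by
  have h1 : ∀ g, (α.τ g).map (biprod.inl : E.obj ⟶ E.obj ⊞ D.obj) ≫
      (α.τ g).map biprod.fst = 𝟙 _ := fun g => by rw [← Functor.map_comp]; simp
  have h2 : ∀ g, (α.τ g).map (biprod.inl : E.obj ⟶ E.obj ⊞ D.obj) ≫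
      (α.τ g).map biprod.snd = 0 := fun g => by rw [← Functor.map_comp]; simp
  have h3 : ∀ g, (α.τ g).map (biprod.inr : D.obj ⟶ E.obj ⊞ D.obj) ≫
      (α.τ g).map biprod.fst = 0 := fun g => by rw [← Functor.map_comp]; simp
  have h4 : ∀ g, (α.τ g).map (biprod.inr : D.obj ⟶ E.obj ⊞ D.obj) ≫
      (α.τ g).map biprod.snd = 𝟙 _ := fun g => by rw [← Functor.map_comp]; simp
  let Z : α.Equivariant :=
    { obj := E.obj ⊞ D.obj
      θ := fun g =>
        { hom := biprod.desc ((E.θ g).hom ≫ (α.τ g).map biprod.inl)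
            ((D.θ g).hom ≫ (α.τ g).map biprod.inr)
          inv := (α.τ g).map biprod.fst ≫ (E.θ g).inv ≫ biprod.inl +
            (α.τ g).map biprod.snd ≫ (D.θ g).inv ≫ biprod.inr
          hom_inv_id := by
            apply biprod.hom_ext' <;> simp [reassoc_of% (h1 g), reassoc_of% (h2 g),
              reassoc_of% (h3 g), reassoc_of% (h4 g)]
          inv_hom_id := by
            simp [← Functor.map_comp, ← Functor.map_add] }
      comm := fun {g h l} e => by
        have h1 := (α.ψ e).hom.naturality (biprod.inl : E.obj ⟶ E.obj ⊞ D.obj)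
        have h2 := (α.ψ e).hom.naturality (biprod.inr : D.obj ⟶ E.obj ⊞ D.obj)
        simp only [Functor.comp_map] at h1 h2
        apply biprod.hom_ext'
        · simp only [biprod.inl_desc_assoc, biprod.inl_desc, Category.assoc, ← E.comm e, ← h1]
          rw [← Functor.map_comp_assoc (α.τ g), biprod.inl_desc, Functor.map_comp_assoc]
        · simp only [biprod.inr_desc_assoc, biprod.inr_desc, Category.assoc, ← D.comm e, ← h2]
          rw [← Functor.map_comp_assoc (α.τ g), biprod.inr_desc, Functor.map_comp_assoc] }
  refine ⟨{ pt := Z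
            fst := ⟨biprod.fst, fun g => ?_⟩
            snd := ⟨biprod.snd, fun g => ?_⟩
            inl := ⟨biprod.inl, fun g => ?_⟩
            inr := ⟨biprod.inr, fun g => ?_⟩
            inl_fst := hom_ext biprod.inl_fst
            inl_snd := hom_ext biprod.inl_snd
            inr_fst := hom_ext biprod.inr_fst
            inr_snd := hom_ext biprod.inr_snd }, hom_ext biprod.total⟩
  all_goals (try apply biprod.hom_ext') <;> simp [Z, h1, h2, h3, h4]

instance [HasBinaryBiproducts B] : HasBinaryBiproducts α.Equivariant := ⟨fun f g => by
  obtain ⟨b, hb⟩ := exists_biprod f g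
  exact HasBinaryBiproduct.mk ⟨b, isBinaryBilimitOfTotal b hb⟩⟩

open ZeroObject in
instance [HasZeroObject B] : HasZeroObject α.Equivariant :=
  ⟨⟨⟨0, fun g => (isZero_zero B).iso ((α.τ g).map_isZero (isZero_zero B)), fun _ =>
    (isZero_zero B).eq_of_src _ _⟩, (IsZero.iff_id_eq_zero _).2
    (hom_ext ((isZero_zero B).eq_of_src _ _))⟩⟩

end Equivariant

/-- A single evaluation functor suffices: forgetting the structure reflects isomorphisms, because
the inverse of an equivariant morphism is equivariant. -/
theorem isAbelianCat_equivariant (α : GAction k G B) (hB : IsAbelianCat B) :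
    IsAbelianCat α.Equivariant := by
  obtain ⟨A, rfl⟩ := hB
  refine isAbelianCat_of_evaluations (ι := Unit) (fun _ => Equivariant.forget α)
    (fun f h => Equivariant.isIso_of_val f (h ())) (fun f => ?_) (fun f => ?_)
  · obtain ⟨Z, j, h, l, h'⟩ := Equivariant.exists_kernel f
    exact ⟨Z, j, h, l, fun _ => h'⟩
  · obtain ⟨Z, j, h, l, h'⟩ := Equivariant.exists_cokernel f
    exact ⟨Z, j, h, l, fun _ => h'⟩

end GAction

end Equivariant
end TwoDim

namespace TwoDim

open Limits

/-! ### The 2-colimit: abelian structure and smoothness. -/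

section InductionAbelian

variable {k : Type*} [Field k] {G : Type w} [Group G] {P : Subgroup G}
  {B : Type u} [Category.{v} B] [Preadditive B] [Linear k B]

/-- Evaluation preserves the memberwise kernel, hence every kernel of the same morphism. This form
applies to kernels obtained from abstract existence, as those of equivariant families are. -/
theorem Fam.isLimit_app [HasKernels B] {X : Type w} {z f g : Fam X B} {φ : f ⟶ g} {j : z ⟶ f}
    {h : j ≫ φ = 0} (l : IsLimit (KernelFork.ofι j h)) (x : X) :
    ∃ h', Nonempty (IsLimit (KernelFork.ofι (f := φ.app x) (j.app x) h')) := by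
  obtain ⟨z', j', h', ⟨l'⟩, hx⟩ := Fam.exists_kernel φ
  obtain ⟨h'', ⟨l''⟩⟩ := hx x
  have : PreservesLimit (parallelPair φ 0) (Fam.eval B x) :=
    preservesLimit_of_preserves_limit_cone l' ((KernelFork.isLimitMapConeEquiv _ _).2 l'')
  exact ⟨congrArg (fun a => Hom.app a x) h, ⟨KernelFork.mapIsLimit _ l (Fam.eval B x)⟩⟩

theorem Fam.isColimit_app [HasCokernels B] {X : Type w} {z f g : Fam X B} {φ : f ⟶ g} {j : g ⟶ z}
    {h : φ ≫ j = 0} (l : IsColimit (CokernelCofork.ofπ j h)) (x : X) :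
    ∃ h', Nonempty (IsColimit (CokernelCofork.ofπ (f := φ.app x) (j.app x) h')) := by
  obtain ⟨z', j', h', ⟨l'⟩, hx⟩ := Fam.exists_cokernel φ
  obtain ⟨h'', ⟨l''⟩⟩ := hx x
  have : PreservesColimit (parallelPair φ 0) (Fam.eval B x) :=
    preservesColimit_of_preserves_colimit_cocone l'
      ((CokernelCofork.isColimitMapCoconeEquiv _ _).2 l'')
  exact ⟨congrArg (fun a => Hom.app a x) h, ⟨CokernelCofork.mapIsColimit _ l (Fam.eval B x)⟩⟩

namespace EqFam

variable {α : GAction k P B} {C : Subgroup G}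

theorem exists_kernel [HasKernels B] {E D : EqFam α C} (χ : E ⟶ D) :
    ∃ (Z : EqFam α C) (j : Z ⟶ E), ∀ g, ∃ h, Nonempty (IsLimit (KernelFork.ofι (f := ev χ g) (ev j g) h)) := by
  obtain ⟨Z, j, -, -, h, ⟨l⟩⟩ := GAction.Equivariant.exists_kernel χ
  exact ⟨Z, j, fun g => Fam.isLimit_app l _⟩

theorem exists_cokernel [HasCokernels B] {E D : EqFam α C} (χ : E ⟶ D) :
    ∃ (Z : EqFam α C) (j : D ⟶ Z), ∀ g, ∃ h, Nonempty (IsColimit (CokernelCofork.ofπ (f := ev χ g) (ev j g) h)) := by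
  obtain ⟨Z, j, -, -, h, ⟨l⟩⟩ := GAction.Equivariant.exists_cokernel χ
  exact ⟨Z, j, fun g => Fam.isColimit_app l _⟩

end EqFam

namespace Ind

variable {F : SubgroupFiltration G} {α : GAction k P B}

/-- The functor which takes the value of an object at a point of `G`. -/
noncomputable def eval (F : SubgroupFiltration G) (α : GAction k P B) (g : G) : Ind F α ⥤ B where
  obj E := E.at' g
  map f := app f g

instance (g : G) : (eval F α g).Additive := ⟨add_app _ _ g⟩

@[simp] theorem zero_app (E D : Ind F α) (g : G) : app (0 : E ⟶ D) g = 0 :=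
  (eval F α g).map_zero E D

theorem app_th {E D : Ind F α} (f : E ⟶ D) (p : P) (g : G) :
    E.th p g ≫ (α.τ p).map (app f ((p : G)⁻¹ * g)) = app f g ≫ D.th p g := ev_th f p g

theorem app_mul {E D : Ind F α} (f : E ⟶ D) : ∃ (m : ℕ) (hE : E.lev ≤ m) (hD : D.lev ≤ m),
    ∀ (g u : G) (hu : u ∈ F.C m), app f (g * u) =
      eqToHom (E.at_mul hE g hu) ≫ app f g ≫ eqToHom (D.at_mul hD g hu).symm := by
  obtain ⟨m, h⟩ := ev_mul f
  exact ⟨m.1, m.2.1, m.2.2, h⟩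

theorem exists_hom_app {E D : Ind F α} (φ : ∀ g, E.at' g ⟶ D.at' g) (m : ℕ)
    (hE : E.lev ≤ m) (hD : D.lev ≤ m)
    (h₁ : ∀ (g u : G) (hu : u ∈ F.C m), φ (g * u) =
      eqToHom (E.at_mul hE g hu) ≫ φ g ≫ eqToHom (D.at_mul hD g hu).symm)
    (h₂ : ∀ (p : P) (g : G), E.th p g ≫ (α.τ p).map (φ ((p : G)⁻¹ * g)) = φ g ≫ D.th p g) :
    ∃ f : E ⟶ D, ∀ g, app f g = φ g := exists_hom φ m hE hD h₁ h₂

/-- The inverses of the components are constant on cosets at the same level as `f`, so they form a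
morphism of the colimit. -/
theorem isIso_of_app {E D : Ind F α} (f : E ⟶ D) (h : ∀ g, IsIso (app f g)) : IsIso f := by
  obtain ⟨m, hE, hD, hm⟩ := app_mul f
  obtain ⟨f', hf'⟩ := exists_hom_app (fun g => inv (app f g)) m hD hE (fun g u hu => by
    rw [← cancel_epi (app f (g * u)), IsIso.hom_inv_id, hm g u hu]
    simp) (fun p g => by
    rw [Functor.map_inv, IsIso.eq_inv_comp, ← Category.assoc, IsIso.comp_inv_eq]
    exact (app_th f p g).symm)
  exact ⟨f', hom_ext fun g => by simp [hf'], hom_ext fun g => by simp [hf']⟩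

/-- The kernel is taken at a finite level at which `f` is defined. A test morphism may have a higher
level, but it factors pointwise, and uniqueness of the pointwise factorization forces the factors to
be constant on cosets and compatible with `P`. -/
theorem exists_kernel [HasKernels B] {E D : Ind F α} (f : E ⟶ D) :
    ∃ (Z : Ind F α) (j : Z ⟶ E) (h : j ≫ f = 0), Nonempty (IsLimit (KernelFork.ofι j h)) ∧
      ∀ g, ∃ h', Nonempty (IsLimit (KernelFork.ofι (f := app f g) (app j g) h')) := by
  obtain ⟨m, χ, hχ⟩ := exists_lev f
  obtain ⟨Z, j, hj⟩ := EqFam.exists_kernel χ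
  obtain ⟨j', hj'⟩ := exists_hom_app (E := ⟨m.1, Z⟩) (D := E) (fun g => EqFam.ev j g) m.1 le_rfl
    m.2.1 (fun g u hu => EqFam.ev_mul j g hu) (fun p g => by
      have := EqFam.ev_th j p g
      rw [eqQ_th] at this
      exact this)
  have hl : ∀ g, ∃ h', Nonempty (IsLimit (KernelFork.ofι (f := app f g) (app j' g) h')) := fun g => by
    obtain ⟨h, ⟨l⟩⟩ := hj g
    have h1 : app f g = EqFam.ev χ g := hχ g
    rw [hj', h1]
    exact ⟨h, ⟨l⟩⟩
  choose h' l using hl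
  have l := fun g => (l g).some
  -- The pointwise kernel maps are monomorphisms; every identity about the factorizations below is
  -- proved by cancelling one of them.
  have hm : ∀ g, Mono (app j' g) := fun g =>
    ⟨fun a b e => Fork.IsLimit.hom_ext (l g) e⟩
  have hlift : ∀ {W : Ind F α} (a : W ⟶ E), a ≫ f = 0 → ∃ b : W ⟶ ⟨m.1, Z⟩, b ≫ j' = a := by
    intro W a ha
    have ha' : ∀ g, app a g ≫ app f g = 0 := fun g => by rw [← comp_app, ha, zero_app]
    have hb : ∀ g, ∃ b, b ≫ app j' g = app a g := fun g =>
      ⟨_, (KernelFork.IsLimit.lift' (l g) (app a g) (ha' g)).2⟩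
    choose b hb using hb
    obtain ⟨m₁, h1, h2, hm₁⟩ := app_mul a
    obtain ⟨m₂, h3, h4, hm₂⟩ := app_mul j'
    obtain ⟨b', hb'⟩ := exists_hom_app b (max m₁ m₂) (h1.trans (le_max_left _ _))
      (h3.trans (le_max_right _ _)) (fun g u hu => by
        rw [← cancel_mono (app j' (g * u)), hb, hm₁ g u (F.anti (le_max_left _ _) hu),
          hm₂ g u (F.anti (le_max_right _ _) hu), ← hb g]
        simp) (fun p g => by
        -- An equivalence keeps the component of `j'` a monomorphism, which allows the cancellation
        -- in the next line.
        have := (α.isEquivalence p)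
        rw [← cancel_mono ((α.τ p).map (app j' ((p : G)⁻¹ * g))), Category.assoc, Category.assoc,
          ← Functor.map_comp, hb, app_th, app_th, ← Category.assoc, hb])
    exact ⟨b', hom_ext fun g => by rw [comp_app, hb', hb]⟩
  have hz : j' ≫ f = 0 := hom_ext fun g => by rw [comp_app, h', zero_app]
  exact ⟨_, j', hz, ⟨KernelFork.IsLimit.ofι _ _ (fun a ha => (hlift a ha).choose)
    (fun a ha => (hlift a ha).choose_spec) (fun a ha b hb => hom_ext fun g => by
      rw [← cancel_mono (app j' g), ← comp_app, ← comp_app, hb, (hlift a ha).choose_spec])⟩,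
    fun g => ⟨h' g, ⟨l g⟩⟩⟩

theorem exists_cokernel [HasCokernels B] {E D : Ind F α} (f : E ⟶ D) :
    ∃ (Z : Ind F α) (j : D ⟶ Z) (h : f ≫ j = 0), Nonempty (IsColimit (CokernelCofork.ofπ j h)) ∧
      ∀ g, ∃ h', Nonempty (IsColimit (CokernelCofork.ofπ (f := app f g) (app j g) h')) := by
  obtain ⟨m, χ, hχ⟩ := exists_lev f
  obtain ⟨Z, j, hj⟩ := EqFam.exists_cokernel χ
  obtain ⟨j', hj'⟩ := exists_hom_app (E := D) (D := ⟨m.1, Z⟩) (fun g => EqFam.ev j g) m.1 m.2.2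
    le_rfl (fun g u hu => EqFam.ev_mul j g hu) (fun p g => by
      have := EqFam.ev_th j p g
      rw [eqQ_th] at this
      exact this)
  have hl : ∀ g, ∃ h', Nonempty (IsColimit (CokernelCofork.ofπ (f := app f g) (app j' g) h')) :=
    fun g => by
      obtain ⟨h, ⟨l⟩⟩ := hj g
      have h1 : app f g = EqFam.ev χ g := hχ g
      rw [hj', h1]
      exact ⟨h, ⟨l⟩⟩
  choose h' l using hl
  have l := fun g => (l g).some
  have hm : ∀ g, Epi (app j' g) := fun g =>
    ⟨fun a b e => Cofork.IsColimit.hom_ext (l g) e⟩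
  have hlift : ∀ {W : Ind F α} (a : D ⟶ W), f ≫ a = 0 → ∃ b : ⟨m.1, Z⟩ ⟶ W, j' ≫ b = a := by
    intro W a ha
    have ha' : ∀ g, app f g ≫ app a g = 0 := fun g => by rw [← comp_app, ha, zero_app]
    have hb : ∀ g, ∃ b, app j' g ≫ b = app a g := fun g =>
      ⟨_, (CokernelCofork.IsColimit.desc' (l g) (app a g) (ha' g)).2⟩
    choose b hb using hb
    obtain ⟨m₁, h1, h2, hm₁⟩ := app_mul a
    obtain ⟨m₂, h3, h4, hm₂⟩ := app_mul j'
    obtain ⟨b', hb'⟩ := exists_hom_app b (max m₁ m₂) (h4.trans (le_max_right _ _))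
      (h2.trans (le_max_left _ _)) (fun g u hu => by
        have e1 := hm₂ g u (F.anti (le_max_right _ _) hu)
        rw [← cancel_epi (app j' (g * u)), hb, hm₁ g u (F.anti (le_max_left _ _) hu), e1, ← hb g]
        simp) (fun p g => by
        rw [← cancel_epi (app j' g), ← Category.assoc, ← app_th, Category.assoc,
          ← Functor.map_comp, hb, app_th, ← Category.assoc, hb])
    exact ⟨b', hom_ext fun g => by rw [comp_app, hb', hb]⟩
  have hz : f ≫ j' = 0 := hom_ext fun g => by rw [comp_app, h', zero_app]
  exact ⟨_, j', hz, ⟨CokernelCofork.IsColimit.ofπ _ _ (fun a ha => (hlift a ha).choose)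
    (fun a ha => (hlift a ha).choose_spec) (fun a ha b hb => hom_ext fun g => by
      rw [← cancel_epi (app j' g), ← comp_app, ← comp_app, hb, (hlift a ha).choose_spec])⟩,
    fun g => ⟨h' g, ⟨l g⟩⟩⟩

/-- Both objects are pulled back to the larger of their two levels, where the biproduct of
equivariant families is available; pulling back changes neither the values nor the structure at the
points of `G`. -/
theorem exists_biprod [HasBinaryBiproducts B] (E D : Ind F α) :
    ∃ b : BinaryBicone E D, b.fst ≫ b.inl + b.snd ≫ b.inr = 𝟙 b.pt := by
  obtain ⟨b, hb⟩ := GAction.Equivariant.exists_biprod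
    ((eqQ α (F.anti (le_max_left E.lev D.lev))).obj E.obj)
    ((eqQ α (F.anti (le_max_right E.lev D.lev))).obj D.obj)
  let Z : Ind F α := ⟨max E.lev D.lev, b.pt⟩
  obtain ⟨p₁, h1⟩ := exists_hom_app (E := Z) (D := E) (fun g => EqFam.ev b.fst g) _ le_rfl
    (le_max_left _ _) (fun g u hu => EqFam.ev_mul b.fst g hu) (fun p g => by
      have := EqFam.ev_th b.fst p g
      rw [eqQ_th] at this
      exact this)
  obtain ⟨p₂, h2⟩ := exists_hom_app (E := Z) (D := D) (fun g => EqFam.ev b.snd g) _ le_rfl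
    (le_max_right _ _) (fun g u hu => EqFam.ev_mul b.snd g hu) (fun p g => by
      have := EqFam.ev_th b.snd p g
      rw [eqQ_th] at this
      exact this)
  obtain ⟨i₁, h3⟩ := exists_hom_app (E := E) (D := Z) (fun g => EqFam.ev b.inl g) _
    (le_max_left _ _) le_rfl (fun g u hu => EqFam.ev_mul b.inl g hu) (fun p g => by
      have := EqFam.ev_th b.inl p g
      rw [eqQ_th] at this
      exact this)
  obtain ⟨i₂, h4⟩ := exists_hom_app (E := D) (D := Z) (fun g => EqFam.ev b.inr g) _
    (le_max_right _ _) le_rfl (fun g u hu => EqFam.ev_mul b.inr g hu) (fun p g => by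
      have := EqFam.ev_th b.inr p g
      rw [eqQ_th] at this
      exact this)
  have key : ∀ {X Y : EqFam α (F.C (max E.lev D.lev))} {a b : X ⟶ Y} (_ : a = b) (g : G),
      EqFam.ev a g = EqFam.ev b g := by rintro _ _ _ _ rfl _; rfl
  refine ⟨⟨Z, p₁, p₂, i₁, i₂, hom_ext fun g => ?_, hom_ext fun g => ?_, hom_ext fun g => ?_,
    hom_ext fun g => ?_⟩, hom_ext fun g => ?_⟩
  · rw [comp_app, h1, h3, id_app]; exact key b.inl_fst g
  · rw [comp_app, h2, h3, zero_app]; exact key b.inl_snd g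
  · rw [comp_app, h1, h4, zero_app]; exact key b.inr_fst g
  · rw [comp_app, h2, h4, id_app]; exact key b.inr_snd g
  · have e1 := (comp_app p₁ i₁ g).trans (congrArg₂ (· ≫ ·) (h1 g) (h3 g))
    have e2 := (comp_app p₂ i₂ g).trans (congrArg₂ (· ≫ ·) (h2 g) (h4 g))
    exact (add_app _ _ g).trans ((congrArg₂ (· + ·) e1 e2).trans
      ((key hb g).trans (id_app Z g).symm))

instance [HasBinaryBiproducts B] : HasBinaryBiproducts (Ind F α) := ⟨fun f g => by
  obtain ⟨b, hb⟩ := exists_biprod f g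
  exact HasBinaryBiproduct.mk ⟨b, isBinaryBilimitOfTotal b hb⟩⟩

open ZeroObject in
instance [HasZeroObject B] : HasZeroObject (Ind F α) :=
  ⟨⟨0, (0 : EqFam α (F.C 0))⟩, (IsZero.iff_id_eq_zero _).2 (hom_ext fun g => by
    rw [id_app, zero_app]
    have h := (IsZero.iff_id_eq_zero _).1 (isZero_zero (EqFam α (F.C 0)))
    exact congrArg (fun a => EqFam.ev a g) h)⟩

end Ind

theorem isAbelianCat_ind {B : Type u} [Category.{v} B] [Abelian B] [Linear k B]
    (F : SubgroupFiltration G) (α : GAction k P B) : IsAbelianCat (Ind F α) :=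
  isAbelianCat_of_evaluations (Ind.eval F α) Ind.isIso_of_app Ind.exists_kernel Ind.exists_cokernel

namespace Ind

variable {F : SubgroupFiltration G} {α : GAction k P B}

/-- Translation by `u` on the right does not leave a coset, so the translated object has the same
values and the identifications of equal objects form an isomorphism. -/
theorem exists_fixedIso (E : Ind F α) {m : ℕ} (hm : E.lev ≤ m) (u : F.C m) :
    ∃ i : E ≅ (rightFunctor F α u).obj E, ∀ g, ∀ e : E.at' g = (right (u : G) E).at' g, app i.hom g = eqToHom e := by
  have e : ∀ g, E.at' g = (right (u : G) E).at' g := fun g => (E.at_mul hm g u.2).symm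
  obtain ⟨i, hi⟩ := exists_eqToHom e fun p x => by
    rw [right_th]
    -- The equivariant structure is indexed by cosets, so its components at two representatives of a
    -- coset differ only by identifications.
    have key : ∀ (y : G) (hy : (QuotientGroup.mk y : G ⧸ F.C E.lev) = QuotientGroup.mk x)
      (h1 : E.at' ((p : G)⁻¹ * x) = E.at' ((p : G)⁻¹ * y))
      (h2 : E.at' x = E.at' y),
      E.th p x ≫ (α.τ p).map (eqToHom h1) = eqToHom h2 ≫ E.th p y := fun y hy h1 h2 => by
        have := Fam.tr_naturality (E.obj.θ p).hom.app hy.symm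
        refine Eq.trans ?_ this.symm
        rw [eqToHom_map]
        rfl
    have h := key (x * u) (QuotientGroup.mk_mul_of_mem x (F.anti hm u.2))
      (by rw [← mul_assoc]; exact (E.at_mul hm _ u.2).symm) (E.at_mul hm x u.2).symm
    have e3 : (p : G)⁻¹ * (x * u) = (p : G)⁻¹ * x * u := (mul_assoc _ _ _).symm
    have key2 : E.th p x ≫ (α.τ p).map (eqToHom (E.at_mul hm ((p : G)⁻¹ * x) u.2).symm) =
        eqToHom (E.at_mul hm x u.2).symm ≫ E.th p (x * u) ≫
          (α.τ p).map (eqToHom (congrArg E.at' e3)) := by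
      rw [← Category.assoc, ← h, Category.assoc, ← Functor.map_comp, eqToHom_trans]
    exact key2
  exact ⟨i, fun x _ => hi x⟩

/-- The canonical equivariant structure for the subgroup `C_m` on an object of level `≤ m`. -/
noncomputable def fixed (E : Ind F α) {m : ℕ} (hm : E.lev ≤ m) :
    ((σ F α).comap (F.C m).subtype).Equivariant where
  obj := E
  θ u := (exists_fixedIso E hm u).choose
  comm {g h l} e := hom_ext fun x => by
    subst e
    have key : ∀ {a b c d : B} (h₁ : a = b) (h₂ : b = c) (h₃ : c = d) (h₄ : a = d),
      eqToHom h₁ ≫ eqToHom h₂ ≫ eqToHom h₃ = eqToHom h₄ := by intros; simp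
    have h1 := (exists_fixedIso E hm g).choose_spec x (E.at_mul hm x g.2).symm
    have h2 := (exists_fixedIso E hm h).choose_spec (x * g) (E.at_mul hm _ h.2).symm
    have h3 := (exists_fixedIso E hm (g * h)).choose_spec x (E.at_mul hm x (g * h).2).symm
    have h4 := right_map_app (g : G) (exists_fixedIso E hm h).choose.hom x
    have h5 := rightMul_app (rfl : (g : G) * h = g * h) E x (congrArg E.at' (mul_assoc _ _ _))
    have c1 := comp_app (exists_fixedIso E hm g).choose.hom
      ((rightFunctor F α g).map (exists_fixedIso E hm h).choose.hom ≫
        (rightMul (rfl : (g : G) * h = g * h) E).hom) x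
    have c2 := comp_app ((rightFunctor F α g).map (exists_fixedIso E hm h).choose.hom)
      (rightMul (rfl : (g : G) * h = g * h) E).hom x
    exact c1.trans ((congrArg₂ (· ≫ ·) h1 (c2.trans (congrArg₂ (· ≫ ·) (h4.trans h2) h5))).trans
      ((key _ _ _ _).trans h3.symm))

theorem fixed_θ_app (E : Ind F α) {m : ℕ} (hm : E.lev ≤ m) (u : F.C m) (g : G)
    (e : E.at' g = (right (u : G) E).at' g) : app ((E.fixed hm).θ u).hom g = eqToHom e :=
  (exists_fixedIso E hm u).choose_spec g e

/-- With the canonical structures on both sides, the equivariance square at `u` has identifications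
as two of its sides; what remains is constancy of the components on cosets of the subgroup. -/
theorem fixed_hom_iff {E D : Ind F α} {m : ℕ} (hE : E.lev ≤ m) (hD : D.lev ≤ m) (f : E ⟶ D) :
    f ∈ (E.fixed hE).homSubmodule (D.fixed hD) ↔ ∀ (g u : G) (hu : u ∈ F.C m), app f (g * u) =
      eqToHom (E.at_mul hE g hu) ≫ app f g ≫ eqToHom (D.at_mul hD g hu).symm := by
  have key : ∀ (u : F.C m) (g : G), app (((E.fixed hE).θ u).hom ≫ (rightFunctor F α u).map f) g =
      app (f ≫ ((D.fixed hD).θ u).hom) g ↔ app f (g * u) =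
      eqToHom (E.at_mul hE g u.2) ≫ app f g ≫ eqToHom (D.at_mul hD g u.2).symm := fun u g => by
    have h1 := fixed_θ_app E hE u g (E.at_mul hE g u.2).symm
    have h2 := fixed_θ_app D hD u g (D.at_mul hD g u.2).symm
    have h3 := right_map_app (u : G) f g
    have c1 := comp_app ((E.fixed hE).θ u).hom ((rightFunctor F α u).map f) g
    have c2 := comp_app f ((D.fixed hD).θ u).hom g
    have e1 : app (((E.fixed hE).θ u).hom ≫ (rightFunctor F α u).map f) g =
      eqToHom (E.at_mul hE g u.2).symm ≫ app f (g * u) := c1.trans (congrArg₂ (· ≫ ·) h1 h3)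
    have e2 : app (f ≫ ((D.fixed hD).θ u).hom) g = app f g ≫ eqToHom (D.at_mul hD g u.2).symm :=
      c2.trans (congrArg (_ ≫ ·) h2)
    refine Iff.trans (Eq.congr e1 e2) ⟨fun h => ?_, fun h => ?_⟩
    · rw [← h, eqToHom_trans_assoc, eqToHom_refl, Category.id_comp]
    · rw [h, eqToHom_trans_assoc, eqToHom_refl, Category.id_comp]
  constructor
  · intro h g u hu
    exact (key ⟨u, hu⟩ g).1 (congrArg (fun a => app a g) (h ⟨u, hu⟩))
  · intro h u
    exact hom_ext fun g => (key u g).2 (h g u u.2)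

/-- A morphism of the colimit is constant on cosets from some level on, and `fixed_hom_iff` applies
at that level. -/
theorem isSmoothAction (F : SubgroupFiltration G) (α : GAction k P B) :
    IsSmoothAction F (σ F α) := fun E D f => by
  obtain ⟨m, hE, hD, h⟩ := app_mul f
  exact ⟨m, E.fixed hE, D.fixed hD, ⟨f, (fixed_hom_iff hE hD f).2 h⟩, rfl, rfl,
    ((Category.id_comp _).trans (Category.comp_id _)).symm⟩

end Ind

end InductionAbelian

end TwoDim

namespace TwoDim

/-! ### Objects induced from a splitting of the extension. -/

section InducedObject

variable {A : Type v} {E Q G : Type u} [CommGroup A] [Group E] [Group Q] [Group G]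
  {S : GroupExtension A E Q} {χ : A →* ℂˣ} {P : Subgroup G} {f : P →* Q} {C : Subgroup G}

/-- A multiplicative section over a subgroup `C` of the pull-back of a group extension along
`f : P → Q`. -/
structure SplittingOn (S : GroupExtension A E Q) (f : P →* Q) (C : Subgroup G) where
  s : P → E
  rightHom_s : ∀ k : P, (k : G) ∈ C → S.rightHom (s k) = f k
  s_mul : ∀ k k' : P, (k : G) ∈ C → (k' : G) ∈ C → s (k * k') = s k * s k'

theorem SplittingOn.s_one (s : SplittingOn S f C) : s.s 1 = 1 := by
  have := s.s_mul 1 1 C.one_mem C.one_mem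
  rw [one_mul] at this
  exact left_eq_mul.1 this

/-- The elements of the pull-back of an extension over a given coset. -/
abbrev LiftOver (S : GroupExtension A E Q) (f : P →* Q) (C : Subgroup G) (x : G ⧸ C) : Type u :=
  {z : E × P // S.rightHom z.1 = f z.2 ∧ (QuotientGroup.mk (z.2 : G) : G ⧸ C) = x}

/-- The functions on the part of the pull-back of an extension over a coset which transform under
`A` by `χ⁻¹` and are invariant under the image of a splitting. -/
def coinvariants (χ : A →* ℂˣ) (s : SplittingOn S f C) (x : G ⧸ C) (Y : Type u) [AddCommGroup Y]
    [Module ℂ Y] : Submodule ℂ (LiftOver S f C x → Y) where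
  carrier := {φ | (∀ (a : A) (z z' : LiftOver S f C x), z'.1 = (S.inl a * z.1.1, z.1.2) →
      φ z' = ((χ a)⁻¹ : ℂˣ) • φ z) ∧
    ∀ (k : P) (z z' : LiftOver S f C x), (k : G) ∈ C → z'.1 = (z.1.1 * s.s k, z.1.2 * k) →
      φ z' = φ z}
  add_mem' {φ φ'} h h' := ⟨fun a x y e => by simp [h.1 a x y e, h'.1 a x y e],
    fun a x y hk e => by simp [h.2 a x y hk e, h'.2 a x y hk e]⟩
  zero_mem' := ⟨fun a x y e => by simp, fun a x y hk e => by simp⟩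
  smul_mem' c φ h := ⟨fun a x y e => by simp [h.1 a x y e, smul_comm c],
    fun a x y hk e => by simp [h.2 a x y hk e]⟩

namespace coinvariants

variable {s : SplittingOn S f C} {Y : Type u} [AddCommGroup Y] [Module ℂ Y]
  {Y' : Type u} [AddCommGroup Y'] [Module ℂ Y']

theorem mem_of_mk_eq {k k' : P} (h : (QuotientGroup.mk (k : G) : G ⧸ C) = QuotientGroup.mk (k' : G)) :
    ((k⁻¹ * k' : P) : G) ∈ C := QuotientGroup.eq.1 h

/-- Two lifts over the same coset differ by right multiplication with a value of the splitting
followed by left multiplication with an element of `A`. The two transformation laws therefore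
determine a function from one value. -/
theorem ext_at {x : G ⧸ C} {φ φ' : coinvariants χ s x Y} (z : LiftOver S f C x)
    (h : φ.1 z = φ'.1 z) : φ = φ' := Subtype.ext <| funext fun z' => by
  have hk := mem_of_mk_eq (z.2.2.trans z'.2.2.symm)
  have e : z.1.2 * (z.1.2⁻¹ * z'.1.2) = z'.1.2 := mul_inv_cancel_left _ _
  let w : LiftOver S f C x := ⟨(z.1.1 * s.s (z.1.2⁻¹ * z'.1.2), z'.1.2), by
    rw [map_mul, z.2.1, s.rightHom_s _ hk, ← map_mul, e], z'.2.2⟩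
  obtain ⟨a, ha⟩ := lineTensor.exists_inl (w.2.1.trans z'.2.1.symm)
  have e' : z'.1 = (S.inl a * w.1.1, w.1.2) := Prod.ext ha rfl
  have e'' : w.1 = (z.1.1 * s.s (z.1.2⁻¹ * z'.1.2), z.1.2 * (z.1.2⁻¹ * z'.1.2)) :=
    Prod.ext rfl e.symm
  rw [φ.2.1 a w z' e', φ'.2.1 a w z' e', φ.2.2 _ z w hk e'', φ'.2.2 _ z w hk e'', h]

instance (x : G ⧸ C) [Module.Finite ℂ Y] : Module.Finite ℂ (coinvariants χ s x Y) := by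
  by_cases hx : Nonempty (LiftOver S f C x)
  · obtain ⟨z⟩ := hx
    exact Module.Finite.of_injective
      ((LinearMap.proj z).comp (coinvariants χ s x Y).subtype) fun φ φ' h => ext_at z h
  -- A coset that does not meet `P` has no lifts, and its space of functions is zero.
  · have : Subsingleton (coinvariants χ s x Y) :=
      ⟨fun φ φ' => Subtype.ext (funext fun z => (hx ⟨z⟩).elim)⟩
    infer_instance

/-- Functoriality in `Y`. -/
def map (x : G ⧸ C) (l : Y →ₗ[ℂ] Y') : coinvariants χ s x Y →ₗ[ℂ] coinvariants χ s x Y' where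
  toFun φ := ⟨fun z => l (φ.1 z), fun a z z' e =>
    (congrArg l (φ.2.1 a z z' e)).trans (map_smul l ((χ a)⁻¹ : ℂˣ).1 (φ.1 z)),
    fun k z z' hk e => congrArg l (φ.2.2 k z z' hk e)⟩
  map_add' _ _ := Subtype.ext (funext fun _ => map_add l _ _)
  map_smul' _ _ := Subtype.ext (funext fun _ => map_smul l _ _)

/-- Identification at equal cosets. -/
def cast {x y : G ⧸ C} (h : x = y) : coinvariants χ s x Y →ₗ[ℂ] coinvariants χ s y Y where
  toFun φ := ⟨fun z => φ.1 ⟨z.1, z.2.1, z.2.2.trans h.symm⟩,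
    fun a _ _ e => φ.2.1 a _ _ e, fun k _ _ hk e => φ.2.2 k _ _ hk e⟩
  map_add' _ _ := rfl
  map_smul' _ _ := rfl

theorem mul_mem {p : P} {x y : G ⧸ C} (h : x = p • y) {e : E} (he : S.rightHom e = f p)
    (z : LiftOver S f C y) : S.rightHom (e * z.1.1) = f (p * z.1.2) ∧
      (QuotientGroup.mk ((p * z.1.2 : P) : G) : G ⧸ C) = x :=
  ⟨by rw [map_mul, map_mul, he, z.2.1], by
    refine Eq.trans ?_ h.symm
    exact congrArg (p • ·) z.2.2⟩

/-- Translation by an element of the pull-back. -/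
def translate (hS : ∀ a e, S.inl a * e = e * S.inl a) (p : P) {x y : G ⧸ C} (h : x = p • y)
    (e : E) (he : S.rightHom e = f p) : coinvariants χ s x Y →ₗ[ℂ] coinvariants χ s y Y where
  toFun φ := ⟨fun z => φ.1 ⟨(e * z.1.1, p * z.1.2), mul_mem h he z⟩,
    fun a z z' e' => φ.2.1 a ⟨_, mul_mem h he z⟩ ⟨_, mul_mem h he z'⟩ (Prod.ext (by
      change e * z'.1.1 = S.inl a * (e * z.1.1)
      rw [e', ← mul_assoc, ← mul_assoc, hS]) (congrArg (fun t : E × P => p * t.2) e' : _)),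
    fun k z z' hk e' => φ.2.2 k _ _ hk (Prod.ext
      ((congrArg (e * ·) (congrArg Prod.fst e')).trans (mul_assoc _ _ _).symm)
      ((congrArg (p * ·) (congrArg Prod.snd e')).trans (mul_assoc _ _ _).symm))⟩
  map_add' _ _ := rfl
  map_smul' _ _ := rfl

/-- The equivariant structure on the spaces of functions. -/
def toLine (hS : ∀ a e, S.inl a * e = e * S.inl a) (p : P) {x y : G ⧸ C} (h : x = p • y) :
    coinvariants χ s x Y →ₗ[ℂ] lineTensor S χ (f p) (coinvariants χ s y Y) where
  toFun φ := ⟨fun e => translate hS p h e.1 e.2 φ, fun a e e' h' => Subtype.ext <| funext fun z =>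
    φ.2.1 a _ _ (Prod.ext ((congrArg (· * z.1.1) h').trans (mul_assoc _ _ _)) rfl)⟩
  map_add' _ _ := rfl
  map_smul' _ _ := rfl

/-- For a fixed lift `e` of `p`, translation by the inverse of `e` undoes translation by `e`, and an
element of the line tensor is determined by its value at `e`. -/
theorem toLine_bijective (hS : ∀ a e, S.inl a * e = e * S.inl a) (p : P) {x y : G ⧸ C}
    (h : x = p • y) : Function.Bijective (toLine (χ := χ) (s := s) (Y := Y) hS p h) := by
  obtain ⟨⟨e, he⟩⟩ := lineTensor.nonempty S (f p)
  have he' : S.rightHom e⁻¹ = f p⁻¹ := by rw [map_inv, map_inv, he]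
  have h' : y = p⁻¹ • x := by rw [h, inv_smul_smul]
  refine ⟨fun φ φ' hφ => Subtype.ext (funext fun z => ?_), fun Φ => ?_⟩
  · have h1 := congrFun (congrArg Subtype.val (congrFun (congrArg Subtype.val hφ) ⟨e, he⟩))
      ⟨(e⁻¹ * z.1.1, p⁻¹ * z.1.2), mul_mem h' he' z⟩
    have hz : (⟨(e * (e⁻¹ * z.1.1), p * (p⁻¹ * z.1.2)), mul_mem h he
      ⟨(e⁻¹ * z.1.1, p⁻¹ * z.1.2), mul_mem h' he' z⟩⟩ : LiftOver S f C x) = z :=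
      Subtype.ext (Prod.ext (mul_inv_cancel_left _ _) (mul_inv_cancel_left _ _))
    exact (congrArg φ.1 hz.symm).trans (h1.trans (congrArg φ'.1 hz))
  · refine ⟨translate hS p⁻¹ h' e⁻¹ he' (Φ.1 ⟨e, he⟩), lineTensor.ext_at ⟨e, he⟩
      (Subtype.ext (funext fun z => ?_))⟩
    exact congrArg (Φ.1 ⟨e, he⟩).1
      (Subtype.ext (Prod.ext (inv_mul_cancel_left _ _) (inv_mul_cancel_left _ _)))

variable (χ s) in
/-- The point of the pull-back over the trivial coset. -/
def basePoint {x : G ⧸ C} (h : x = QuotientGroup.mk 1) : LiftOver S f C x :=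
  ⟨(1, 1), by rw [map_one, map_one], h.symm⟩

/-- Over the trivial coset every lift is uniquely an element of `A` times a value of the splitting,
so a function is obtained by letting only the factor in `A` act. Together with `ext_at`, evaluation
at the base point identifies this space with `Y`. -/
theorem exists_value (hS : ∀ a e, S.inl a * e = e * S.inl a) {x : G ⧸ C}
    (h : x = QuotientGroup.mk 1) (y : Y) :
    ∃ φ : coinvariants χ s x Y, φ.1 (basePoint h) = y := by
  have hC : ∀ z : LiftOver S f C x, (z.1.2 : G) ∈ C := fun z => by
    have := mem_of_mk_eq (k := 1) (h.symm.trans z.2.2.symm)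
    rwa [inv_one, one_mul] at this
  have key : ∀ z : LiftOver S f C x, ∃ a, z.1.1 = S.inl a * s.s z.1.2 := fun z =>
    lineTensor.exists_inl ((s.rightHom_s _ (hC z)).trans z.2.1.symm)
  choose c hc using key
  have hc' : ∀ z a, z.1.1 = S.inl a * s.s z.1.2 → c z = a := fun z a ha =>
    S.inl_injective (mul_right_cancel ((hc z).symm.trans ha))
  refine ⟨⟨fun z => ((χ (c z))⁻¹ : ℂˣ) • y, fun a z z' e => ?_, fun k z z' hk e => ?_⟩, ?_⟩
  · change ((χ (c z'))⁻¹ : ℂˣ) • y = ((χ a)⁻¹ : ℂˣ) • ((χ (c z))⁻¹ : ℂˣ) • y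
    rw [hc' z' (a * c z) (by rw [e, map_mul, mul_assoc, ← hc z]), map_mul, mul_inv, mul_smul]
  · change ((χ (c z'))⁻¹ : ℂˣ) • y = ((χ (c z))⁻¹ : ℂˣ) • y
    rw [hc' z' (c z) (by rw [e, s.s_mul _ _ (hC z) hk, ← mul_assoc, ← hc z])]
  · change ((χ (c _))⁻¹ : ℂˣ) • y = y
    rw [hc' _ 1 (by
      change (1 : E) = S.inl 1 * s.s 1
      rw [s.s_one, map_one, mul_one]), map_one, inv_one, one_smul]

end coinvariants

open coinvariants Fam

variable (χ) in
/-- The family of spaces of functions. -/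
def inducedFam (s : SplittingOn S f C) (Y : FGModuleCat.{u} ℂ) : Fam (G ⧸ C) (FGModuleCat.{u} ℂ) :=
  ⟨fun x => FGModuleCat.of ℂ (coinvariants χ s x Y)⟩

variable (χ) in
/-- Functoriality of the family of spaces of functions. -/
def inducedFamMap (s : SplittingOn S f C) {Y Y' : FGModuleCat.{u} ℂ} (l : Y ⟶ Y') (x : G ⧸ C) :
    (inducedFam χ s Y).fam x ⟶ (inducedFam χ s Y').fam x :=
  FGModuleCat.ofHom (coinvariants.map x l.hom.hom)

theorem inducedFam_tr (s : SplittingOn S f C) (Y : FGModuleCat.{u} ℂ) {x y : G ⧸ C} (h : x = y) :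
    tr (inducedFam χ s Y).fam h = FGModuleCat.ofHom (coinvariants.cast h) := by
  subst h; rfl

theorem inducedFam_eqToHom (s : SplittingOn S f C) (Y : FGModuleCat.{u} ℂ) {x y : G ⧸ C} (h : x = y)
    (e : (inducedFam χ s Y).fam x = (inducedFam χ s Y).fam y) :
    eqToHom e = FGModuleCat.ofHom (coinvariants.cast h) := inducedFam_tr s Y h

/-- The equivariant structure on the family of spaces of functions. -/
noncomputable def inducedEq (hS : ∀ a e, S.inl a * e = e * S.inl a) (χ : A →* ℂˣ)
    (s : SplittingOn S f C) (Y : FGModuleCat.{u} ℂ) :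
    EqFam ((lineAction S hS χ).comap f) C where
  obj := inducedFam χ s Y
  θ p := Fam.mkIso fun x => (LinearEquiv.ofBijective _ (toLine_bijective (χ := χ) (s := s)
    (Y := Y) hS p (smul_inv_smul p x).symm)).toFGModuleCatIso
  comm {g h l} e := Fam.hom_ext fun x => by
    have q : h⁻¹ • g⁻¹ • x = l⁻¹ • x := by rw [← e, mul_inv_rev, mul_smul]
    have hx : x = l • h⁻¹ • g⁻¹ • x := by rw [q, smul_inv_smul]
    have ef : f g * f h = f l := by rw [← map_mul, e]
    refine FGModuleCat.hom_ext (LinearMap.ext fun φ => ?_)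
    -- Evaluated on lifts, both sides are `φ` at a triple product, so the cocycle condition is
    -- associativity in the pull-back; the indices of the cosets are adjusted afterwards by `h2`.
    have h1 : lineTensor.mulEquiv hS ef _ (lineTensor.map (f g)
        (toLine (χ := χ) (s := s) (Y := Y) hS h (smul_inv_smul h (g⁻¹ • x)).symm)
        (toLine hS g (smul_inv_smul g x).symm φ)) = toLine hS l hx φ := by
      rw [lineTensor.mulEquiv_eq_iff]
      refine Subtype.ext (funext fun a => Subtype.ext (funext fun b => Subtype.ext (funext fun z => ?_)))
      exact congrArg φ.1 (Subtype.ext (Prod.ext (mul_assoc _ _ _).symm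
        ((mul_assoc _ _ _).symm.trans (congrArg (· * z.1.2) e))))
    have h2 := inducedFam_tr (χ := χ) s Y q
    change lineTensor.map (f l) (tr (inducedFam χ s Y).fam q).hom.hom (lineTensor.mulEquiv hS ef _
      (lineTensor.map (f g)
        (toLine (χ := χ) (s := s) (Y := Y) hS h (smul_inv_smul h (g⁻¹ • x)).symm)
        (toLine hS g (smul_inv_smul g x).symm φ))) = toLine hS l (smul_inv_smul l x).symm φ
    refine (congrArg (lineTensor.map (f l) (tr (inducedFam χ s Y).fam q).hom.hom) h1).trans ?_
    exact (congrArg (fun t => lineTensor.map (f l) t.hom.hom (toLine hS l hx φ)) h2)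

variable (hS : ∀ a e, S.inl a * e = e * S.inl a) (χ) (F : SubgroupFiltration G)
  (s : SplittingOn S f (F.C 0))

/-- The object of the induced category defined by a vector space and a splitting of the extension
over the largest subgroup of the filtration. -/
noncomputable def inducedObj (Y : FGModuleCat.{u} ℂ) : Ind F ((lineAction S hS χ).comap f) :=
  ⟨0, inducedEq hS χ s Y⟩

variable {F s}

/-- The components of a morphism as linear maps. -/
noncomputable def inducedApp {Y Y' : FGModuleCat.{u} ℂ}
    (X : inducedObj χ hS F s Y ⟶ inducedObj χ hS F s Y') (g : G) :
    coinvariants χ s (QuotientGroup.mk g) Y →ₗ[ℂ] coinvariants χ s (QuotientGroup.mk g) Y' :=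
  (Ind.app X g).hom.hom

variable {hS χ}

theorem inducedApp_ext {Y Y' : FGModuleCat.{u} ℂ}
    {X X' : inducedObj χ hS F s Y ⟶ inducedObj χ hS F s Y'}
    (h : ∀ g φ, inducedApp χ hS X g φ = inducedApp χ hS X' g φ) : X = X' :=
  Ind.hom_ext fun g => FGModuleCat.hom_ext (LinearMap.ext (h g))

/-- This is compatibility of a morphism with the action of `p`, read off at one chosen lift `e` of
`p`. It is the tool that moves components from one coset to another. -/
theorem inducedApp_toLine {Y Y' : FGModuleCat.{u} ℂ}
    (X : inducedObj χ hS F s Y ⟶ inducedObj χ hS F s Y') (p : P) (g : G)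
    (φ : coinvariants χ s (QuotientGroup.mk g) Y) (e : E) (he : S.rightHom e = f p) :
    inducedApp χ hS X ((p : G)⁻¹ * g)
        (translate (y := QuotientGroup.mk ((p : G)⁻¹ * g)) hS p
          (smul_inv_smul p (QuotientGroup.mk g)).symm e he φ) =
      translate hS p (smul_inv_smul p (QuotientGroup.mk g)).symm e he (inducedApp χ hS X g φ) := by
  have h := Ind.app_th X p g
  have h' := congrArg (fun t => t.hom.hom φ) h
  exact congrFun (congrArg Subtype.val h') ⟨e, he⟩

/-- Composing functions with `l` affects only their values, not their arguments, so compatibility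
with cosets and with `P` holds by definition once the identifications of objects are written as
reindexing maps. -/
theorem exists_inducedMap {Y Y' : FGModuleCat.{u} ℂ} (l : Y ⟶ Y') :
    ∃ X : inducedObj χ hS F s Y ⟶ inducedObj χ hS F s Y', ∀ g,
      inducedApp χ hS X g = coinvariants.map _ l.hom.hom := by
  obtain ⟨X, hX⟩ := Ind.exists_hom_app (E := inducedObj χ hS F s Y) (D := inducedObj χ hS F s Y')
    (fun g => inducedFamMap χ s l (QuotientGroup.mk g))
    0 le_rfl le_rfl
    (fun g u hu => by
      have q : (QuotientGroup.mk (g * u) : G ⧸ F.C 0) = QuotientGroup.mk g :=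
        QuotientGroup.mk_mul_of_mem g hu
      have h1 := inducedFam_eqToHom (χ := χ) s Y q (congrArg _ q)
      have h2 := inducedFam_eqToHom (χ := χ) s Y' q.symm (congrArg _ q.symm)
      refine Eq.trans ?_ (congrArg₂ (fun a b => a ≫ inducedFamMap χ s l (QuotientGroup.mk g) ≫ b) h1 h2).symm
      rfl)
    (fun p g => rfl)
  exact ⟨X, fun g => congrArg (fun t => t.hom.hom) (hX g)⟩

theorem inducedApp_id (Y : FGModuleCat.{u} ℂ) (g : G) (φ : coinvariants χ s (QuotientGroup.mk g) Y) :
    inducedApp χ hS (𝟙 (inducedObj χ hS F s Y)) g φ = φ :=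
  congrArg (fun t => t.hom.hom φ) (Ind.id_app (inducedObj χ hS F s Y) g)

theorem inducedApp_comp {Y Y' Y'' : FGModuleCat.{u} ℂ}
    (X : inducedObj χ hS F s Y ⟶ inducedObj χ hS F s Y')
    (X' : inducedObj χ hS F s Y' ⟶ inducedObj χ hS F s Y'') (g : G)
    (φ : coinvariants χ s (QuotientGroup.mk g) Y) :
    inducedApp χ hS (X ≫ X') g φ = inducedApp χ hS X' g (inducedApp χ hS X g φ) :=
  congrArg (fun t => t.hom.hom φ) (Ind.comp_app X X' g)

theorem inducedApp_add {Y Y' : FGModuleCat.{u} ℂ}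
    (X X' : inducedObj χ hS F s Y ⟶ inducedObj χ hS F s Y') (g : G)
    (φ : coinvariants χ s (QuotientGroup.mk g) Y) :
    inducedApp χ hS (X + X') g φ = inducedApp χ hS X g φ + inducedApp χ hS X' g φ :=
  congrArg (fun t => t.hom.hom φ) (Ind.add_app X X' g)

theorem inducedApp_smul {Y Y' : FGModuleCat.{u} ℂ} (c : ℂ)
    (X : inducedObj χ hS F s Y ⟶ inducedObj χ hS F s Y') (g : G)
    (φ : coinvariants χ s (QuotientGroup.mk g) Y) :
    inducedApp χ hS (c • X) g φ = c • inducedApp χ hS X g φ :=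
  congrArg (fun t => t.hom.hom φ) (Ind.smul_app c X g)

variable (hS χ F s) in
/-- The functor from vector spaces to the induced category defined by a splitting. -/
noncomputable def inducedFunctor : FGModuleCat.{u} ℂ ⥤ Ind F ((lineAction S hS χ).comap f) where
  obj := inducedObj χ hS F s
  map l := (exists_inducedMap l).choose
  map_id Y := inducedApp_ext fun g φ => by
    rw [(exists_inducedMap _).choose_spec, inducedApp_id]; rfl
  map_comp l l' := inducedApp_ext fun g φ => by
    rw [(exists_inducedMap _).choose_spec, inducedApp_comp, (exists_inducedMap _).choose_spec,
      (exists_inducedMap _).choose_spec]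
    rfl

theorem inducedFunctor_app {Y Y' : FGModuleCat.{u} ℂ} (l : Y ⟶ Y') (g : G) :
    inducedApp χ hS ((inducedFunctor χ hS F s).map l) g = coinvariants.map _ l.hom.hom :=
  (exists_inducedMap l).choose_spec g

instance : (inducedFunctor χ hS F s).Additive := ⟨fun {_ _ l l'} => inducedApp_ext fun g φ => by
  have h := inducedApp_add ((inducedFunctor χ hS F s).map l) ((inducedFunctor χ hS F s).map l') g φ
  rw [inducedFunctor_app, inducedFunctor_app] at h
  rw [inducedFunctor_app]
  exact Eq.trans rfl h.symm⟩

instance : (inducedFunctor χ hS F s).Linear ℂ := ⟨fun {_ _} l c => inducedApp_ext fun g φ => by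
  have h := inducedApp_smul c ((inducedFunctor χ hS F s).map l) g φ
  rw [inducedFunctor_app] at h
  rw [inducedFunctor_app]
  exact Eq.trans rfl h.symm⟩

/-- Functions over the trivial coset take every value at the base point, so the component at 1
recovers the linear map. -/
instance : (inducedFunctor χ hS F s).Faithful := ⟨fun {Y Y' l l'} h => by
  refine FGModuleCat.hom_ext (LinearMap.ext fun y => ?_)
  obtain ⟨φ, hφ⟩ := exists_value (χ := χ) (s := s) hS rfl y
  have h1 := congrArg (fun X => (inducedApp χ hS X 1 φ).1 (basePoint rfl)) h
  simp only [inducedFunctor_app] at h1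
  have h2 : l.hom.hom (φ.1 (basePoint rfl)) = l'.hom.hom (φ.1 (basePoint rfl)) := h1
  rwa [hφ] at h2⟩

theorem inducedApp_congr {Y Y' : FGModuleCat.{u} ℂ}
    (X : inducedObj χ hS F s Y ⟶ inducedObj χ hS F s Y') {g g' : G} (h : g = g')
    (φ : coinvariants χ s (QuotientGroup.mk g) Y) :
    inducedApp χ hS X g φ = coinvariants.cast (congrArg _ h.symm)
      (inducedApp χ hS X g' (coinvariants.cast (congrArg _ h) φ)) := by
  subst h; rfl

/-- A morphism which is invariant under right translations by the largest group of the
filtration comes from a linear map. -/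
theorem exists_map_eq {Y Y' : FGModuleCat.{u} ℂ}
    (X : inducedObj χ hS F s Y ⟶ inducedObj χ hS F s Y')
    (hX : ∀ u (hu : (QuotientGroup.mk 1 : G ⧸ F.C 0) = QuotientGroup.mk u)
      (φ : coinvariants χ s (QuotientGroup.mk 1) Y),
      (inducedApp χ hS X u (coinvariants.cast hu φ)).1 (basePoint hu.symm) =
        (inducedApp χ hS X 1 φ).1 (basePoint rfl)) :
    ∃ l : Y ⟶ Y', (inducedFunctor χ hS F s).map l = X := by
  let v : coinvariants χ s (QuotientGroup.mk 1) Y →ₗ[ℂ] Y :=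
    (LinearMap.proj (basePoint rfl)).comp (coinvariants χ s _ Y).subtype
  let V : coinvariants χ s (QuotientGroup.mk 1) Y ≃ₗ[ℂ] Y := LinearEquiv.ofBijective v
    ⟨fun φ φ' h => ext_at _ h, fun y => exists_value hS rfl y⟩
  let v' : coinvariants χ s (QuotientGroup.mk 1) Y' →ₗ[ℂ] Y' :=
    (LinearMap.proj (basePoint rfl)).comp (coinvariants χ s _ Y').subtype
  -- The linear map is the component of `X` at 1, with source and target identified with `Y` and
  -- `Y'` by evaluation at the base point.
  refine ⟨FGModuleCat.ofHom (v' ∘ₗ inducedApp χ hS X 1 ∘ₗ V.symm.toLinearMap),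
    inducedApp_ext fun g φ => ?_⟩
  rw [inducedFunctor_app]
  refine Subtype.ext (funext fun z => ?_)
  -- A lift `z` over the coset of `g` translates that coset to the trivial one, but its
  -- representative becomes some element `u` of the largest group of the filtration instead of 1;
  -- the hypothesis `hX` compares the components at `u` and at 1.
  have hz : (QuotientGroup.mk 1 : G ⧸ F.C 0) = QuotientGroup.mk ((z.1.2 : G)⁻¹ * g) := by
    refine QuotientGroup.eq.2 ?_
    rw [inv_one, one_mul]
    exact QuotientGroup.eq.1 z.2.2
  have h1 := inducedApp_toLine X z.1.2 g φ z.1.1 z.2.1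
  have h2 := congrArg (fun t => t.1 (basePoint hz.symm)) h1
  let ψ := translate (y := QuotientGroup.mk ((z.1.2 : G)⁻¹ * g)) hS z.1.2
          (smul_inv_smul z.1.2 (QuotientGroup.mk g)).symm z.1.1 z.2.1 φ
  have h3 := hX _ hz (coinvariants.cast hz.symm ψ)
  have h4 : coinvariants.cast hz (coinvariants.cast hz.symm ψ) = ψ := rfl
  rw [h4] at h3
  have h5 : V.symm (φ.1 z) = coinvariants.cast hz.symm ψ := by
    rw [LinearEquiv.symm_apply_eq]
    exact congrArg φ.1 (Subtype.ext (Prod.ext (mul_one _).symm (mul_one _).symm))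
  have h6 : (coinvariants.map (QuotientGroup.mk g) (v' ∘ₗ inducedApp χ hS X 1 ∘ₗ V.symm.toLinearMap)
      φ).1 z = (inducedApp χ hS X 1 (V.symm (φ.1 z))).1 (basePoint rfl) := rfl
  refine h6.trans ?_
  rw [h5]
  refine h3.symm.trans (h2.trans ?_)
  exact congrArg (inducedApp χ hS X g φ).1 (Subtype.ext (Prod.ext (mul_one _) (mul_one _)))

/-- If the group acting is the whole group then the functor is full. -/
theorem inducedFunctor_full (hP : P = ⊤) : (inducedFunctor χ hS F s).Full :=
  ⟨fun {Y Y'} X => exists_map_eq X fun u hu φ => by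
    -- Since `P` is everything, `u` itself acts from the left, with the lift given by the splitting.
    -- Equivariance of `X` under `u` and right invariance of the functions under the splitting give
    -- the required independence of `u`.
    let p : P := ⟨u, hP ▸ Subgroup.mem_top u⟩
    have hp : (p : G) ∈ F.C 0 := by
      have := QuotientGroup.eq.1 hu
      rwa [inv_one, one_mul] at this
    have he := s.rightHom_s p hp
    have h1 := inducedApp_toLine X p u (coinvariants.cast hu φ) (s.s p) he
    have e : (p : G)⁻¹ * u = 1 := inv_mul_cancel u
    rw [inducedApp_congr X e] at h1
    have q : (QuotientGroup.mk ((p : G)⁻¹ * u) : G ⧸ F.C 0) = QuotientGroup.mk 1 := congrArg _ e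
    have h2 := congrArg (fun t => t.1 (basePoint q)) h1
    have h3 : coinvariants.cast q (translate (y := QuotientGroup.mk ((p : G)⁻¹ * u)) hS p
          (smul_inv_smul p (QuotientGroup.mk u)).symm (s.s p) he (coinvariants.cast hu φ)) = φ :=
      ext_at (basePoint rfl) (φ.2.2 p (basePoint rfl) _ hp
        (Prod.ext ((mul_one _).trans (one_mul _).symm) ((mul_one _).trans (one_mul _).symm)))
    have h4 : (inducedApp χ hS X 1 φ).1 (basePoint rfl) = _ :=
      (congrArg (fun t => (inducedApp χ hS X 1 t).1 (basePoint rfl)) h3).symm.trans h2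
    refine Eq.symm (h4.trans ?_)
    exact (inducedApp χ hS X u (coinvariants.cast hu φ)).2.2 p (basePoint hu.symm) _ hp
      (Prod.ext ((mul_one _).trans (one_mul _).symm) ((mul_one _).trans (one_mul _).symm))⟩

end InducedObject

end TwoDim

/-! ### The full subcategory of equivariant induced objects. -/

namespace TwoDim

/-- A fully faithful functor is an equivalence onto its essential image; the inverse of an additive
linear equivalence is additive and linear. -/
theorem containsVect_of_functor {k : Type w} [Field k] {C : Type u} [Category.{v} C] [Preadditive C]
    [Linear k C] (T : FGModuleCat.{w} k ⥤ C) [T.Full] [T.Faithful] [T.Additive] [T.Linear k] :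
    ContainsVect k C := by
  let e := T.toEssImage.asEquivalence
  have h1 : e.functor.Additive := ⟨fun {_ _ f g} => ObjectProperty.hom_ext _ (T.map_add (f := f) (g := g))⟩
  have h2 : e.functor.Linear k := ⟨fun f c => ObjectProperty.hom_ext _ (Functor.Linear.map_smul (F := T) f c)⟩
  exact ⟨T.essImage, e.symm, e.inverse_additive, e.inverseLinear k⟩

section InducedObject

open coinvariants Fam

variable {A : Type v} {E Q G : Type u} [CommGroup A] [Group E] [Group Q] [Group G]
  {S : GroupExtension A E Q} {P : Subgroup G} {f : P →* Q}
  (χ : A →* ℂˣ) (hS : ∀ a e, S.inl a * e = e * S.inl a) (F : SubgroupFiltration G)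
  (s : SplittingOn S f (F.C 0))

/-- The components depend on a point only through its coset, which by `Ind.fixed_hom_iff` is
equivariance for the canonical structures. -/
theorem inducedFunctor_mem {Y Y' : FGModuleCat.{u} ℂ} (l : Y ⟶ Y') :
    (inducedFunctor χ hS F s).map l ∈
      ((inducedObj χ hS F s Y).fixed (m := 0) le_rfl).homSubmodule
        ((inducedObj χ hS F s Y').fixed (m := 0) le_rfl) := by
  refine (Ind.fixed_hom_iff (E := inducedObj χ hS F s Y) (D := inducedObj χ hS F s Y') (m := 0)
      le_rfl le_rfl _).2 fun g u hu => ?_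
  have q : (QuotientGroup.mk (g * u) : G ⧸ F.C 0) = QuotientGroup.mk g :=
    QuotientGroup.mk_mul_of_mem g hu
  have h1 := inducedFam_eqToHom (χ := χ) s Y q (congrArg _ q)
  have h2 := inducedFam_eqToHom (χ := χ) s Y' q.symm (congrArg _ q.symm)
  have h0 : ∀ g, Ind.app ((inducedFunctor χ hS F s).map l) g = inducedFamMap χ s l (QuotientGroup.mk g) :=
    fun g => FGModuleCat.hom_ext (inducedFunctor_app l g)
  refine (h0 _).trans (Eq.trans ?_ (congrArg (fun t => _ ≫ t ≫ _) (h0 g)).symm)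
  refine Eq.trans ?_ (congrArg₂ (fun a b => a ≫ inducedFamMap χ s l (QuotientGroup.mk g) ≫ b) h1 h2).symm
  rfl

/-- The functor from vector spaces to the objects which are equivariant under the largest group
of the filtration. -/
noncomputable def inducedFixedFunctor : FGModuleCat.{u} ℂ ⥤
    ((Ind.σ F ((lineAction S hS χ).comap f)).comap (F.C 0).subtype).Equivariant where
  obj Y := (inducedObj χ hS F s Y).fixed (m := 0) le_rfl
  map l := ⟨(inducedFunctor χ hS F s).map l, inducedFunctor_mem χ hS F s l⟩
  map_id Y := Subtype.ext ((inducedFunctor χ hS F s).map_id Y)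
  map_comp l l' := Subtype.ext ((inducedFunctor χ hS F s).map_comp l l')

instance : (inducedFixedFunctor χ hS F s).Additive :=
  ⟨fun {_ _ _ _} => Subtype.ext ((inducedFunctor χ hS F s).map_add)⟩

instance : (inducedFixedFunctor χ hS F s).Linear ℂ :=
  ⟨fun l c => Subtype.ext (Functor.Linear.map_smul (F := inducedFunctor χ hS F s) l c)⟩

instance : (inducedFixedFunctor χ hS F s).Faithful :=
  ⟨fun h => (inducedFunctor χ hS F s).map_injective (congrArg Subtype.val h)⟩

/-- Equivariance under the largest group of the filtration is exactly the invariance assumed in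
`exists_map_eq`, here at the point 1. -/
instance : (inducedFixedFunctor χ hS F s).Full := ⟨fun {Y Y'} X => by
  obtain ⟨l, hl⟩ := exists_map_eq (χ := χ) (hS := hS) (s := s) X.1 fun u hu φ => by
    have hu' : u ∈ F.C 0 := by
      have := QuotientGroup.eq.1 hu
      rwa [inv_one, one_mul] at this
    have h := (Ind.fixed_hom_iff (E := inducedObj χ hS F s Y) (D := inducedObj χ hS F s Y') (m := 0)
      le_rfl le_rfl X.1).1 X.2 1 u hu'
    have q : (QuotientGroup.mk (1 * u) : G ⧸ F.C 0) = QuotientGroup.mk 1 :=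
      QuotientGroup.mk_mul_of_mem 1 hu'
    have h1 := inducedFam_eqToHom (χ := χ) s Y q (congrArg _ q)
    have h2 := inducedFam_eqToHom (χ := χ) s Y' q.symm (congrArg _ q.symm)
    have h3 := h.trans (congrArg₂ (fun a b => a ≫ Ind.app X.1 1 ≫ b) h1 h2)
    have q' : (QuotientGroup.mk 1 : G ⧸ F.C 0) = QuotientGroup.mk (1 * u) := q.symm
    have h4 : inducedApp χ hS X.1 (1 * u) (coinvariants.cast q' φ) =
      coinvariants.cast q' (inducedApp χ hS X.1 1 φ) :=
      congrArg (fun t => t.hom.hom (coinvariants.cast q' φ)) h3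
    rw [inducedApp_congr X.1 (one_mul u).symm]
    exact congrArg (fun t => t.1 (basePoint q)) h4
  exact ⟨l, Subtype.ext hl⟩⟩

theorem containsVect_of_splitting (hs : Nonempty (SplittingOn S f (F.C 0))) : ContainsVect ℂ
    ((Ind.σ F ((lineAction S hS χ).comap f)).comap (F.C 0).subtype).Equivariant := by
  obtain ⟨s⟩ := hs
  -- The vector spaces in `ContainsVect` live in the universe of ℂ, the induced objects in that of
  -- the group; the universe lift mediates between them.
  have h1 : (FGModuleCat.ulift.{0,u,0} ℂ).Additive := ⟨rfl⟩
  have h2 : (FGModuleCat.ulift.{0,u,0} ℂ).Linear ℂ := ⟨fun _ _ => rfl⟩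
  have h3 : (FGModuleCat.ulift.{0,u,0} ℂ ⋙ inducedFixedFunctor χ hS F s).Linear ℂ := inferInstance
  exact containsVect_of_functor (FGModuleCat.ulift.{0,u,0} ℂ ⋙ inducedFixedFunctor χ hS F s)

end InducedObject

end TwoDim

namespace TwoDim

/-! ### The extension defined by torsors splits over the stabilizer of the base lattice. -/

namespace TorsorSystem

variable {A : Type v} {Γ : Type u} {L : Type w} [CommGroup A] [Group Γ] [PartialOrder L]
  [MulAction Γ L] {T : TorsorSystem.{w, v, u, v'} A Γ L}

/-- Both lower bounds may be replaced by a common smaller one: the additional factor occurs in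
numerator and denominator and cancels. -/
theorem ratio_div_ratio (s' s : T.Triv) {N N' Λ Λ' : L} (h : N ≤ Λ) (h' : N ≤ Λ') (k : N' ≤ Λ)
    (k' : N' ≤ Λ') : ratio s' s h / ratio s' s h' = ratio s' s k / ratio s' s k' := by
  obtain ⟨M, hM, hM'⟩ := T.directed N N'
  rw [← mul_div_mul_left_eq_div _ _ (ratio s' s hM), ratio_mul, ratio_mul,
    ← mul_div_mul_left_eq_div (ratio s' s k) _ (ratio s' s hM'), ratio_mul, ratio_mul]

/-- By `ratio_div_ratio` the condition that defines the extension does not depend on the auxiliary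
lattice, so one lattice for each pair of trivializations is enough. -/
theorem mem_ext_of_exists {L₀ : L} {x : T.Pairs}
    (hx : ∀ s s' : T.Triv, ∃ (N : L) (h : N ≤ L₀) (h' : N ≤ x.right • L₀),
      x.left s * ratio s' s h = x.left s' * ratio s' s h') : x ∈ T.ext L₀ := fun s s' N h h' => by
  obtain ⟨M, k, k', e⟩ := hx s s'
  have e2 := ratio_div_ratio s' s h h' k k'
  rw [div_eq_div_iff_mul_eq_mul] at e2
  rw [← mul_left_inj (ratio s' s k'), mul_assoc, e2, mul_right_comm, ← mul_assoc, e]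

theorem ratio_trans (s'' s' s : T.Triv) {N Λ : L} (h : N ≤ Λ) :
    ratio s'' s' h * ratio s' s h = ratio s'' s h := by
  refine (ratio_eq ?_).symm
  rw [mul_smul, ratio_spec, ratio_spec]

variable (T) in
-- The function β is the coordinate, with respect to varying trivializations, of an element of the
-- torsor attached to the pair `L₀`, `Λ`. It transports splittings over the stabilizer of `Λ` to the
-- extension based at `L₀`.
theorem exists_baseChange (L₀ Λ : L) : ∃ β : T.Triv → A, ∀ (s s' : T.Triv) (N : L) (h : N ≤ L₀)
    (h' : N ≤ Λ), β s * ratio s' s h = β s' * ratio s' s h' := by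
  obtain ⟨M, k, k'⟩ := T.directed L₀ Λ
  have : Nonempty L := ⟨L₀⟩
  obtain ⟨s₀⟩ := T.nonempty_triv
  refine ⟨fun s => ratio s s₀ k / ratio s s₀ k', fun s s' N h h' => ?_⟩
  have e2 := ratio_div_ratio s' s h h' k k'
  change ratio s s₀ k / ratio s s₀ k' * _ = ratio s' s₀ k / ratio s' s₀ k' * _
  rw [← ratio_trans s' s s₀ k, ← ratio_trans s' s s₀ k', mul_div_mul_comm, ← e2, mul_right_comm,
    div_mul_cancel, mul_comm]

/-- If `g` fixes the base lattice, both ratios in the defining condition agree and the constant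
coordinate 1 is admissible. -/
theorem inr_mem_ext {L₀ : L} {g : Γ} (hg : g • L₀ = L₀) :
    (SemidirectProduct.inr g : T.Pairs) ∈ T.ext L₀ := fun s s' N h h' => by
  rw [ratio_congr s' s h h' rfl hg.symm]
  rfl

/-- The splitting of the extension over the stabilizer of the base point. -/
def stabHom (T : TorsorSystem.{w, v, u, v'} A Γ L) (L₀ : L) :
    MulAction.stabilizer Γ L₀ →* T.ext L₀ :=
  ((SemidirectProduct.inr : Γ →* T.Pairs).comp (Subgroup.subtype _)).codRestrict _
    fun g => inr_mem_ext g.2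

/-- On coordinates, the claim is that the coordinate of `e` takes the same value at `s` and at its
translate by the inverse of `u`. The defining condition for `e` gives this as soon as that
translation changes neither of the two measures involved, which is what `h1` and `h2` say. -/
theorem conj_stabHom {L₀ : L} (e : T.ext L₀) (u v : MulAction.stabilizer Γ L₀)
    (huv : T.extHom L₀ e * v * (T.extHom L₀ e)⁻¹ = u) {N : L} (h : N ≤ L₀)
    (h' : N ≤ T.extHom L₀ e • L₀) (h1 : ∀ s : T.Triv, ratio ((u : Γ)⁻¹ • s) s h = 1)
    (h2 : ∀ s : T.Triv, ratio ((u : Γ)⁻¹ • s) s h' = 1) :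
    e * T.stabHom L₀ v * e⁻¹ = T.stabHom L₀ u := by
  rw [mul_inv_eq_iff_eq_mul]
  refine Subtype.ext (SemidirectProduct.ext (funext fun s => ?_) ?_)
  · have e1 := e.2 s ((u : Γ)⁻¹ • s) N h h'
    have e2 := h2 s
    change ratio _ _ (Λ := e.1.right • L₀) h' = 1 at e2
    rw [h1, e2, mul_one, mul_one] at e1
    change e.1.left s * 1 = 1 * e.1.left ((u : Γ)⁻¹ • s)
    rw [mul_one, one_mul, e1]
  · exact mul_inv_eq_iff_eq_mul.1 huv

end TorsorSystem

/-! ### Automorphisms acting trivially on a quotient of lattices. -/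

namespace LatticeSystem

open LQuot TorsorSystem

variable {V : Type v} [AddCommGroup V] [TopologicalSpace V] [IsTopologicalAddGroup V]
  {Γ : Type u} [Group Γ] (D : LatticeSystem Γ V)

/-- Points move only by elements of `N`, so no point leaves an intermediate lattice; the inverse of
`u` gives the opposite inclusion. -/
theorem smul_eq_of_forall {u : Γ} {N Λ Λ' : D.Lat} (hN : N ≤ Λ') (hΛ : Λ' ≤ Λ)
    (h : ∀ x ∈ Λ.1, D.ρ u x - x ∈ N.1) (h' : ∀ x ∈ Λ.1, D.ρ u⁻¹ x - x ∈ N.1) : u • Λ' = Λ' := by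
  have key : ∀ {u : Γ}, (∀ x ∈ Λ.1, D.ρ u x - x ∈ N.1) → u • Λ' ≤ Λ' := by
    rintro u h _ ⟨x, hx, rfl⟩
    have := Λ'.1.add_mem (hN (h x (hΛ hx))) hx
    rwa [sub_add_cancel] at this
  refine le_antisymm (key h) ?_
  have := D.torsors.smul_le u (key h')
  rwa [smul_inv_smul] at this

/-- The map induced by `u` on the quotient is the identity, so it does not change any measure. -/
theorem ratio_smul_eq_one {u : Γ} {N Λ : D.Lat} (hN : N ≤ Λ)
    (h : ∀ x ∈ Λ.1, D.ρ u x - x ∈ N.1) (h' : ∀ x ∈ Λ.1, D.ρ u⁻¹ x - x ∈ N.1) (s : D.torsors.Triv) :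
    ratio (u • s) s hN = 1 := by
  refine ratio_eq ((one_smul _ _).trans ?_)
  have e1 : u • N = N := D.smul_eq_of_forall le_rfl hN h h'
  have e2 : u • Λ = Λ := D.smul_eq_of_forall hN le_rfl h h'
  have e3 := s.map_congr u (D.torsors.smul_le u⁻¹ hN) hN hN (smul_inv_smul _ _) (smul_inv_smul _ _) e1 e2
  refine Eq.trans ?_ e3.symm
  refine HaarMeas.ext ?_
  have : (D.equiv u e1 e2 : LQuot N.1 Λ.1 → LQuot N.1 Λ.1) = id := funext fun y => by
    obtain ⟨y, rfl⟩ := mk_surjective _ _ y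
    rw [equiv_mk]
    exact (LQuot.mk_eq _ _).2 (h y y.2)
  change _ = MeasureTheory.Measure.map (D.equiv u e1 e2) _
  rw [this, MeasureTheory.Measure.map_id]

end LatticeSystem

/-! ### Transfer of splittings to the semidirect product with the multiplicative group. -/

section HatSection

variable {K : Type u} [Field K] {A : Type v} [CommGroup A] {E : Type w} [Group E]
  (θ : E →* GL (Fin 2) K) (hθ : Function.Surjective θ) (inl : A →* E)
  (hinl : Function.Injective inl) (hrange : inl.range = θ.ker)
  (hcomm : ∀ a x, inl a * x = x * inl a)

/-- Two lifts differ by a central element, which disappears in a conjugation. -/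
theorem conj_eq_of_map_eq (θ : E →* GL (Fin 2) K) (inl : A →* E) (hrange : inl.range = θ.ker)
    (hcomm : ∀ a x, inl a * x = x * inl a) {e e' : E} (h : θ e = θ e') (x : E) : e * x * e⁻¹ = e' * x * e'⁻¹ := by
  obtain ⟨a, ha⟩ : e * e'⁻¹ ∈ inl.range := by
    rw [hrange, MonoidHom.mem_ker, map_mul, map_inv, h, mul_inv_cancel]
  rw [eq_mul_inv_iff_mul_eq] at ha
  rw [← ha]
  calc _ = inl a * (e' * x * e'⁻¹) * (inl a)⁻¹ := by group
    _ = _ := by rw [hcomm, mul_inv_cancel_right]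

/-- The action was defined with chosen lifts; this allows any convenient lift to be used, in
particular one from a splitting. -/
theorem HatData.ofExtension_φ {u : Kˣ} {e : E} (he : θ e = corner u)
    (t : (Matrix.GeneralLinearGroup.det.comp θ).ker) :
    ((HatData.ofExtension θ hθ inl hinl hrange hcomm).φ u t).1 = e * t.1 * e⁻¹ :=
  conj_eq_of_map_eq θ inl hrange hcomm ((Function.surjInv_eq hθ _).trans he.symm) _

variable {H : Subgroup (GL (Fin 2) K)} (j : H →* E) (hj : ∀ h, θ (j h) = h)
  (hc : ∀ h ∈ H, corner (Matrix.GeneralLinearGroup.det h) ∈ H)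

/-- A splitting of the extension `E` over a subgroup defines a splitting of `T ⋊ Kˣ`. -/
noncomputable def HatData.splitHom :
    H →* ((Matrix.GeneralLinearGroup.det.comp θ).ker ⋊[(HatData.ofExtension θ hθ inl hinl hrange hcomm).φ] Kˣ) :=
  -- An element h is the product of a matrix of determinant 1 and diag(det h, 1). The first factor
  -- is lifted by `j`, the second is recorded as an element of the multiplicative group.
  MonoidHom.mk' (fun h => ⟨⟨j h * (j ⟨_, hc h h.2⟩)⁻¹, by
    rw [MonoidHom.mem_ker, map_mul, map_inv, MonoidHom.comp_apply, MonoidHom.comp_apply, hj, hj,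
      det_corner, mul_inv_cancel]⟩, Matrix.GeneralLinearGroup.det h.1⟩) fun h h' => by
    have h1 : (⟨_, hc (h * h').1 (h * h').2⟩ : H) = ⟨_, hc h h.2⟩ * ⟨_, hc h' h'.2⟩ :=
      Subtype.ext ((congrArg corner (map_mul _ h.1 h'.1)).trans (map_mul _ _ _))
    refine SemidirectProduct.ext (Subtype.ext ?_) (map_mul _ _ _)
    change _ = j h * (j ⟨_, hc h h.2⟩)⁻¹ * ((HatData.ofExtension θ hθ inl hinl hrange hcomm).φ _ _).1
    rw [HatData.ofExtension_φ θ hθ inl hinl hrange hcomm (hj ⟨_, hc h h.2⟩)]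
    change j (h * h') * (j ⟨_, hc (h * h').1 (h * h').2⟩)⁻¹ = _
    rw [h1, map_mul, map_mul]
    change _ = j h * (j ⟨_, hc h h.2⟩)⁻¹ *
      (j ⟨_, hc h h.2⟩ * (j h' * (j ⟨_, hc h' h'.2⟩)⁻¹) * (j ⟨_, hc h h.2⟩)⁻¹)
    group

theorem HatData.π_splitHom (h : H) : (HatData.ofExtension θ hθ inl hinl hrange hcomm).π
    (HatData.splitHom θ hθ inl hinl hrange hcomm j hj hc h) = h := by
  change θ (j h * (j ⟨_, hc h h.2⟩)⁻¹) * corner (Matrix.GeneralLinearGroup.det h.1) = h.1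
  rw [map_mul, map_inv, hj, hj, inv_mul_cancel_right]

/-- The element `x` behaves like `x.left.1 * e` in `E`. Conjugation preserves determinants, so `h`
and `h'` have the same corner part; by `h2` its lift commutes with `e`, and the rest is a
calculation in `E`. -/
theorem HatData.conj_splitHom (x : (Matrix.GeneralLinearGroup.det.comp θ).ker ⋊[
    (HatData.ofExtension θ hθ inl hinl hrange hcomm).φ] Kˣ) (h h' : H) (e : E)
    (he : θ e = corner x.right) (h1 : x.left.1 * e * j h * (x.left.1 * e)⁻¹ = j h')
    (h2 : e * j ⟨_, hc h h.2⟩ * e⁻¹ = j ⟨_, hc h h.2⟩) :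
    x * HatData.splitHom θ hθ inl hinl hrange hcomm j hj hc h * x⁻¹ =
      HatData.splitHom θ hθ inl hinl hrange hcomm j hj hc h' := by
  have h3 : Matrix.GeneralLinearGroup.det h.1 = Matrix.GeneralLinearGroup.det h'.1 := by
    have := congrArg (fun t => Matrix.GeneralLinearGroup.det (θ t)) h1
    simpa only [map_mul, map_inv, hj, mul_inv_cancel_comm] using this
  have h4 : (⟨_, hc h h.2⟩ : H) = ⟨_, hc h' h'.2⟩ := Subtype.ext (congrArg corner h3)
  rw [mul_inv_eq_iff_eq_mul]
  have h6 := HatData.ofExtension_φ θ hθ inl hinl hrange hcomm (hj ⟨_, hc h' h'.2⟩) x.left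
  have h7 := HatData.ofExtension_φ θ hθ inl hinl hrange hcomm he
    (HatData.splitHom θ hθ inl hinl hrange hcomm j hj hc h).left
  refine SemidirectProduct.ext (Subtype.ext ?_) ?_
  · refine (congrArg (x.left.1 * ·) h7).trans (Eq.trans ?_ (congrArg (_ * ·) h6).symm)
    change x.left.1 * (e * (j h * (j ⟨_, hc h h.2⟩)⁻¹) * e⁻¹) = j h' * (j ⟨_, hc h' h'.2⟩)⁻¹ *
      (j ⟨_, hc h' h'.2⟩ * x.left.1 * (j ⟨_, hc h' h'.2⟩)⁻¹)
    rw [← h4, ← h1]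
    generalize j ⟨_, hc h h.2⟩ = c at h2 ⊢
    have h5 : e * c⁻¹ * e⁻¹ = c⁻¹ := by
      have := congrArg (·⁻¹) h2
      simpa [mul_assoc] using this
    calc _ = x.left.1 * e * j h * e⁻¹ * (e * c⁻¹ * e⁻¹) := by group
      _ = _ := by rw [h5]; group
  · change x.right * Matrix.GeneralLinearGroup.det h.1 = Matrix.GeneralLinearGroup.det h'.1 * x.right
    rw [h3, mul_comm]

end HatSection

/-! ### Congruence subgroups: blocks, determinants and denominators. -/

namespace TwoDimLocalField

open TorsorSystem

variable {K : Type u} [Field K] (F : TwoDimLocalField K)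

theorem mem_matIdeal_zero {I : Type w} {X : Matrix I I K} : X ∈ F.matIdeal I 0 ↔ ∀ i j, X i j ∈ F.O := by
  refine forall_congr' fun i => forall_congr' fun j => ⟨?_, fun h => ⟨⟨_, h⟩, by simp, rfl⟩⟩
  rintro ⟨a, -, ha⟩
  rw [← ha]
  exact a.2

theorem mem_congr_zero {I : Type w} [Fintype I] [DecidableEq I] {g : GL I K} :
    g ∈ F.congr I 0 ↔ (∀ i j, g.1 i j ∈ F.O) ∧ ∀ i j, (g⁻¹).1 i j ∈ F.O := by
  have h1 : (1 : Matrix I I K) ∈ F.matIdeal I 0 := F.mem_matIdeal_zero.2 fun i j => by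
    rw [Matrix.one_apply]
    split_ifs
    exacts [one_mem _, zero_mem _]
  have h2 : ∀ X, X - 1 ∈ F.matIdeal I 0 ↔ ∀ i j, X i j ∈ F.O := fun X => by
    rw [← F.mem_matIdeal_zero]
    exact ⟨fun h => by simpa using add_mem h h1, fun h => sub_mem h h1⟩
  exact and_congr (h2 _) (h2 _)

theorem diagBlocks_mem_congr {n : ℕ} {p : parabolic n K} {m : ℕ}
    (hp : (p : GL (Fin n × Fin 2) K) ∈ F.congr (Fin n × Fin 2) m) (i : Fin n) :
    diagBlocks n K p i ∈ F.congr (Fin 2) m := by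
  have key : ∀ X : Matrix (Fin n × Fin 2) (Fin n × Fin 2) K, X - 1 ∈ F.matIdeal _ m →
      X.submatrix (Prod.mk i) (Prod.mk i) - 1 ∈ F.matIdeal _ m := fun X h a b => by
    have := h (i, a) (i, b)
    simpa [Matrix.one_apply] using this
  exact ⟨key _ hp.1, key _ hp.2⟩

/-- If 1 + X has entries a, b, c, d in X, then its determinant minus 1 is a + d + ad - bc, which
lies in the same power of the maximal ideal. The inverse is treated by applying this to the inverse
matrix. -/
theorem corner_det_mem_congr {g : GL (Fin 2) K} {m : ℕ} (hg : g ∈ F.congr (Fin 2) m) :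
    corner g.det ∈ F.congr (Fin 2) m := by
  have key : ∀ g : GL (Fin 2) K, g ∈ F.congr (Fin 2) m → (corner g.det).1 - 1 ∈ F.matIdeal (Fin 2) m := by
    intro g hg
    obtain ⟨a, ha, ha'⟩ := hg.1 0 0
    obtain ⟨b, hb, hb'⟩ := hg.1 0 1
    obtain ⟨c, hc, hc'⟩ := hg.1 1 0
    obtain ⟨d, hd, hd'⟩ := hg.1 1 1
    simp only [Matrix.sub_apply, Matrix.one_apply] at ha' hb' hc' hd'
    have hdet : ((g.det : Kˣ) : K) - 1 = ((a + d + a * d - b * c : F.O) : K) := by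
      rw [Matrix.GeneralLinearGroup.val_det_apply, Matrix.det_fin_two]
      push_cast
      rw [ha', hb', hc', hd']
      norm_num
      ring
    intro i j
    fin_cases i <;> fin_cases j
    · refine ⟨a + d + a * d - b * c, ?_, ?_⟩
      · exact sub_mem (add_mem (add_mem ha hd) (Ideal.mul_mem_left _ _ hd)) (Ideal.mul_mem_left _ _ hc)
      · rw [← hdet]
        simp [corner, diagGL]
    all_goals exact ⟨0, zero_mem _, by simp [corner, diagGL]⟩
  refine ⟨key g hg, ?_⟩
  have := key g⁻¹ (inv_mem hg)
  rwa [map_inv, map_inv] at this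

/-- Fixed matrices have bounded denominators. Integrality of this product means that `u` moves
points of the lattice of `h` only by elements of the lattice of `n`. -/
theorem exists_level {I : Type} [Fintype I] [DecidableEq I] (n h : GL I K) :
    ∃ m, ∀ u ∈ F.congr I m, (n⁻¹).1 * ((u.1 - 1) * h.1) ∈ F.matIdeal I 0 := by
  obtain ⟨l, hl⟩ := F.exists_scale h.1
  obtain ⟨l', hl'⟩ := F.exists_scale (n⁻¹).1
  exact ⟨l + (l' + 0), fun u hu => (hl' _ _ (hl _ _ hu.1).2).1⟩

theorem matAct_mem_of_matIdeal {I : Type} [Fintype I] [DecidableEq I] {X : Matrix I I K}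
    (hX : X ∈ F.matIdeal I 0) {v : I → K} (hv : v ∈ F.stdLattice I) : X.mulVec v ∈ F.stdLattice I :=
  fun i => sum_mem fun j _ => mul_mem (F.mem_matIdeal_zero.1 hX i j) (hv j)

end TwoDimLocalField

/-- Conjugation by an element of the semidirect product reduces to two conjugations in the original
extension, one of the element itself and one of its corner part, so the property passes from `E` to
the semidirect product. -/
theorem HatData.exists_conj_splitHom {K : Type u} [Field K] (F : TwoDimLocalField K) {A : Type v}
    [CommGroup A] {E : Type w} [Group E] (θ : E →* GL (Fin 2) K) (hθ : Function.Surjective θ)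
    (inl : A →* E) (hinl : Function.Injective inl) (hrange : inl.range = θ.ker)
    (hcomm : ∀ a x, inl a * x = x * inl a) (j : F.congr (Fin 2) 0 →* E) (hj : ∀ h, θ (j h) = h)
    (hconj : ∀ e : E, ∃ m, ∀ u ∈ F.congr (Fin 2) m, ∀ (hu : u ∈ F.congr (Fin 2) 0)
      (v : F.congr (Fin 2) 0), θ e * v * (θ e)⁻¹ = u → e * j v * e⁻¹ = j ⟨u, hu⟩)
    (x : (Matrix.GeneralLinearGroup.det.comp θ).ker ⋊[
      (HatData.ofExtension θ hθ inl hinl hrange hcomm).φ] Kˣ) :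
    ∃ m, ∀ u ∈ F.congr (Fin 2) m, ∀ (hu : u ∈ F.congr (Fin 2) 0) (v : F.congr (Fin 2) 0),
      (HatData.ofExtension θ hθ inl hinl hrange hcomm).π x * v *
        ((HatData.ofExtension θ hθ inl hinl hrange hcomm).π x)⁻¹ = u →
      x * HatData.splitHom θ hθ inl hinl hrange hcomm j hj (fun _ => F.corner_det_mem_congr) v * x⁻¹ =
        HatData.splitHom θ hθ inl hinl hrange hcomm j hj (fun _ => F.corner_det_mem_congr) ⟨u, hu⟩ := by
  obtain ⟨e, he⟩ := hθ (corner x.right)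
  -- This instance handles the whole element; the next one, for `e` alone, shows that `e` commutes
  -- with the lift of diag(det v, 1), because the two diagonal matrices commute.
  obtain ⟨m, hm⟩ := hconj (x.left.1 * e)
  obtain ⟨m', hm'⟩ := hconj e
  refine ⟨max m m', fun u hu hu0 v hv => ?_⟩
  have hu1 := (F.filtration (Fin 2)).anti (le_max_left m m') hu
  have hu2 := (F.filtration (Fin 2)).anti (le_max_right m m') hu
  have hx : (HatData.ofExtension θ hθ inl hinl hrange hcomm).π x = θ (x.left.1 * e) := by
    rw [map_mul, he]
    rfl
  rw [hx] at hv
  refine HatData.conj_splitHom _ _ _ _ _ _ _ _ _ x v ⟨u, hu0⟩ e he (hm u hu1 hu0 v hv) ?_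
  have hdet : Matrix.GeneralLinearGroup.det v.1 = Matrix.GeneralLinearGroup.det u := by
    rw [← hv, map_mul, map_mul, map_inv, mul_inv_cancel_comm]
  have hc := F.corner_det_mem_congr hu2
  rw [← hdet] at hc
  refine hm' _ hc (F.corner_det_mem_congr v.2) ⟨_, F.corner_det_mem_congr v.2⟩ ?_
  rw [he]
  change corner _ * corner _ * (corner _)⁻¹ = _
  rw [← map_mul, ← map_inv, ← map_mul, mul_inv_cancel_comm]

/-! ### The Haar extension over GL_2(O). -/

namespace TwoDimLocalField

open TorsorSystem

variable {K : Type u} [Field K] {F : TwoDimLocalField K} [TopologicalSpace K] (hF : F.IsNaturalTopology)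

/-- Deep congruence subgroups act on `Λ` trivially modulo `N`, by the bound on denominators in
`exists_level`. -/
theorem exists_level_forall {I : Type} [Fintype I] [DecidableEq I] (N Λ : (latticeSystem I hF).Lat) :
    ∃ m, ∀ u ∈ F.congr I m, ∀ x ∈ Λ.1, matAct I u x - x ∈ N.1 := by
  obtain ⟨N, n, rfl⟩ := N
  obtain ⟨Λ, l, rfl⟩ := Λ
  obtain ⟨m, hm⟩ := F.exists_level n l
  refine ⟨m, fun u hu => ?_⟩
  rintro _ ⟨v, hv, rfl⟩
  refine (F.mem_map_iff I n _).2 ?_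
  have : matAct I n⁻¹ (matAct I u (matAct I l v) - matAct I l v) =
      ((n⁻¹).1 * ((u.1 - 1) * l.1)).mulVec v := by
    simp only [matAct_apply, ← Matrix.mulVec_mulVec, Matrix.sub_mulVec, Matrix.one_mulVec]
  rw [this]
  exact F.matAct_mem_of_matIdeal (hm u hu) hv

/-- Integrality of the matrix and of its inverse gives the two inclusions; this is why the extension
splits over GL_2(O). -/
theorem smul_baseLattice {I : Type} [Fintype I] [DecidableEq I] {u : GL I K} (hu : u ∈ F.congr I 0) :
    u • baseLattice I hF = baseLattice I hF := by
  have := hF.isTopologicalAddGroup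
  rw [mem_congr_zero] at hu
  have key : ∀ u : GL I K, (∀ i j, u.1 i j ∈ F.O) → ∀ x ∈ (baseLattice I hF).1,
      matAct I u x - x ∈ (baseLattice I hF).1 := fun u hu x hx =>
    sub_mem (F.matAct_mem_of_matIdeal (F.mem_matIdeal_zero.2 hu) hx) hx
  exact (latticeSystem I hF).smul_eq_of_forall le_rfl le_rfl (key u hu.1) (key u⁻¹ hu.2)

/-- The splitting of the extension of `GL₂(K)` over `GL₂(O)`. -/
noncomputable def integralHom : F.congr (Fin 2) 0 →* (haarTorsors hF (Fin 2)).ext (baseLattice (Fin 2) hF) :=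
  (stabHom _ _).comp (Subgroup.inclusion fun _ h => smul_baseLattice hF h)

/-- Take a lattice below O^2 and its translate by the image of `e`, and a level at which both
quotients are acted on trivially. Then `u` changes no measure that enters the coordinate of `e`, and
`conj_stabHom` applies. -/
theorem exists_conj_integralHom (e : (haarTorsors hF (Fin 2)).ext (baseLattice (Fin 2) hF)) :
    ∃ m, ∀ u ∈ F.congr (Fin 2) m, ∀ (hu : u ∈ F.congr (Fin 2) 0) (v : F.congr (Fin 2) 0),
      extHom _ _ e * v * (extHom _ _ e)⁻¹ = u → e * integralHom hF v * e⁻¹ = integralHom hF ⟨u, hu⟩ := by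
  have := hF.isTopologicalAddGroup
  obtain ⟨N, h, h'⟩ := (haarTorsors hF (Fin 2)).directed (baseLattice (Fin 2) hF)
    (extHom _ _ e • baseLattice (Fin 2) hF)
  obtain ⟨m, hm⟩ := exists_level_forall hF N (baseLattice (Fin 2) hF)
  obtain ⟨m', hm'⟩ := exists_level_forall hF N (extHom _ _ e • baseLattice (Fin 2) hF)
  refine ⟨max m m', fun u hu hu0 v hv => ?_⟩
  have hu1 := (F.filtration (Fin 2)).anti (le_max_left m m') hu
  have hu2 := (F.filtration (Fin 2)).anti (le_max_right m m') hu
  refine conj_stabHom e (Subgroup.inclusion (fun _ h => smul_baseLattice hF h) ⟨u, hu0⟩) _ hv h h'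
    (fun s => ?_) (fun s => ?_)
  · exact (latticeSystem (Fin 2) hF).ratio_smul_eq_one h (hm _ (inv_mem hu1))
      (hm _ (inv_mem (inv_mem hu1))) s
  · exact (latticeSystem (Fin 2) hF).ratio_smul_eq_one h' (hm' _ (inv_mem hu2))
      (hm' _ (inv_mem (inv_mem hu2))) s

/-- The splitting over `GL₂(O)` of the extension `T ⋊ Kˣ` of `GL₂(K)`. -/
noncomputable def integralHatHom : F.congr (Fin 2) 0 →* _ ⋊[(haarHatData hF).φ] Kˣ := HatData.splitHom
  ((haarTorsors hF (Fin 2)).extHom (baseLattice (Fin 2) hF))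
  ((haarTorsors hF (Fin 2)).extHom_surjective _)
  ((haarTorsors hF (Fin 2)).extInl _)
  ((haarTorsors hF (Fin 2)).extInl_injective _)
  ((haarTorsors hF (Fin 2)).extInl_range _)
  ((haarTorsors hF (Fin 2)).extInl_comm _) (integralHom hF) (fun _ => rfl)
  (fun _ => F.corner_det_mem_congr)

theorem rightHom_integralHatHom (h : F.congr (Fin 2) 0) :
    (haarHatData hF).ext.rightHom (integralHatHom hF h) = h := HatData.π_splitHom ..

theorem exists_conj_integralHatHom (x : (Matrix.GeneralLinearGroup.det.comp
    ((haarTorsors hF (Fin 2)).extHom (baseLattice (Fin 2) hF))).ker ⋊[(haarHatData hF).φ] Kˣ) :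
    ∃ m, ∀ u ∈ F.congr (Fin 2) m, ∀ (hu : u ∈ F.congr (Fin 2) 0) (v : F.congr (Fin 2) 0),
      (haarHatData hF).ext.rightHom x * v * ((haarHatData hF).ext.rightHom x)⁻¹ = u →
      x * integralHatHom hF v * x⁻¹ = integralHatHom hF ⟨u, hu⟩ := by
  exact HatData.exists_conj_splitHom F _ _ _ _ _ _ _ _ (exists_conj_integralHom hF) x

end TwoDimLocalField

open Classical in
/-- A homomorphism on a subgroup, extended by `1`. -/
noncomputable def extendByOne {G : Type*} {M : Type*} [Group G] [Group M] {H : Subgroup G} (j : H →* M)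
    (g : G) : M := if h : g ∈ H then j ⟨g, h⟩ else 1

theorem extendByOne_of_mem {G : Type*} {M : Type*} [Group G] [Group M] {H : Subgroup G} (j : H →* M)
    {g : G} (h : g ∈ H) : extendByOne j g = j ⟨g, h⟩ := dif_pos h

theorem extendByOne_mul {G : Type*} {M : Type*} [Group G] [Group M] {H : Subgroup G} (j : H →* M)
    {g g' : G} (h : g ∈ H) (h' : g' ∈ H) :
    extendByOne j (g * g') = extendByOne j g * extendByOne j g' := by
  rw [extendByOne_of_mem j h, extendByOne_of_mem j h', extendByOne_of_mem j (mul_mem h h'), ← map_mul]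
  rfl

namespace TwoDimLocalField

variable {K : Type u} [Field K] {F : TwoDimLocalField K} [TopologicalSpace K] (hF : F.IsNaturalTopology)

/-- The splitting over `P ∩ GL_{2n}(O)` of the extension which defines the action of `P`. -/
noncomputable def parabolicSplitting (n : ℕ) : SplittingOn (piExt (haarHatData hF).ext (Fin n))
    (diagBlocks n K) ((F.filtration (Fin n × Fin 2)).C 0) where
  s k i := extendByOne (integralHatHom hF) (diagBlocks n K k i)
  rightHom_s k hk := funext fun i => by
    have h := extendByOne_of_mem (integralHatHom hF) (F.diagBlocks_mem_congr hk i)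
    exact (congrArg _ h).trans (rightHom_integralHatHom hF _)
  s_mul k k' hk hk' := funext fun i => by
    refine (congrArg (extendByOne (integralHatHom hF)) (congrFun (map_mul (diagBlocks n K) k k') i)).trans ?_
    exact extendByOne_mul _ (F.diagBlocks_mem_congr hk i) (F.diagBlocks_mem_congr hk' i)

end TwoDimLocalField

end TwoDim

namespace TwoDim

/-! ### Right translates of induced objects. -/

section InducedLinear

open coinvariants Fam

variable {A : Type v} {E Q G : Type u} [CommGroup A] [Group E] [Group Q] [Group G]
  {S : GroupExtension A E Q} {χ : A →* ℂˣ} {P : Subgroup G} {f : P →* Q}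
  {A' : Type v'} {E' G' : Type u} [CommGroup A'] [Group E'] [Group G']

/-- Translation by the inverse of `z` moves the coset to the trivial one and `z` to the base point,
where `exists_value` applies. -/
theorem coinvariants.exists_value_at {C : Subgroup G} {s : SplittingOn S f C} {Y : Type u}
    [AddCommGroup Y] [Module ℂ Y] (hS : ∀ a e, S.inl a * e = e * S.inl a) {x : G ⧸ C}
    (z : LiftOver S f C x) (y : Y) : ∃ φ : coinvariants χ s x Y, φ.1 z = y := by
  have h : (QuotientGroup.mk 1 : G ⧸ C) = z.1.2⁻¹ • x := by
    refine Eq.trans (congrArg QuotientGroup.mk ?_ : _ = (QuotientGroup.mk ((z.1.2⁻¹ : P) * (z.1.2 : G)) : G ⧸ C))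
      (congrArg (z.1.2⁻¹ • ·) z.2.2)
    rw [Subgroup.coe_inv, inv_mul_cancel]
  obtain ⟨ψ, hψ⟩ := exists_value (χ := χ) (s := s) hS (x := QuotientGroup.mk 1) rfl y
  refine ⟨translate hS z.1.2⁻¹ h z.1.1⁻¹ (by rw [map_inv, z.2.1, map_inv]) ψ, ?_⟩
  refine Eq.trans ?_ hψ
  exact congrArg ψ.1 (Subtype.ext (Prod.ext (inv_mul_cancel _) (inv_mul_cancel _)))

/-- Conjugation by an element of the extension respects a splitting over a small subgroup. -/
def SplittingOn.IsConjCompatible {F : SubgroupFiltration G} (s : SplittingOn S f (F.C 0)) : Prop :=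
  ∀ (e : E) (p : P), S.rightHom e = f p → ∃ m, ∀ u v : P, (u : G) ∈ F.C m → (u : G) ∈ F.C 0 →
    (v : G) ∈ F.C 0 → p * v * p⁻¹ = u → e * s.s v * e⁻¹ = s.s u

/-- A morphism of group extensions over a homomorphism to the group `P`. -/
structure ExtMorphism (S' : GroupExtension A' E' G') (S : GroupExtension A E Q) (ι : G' →* G)
    (f : P →* Q) where
  mem : ∀ g, g ∈ P
  Φ : E' →* E
  κ : A' →* A
  Φ_inl : ∀ a, Φ (S'.inl a) = S.inl (κ a)
  rightHom_Φ : ∀ e, S.rightHom (Φ e) = f ⟨ι (S'.rightHom e), mem _⟩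

variable {S' : GroupExtension A' E' G'} {ι : G' →* G} (M : ExtMorphism S' S ι f) {C : Subgroup G}
  {s : SplittingOn S f C}

namespace ExtMorphism

theorem div_mem {x : G} (z : LiftOver S f C (QuotientGroup.mk x)) :
    (((⟨x, M.mem x⟩ : P)⁻¹ * z.1.2 : P) : G) ∈ C := QuotientGroup.eq.1 z.2.2.symm

theorem push_mem (x : G) {g : G'} (z : LiftOver S f C (QuotientGroup.mk x))
    (e : {e : E' // S'.rightHom e = g}) :
    S.rightHom (z.1.1 * (s.s ((⟨x, M.mem x⟩ : P)⁻¹ * z.1.2))⁻¹ * M.Φ e.1) = f ⟨x * ι g, M.mem _⟩ := by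
  rw [map_mul, map_mul, map_inv, z.2.1, s.rightHom_s _ (M.div_mem z), M.rightHom_Φ, ← map_inv,
    ← map_mul, ← map_mul]
  refine congrArg f (Subtype.ext ?_)
  simp only [Subgroup.coe_mul, Subgroup.coe_inv, e.2]
  group

/-- The map which compares the value of an induced object at `x ι(g)` with the value at `x` of the
object induced from `L_g ⊗ Y`. -/
def push (hS : ∀ a e, S.inl a * e = e * S.inl a) (χ : A →* ℂˣ) (s : SplittingOn S f C) (x : G) (g : G')
    (Y : Type u) [AddCommGroup Y] [Module ℂ Y] :
    coinvariants χ s (QuotientGroup.mk (x * ι g)) Y →ₗ[ℂ]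
      coinvariants χ s (QuotientGroup.mk x) (lineTensor S' (χ.comp M.κ) g Y) where
  -- The lift `z` lies only over the coset of `x`. Dividing by the splitting normalizes it to a lift
  -- of `x` itself, and multiplying by the image of `e` then gives a lift of `x * ι g`.
  toFun φ := ⟨fun z => ⟨fun e => φ.1 ⟨(z.1.1 * (s.s ((⟨x, M.mem x⟩ : P)⁻¹ * z.1.2))⁻¹ * M.Φ e.1,
      ⟨x * ι g, M.mem _⟩), M.push_mem x z e, rfl⟩, fun a e e' h => φ.2.1 (M.κ a) _ _ (Prod.ext (by
        change _ * _ * M.Φ e'.1 = S.inl (M.κ a) * (_ * M.Φ e.1)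
        rw [h, map_mul, M.Φ_inl, ← mul_assoc, ← hS, mul_assoc]) rfl)⟩,
    fun a z z' h => Subtype.ext (funext fun e => φ.2.1 a _ _ (Prod.ext (by
        change z'.1.1 * (s.s (_ * z'.1.2))⁻¹ * _ = _ * (z.1.1 * (s.s (_ * z.1.2))⁻¹ * _)
        rw [h]
        simp only [mul_assoc]) rfl)),
    fun k z z' hk h => Subtype.ext (funext fun e => congrArg φ.1 (Subtype.ext (Prod.ext (by
        change z'.1.1 * (s.s (_ * z'.1.2))⁻¹ * _ = z.1.1 * (s.s (_ * z.1.2))⁻¹ * _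
        rw [h, ← mul_assoc, s.s_mul _ _ (M.div_mem z) hk]
        group) rfl)))⟩
  map_add' _ _ := rfl
  map_smul' _ _ := rfl

variable (hS : ∀ a e, S.inl a * e = e * S.inl a)

/-- Functions on both sides are determined by a single value, which can be arbitrary. With the
evaluation points `z'` on the source and `z` and `ĝ` on the target, the map becomes the identity of
`Y`. -/
theorem push_bijective (x : G) (g : G') (Y : Type u) [AddCommGroup Y] [Module ℂ Y] :
    Function.Bijective (M.push hS χ s x g Y) := by
  obtain ⟨e, he⟩ := S.rightHom_surjective (f ⟨x, M.mem x⟩)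
  obtain ⟨ĝ⟩ := lineTensor.nonempty S' g
  let z : LiftOver S f C (QuotientGroup.mk x) := ⟨(e, ⟨x, M.mem x⟩), he, rfl⟩
  let z' : LiftOver S f C (QuotientGroup.mk (x * ι g)) := ⟨(z.1.1 * (s.s ((⟨x, M.mem x⟩ : P)⁻¹ * z.1.2))⁻¹ * M.Φ ĝ.1,
      ⟨x * ι g, M.mem _⟩), M.push_mem x z ĝ, rfl⟩
  refine ⟨fun φ φ' h => ext_at z' ?_, fun φ => ?_⟩
  · exact congrFun (congrArg Subtype.val (congrFun (congrArg Subtype.val h) z)) ĝ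
  · obtain ⟨ψ, hψ⟩ := exists_value_at (χ := χ) (s := s) hS z' ((φ.1 z).1 ĝ)
    exact ⟨ψ, ext_at z (lineTensor.ext_at ĝ hψ)⟩

/-- `push` as a morphism of members of families. -/
def pushHom (s : SplittingOn S f C) (x : G) (g : G') (Y : FGModuleCat.{u} ℂ) :
    (inducedFam χ s Y).fam (QuotientGroup.mk (x * ι g)) ⟶
      (inducedFam χ s (FGModuleCat.of ℂ (lineTensor S' (χ.comp M.κ) g Y))).fam (QuotientGroup.mk x) :=
  FGModuleCat.ofHom (M.push hS χ s x g Y)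

variable {F : SubgroupFiltration G} {s : SplittingOn S f (F.C 0)}

/-- Compatibility with `P` is formal, because left multiplication commutes with the right-hand
normalization. Constancy on cosets is not: it uses that conjugation by a lift of `ι g` respects the
splitting near the identity. -/
theorem exists_push (hs : s.IsConjCompatible)
    (g : G') (Y : FGModuleCat.{u} ℂ) :
    ∃ X : Ind.right (ι g) (inducedObj χ hS F s Y) ⟶
        inducedObj χ hS F s (FGModuleCat.of ℂ (lineTensor S' (χ.comp M.κ) g Y)),
      ∀ x, Ind.app X x = M.pushHom hS s x g Y := by
  obtain ⟨ĝ⟩ := lineTensor.nonempty S' g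
  -- At level m conjugation by the lift of `ι g` matches the splitting with itself; the level l
  -- below ensures that the conjugated elements stay in the largest group, where the splitting is
  -- defined.
  obtain ⟨m, hm⟩ := hs (M.Φ ĝ.1) ⟨ι g, M.mem _⟩ (by rw [M.rightHom_Φ]; exact congrArg f (Subtype.ext (congrArg ι ĝ.2)))
  obtain ⟨l, hl⟩ := F.conj (ι g) 0
  refine Ind.exists_hom_app (E := Ind.right (ι g) (inducedObj χ hS F s Y))
    (D := inducedObj χ hS F s (FGModuleCat.of ℂ (lineTensor S' (χ.comp M.κ) g Y)))
    (fun x => M.pushHom hS s x g Y)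
    (max (max m l) (Ind.right (ι g) (inducedObj χ hS F s Y)).lev) (le_max_right _ _) (Nat.zero_le _)
    (fun x u hu => ?_) (fun p x => ?_)
  · have hum : u ∈ F.C m := F.anti ((le_max_left _ _).trans (le_max_left _ _)) hu
    have hul : u ∈ F.C l := F.anti ((le_max_right _ _).trans (le_max_left _ _)) hu
    have hu0 : u ∈ F.C 0 := F.anti (Nat.zero_le _) hu
    have hv := hl u hul
    have q : (QuotientGroup.mk (x * u * ι g) : G ⧸ F.C 0) = QuotientGroup.mk (x * ι g) := by
      have : x * u * ι g = x * ι g * ((ι g)⁻¹ * u * ι g) := by group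
      rw [this]
      exact QuotientGroup.mk_mul_of_mem _ hv
    have q' : (QuotientGroup.mk (x * u) : G ⧸ F.C 0) = QuotientGroup.mk x :=
      QuotientGroup.mk_mul_of_mem _ hu0
    have h1 := inducedFam_eqToHom (χ := χ) s Y q (congrArg _ q)
    have h2 := inducedFam_eqToHom (χ := χ) s (FGModuleCat.of ℂ (lineTensor S' (χ.comp M.κ) g Y)) q'.symm
      (congrArg _ q'.symm)
    refine Eq.trans ?_ (congrArg₂ (fun a b => a ≫ M.pushHom hS s x g Y ≫ b) h1 h2).symm
    refine FGModuleCat.hom_ext (LinearMap.ext fun φ => Subtype.ext (funext fun z =>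
      lineTensor.ext_at ĝ ?_))
    let z₁ : LiftOver S f (F.C 0) (QuotientGroup.mk x) := ⟨z.1, z.2.1, z.2.2.trans q'⟩
    have hk := M.div_mem z₁
    -- Replacing the representative `x` by `x * u` inserts the lift of `u` before the image of `ĝ`;
    -- this identity moves it to the other side, where right invariance of `φ` absorbs it.
    have key := hm ⟨u, M.mem u⟩ ⟨(ι g)⁻¹ * u * ι g, M.mem _⟩ hum hu0 hv (Subtype.ext (by
      simp only [Subgroup.coe_mul, Subgroup.coe_inv]; group))
    refine φ.2.2 ⟨(ι g)⁻¹ * u * ι g, M.mem _⟩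
      ⟨(z.1.1 * (s.s ((⟨x, M.mem x⟩ : P)⁻¹ * z.1.2))⁻¹ * M.Φ ĝ.1, ⟨x * ι g, M.mem _⟩),
        M.push_mem x z₁ ĝ, q.symm⟩ _ hv (Prod.ext ?_ (Subtype.ext ?_))
    · change z.1.1 * (s.s ((⟨x * u, M.mem _⟩ : P)⁻¹ * z.1.2))⁻¹ * M.Φ ĝ.1 =
        z.1.1 * (s.s ((⟨x, M.mem x⟩ : P)⁻¹ * z.1.2))⁻¹ * M.Φ ĝ.1 * s.s ⟨(ι g)⁻¹ * u * ι g, M.mem _⟩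
      have e1 : (⟨x, M.mem x⟩ : P)⁻¹ * z.1.2 = ⟨u, M.mem u⟩ * ((⟨x * u, M.mem _⟩ : P)⁻¹ * z.1.2) :=
        Subtype.ext (by simp only [Subgroup.coe_mul, Subgroup.coe_inv]; group)
      rw [e1, s.s_mul _ _ hu0 (M.div_mem z), ← key]
      group
    · change x * u * ι g = x * ι g * ((ι g)⁻¹ * u * ι g)
      group
  · have q : (QuotientGroup.mk ((p : G)⁻¹ * (x * ι g)) : G ⧸ F.C 0) = QuotientGroup.mk ((p : G)⁻¹ * x * ι g) := by
      rw [mul_assoc]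
    have h1 := inducedFam_eqToHom (χ := χ) s Y q (congrArg _ q)
    refine FGModuleCat.hom_ext (LinearMap.ext fun φ => ?_)
    have h2 := Ind.right_th (ι g) (inducedObj χ hS F s Y) p x
    refine (congrArg (fun t => (t ≫ (((lineAction S hS χ).comap f).τ p).map
      (M.pushHom hS s ((p : G)⁻¹ * x) g Y)).hom.hom φ) (h2.trans
        (congrArg (fun t => (inducedObj χ hS F s Y).th p (x * ι g) ≫
          (((lineAction S hS χ).comap f).τ p).map t) h1))).trans ?_
    refine Subtype.ext (funext fun e => Subtype.ext (funext fun z => Subtype.ext (funext fun e' =>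
      congrArg φ.1 (Subtype.ext (Prod.ext ?_ (Subtype.ext ?_))))))
    · have e1 : (⟨(p : G)⁻¹ * x, M.mem _⟩ : P)⁻¹ * z.1.2 = (⟨x, M.mem x⟩ : P)⁻¹ * (p * z.1.2) :=
        Subtype.ext (by simp only [Subgroup.coe_mul, Subgroup.coe_inv]; group)
      change e.1 * (z.1.1 * (s.s ((⟨(p : G)⁻¹ * x, M.mem _⟩ : P)⁻¹ * z.1.2))⁻¹ * M.Φ e'.1) =
        e.1 * z.1.1 * (s.s ((⟨x, M.mem x⟩ : P)⁻¹ * (p * z.1.2)))⁻¹ * M.Φ e'.1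
      rw [e1]
      group
    · change (p : G) * ((p : G)⁻¹ * x * ι g) = x * ι g
      group

theorem isIso_pushHom (s : SplittingOn S f C) (x : G) (g : G') (Y : FGModuleCat.{u} ℂ) :
    IsIso (M.pushHom (χ := χ) hS s x g Y) := by
  let e := LinearEquiv.ofBijective _ (M.push_bijective (χ := χ) (s := s) hS x g Y)
  let i : (inducedFam χ s (FGModuleCat.of ℂ (lineTensor S' (χ.comp M.κ) g Y))).fam
      (QuotientGroup.mk x) ⟶ (inducedFam χ s Y).fam (QuotientGroup.mk (x * ι g)) :=
    FGModuleCat.ofHom e.symm.toLinearMap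
  exact ⟨i, FGModuleCat.hom_ext (LinearMap.ext fun φ => e.symm_apply_apply φ),
    FGModuleCat.hom_ext (LinearMap.ext fun φ => e.apply_symm_apply φ)⟩

/-- The morphism with the components `push`. -/
@[irreducible] noncomputable def pushMor (hs : s.IsConjCompatible) (g : G') (Y : FGModuleCat.{u} ℂ) :
    Ind.right (ι g) (inducedObj χ hS F s Y) ⟶
      inducedObj χ hS F s (FGModuleCat.of ℂ (lineTensor S' (χ.comp M.κ) g Y)) :=
  (M.exists_push hS hs g Y).choose

variable {hs : s.IsConjCompatible}

theorem pushMor_app (g : G') (Y : FGModuleCat.{u} ℂ) (x : G) :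
    Ind.app (M.pushMor hS (χ := χ) hs g Y) x = M.pushHom hS s x g Y := by
  unfold pushMor
  exact (M.exists_push hS hs g Y).choose_spec x

theorem isIso_pushMor (g : G') (Y : FGModuleCat.{u} ℂ) : IsIso (M.pushMor hS (χ := χ) hs g Y) :=
  Ind.isIso_of_app _ fun x => Eq.mpr (congrArg IsIso (M.pushMor_app hS g Y x))
    (M.isIso_pushHom hS s x g Y)

/-- The isomorphism between a right translate of an induced object and the object induced from
`L_g ⊗ Y`. -/
noncomputable def pushIso (hs : s.IsConjCompatible) (g : G') (Y : FGModuleCat.{u} ℂ) :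
    Ind.right (ι g) (inducedObj χ hS F s Y) ≅
      inducedObj χ hS F s (FGModuleCat.of ℂ (lineTensor S' (χ.comp M.κ) g Y)) :=
  @asIso _ _ _ _ (M.pushMor hS hs g Y) (M.isIso_pushMor hS g Y)

theorem pushIso_app (g : G') (Y : FGModuleCat.{u} ℂ) (x : G) :
    Ind.app (M.pushIso hS (χ := χ) hs g Y).hom x = M.pushHom hS s x g Y :=
  M.pushMor_app hS g Y x

theorem pushIso_naturality (g : G') {Y Y' : FGModuleCat.{u} ℂ} (l : Y ⟶ Y') :
    (Ind.rightFunctor F _ (ι g)).map ((inducedFunctor χ hS F s).map l) ≫ (M.pushIso hS hs g Y').hom =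
      (M.pushIso hS hs g Y).hom ≫ (inducedFunctor χ hS F s).map ((lineFunctor S' (χ.comp M.κ) g).map l) := by
  refine Ind.hom_ext fun x => ?_
  have c1 := Ind.comp_app ((Ind.rightFunctor F _ (ι g)).map ((inducedFunctor χ hS F s).map l))
    (M.pushIso hS hs g Y').hom x
  have c2 := Ind.comp_app (M.pushIso hS hs g Y).hom
    ((inducedFunctor χ hS F s).map ((lineFunctor S' (χ.comp M.κ) g).map l)) x
  refine c1.trans (Eq.trans ?_ c2.symm)
  have h1 := Ind.right_map_app (ι g) ((inducedFunctor χ hS F s).map l) x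
  have h4 := M.pushIso_app hS (hs := hs) (χ := χ) g Y' x
  have h5 := M.pushIso_app hS (hs := hs) (χ := χ) g Y x
  refine (congrArg₂ (· ≫ ·) h1 h4).trans (Eq.trans ?_ (congrArg (· ≫ _) h5).symm)
  have h2 := inducedFunctor_app (hS := hS) (χ := χ) (s := s) (F := F) l (x * ι g)
  have h3 := inducedFunctor_app (hS := hS) (χ := χ) (s := s) (F := F)
    ((lineFunctor S' (χ.comp M.κ) g).map l) x
  refine FGModuleCat.hom_ext (LinearMap.ext fun φ => ?_)
  exact (congrArg (M.push hS χ s x g Y') (LinearMap.congr_fun h2 φ)).trans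
    (LinearMap.congr_fun h3 (M.push hS χ s x g Y φ)).symm

/-- Evaluated on lifts, the two sides differ by the normalization at the intermediate point, which
is the splitting at 1 and hence trivial; what remains is multiplicativity of `M.Φ`. -/
theorem pushIso_mul (hS' : ∀ a e, S'.inl a * e = e * S'.inl a) {g h l : G'} (e : g * h = l)
    (e' : ι g * ι h = ι l) (Y : FGModuleCat.{u} ℂ) :
    (Ind.rightFunctor F _ (ι g)).map (M.pushIso hS (χ := χ) hs h Y).hom ≫
        (M.pushIso hS hs g (FGModuleCat.of ℂ (lineTensor S' (χ.comp M.κ) h Y))).hom ≫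
        (inducedFunctor χ hS F s).map (lineMul S' hS' (χ.comp M.κ) e Y).hom =
      (Ind.rightMul e' (inducedObj χ hS F s Y)).hom ≫ (M.pushIso hS hs l Y).hom := by
  let D := FGModuleCat.of ℂ (lineTensor S' (χ.comp M.κ) h Y)
  refine Ind.hom_ext fun x => ?_
  have c1 := Ind.comp_app ((Ind.rightFunctor F _ (ι g)).map (M.pushIso hS (χ := χ) hs h Y).hom)
    ((M.pushIso hS hs g D).hom ≫
      (inducedFunctor χ hS F s).map (lineMul S' hS' (χ.comp M.κ) e Y).hom) x
  have c2 := Ind.comp_app (M.pushIso hS hs g D).hom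
    ((inducedFunctor χ hS F s).map (lineMul S' hS' (χ.comp M.κ) e Y).hom) x
  have c3 := Ind.comp_app (Ind.rightMul e' (inducedObj χ hS F s Y)).hom (M.pushIso hS hs l Y).hom x
  have h1 := (Ind.right_map_app (ι g) (M.pushIso hS (χ := χ) hs h Y).hom x).trans
    (M.pushIso_app hS h Y (x * ι g))
  have h2 := M.pushIso_app hS (hs := hs) (χ := χ) g D x
  have h3 := inducedFunctor_app (hS := hS) (χ := χ) (s := s) (F := F)
    (lineMul S' hS' (χ.comp M.κ) e Y).hom x
  have h5 := M.pushIso_app hS (hs := hs) (χ := χ) l Y x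
  have e'' : x * ι g * ι h = x * ι l := by rw [mul_assoc, e']
  have q : (QuotientGroup.mk (x * ι g * ι h) : G ⧸ F.C 0) = QuotientGroup.mk (x * ι l) := by rw [e'']
  have h4 := (Ind.rightMul_app e' (inducedObj χ hS F s Y) x (congrArg (inducedObj χ hS F s Y).at' e'')).trans
    (inducedFam_eqToHom (χ := χ) s Y q (congrArg _ q))
  refine (c1.trans (congrArg₂ (· ≫ ·) h1 (c2.trans (congrArg (· ≫ _) h2)))).trans
    (Eq.trans ?_ (c3.trans (congrArg₂ (· ≫ ·) h4 h5)).symm)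
  refine FGModuleCat.hom_ext (LinearMap.ext fun φ => ?_)
  refine (LinearMap.congr_fun h3 (M.push hS χ s x g D (M.push hS χ s (x * ι g) h Y φ))).trans ?_
  refine Subtype.ext (funext fun z => ?_)
  refine (lineTensor.mulEquiv_eq_iff hS' e _ _).2 ?_
  refine Subtype.ext (funext fun a => Subtype.ext (funext fun b =>
    congrArg φ.1 (Subtype.ext (Prod.ext ?_ (Subtype.ext ?_)))))
  · change z.1.1 * (s.s ((⟨x, M.mem x⟩ : P)⁻¹ * z.1.2))⁻¹ * M.Φ a.1 *
      (s.s ((⟨x * ι g, M.mem _⟩ : P)⁻¹ * ⟨x * ι g, M.mem _⟩))⁻¹ * M.Φ b.1 =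
      z.1.1 * (s.s ((⟨x, M.mem x⟩ : P)⁻¹ * z.1.2))⁻¹ * M.Φ (a.1 * b.1)
    rw [inv_mul_cancel, s.s_one, inv_one, mul_one, map_mul, mul_assoc, mul_assoc]
  · exact e''

/-- For the neutral element the comparison map only normalizes a lift by the splitting, and
functions in the induced object are invariant under this. -/
theorem pushIso_one (e : Ind.rightFunctor F ((lineAction S hS χ).comap f) (ι 1) =
    Ind.rightFunctor F ((lineAction S hS χ).comap f) 1) (Y : FGModuleCat.{u} ℂ) :
    (M.pushIso hS (χ := χ) hs 1 Y).hom ≫ (inducedFunctor χ hS F s).map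
        (lineTensor.oneEquiv S' (χ.comp M.κ) Y).toFGModuleCatIso.hom =
      (eqToIso e ≪≫ Ind.rightOneIso).hom.app (inducedObj χ hS F s Y) := by
  -- The elements `ι 1` and 1 are equal but not definitionally so; with a variable in place of `ι 1`
  -- the equality can be eliminated.
  have key : ∀ (w : G) (hw : w = 1) (e : Ind.rightFunctor F ((lineAction S hS χ).comap f) w =
      Ind.rightFunctor F ((lineAction S hS χ).comap f) 1) (x : G)
      (e' : (Ind.right w (inducedObj χ hS F s Y)).at' x = (inducedObj χ hS F s Y).at' x),
      Ind.app ((eqToIso e ≪≫ Ind.rightOneIso).hom.app (inducedObj χ hS F s Y)) x = eqToHom e' := by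
    rintro w rfl e x e'
    have h1 : (eqToIso e ≪≫ Ind.rightOneIso).hom.app (inducedObj χ hS F s Y) =
        (Ind.rightOne (inducedObj χ hS F s Y)).hom := Category.id_comp _
    exact (congrArg (fun t => Ind.app t x) h1).trans (Ind.rightOne_app _ x e')
  refine Ind.hom_ext fun x => ?_
  have c1 := Ind.comp_app (M.pushIso hS (χ := χ) hs 1 Y).hom ((inducedFunctor χ hS F s).map
        (lineTensor.oneEquiv S' (χ.comp M.κ) Y).toFGModuleCatIso.hom) x
  have h2 := M.pushIso_app hS (hs := hs) (χ := χ) 1 Y x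
  have h3 := inducedFunctor_app (hS := hS) (χ := χ) (s := s) (F := F)
    (lineTensor.oneEquiv S' (χ.comp M.κ) Y).toFGModuleCatIso.hom x
  have e'' : x * ι 1 = x := by rw [map_one, mul_one]
  have q : (QuotientGroup.mk (x * ι 1) : G ⧸ F.C 0) = QuotientGroup.mk x := by rw [e'']
  have h4 := (key (ι 1) (map_one ι) e x (congrArg (inducedObj χ hS F s Y).at' e'')).trans
    (inducedFam_eqToHom (χ := χ) s Y q (congrArg _ q))
  refine (c1.trans (congrArg (· ≫ _) h2)).trans (Eq.trans ?_ h4.symm)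
  refine FGModuleCat.hom_ext (LinearMap.ext fun φ => ?_)
  refine (LinearMap.congr_fun h3 (M.push hS χ s x 1 Y φ)).trans ?_
  refine Subtype.ext (funext fun z => ?_)
  refine (φ.2.2 ((⟨x, M.mem x⟩ : P)⁻¹ * z.1.2) ⟨(z.1.1 * (s.s ((⟨x, M.mem x⟩ : P)⁻¹ * z.1.2))⁻¹ * M.Φ 1,
    ⟨x * ι 1, M.mem _⟩), M.push_mem x z ⟨1, map_one _⟩, rfl⟩ ⟨z.1, z.2.1, z.2.2.trans q.symm⟩ (M.div_mem z)
    (Prod.ext ?_ (Subtype.ext ?_))).symm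
  · change z.1.1 = z.1.1 * (s.s ((⟨x, M.mem x⟩ : P)⁻¹ * z.1.2))⁻¹ * M.Φ 1 *
      s.s ((⟨x, M.mem x⟩ : P)⁻¹ * z.1.2)
    rw [map_one, mul_one, inv_mul_cancel_right]
  · change (z.1.2 : G) = x * ι 1 * (x⁻¹ * z.1.2)
    rw [e'', mul_inv_cancel_left]

/-- The structure isomorphisms are the inverses of `pushIso`, as the source of `ε` is the object
induced from the twisted space; `key` turns the multiplicativity of `pushIso` into that of the
inverses. Fullness uses that `P` is the whole group. -/
theorem exists_gLinearFunctor (hS' : ∀ a e, S'.inl a * e = e * S'.inl a) (hP : P = ⊤)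
    (hs : s.IsConjCompatible) :
    ∃ T : GLinearFunctor (lineAction S' hS' (χ.comp M.κ))
      ((Ind.σ F ((lineAction S hS χ).comap f)).comap ι), T.T.Full ∧ T.T.Faithful := by
  have key : ∀ {C : Type (u + 1)} [Category.{u} C] {X Y Z X' W : C} (p : X ≅ Y) (q : Y ≅ Z) (t : Z ⟶ W)
      (m : X ⟶ X') (r : X' ≅ W), p.hom ≫ q.hom ≫ t = m ≫ r.hom → t ≫ r.inv = q.inv ≫ p.inv ≫ m := by
    intro C _ X Y Z X' W p q t m r h
    rw [Iso.comp_inv_eq, Category.assoc, Category.assoc, ← h, Iso.inv_hom_id_assoc,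
      Iso.inv_hom_id_assoc]
  exact ⟨{
    T := inducedFunctor χ hS F s
    additive := inferInstance
    linear := inferInstance
    ε := fun g => (NatIso.ofComponents (fun Y => M.pushIso hS hs g Y)
      (fun l => M.pushIso_naturality hS g l)).symm
    ε_mul := fun {g h l} e Y => key ((Ind.rightFunctor F _ (ι g)).mapIso (M.pushIso hS hs h Y))
      (M.pushIso hS hs g _) _ _ (M.pushIso hS hs l Y) (M.pushIso_mul hS hS' e (by rw [← map_mul, e]) Y)
    ε_one := fun Y => (Iso.inv_comp_eq _).2 (M.pushIso_one hS _ Y).symm },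
    inducedFunctor_full hP, inferInstance⟩

end ExtMorphism

end InducedLinear

end TwoDim

namespace TwoDim

/-! ### The case of one block. -/

namespace TwoDimLocalField

open scoped NNReal

variable {K : Type u} [Field K] {F : TwoDimLocalField K} [TopologicalSpace K] (hF : F.IsNaturalTopology)

/-- There are no pairs of distinct blocks, so block triangularity is an empty condition. -/
theorem parabolic_one : parabolic 1 K = ⊤ := by
  refine eq_top_iff.2 fun g _ => ?_
  intro i j hij
  exact absurd hij (by rw [Subsingleton.elim i.1 j.1]; exact lt_irrefl _)

theorem diagBlocks_oneBlock (g : GL (Fin 2) K) (h : oneBlock K g ∈ parabolic 1 K) :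
    diagBlocks 1 K ⟨oneBlock K g, h⟩ = fun _ => g := by
  refine funext fun i => Units.ext (Matrix.ext fun a b => ?_)
  rfl

/-- The product of extensions has a single factor, so the statement is read off at index 0; diagonal
blocks of congruence matrices are again congruence matrices of the same level. -/
theorem isConjCompatible_of_conj (F : TwoDimLocalField K) {A : Type} [CommGroup A] {E : Type u} [Group E]
    (S : GroupExtension A E (GL (Fin 2) K)) (j : F.congr (Fin 2) 0 →* E)
    (hj : ∀ x : E, ∃ m, ∀ u ∈ F.congr (Fin 2) m, ∀ (hu : u ∈ F.congr (Fin 2) 0) (v : F.congr (Fin 2) 0),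
      S.rightHom x * v * (S.rightHom x)⁻¹ = u → x * j v * x⁻¹ = j ⟨u, hu⟩)
    (s : SplittingOn (piExt S (Fin 1)) (diagBlocks 1 K) ((F.filtration (Fin 1 × Fin 2)).C 0))
    (hs : ∀ k i, s.s k i = extendByOne j (diagBlocks 1 K k i)) :
    SplittingOn.IsConjCompatible (F := F.filtration (Fin 1 × Fin 2)) s := by
  intro e p hep
  obtain ⟨m, hm⟩ := hj (e 0)
  refine ⟨m, fun u v hu hu0 hv0 huv => funext fun i => ?_⟩
  rw [Subsingleton.elim i 0]
  have hu' := F.diagBlocks_mem_congr (m := m) hu 0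
  have hu0' := F.diagBlocks_mem_congr (m := 0) hu0 0
  have hv0' := F.diagBlocks_mem_congr (m := 0) hv0 0
  have h1 := hm _ hu' hu0' ⟨_, hv0'⟩ (by
    have h2 := congrArg (fun t => diagBlocks 1 K t 0) huv
    have h3 := congrFun hep 0
    have h4 : S.rightHom (e 0) = diagBlocks 1 K p 0 := h3
    rw [h4]
    simp only [map_mul, map_inv] at h2
    exact h2)
  change e 0 * s.s v 0 * (e 0)⁻¹ = s.s u 0
  rw [hs, hs, extendByOne_of_mem j hv0', extendByOne_of_mem j hu0', h1]

/-- A morphism of central extensions to the extension defined by Haar measures gives a fully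
faithful functor to the category `V_a`. -/
theorem exists_gLinearFunctor (a : ℂ)
    (Φ : Steinberg.tildeSL₂ K ⋊[(Steinberg.hatData K).φ] Kˣ →*
      (Matrix.GeneralLinearGroup.det.comp ((haarTorsors hF (Fin 2)).extHom (baseLattice (Fin 2) hF))).ker
        ⋊[(haarHatData hF).φ] Kˣ)
    (κ : Steinberg.K₂ K →* ℝ≥0ˣ)
    (h1 : ∀ k, Φ ((Steinberg.hatData K).ext.inl k) = (haarHatData hF).ext.inl (κ k))
    (h2 : ∀ x, (haarHatData hF).ext.rightHom (Φ x) = (Steinberg.hatData K).ext.rightHom x) :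
    ∃ T : GLinearFunctor (steinbergAction ((cpowHom a).comp κ))
      ((principalSeriesAction hF (fun _ : Fin 1 => a)).comap (oneBlock K)), T.T.Full ∧ T.T.Faithful := by
  let M : ExtMorphism (Steinberg.hatData K).ext (piExt (haarHatData hF).ext (Fin 1)) (oneBlock K)
      (diagBlocks 1 K) :=
    { mem := fun g => parabolic_one (K := K) ▸ Subgroup.mem_top g
      Φ := MonoidHom.pi fun _ => Φ
      κ := MonoidHom.pi fun _ => κ
      Φ_inl := fun k => funext fun _ => h1 k
      rightHom_Φ := fun e => (funext fun _ => h2 e : _).trans (diagBlocks_oneBlock _ _).symm }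
  have e : (cpowProd fun _ : Fin 1 => a).comp M.κ = (cpowHom a).comp κ := MonoidHom.ext fun k => by
    simp [cpowProd, M]
  rw [← e]
  exact M.exists_gLinearFunctor (piExt_comm (haarHatData hF).ext_comm) (Steinberg.hatData K).ext_comm
    parabolic_one (isConjCompatible_of_conj F (haarHatData hF).ext (integralHatHom hF)
      (exists_conj_integralHatHom hF) (parabolicSplitting hF 1) fun _ _ => rfl)

end TwoDimLocalField

end TwoDim

namespace TwoDim

/-! ### Commutators in central extensions and uniqueness of Steinberg lifts. -/

section Central

open scoped commutatorElement

variable {A : Type v} {E : Type u} {Γ : Type w} [CommGroup A] [Group E] [Group Γ] (π : E →* Γ)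
  (inl : A →* E)

/-- Lifts of the same elements differ by central factors, and each of these cancels against its
inverse in the commutator. -/
theorem commutator_eq_of_map_eq (hrange : inl.range = π.ker) (hcomm : ∀ a x, inl a * x = x * inl a)
    {e e' f f' : E} (h : π e = π e') (h' : π f = π f') : ⁅e, f⁆ = ⁅e', f'⁆ := by
  have key : ∀ {e e' : E}, π e = π e' → ∃ a, e = inl a * e' := fun {e e'} h => by
    obtain ⟨a, ha⟩ : e * e'⁻¹ ∈ inl.range := by
      rw [hrange, MonoidHom.mem_ker, map_mul, map_inv, h, mul_inv_cancel]
    exact ⟨a, by rw [ha, inv_mul_cancel_right]⟩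
  obtain ⟨a, rfl⟩ := key h
  obtain ⟨b, rfl⟩ := key h'
  have ha : ∀ x, x * inl a = inl a * x := fun x => (hcomm a x).symm
  have hb : ∀ x, x * inl b = inl b * x := fun x => (hcomm b x).symm
  rw [commutatorElement_def, commutatorElement_def]
  calc inl a * e' * (inl b * f') * (inl a * e')⁻¹ * (inl b * f')⁻¹
      = inl a * (e' * inl b) * f' * e'⁻¹ * (inl a)⁻¹ * f'⁻¹ * (inl b)⁻¹ := by group
    _ = (inl a * inl b * (e' * f' * e'⁻¹) * (inl a)⁻¹) * f'⁻¹ * (inl b)⁻¹ := by rw [hb]; group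
    _ = inl b * (e' * f' * e'⁻¹) * f'⁻¹ * (inl b)⁻¹ := by
      rw [hcomm a (inl b), mul_assoc (inl b), hcomm a, ← mul_assoc, mul_inv_cancel_right]
    _ = _ := by
      rw [mul_assoc (inl b), hcomm b, mul_inv_cancel_right]

/-- Every generator of the Steinberg group is a commutator of two generators through a third index,
and a commutator in a central extension depends only on the images below. -/
theorem Steinberg.hom_ext_of_central {K : Type u'} [Field K] (hrange : inl.range = π.ker)
    (hcomm : ∀ a x, inl a * x = x * inl a) {f g : Steinberg.St K →* E} (h : ∀ s, π (f s) = π (g s)) :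
    f = g := Steinberg.hom_ext fun i j a => by
  rcases eq_or_ne i j with rfl | hij
  · rw [Steinberg.x_self, map_one, map_one]
  have h1 := Steinberg.x_comm (K := K) (i := i) (j := i + j + 1) (k := j) (by lia) (by lia) hij a 1
  rw [mul_one] at h1
  rw [← h1, map_commutatorElement, map_commutatorElement]
  exact commutator_eq_of_map_eq π inl hrange hcomm (h _) (h _)

end Central

/-! ### Splittings over stabilizers of arbitrary lattices, and maps of extensions. -/

namespace TorsorSystem

variable {A : Type v} {Γ : Type u} {L : Type w} [CommGroup A] [Group Γ] [PartialOrder L]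
  [MulAction Γ L] (T : TorsorSystem.{w, v, u, v'} A Γ L)

/-- The splitting of the extension over the stabilizer of an element `Λ`. -/
noncomputable def stabilizerHom (L₀ Λ : L) : MulAction.stabilizer Γ Λ →* T.ext L₀ :=
  -- If b is the element of the torsor of the pair `L₀`, `Λ` with coordinate β, this is the
  -- coordinate of the product of b with the inverse of its translate by g. It belongs to the pair
  -- `L₀`, `g • L₀` because g fixes `Λ`; multiplicativity is a telescoping product.
  MonoidHom.mk' (fun g => ⟨⟨fun s => (T.exists_baseChange L₀ Λ).choose s /
      (T.exists_baseChange L₀ Λ).choose ((g : Γ)⁻¹ • s), g⟩, mem_ext_of_exists fun s s' => by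
    have hβ := (T.exists_baseChange L₀ Λ).choose_spec
    generalize (T.exists_baseChange L₀ Λ).choose = β at hβ ⊢
    obtain ⟨N₀, h, h'⟩ := T.directed L₀ ((g : Γ) • L₀)
    obtain ⟨N, k, k'⟩ := T.directed N₀ Λ
    refine ⟨N, k.trans h, k.trans h', ?_⟩
    have e1 := hβ s s' N (k.trans h) k'
    have h1 : (g : Γ)⁻¹ • N ≤ L₀ := by
      have := T.smul_le (g : Γ)⁻¹ (k.trans h')
      rwa [inv_smul_smul] at this
    have hg : (g : Γ) • Λ = Λ := g.2
    have hg' : (g : Γ)⁻¹ • Λ = Λ := by rw [inv_smul_eq_iff, hg]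
    have h2 : (g : Γ)⁻¹ • N ≤ Λ := by
      have := T.smul_le (g : Γ)⁻¹ k'
      rwa [hg'] at this
    have e2 := hβ ((g : Γ)⁻¹ • s) ((g : Γ)⁻¹ • s') _ h1 h2
    have e3 : ratio ((g : Γ)⁻¹ • s') ((g : Γ)⁻¹ • s) h1 = ratio s' s (k.trans h') :=
      (ratio_smul ..).trans (ratio_congr _ _ _ _ (by rw [inv_inv, smul_inv_smul]) (by rw [inv_inv]))
    have e4 : ratio ((g : Γ)⁻¹ • s') ((g : Γ)⁻¹ • s) h2 = ratio s' s k' :=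
      (ratio_smul ..).trans (ratio_congr _ _ _ _ (by rw [inv_inv, smul_inv_smul]) (by rw [inv_inv, hg]))
    rw [e3, e4] at e2
    change β s / β ((g : Γ)⁻¹ • s) * _ = β s' / β ((g : Γ)⁻¹ • s') * _
    rw [div_mul_eq_mul_div, div_mul_eq_mul_div, div_eq_div_iff_mul_eq_mul, e1,
      mul_right_comm, mul_assoc (β s'), mul_assoc (β s'), ← e2, mul_comm (ratio s' s (k.trans h'))]⟩)
    fun g h => Subtype.ext (SemidirectProduct.ext (funext fun s => by
      have e : ((g * h : MulAction.stabilizer Γ Λ) : Γ)⁻¹ • s = (h : Γ)⁻¹ • (g : Γ)⁻¹ • s := by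
        rw [Subgroup.coe_mul, mul_inv_rev, mul_smul]
      exact (congrArg (fun t => (T.exists_baseChange L₀ Λ).choose s / (T.exists_baseChange L₀ Λ).choose t)
        e).trans (div_mul_div_cancel _ _ _).symm) rfl)

variable {T} {Γ' : Type u'} {L' : Type*} [Group Γ'] [PartialOrder L'] [MulAction Γ' L']
  {T' : TorsorSystem A Γ' L'}

/-- A homomorphism of extensions defined by a restriction map of trivializations. -/
def extMap (ι : Γ' →* Γ) (r : L' → L) (hr : ∀ {N Λ}, N ≤ Λ → r N ≤ r Λ)
    (hι : ∀ g N, r (g • N) = ι g • r N) (R : T.Triv → T'.Triv) (hR : ∀ g s, R (ι g • s) = g • R s)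
    (hratio : ∀ (s s' : T.Triv) {N Λ : L'} (h : N ≤ Λ), ratio (R s') (R s) h = ratio s' s (hr h))
    (L₀ : L') (L₁ : L) (h₀ : r L₀ = L₁) : T'.ext L₀ →* T.ext L₁ :=
  MonoidHom.mk' (fun x => ⟨⟨fun s => x.1.left (R s), ι x.1.right⟩, mem_ext_of_exists fun s s' => by
    obtain ⟨N, h, h'⟩ := T'.directed L₀ (x.1.right • L₀)
    have e := x.2 (R s) (R s') N h h'
    refine ⟨r N, h₀ ▸ hr h, h₀ ▸ hι x.1.right L₀ ▸ hr h', ?_⟩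
    rw [hratio, hratio] at e
    refine Eq.trans ?_ (e.trans ?_)
    · exact congrArg (_ * ·) (ratio_congr _ _ _ _ rfl h₀.symm)
    · exact congrArg (_ * ·) (ratio_congr _ _ _ _ rfl ((hι _ _).trans (congrArg _ h₀)))⟩)
    fun x y => Subtype.ext (SemidirectProduct.ext (funext fun s => by
      change x.1.left (R s) * y.1.left (x.1.right⁻¹ • R s) =
        x.1.left (R s) * y.1.left (R ((ι x.1.right)⁻¹ • s))
      rw [← map_inv, hR]) (_root_.map_mul ι _ _))

end TorsorSystem

/-! ### Comparison of Haar measures for lattices in different groups. -/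

section HaarMaps

open MeasureTheory MeasureTheory.Measure
open scoped NNReal CompactlySupported
open LQuot

variable {V : Type v} [AddCommGroup V] [TopologicalSpace V] {W : Type w} [AddCommGroup W]
  [TopologicalSpace W] [IsTopologicalAddGroup V] [IsTopologicalAddGroup W]

/-- The homomorphism of quotients defined by a homomorphism. -/
def LQuot.mapOf (f : V →+ W) {N Λ : AddSubgroup V} {N' Λ' : AddSubgroup W} (hN : N ≤ N'.comap f)
    (hΛ : Λ ≤ Λ'.comap f) : LQuot N Λ →+ LQuot N' Λ' :=
  QuotientAddGroup.map _ _ ((f.comp Λ.subtype).codRestrict Λ' fun x => hΛ x.2) fun _ hx => hN hx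

theorem LQuot.continuous_mapOf {f : V →+ W} (hf : Continuous f) {N Λ : AddSubgroup V}
    {N' Λ' : AddSubgroup W} (hN : N ≤ N'.comap f) (hΛ : Λ ≤ Λ'.comap f) :
    Continuous (LQuot.mapOf f hN hΛ) := by
  rw [(isOpenQuotientMap_mk N Λ).continuous_comp_iff.symm]
  exact (isOpenQuotientMap_mk N' Λ').continuous.comp
    ((hf.comp continuous_subtype_val).subtype_mk _)

/-- An isomorphism of quotients defined by homomorphisms which are inverse to each other on the
quotients. -/
def LQuot.homeo (f : V →+ W) (s : W →+ V) (hf : Continuous f) (hs : Continuous s)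
    {N Λ : AddSubgroup V} {N' Λ' : AddSubgroup W} (hN : N ≤ N'.comap f) (hΛ : Λ ≤ Λ'.comap f)
    (hN' : N' ≤ N.comap s) (hΛ' : Λ' ≤ Λ.comap s) (h : ∀ x ∈ Λ, s (f x) - x ∈ N)
    (h' : ∀ y ∈ Λ', f (s y) - y ∈ N') : LQuot N Λ ≃ₜ+ LQuot N' Λ' where
  toFun := LQuot.mapOf f hN hΛ
  invFun := LQuot.mapOf s hN' hΛ'
  left_inv x := by
    obtain ⟨x, rfl⟩ := mk_surjective _ _ x
    exact (LQuot.mk_eq _ _).2 (h x x.2)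
  right_inv x := by
    obtain ⟨x, rfl⟩ := mk_surjective _ _ x
    exact (LQuot.mk_eq _ _).2 (h' x x.2)
  map_add' := map_add _
  continuous_toFun := continuous_mapOf hf _ _
  continuous_invFun := continuous_mapOf hs _ _

namespace HaarMeas

/-- The image of a Haar measure under an isomorphism of quotients in different groups. -/
noncomputable def transfer {N Λ : AddSubgroup V} {N' Λ' : AddSubgroup W} (e : LQuot N Λ ≃ₜ+ LQuot N' Λ')
    (μ : HaarMeas N Λ) : HaarMeas N' Λ' :=
  ⟨μ.1.map e, inferInstance, Regular.map e.toHomeomorph⟩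

theorem integral_transfer {N Λ : AddSubgroup V} {N' Λ' : AddSubgroup W} (e : LQuot N Λ ≃ₜ+ LQuot N' Λ')
    (μ : HaarMeas N Λ) (f : LQuot N' Λ' → ℝ) : ∫ x, f x ∂(transfer e μ).1 = ∫ x, f (e x) ∂μ.1 :=
  e.toHomeomorph.isClosedEmbedding.measurableEmbedding.integral_map f

theorem transfer_smul {N Λ : AddSubgroup V} {N' Λ' : AddSubgroup W} (e : LQuot N Λ ≃ₜ+ LQuot N' Λ')
    (c : ℝ≥0ˣ) (μ : HaarMeas N Λ) : transfer e (c • μ) = c • transfer e μ :=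
  HaarMeas.ext (Measure.map_smul _ _ _)

/-- The argument is that of `HaarMeas.map_mul`, now for two ambient groups: both measures integrate
a test function first over the fibres and then over the base, and the isomorphisms match these two
steps. -/
theorem transfer_mul {N₁ N₂ N₃ : AddSubgroup V} {M₁ M₂ M₃ : AddSubgroup W}
    [LocallyCompactSpace (LQuot N₁ N₃)] [T2Space (LQuot N₁ N₃)]
    [LocallyCompactSpace (LQuot M₁ M₃)] [T2Space (LQuot M₁ M₃)]
    (h₁ : N₁ ≤ N₂) (h₂ : N₂ ≤ N₃) (h₁' : M₁ ≤ M₂) (h₂' : M₂ ≤ M₃) (hN : IsClosed (N₂ : Set V))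
    (hM : IsClosed (M₂ : Set W)) (e : LQuot N₁ N₃ ≃ₜ+ LQuot M₁ M₃) (i : LQuot N₁ N₂ ≃ₜ+ LQuot M₁ M₂)
    (p : LQuot N₂ N₃ ≃ₜ+ LQuot M₂ M₃) (hi : ∀ x, e (incl h₂ x) = incl h₂' (i x))
    (hp : ∀ x, p (proj h₁ x) = proj h₁' (e x)) (x : HaarMeas N₁ N₂) (y : HaarMeas N₂ N₃) :
    transfer e (mul h₁ h₂ hN x y) = mul h₁' h₂' hM (transfer i x) (transfer p y) := by
  refine ext_integral fun f => ?_
  rw [integral_transfer, integral_mul, integral_transfer]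
  refine (integral_mul h₁ h₂ hN x y (f.comp e.toHomeomorph.toCocompactMap)).trans ?_
  refine integral_congr_ae (.of_forall fun c => ?_)
  refine push_eq _ _ hN _ _ (fun c => push h₁' h₂' hM (transfer i x) f (p c)) (fun b => ?_) c
  rw [hp, push_proj, integral_transfer]
  refine integral_congr_ae (.of_forall fun a => ?_)
  refine congrArg f ?_
  rw [← hi, ← map_add]
  rfl

end HaarMeas

/-- A system of lattices `D'` in `W` as a part of a system `D` of lattices in `V`: the lattices
`Λ` of `D'` have extensions `r Λ` to `V` such that `r Λ / r N ≅ Λ / N`. -/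
structure LatticeSystem.Extension {Γ : Type u} [Group Γ] {Γ' : Type u'} [Group Γ']
    (D : LatticeSystem Γ V) (D' : LatticeSystem Γ' W) (ι : Γ' →* Γ) where
  r : D'.Lat → D.Lat
  mono : ∀ {N Λ}, N ≤ Λ → r N ≤ r Λ
  r_smul : ∀ g N, r (g • N) = ι g • r N
  f : V →+ W
  s : W →+ V
  continuous_f : Continuous f
  continuous_s : Continuous s
  f_mem : ∀ Λ, (r Λ).1 ≤ Λ.1.comap f
  s_mem : ∀ Λ, Λ.1 ≤ (r Λ).1.comap s
  f_s : ∀ y, f (s y) = y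
  s_f : ∀ N Λ, ∀ x ∈ (r Λ).1, s (f x) - x ∈ (r N).1
  f_ρ : ∀ g x, f (D.ρ (ι g) x) = D'.ρ g (f x)

namespace LatticeSystem.Extension

open TorsorSystem

variable {Γ : Type u} [Group Γ] {Γ' : Type u'} [Group Γ'] {D : LatticeSystem Γ V}
  {D' : LatticeSystem Γ' W} {ι : Γ' →* Γ} (X : D.Extension D' ι)

/-- The isomorphism `r Λ / r N ≅ Λ / N`. -/
def equiv (N Λ : D'.Lat) : LQuot (X.r N).1 (X.r Λ).1 ≃ₜ+ LQuot N.1 Λ.1 :=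
  LQuot.homeo X.f X.s X.continuous_f X.continuous_s (X.f_mem N) (X.f_mem Λ) (X.s_mem N) (X.s_mem Λ)
    (X.s_f N Λ) fun y _ => by rw [X.f_s, sub_self]; exact zero_mem _

/-- The restriction of trivializations. -/
noncomputable def restrict (t : D.torsors.Triv) : D'.torsors.Triv where
  val {N Λ} h := HaarMeas.transfer (X.equiv N Λ) (t.1 (X.mono h))
  mul {M N Λ} h h' := by
    have := D.lc (X.mono (h.trans h'))
    have := D.t2 (X.r M) (X.r Λ)
    have := D'.lc (h.trans h')
    have := D'.t2 M Λ
    rw [← t.2 (X.mono h) (X.mono h')]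
    refine (HaarMeas.transfer_mul (X.mono h) (X.mono h') h h' (D.closed _ (X.r N).2) (D'.closed _ N.2)
      (X.equiv M Λ) (X.equiv M N) (X.equiv N Λ) (fun x => ?_) (fun x => ?_) _ _).symm
    · obtain ⟨x, rfl⟩ := mk_surjective _ _ x
      rfl
    · obtain ⟨x, rfl⟩ := mk_surjective _ _ x
      rfl

/-- Both sides are push-forwards of the same measure under two composites of isomorphisms, which
agree by equivariance of the projection `X.f`. -/
theorem restrict_smul (g : Γ') (t : D.torsors.Triv) : X.restrict (ι g • t) = g • X.restrict t := by
  refine Triv.ext <| funext fun N => funext fun Λ => funext fun h => ?_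
  have e1 : ∀ N, ι g • X.r (g⁻¹ • N) = X.r N := fun N => by rw [← X.r_smul, smul_inv_smul]
  have h1 : (ι g • t).1 (X.mono h) = D.torsors.map (ι g) (X.mono (D'.torsors.smul_le g⁻¹ h)) (X.mono h)
      (e1 N) (e1 Λ) (t.1 _) := t.map_congr ..
  refine (congrArg (HaarMeas.transfer (X.equiv N Λ)) h1).trans (HaarMeas.ext ?_)
  change Measure.map (X.equiv N Λ) (Measure.map (D.equiv (ι g) (e1 N) (e1 Λ)) _) =
    Measure.map (D'.equiv g (smul_inv_smul g N) (smul_inv_smul g Λ)) (Measure.map (X.equiv _ _) _)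
  have m1 : Measurable (X.equiv N Λ) := (X.equiv N Λ).continuous_toFun.measurable
  have m2 : Measurable (X.equiv (g⁻¹ • N) (g⁻¹ • Λ)) := (X.equiv _ _).continuous_toFun.measurable
  have m3 : Measurable (D.equiv (ι g) (e1 N) (e1 Λ)) := (D.equiv (ι g) (e1 N) (e1 Λ)).continuous_toFun.measurable
  have m4 : Measurable (D'.equiv g (smul_inv_smul g N) (smul_inv_smul g Λ)) :=
    (D'.equiv g (smul_inv_smul g N) (smul_inv_smul g Λ)).continuous_toFun.measurable
  rw [Measure.map_map m1 m3, Measure.map_map m4 m2]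
  congr 1
  funext y
  obtain ⟨y, rfl⟩ := mk_surjective _ _ y
  exact congrArg _ (Subtype.ext (X.f_ρ g y))

/-- Transport of measures commutes with scaling, so ratios survive restriction. This makes
`X.extMap` the identity on the central subgroup. -/
theorem ratio_restrict (t t' : D.torsors.Triv) {N Λ : D'.Lat} (h : N ≤ Λ) :
    ratio (X.restrict t') (X.restrict t) h = ratio t' t (X.mono h) := by
  refine ratio_eq ?_
  refine (HaarMeas.transfer_smul (X.equiv N Λ) _ _).symm.trans ?_
  exact congrArg (HaarMeas.transfer (X.equiv N Λ)) (ratio_spec t' t (X.mono h))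

/-- The homomorphism between the extensions defined by Haar measures. -/
noncomputable def extMap (L₀ : D'.Lat) (L₁ : D.Lat) (h : X.r L₀ = L₁) :
    D'.torsors.ext L₀ →* D.torsors.ext L₁ :=
  TorsorSystem.extMap ι X.r X.mono X.r_smul X.restrict X.restrict_smul X.ratio_restrict L₀ L₁ h

theorem extMap_extInl (L₀ : D'.Lat) (L₁ : D.Lat) (h : X.r L₀ = L₁) (a : ℝ≥0ˣ) :
    X.extMap L₀ L₁ h (D'.torsors.extInl L₀ a) = D.torsors.extInl L₁ a :=
  Subtype.ext (SemidirectProduct.ext rfl (map_one ι))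

end LatticeSystem.Extension

end HaarMaps

end TwoDim

namespace TwoDim

/-! ### Infinite matrices that involve only finitely many coordinates. -/

namespace Steinberg

variable {K : Type u} [Field K]

/-- The first coordinates of a finite sequence. -/
def firstCoords (N : ℕ) : (ℕ →₀ K) →ₗ[K] (Fin N → K) where
  toFun v i := v i
  map_add' _ _ := rfl
  map_smul' _ _ := rfl

theorem firstCoords_apply (N : ℕ) (v : ℕ →₀ K) (i : Fin N) : firstCoords N v i = v i := rfl

/-- The extension of a vector by zeros. -/
noncomputable def extZero (N : ℕ) : (Fin N → K) →ₗ[K] (ℕ →₀ K) where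
  toFun y := Finsupp.onFinset (Finset.range N) (fun j => if h : j < N then y ⟨j, h⟩ else 0) fun j hj => by
    by_contra h
    rw [Finset.mem_range] at h
    simp [h] at hj
  map_add' y z := Finsupp.ext fun j => by
    by_cases h : j < N <;> simp [h]
  map_smul' c y := Finsupp.ext fun j => by
    by_cases h : j < N <;> simp [h]

theorem extZero_of_lt {N j : ℕ} (h : j < N) (y : Fin N → K) : extZero N y j = y ⟨j, h⟩ := dif_pos h

theorem extZero_of_le {N j : ℕ} (h : N ≤ j) (y : Fin N → K) : extZero N y j = 0 := dif_neg h.not_gt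

theorem firstCoords_extZero (N : ℕ) (y : Fin N → K) : firstCoords N (extZero N y) = y :=
  funext fun i => extZero_of_lt i.2 y

/-- An automorphism which only involves the first `N` coordinates. -/
def IsBlock (N : ℕ) (g : (Mat K)ˣ) : Prop :=
  (∀ v i, N ≤ i → g.1 v i = v i) ∧ ∀ v : ℕ →₀ K, (∀ j < N, v j = 0) → g.1 v = v

theorem IsBlock.mono {N M : ℕ} (h : N ≤ M) {g : (Mat K)ˣ} (hg : IsBlock N g) : IsBlock M g :=
  ⟨fun v i hi => hg.1 v i (h.trans hi), fun v hv => hg.2 v fun j hj => hv j (hj.trans_le h)⟩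

theorem IsBlock.mul {N : ℕ} {g g' : (Mat K)ˣ} (hg : IsBlock N g) (hg' : IsBlock N g') :
    IsBlock N (g * g') :=
  ⟨fun v i hi => (hg.1 _ i hi).trans (hg'.1 v i hi),
    fun v hv => (congrArg g.1 (hg'.2 v hv)).trans (hg.2 v hv)⟩

theorem unit_apply_inv (g : (Mat K)ˣ) (v : ℕ →₀ K) : g.1 ((g⁻¹).1 v) = v :=
  LinearMap.congr_fun g.mul_inv v

theorem unit_inv_apply (g : (Mat K)ˣ) (v : ℕ →₀ K) : (g⁻¹).1 (g.1 v) = v :=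
  LinearMap.congr_fun g.inv_mul v

theorem IsBlock.inv {N : ℕ} {g : (Mat K)ˣ} (hg : IsBlock N g) : IsBlock N g⁻¹ :=
  ⟨fun v i hi => by rw [← hg.1 ((g⁻¹).1 v) i hi, unit_apply_inv],
    fun v hv => by rw [← congrArg (g⁻¹).1 (hg.2 v hv), unit_inv_apply]⟩

theorem isBlock_one (N : ℕ) : IsBlock N (1 : (Mat K)ˣ) := ⟨fun _ _ _ => rfl, fun _ _ => rfl⟩

variable (K) in
/-- The group of automorphisms which only involve finitely many coordinates. -/
def finMat : Subgroup (Mat K)ˣ where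
  carrier := {g | ∃ N, IsBlock N g}
  one_mem' := ⟨0, isBlock_one 0⟩
  mul_mem' := fun ⟨N, h⟩ ⟨M, h'⟩ => ⟨max N M, (h.mono (le_max_left _ _)).mul (h'.mono (le_max_right _ _))⟩
  inv_mem' := fun ⟨N, h⟩ => ⟨N, h.inv⟩

/-- The tail of `v` is fixed by `g`, so it contributes nothing to the first coordinates of the
image. -/
theorem IsBlock.firstCoords_extZero_firstCoords {N : ℕ} {g : (Mat K)ˣ} (hg : IsBlock N g) (v : ℕ →₀ K) :
    firstCoords N (g.1 (extZero N (firstCoords N v))) = firstCoords N (g.1 v) := by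
  have h1 : ∀ j < N, (v - extZero N (firstCoords N v)) j = 0 := fun j hj => by
    rw [Finsupp.sub_apply, extZero_of_lt hj, firstCoords_apply, sub_self]
  have h2 := hg.2 _ h1
  rw [map_sub, sub_eq_iff_eq_add] at h2
  rw [h2, map_add, map_sub, firstCoords_extZero, sub_self, zero_add]

/-- The invertible matrix of an automorphism which only involves the first `N` coordinates. -/
theorem IsBlock.exists_matrix {N : ℕ} {g : (Mat K)ˣ} (hg : IsBlock N g) :
    ∃ h : GL (Fin N) K, ∀ v, firstCoords N (g.1 v) = TwoDimLocalField.matAct (Fin N) h (firstCoords N v) := by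
  let f : (Mat K)ˣ → ((Fin N → K) →ₗ[K] (Fin N → K)) := fun g => firstCoords N ∘ₗ g.1 ∘ₗ extZero N
  have key : ∀ g : (Mat K)ˣ, IsBlock N g → f g ∘ₗ f g⁻¹ = LinearMap.id := fun g hg =>
    LinearMap.ext fun y => by
      change firstCoords N (g.1 (extZero N (firstCoords N ((g⁻¹).1 (extZero N y))))) = y
      rw [hg.firstCoords_extZero_firstCoords, unit_apply_inv, firstCoords_extZero]
  refine ⟨⟨LinearMap.toMatrix' (f g), LinearMap.toMatrix' (f g⁻¹), ?_, ?_⟩, fun v => ?_⟩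
  · rw [← LinearMap.toMatrix'_comp, key g hg, LinearMap.toMatrix'_id]
  · have := key g⁻¹ hg.inv
    rw [inv_inv] at this
    rw [← LinearMap.toMatrix'_comp, this, LinearMap.toMatrix'_id]
  · refine Eq.trans ?_ (LinearMap.toMatrix'_mulVec (f g) (firstCoords N v)).symm
    exact (hg.firstCoords_extZero_firstCoords v).symm

/-- The automorphism defined by an invertible matrix. -/
noncomputable def ofMatrix {N : ℕ} (h : GL (Fin N) K) : (Mat K)ˣ :=
  have key : ∀ h : GL (Fin N) K, ∀ v : ℕ →₀ K, v + extZero N (h.1.mulVec (firstCoords N v) - firstCoords N v) +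
      extZero N ((h⁻¹).1.mulVec (firstCoords N (v + extZero N (h.1.mulVec (firstCoords N v) - firstCoords N v))) -
        firstCoords N (v + extZero N (h.1.mulVec (firstCoords N v) - firstCoords N v))) = v := fun h v => by
    rw [map_add, firstCoords_extZero, add_sub_cancel, Matrix.mulVec_mulVec, ← Units.val_mul, inv_mul_cancel,
      Units.val_one, Matrix.one_mulVec, add_assoc, ← map_add, sub_add_sub_cancel, sub_self, map_zero, add_zero]
  { val := LinearMap.id + extZero N ∘ₗ (h.1.mulVecLin - LinearMap.id) ∘ₗ firstCoords N
    inv := LinearMap.id + extZero N ∘ₗ ((h⁻¹).1.mulVecLin - LinearMap.id) ∘ₗ firstCoords N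
    val_inv := LinearMap.ext fun v => by
      have := key h⁻¹ v
      rw [inv_inv] at this
      exact this
    inv_val := LinearMap.ext fun v => key h v }

theorem ofMatrix_apply {N : ℕ} (h : GL (Fin N) K) (v : ℕ →₀ K) :
    (ofMatrix h).1 v = v + extZero N (h.1.mulVec (firstCoords N v) - firstCoords N v) := rfl

theorem firstCoords_ofMatrix {N : ℕ} (h : GL (Fin N) K) (v : ℕ →₀ K) :
    firstCoords N ((ofMatrix h).1 v) = TwoDimLocalField.matAct (Fin N) h (firstCoords N v) := by
  rw [ofMatrix_apply, map_add, firstCoords_extZero, add_sub_cancel]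
  rfl

theorem isBlock_ofMatrix {N : ℕ} (h : GL (Fin N) K) : IsBlock N (ofMatrix h) :=
  ⟨fun v i hi => by rw [ofMatrix_apply, Finsupp.add_apply, extZero_of_le hi, add_zero],
    fun v hv => by
      have : firstCoords N v = 0 := funext fun i => hv i i.2
      rw [ofMatrix_apply, this, Matrix.mulVec_zero, sub_zero, map_zero, add_zero]⟩

theorem isBlock_elem (i j : ℕ) (a : K) : IsBlock (i + j + 1) (elem i j a) := by
  rcases eq_or_ne i j with rfl | h
  · rw [elem, elemOf_self]
    exact isBlock_one _
  refine ⟨fun v k hk => ?_, fun v hv => ?_⟩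
  · rw [elem_apply h, Finsupp.add_apply, Finsupp.single_apply, if_neg (by lia), add_zero]
  · rw [elem_apply h, hv j (by lia), mul_zero, Finsupp.single_zero, add_zero]

theorem toMat_mem (s : St K) : toMat s ∈ finMat K := by
  induction s using induction with
  | h i j a => exact toMat_x (K := K) i j a ▸ ⟨_, isBlock_elem i j a⟩
  | hmul s t hs ht => rw [map_mul]; exact mul_mem hs ht
  | hinv s hs => rw [map_inv]; exact inv_mem hs

variable (K) in
/-- The homomorphism from the Steinberg group to the group of automorphisms which only involve
finitely many coordinates. -/
noncomputable def toFin : St K →* finMat K := toMat.codRestrict _ toMat_mem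

theorem firstCoords_block (g : GL (Fin 2) K) (v : ℕ →₀ K) :
    firstCoords 2 ((block firstTwo g).1 v) = TwoDimLocalField.matAct (Fin 2) g (firstCoords 2 v) := by
  refine funext fun i => ?_
  rw [firstCoords_apply, block_apply, TwoDimLocalField.matAct_apply]
  simp only [firstTwo, Fin.sum_univ_two, Matrix.mulVec, dotProduct, Finsupp.add_apply, Finsupp.single_apply,
    Matrix.sub_apply, Matrix.one_apply, firstCoords_apply, Function.Embedding.coeFn_mk]
  fin_cases i <;> simp <;> ring

theorem isBlock_block (g : GL (Fin 2) K) : IsBlock 2 (block firstTwo g) := by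
  refine ⟨fun v i hi => ?_, fun v hv => ?_⟩
  · rw [block_apply]
    have h : ∀ k : Fin 2, (k : ℕ) ≠ i := fun k => by lia
    simp [firstTwo, Fin.sum_univ_two, h, Finsupp.single_apply, show ¬ 0 = i by lia, show ¬ 1 = i by lia]
  · rw [block_apply]
    have h : ∀ k : Fin 2, v k = 0 := fun k => hv k k.2
    simp [firstTwo, h]

/-- The embedding of `GL₂(K)`. -/
noncomputable def blockFin : GL (Fin 2) K →* finMat K :=
  (block firstTwo).codRestrict _ fun g => ⟨2, isBlock_block g⟩

end Steinberg

/-! ### Lattices of finite sequences. -/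

namespace TwoDimLocalField

open Steinberg

variable {K : Type u} [Field K] (F : TwoDimLocalField K)

/-- The lattice of finite sequences with initial part in a given lattice and all other terms in
`O`. -/
def extLattice (N : ℕ) (Λ : AddSubgroup (Fin N → K)) : AddSubgroup (ℕ →₀ K) where
  carrier := {v | firstCoords N v ∈ Λ ∧ ∀ i, N ≤ i → v i ∈ F.O}
  zero_mem' := ⟨by rw [map_zero]; exact zero_mem _, fun _ _ => zero_mem _⟩
  add_mem' hv hw := ⟨by rw [map_add]; exact add_mem hv.1 hw.1, fun i hi => add_mem (hv.2 i hi) (hw.2 i hi)⟩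
  neg_mem' hv := ⟨by rw [map_neg]; exact neg_mem hv.1, fun i hi => neg_mem (hv.2 i hi)⟩

/-- The automorphism of the additive group defined by a linear automorphism. -/
noncomputable def finAct (g : finMat K) : (ℕ →₀ K) →+ (ℕ →₀ K) := g.1.1.toAddMonoidHom

theorem finAct_mul (g h : finMat K) : finAct (g * h) = (finAct g).comp (finAct h) := rfl

theorem extLattice_mono {N : ℕ} {Λ Λ' : AddSubgroup (Fin N → K)} (h : Λ ≤ Λ') :
    F.extLattice N Λ ≤ F.extLattice N Λ' := fun _ hv => ⟨h hv.1, hv.2⟩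

theorem le_of_extLattice_le {N : ℕ} {Λ Λ' : AddSubgroup (Fin N → K)}
    (h : F.extLattice N Λ ≤ F.extLattice N Λ') : Λ ≤ Λ' := fun y hy => by
  have := (h (x := extZero N y) ⟨by rwa [firstCoords_extZero], fun i hi => by
    rw [extZero_of_le hi]; exact zero_mem _⟩).1
  rwa [firstCoords_extZero] at this

/-- The automorphism acts through `h` on the first coordinates and leaves the others alone;
preimages are found with the inverse automorphism. -/
theorem extLattice_map {N : ℕ} (Λ : AddSubgroup (Fin N → K)) (g : finMat K) (hg : IsBlock N g.1)
    (h : GL (Fin N) K) (hh : ∀ v, firstCoords N (g.1.1 v) = matAct (Fin N) h (firstCoords N v)) :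
    (F.extLattice N Λ).map (finAct g) = F.extLattice N (Λ.map (matAct (Fin N) h)) := by
  ext v
  constructor
  · rintro ⟨v, hv, rfl⟩
    refine ⟨?_, fun i hi => ?_⟩
    · exact ⟨_, hv.1, (hh v).symm⟩
    · have := hv.2 i hi
      rwa [← hg.1 v i hi] at this
  · rintro ⟨⟨y, hy, e⟩, hv⟩
    refine ⟨(g.1⁻¹).1 v, ⟨?_, fun i hi => ?_⟩, unit_apply_inv g.1 v⟩
    · have h1 := hh ((g.1⁻¹).1 v)
      rw [unit_apply_inv, ← e] at h1
      have h2 := congrArg (matAct (Fin N) h⁻¹) h1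
      rw [matAct_inv, matAct_inv] at h2
      rw [← h2]
      exact hy
    · rw [hg.inv.1 v i hi]
      exact hv i hi

variable (K) in
/-- The lattice of finite sequences in `O`. -/
def infLattice : AddSubgroup (ℕ →₀ K) where
  carrier := {v | ∀ i, v i ∈ F.O}
  zero_mem' _ := zero_mem _
  add_mem' hv hw i := add_mem (hv i) (hw i)
  neg_mem' hv i := neg_mem (hv i)

theorem infLattice_eq (N : ℕ) : F.infLattice K = F.extLattice N (F.stdLattice (Fin N)) := by
  ext v
  refine ⟨fun h => ⟨fun i => h i, fun i _ => h i⟩, fun h i => ?_⟩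
  rcases lt_or_ge i N with hi | hi
  · exact h.1 ⟨i, hi⟩
  · exact h.2 i hi

/-- The lattices `g O^ℕ` of finite sequences. -/
def infLattices : Set (AddSubgroup (ℕ →₀ K)) := {Λ | ∃ g : finMat K, Λ = (F.infLattice K).map (finAct g)}

/-- With `extLattice_mem` this identifies the lattices of finite sequences with the extensions of
lattices in finite-dimensional spaces. -/
theorem exists_extLattice (g : finMat K) {N : ℕ} (hg : IsBlock N g.1) :
    ∃ Λ ∈ F.lattices (Fin N), (F.infLattice K).map (finAct g) = F.extLattice N Λ := by
  obtain ⟨h, hh⟩ := hg.exists_matrix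
  exact ⟨_, ⟨h, rfl⟩, by rw [F.infLattice_eq N, F.extLattice_map _ g hg h hh]⟩

theorem extLattice_mem {N : ℕ} {Λ : AddSubgroup (Fin N → K)} (hΛ : Λ ∈ F.lattices (Fin N)) :
    F.extLattice N Λ ∈ F.infLattices := by
  obtain ⟨h, rfl⟩ := hΛ
  refine ⟨⟨ofMatrix h, N, isBlock_ofMatrix h⟩, ?_⟩
  rw [F.infLattice_eq N, F.extLattice_map _ _ (isBlock_ofMatrix h) h (firstCoords_ofMatrix h)]

/-- A matrix block may be enlarged, so both lattices are described with the same number of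
coordinates. This reduces local compactness and directedness to finite dimension. -/
theorem exists_extLattice₂ {Λ Λ' : AddSubgroup (ℕ →₀ K)} (h : Λ ∈ F.infLattices) (h' : Λ' ∈ F.infLattices) :
    ∃ (N : ℕ) (M M' : AddSubgroup (Fin N → K)), M ∈ F.lattices (Fin N) ∧ M' ∈ F.lattices (Fin N) ∧
      Λ = F.extLattice N M ∧ Λ' = F.extLattice N M' := by
  obtain ⟨⟨g, n, hn⟩, rfl⟩ := h
  obtain ⟨⟨g', n', hn'⟩, rfl⟩ := h'
  obtain ⟨M, hM, e⟩ := F.exists_extLattice ⟨g, n, hn⟩ (hn.mono (le_max_left n n'))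
  obtain ⟨M', hM', e'⟩ := F.exists_extLattice ⟨g', n', hn'⟩ (hn'.mono (le_max_right n n'))
  exact ⟨_, M, M', hM, hM', e, e'⟩

variable {F} [TopologicalSpace K]

/-- The topology of coordinatewise convergence. -/
instance : TopologicalSpace (ℕ →₀ K) := TopologicalSpace.induced (fun v => (v : ℕ → K)) inferInstance

theorem continuous_finsupp_apply (i : ℕ) : Continuous fun v : ℕ →₀ K => v i :=
  (continuous_apply i).comp continuous_induced_dom

theorem continuous_firstCoords (N : ℕ) : Continuous (firstCoords (K := K) N) :=
  continuous_pi fun i => continuous_finsupp_apply i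

theorem continuous_extZero (N : ℕ) : Continuous (extZero (K := K) N) := by
  refine continuous_induced_rng.2 (continuous_pi fun i => ?_)
  rcases lt_or_ge i N with hi | hi
  · exact (continuous_apply (⟨i, hi⟩ : Fin N)).congr fun y => (extZero_of_lt hi y).symm
  · exact continuous_const.congr fun y => (extZero_of_le hi y).symm

theorem isTopologicalAddGroup_finsupp (hF : F.IsNaturalTopology) : IsTopologicalAddGroup (ℕ →₀ K) := by
  have := hF.isTopologicalAddGroup
  exact topologicalAddGroup_induced (Finsupp.coeFnAddHom : (ℕ →₀ K) →+ (ℕ → K))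

/-- For coordinatewise convergence it suffices to look at each coordinate of the image: it is given
by a finite matrix or is unchanged. -/
theorem continuous_finAct (hF : F.IsNaturalTopology) (g : finMat K) : Continuous (finAct g) := by
  obtain ⟨g, N, hg⟩ := g
  obtain ⟨h, hh⟩ := hg.exists_matrix
  refine continuous_induced_rng.2 (continuous_pi fun i => ?_)
  rcases lt_or_ge i N with hi | hi
  · exact (((continuous_apply (⟨i, hi⟩ : Fin N)).comp (continuous_matAct (Fin N) hF h)).comp
      (continuous_firstCoords N)).congr fun v => (congrFun (hh v) ⟨i, hi⟩).symm
  · exact (continuous_finsupp_apply i).congr fun v => (hg.1 v i hi).symm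

theorem isClosed_extLattice (hF : F.IsNaturalTopology) {N : ℕ} {Λ : AddSubgroup (Fin N → K)}
    (hΛ : Λ ∈ F.lattices (Fin N)) : IsClosed (F.extLattice N Λ : Set (ℕ →₀ K)) := by
  have h1 : (F.extLattice N Λ : Set (ℕ →₀ K)) = firstCoords N ⁻¹' (Λ : Set (Fin N → K)) ∩
      ⋂ i, ⋂ _ : N ≤ i, (fun v => v i) ⁻¹' (F.O : Set K) := by
    ext v
    simp [extLattice]
  rw [h1]
  exact ((isClosed_lattice (Fin N) hF hΛ).preimage (continuous_firstCoords N)).inter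
    (isClosed_iInter fun i => isClosed_iInter fun _ => hF.isClosed.preimage (continuous_finsupp_apply i))

/-- Removing the integral tail does not change a class modulo any extended lattice. Hence the
quotients of extended lattices are those of the finite-dimensional ones. -/
theorem extZero_sub_mem {N : ℕ} {Λ Λ' : AddSubgroup (Fin N → K)} {v : ℕ →₀ K}
    (hv : v ∈ F.extLattice N Λ) : extZero N (firstCoords N v) - v ∈ F.extLattice N Λ' := by
  refine ⟨?_, fun i hi => ?_⟩
  · rw [map_sub, firstCoords_extZero, sub_self]
    exact zero_mem _
  · rw [Finsupp.sub_apply, extZero_of_le hi, zero_sub]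
    exact neg_mem (hv.2 i hi)

theorem extZero_mem {N : ℕ} {Λ : AddSubgroup (Fin N → K)} {y : Fin N → K} (hy : y ∈ Λ) :
    extZero N y ∈ F.extLattice N Λ :=
  ⟨by rwa [firstCoords_extZero], fun i hi => by rw [extZero_of_le hi]; exact zero_mem _⟩

variable (F) in
/-- The lattices in the space of finite sequences. -/
noncomputable def infLatticeSystem (hF : F.IsNaturalTopology) : LatticeSystem (finMat K) (ℕ →₀ K) where
  ρ := finAct
  ρ_one := rfl
  ρ_mul := finAct_mul
  continuous := continuous_finAct hF
  Lat := F.infLattices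
  map_mem g Λ := by
    rintro ⟨h, rfl⟩
    exact ⟨g * h, by rw [finAct_mul, AddSubgroup.map_map]⟩
  closed Λ h := by
    obtain ⟨N, M, _, hM, _, rfl, _⟩ := F.exists_extLattice₂ h h
    exact isClosed_extLattice hF hM
  locallyCompact N hN Λ hΛ h := by
    obtain ⟨n, M, M', hM, hM', rfl, rfl⟩ := F.exists_extLattice₂ hN hΛ
    have := hF.isTopologicalAddGroup
    have := isTopologicalAddGroup_finsupp hF
    have := locallyCompact_lattice (Fin n) hF hM hM' (F.le_of_extLattice_le h)
    let f : (ℕ →₀ K) →+ (Fin n → K) := (firstCoords n).toAddMonoidHom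
    let s : (Fin n → K) →+ (ℕ →₀ K) := (extZero n).toAddMonoidHom
    -- Truncation and extension by zero are inverse to each other on the quotients, so local
    -- compactness comes from finite dimension.
    let e : LQuot (F.extLattice n M) (F.extLattice n M') ≃ₜ+ LQuot M M' :=
      LQuot.homeo f s (continuous_firstCoords n)
        (continuous_extZero n) (fun _ hx => hx.1) (fun _ hx => hx.1) (fun _ hx => extZero_mem hx)
        (fun _ hx => extZero_mem hx) (fun _ hx => extZero_sub_mem hx) fun y _ => by
          have : f (s y) = y := firstCoords_extZero n y
          rw [this, sub_self]
          exact zero_mem _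
    exact e.toHomeomorph.isClosedEmbedding.locallyCompactSpace
  directed N hN Λ hΛ := by
    obtain ⟨n, M, M', hM, hM', rfl, rfl⟩ := F.exists_extLattice₂ hN hΛ
    obtain ⟨M'', h, h1, h2⟩ := directed_lattices (Fin n) hM hM'
    exact ⟨_, F.extLattice_mem h, F.extLattice_mono h1, F.extLattice_mono h2⟩

/-- The lattice of finite sequences in `O` as an element of the set of lattices. -/
noncomputable def infBase (hF : F.IsNaturalTopology) : (F.infLatticeSystem hF).Lat :=
  ⟨F.infLattice K, 1, (AddSubgroup.map_id _).symm⟩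

/-- The lattices in `K²` as a part of the system of lattices in the space of finite sequences. -/
noncomputable def infExtension (hF : F.IsNaturalTopology) :
    (F.infLatticeSystem hF).Extension (latticeSystem (Fin 2) hF) blockFin where
  r Λ := ⟨F.extLattice 2 Λ.1, F.extLattice_mem Λ.2⟩
  mono h := F.extLattice_mono h
  r_smul g Λ := Subtype.ext (F.extLattice_map Λ.1 (blockFin g) (isBlock_block g) g (firstCoords_block g)).symm
  f := (firstCoords 2).toAddMonoidHom
  s := (extZero 2).toAddMonoidHom
  continuous_f := continuous_firstCoords 2
  continuous_s := continuous_extZero 2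
  f_mem _ _ hx := hx.1
  s_mem _ _ hx := extZero_mem hx
  f_s := firstCoords_extZero 2
  s_f _ _ _ hx := extZero_sub_mem hx
  f_ρ g x := firstCoords_block g x

theorem infExtension_r (hF : F.IsNaturalTopology) :
    (infExtension hF).r (baseLattice (Fin 2) hF) = infBase hF := Subtype.ext (F.infLattice_eq 2).symm

end TwoDimLocalField

end TwoDim

namespace TwoDim

/-! ### Lifting the Steinberg group by partial splittings. -/

namespace Steinberg

open scoped commutatorElement

variable {K : Type u} [Field K]

/-- A central extension with compatible partial splittings which contain the generators of the
Steinberg group has a canonical lift of the Steinberg group. -/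
theorem exists_lift_of_splittings {A : Type v} {E : Type v'} {Γ : Type w} [CommGroup A] [Group E] [Group Γ]
    (π : E →* Γ) (hπ : Function.Surjective π) (inl : A →* E) (hrange : inl.range = π.ker)
    (hcomm : ∀ a x, inl a * x = x * inl a) (ξ : St K →* Γ) {ι : Type u'} (S : ι → Subgroup Γ)
    (σ : ∀ d, S d →* E) (hσ : ∀ d g, π (σ d g) = g) (δ : ℕ → Γ) (w : K) (hw : w - 1 ≠ 0)
    (hδ : ∀ i j a, i ≠ j → δ i * ξ (x i j a) * (δ i)⁻¹ = ξ (x i j (w * a)))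
    (hδS : ∀ d i, δ i ∈ S d)
    (hscale : ∀ d i j a, i ≠ j → ξ (x i j a) ∈ S d → ξ (x i j (a / (w - 1))) ∈ S d)
    (hcommon : ∀ i j k l a b, i ≠ j → k ≠ l → ¬ (j = k ∧ i = l) →
      ∃ d, ξ (x i j a) ∈ S d ∧ ξ (x k l b) ∈ S d) :
    ∃ Ψ : St K →* E, ∀ s, π (Ψ s) = ξ s := by
  classical
  let L := Function.surjInv hπ
  have hL : ∀ g, π (L g) = g := Function.surjInv_eq hπ
  -- Conjugation by `δ i` multiplies the parameter by `w`, so with b = a / (w - 1) the commutator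
  -- below has parameter wb - b = a. As a commutator of arbitrary lifts it is independent of all
  -- choices.
  let X : ℕ → ℕ → K → E := fun i j a => if i = j then 1 else ⁅L (δ i), L (ξ (x i j (a / (w - 1))))⁆
  -- The two lifts may be taken from the splitting with index `d`, so the canonical lift agrees with
  -- every partial splitting whose domain contains the generator.
  have hX : ∀ i j a d (h : ξ (x i j a) ∈ S d), i ≠ j → X i j a = σ d ⟨_, h⟩ := fun i j a d h hij => by
    have h1 : X i j a = ⁅L (δ i), L (ξ (x i j (a / (w - 1))))⁆ := if_neg hij
    have h2 := commutator_eq_of_map_eq π inl hrange hcomm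
      ((hL (δ i)).trans (hσ d ⟨_, hδS d i⟩).symm)
      ((hL _).trans (hσ d ⟨_, hscale d i j a hij h⟩).symm)
    rw [h1, h2, ← map_commutatorElement]
    refine congrArg (σ d) (Subtype.ext ?_)
    change δ i * ξ (x i j (a / (w - 1))) * (δ i)⁻¹ * (ξ (x i j (a / (w - 1))))⁻¹ = ξ (x i j a)
    rw [hδ i j _ hij, ← map_inv, ← map_mul, x_inv, x_add]
    congr 2
    field_simp
    ring
  have hadd : ∀ i j a b, i ≠ j → X i j a * X i j b = X i j (a + b) := fun i j a b hij => by
    obtain ⟨d, h, h'⟩ := hcommon i j i j a b hij hij (fun h => hij h.2)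
    have h3 : ξ (x i j (a + b)) ∈ S d := by
      rw [← x_add, map_mul]
      exact mul_mem h h'
    rw [hX i j a d h hij, hX i j b d h' hij, hX i j (a + b) d h3 hij, ← map_mul]
    refine congrArg (σ d) (Subtype.ext ?_)
    change ξ _ * ξ _ = ξ _
    rw [← map_mul, x_add]
  -- Each commutator relation begins with two generators in a common domain, where it holds because
  -- the splitting is a homomorphism. The pair of opposite positions ij and ji, excluded in
  -- `hcommon`, occurs in no relation.
  have hc : ∀ i j k l a b d (h : ξ (x i j a) ∈ S d) (h' : ξ (x k l b) ∈ S d), i ≠ j → k ≠ l →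
      ∀ (h'' : ξ ⁅x i j a, x k l b⁆ ∈ S d), ⁅X i j a, X k l b⁆ = σ d ⟨_, h''⟩ := by
    intro i j k l a b d h h' hij hkl h''
    rw [hX i j a d h hij, hX k l b d h' hkl, ← map_commutatorElement]
    exact congrArg (σ d) (Subtype.ext (map_commutatorElement ξ _ _).symm)
  refine ⟨lift X (fun i a => if_pos rfl) hadd (fun i j k a b hij hjk hik => ?_)
    (fun i j k l a b hij hkl hjk hil => ?_), fun s => ?_⟩
  · obtain ⟨d, h, h'⟩ := hcommon i j j k a b hij hjk (fun h => hik h.2)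
    have h3 : ξ (x i k (a * b)) ∈ S d := by
      rw [← x_comm hij hjk hik, map_commutatorElement, commutatorElement_def]
      exact mul_mem (mul_mem (mul_mem h h') (inv_mem h)) (inv_mem h')
    rw [hc i j j k a b d h h' hij hjk (by rwa [x_comm hij hjk hik]), hX i k _ d h3 hik]
    exact congrArg (σ d) (Subtype.ext (congrArg ξ (x_comm hij hjk hik a b)))
  · obtain ⟨d, h, h'⟩ := hcommon i j k l a b hij hkl (fun h => hjk h.1)
    rw [hc i j k l a b d h h' hij hkl (by rw [x_comm' hjk hil, map_one]; exact one_mem _)]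
    refine (congrArg (σ d) (Subtype.ext ?_)).trans (map_one (σ d))
    change ξ _ = 1
    rw [x_comm' hjk hil, map_one]
  · refine DFunLike.congr_fun (f := π.comp (lift X _ _ _ _)) (g := ξ) (hom_ext fun i j a => ?_) s
    rw [MonoidHom.comp_apply, lift_x]
    rcases eq_or_ne i j with rfl | hij
    · rw [x_self, map_one]
      exact (congrArg π (if_pos rfl)).trans (map_one π)
    · obtain ⟨d, h, -⟩ := hcommon i j i j a a hij hij (fun h => hij h.2)
      rw [hX i j a d h hij, hσ]

/-- The arrows from i to j and from k to l do not form a cycle. If they can be composed, the middle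
vertex gets weight 1 and the final one weight 2; otherwise both targets get weight 1. All other
weights are 0. -/
theorem exists_weights {i j k l : ℕ} (hij : i ≠ j) (hkl : k ≠ l) (h : ¬ (j = k ∧ i = l)) :
    ∃ (n : ℕ → ℕ) (N : ℕ), (∀ m, N ≤ m → n m = 0) ∧ n i + 1 ≤ n j ∧ n k + 1 ≤ n l := by
  refine ⟨fun m => if j = k then (if m = l then 2 else if m = j then 1 else 0)
    else if i = l then (if m = j then 2 else if m = l then 1 else 0)
    else if m = j ∨ m = l then 1 else 0, j + l + 1, fun m hm => ?_, ?_, ?_⟩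
  · have h1 : m ≠ j := by lia
    have h2 : m ≠ l := by lia
    simp [h1, h2]
  · grind
  · grind

/-- The diagonal automorphism with entries `d i`. -/
noncomputable def diagUnit (d : ℕ → Kˣ) : (Mat K)ˣ :=
  let f : (ℕ → Kˣ) → Mat K := fun d =>
    { toFun := fun v => Finsupp.onFinset v.support (fun i => (d i : K) * v i) fun i hi =>
        Finsupp.mem_support_iff.2 (right_ne_zero_of_mul hi)
      map_add' := fun v w => Finsupp.ext fun i => mul_add _ _ _
      map_smul' := fun c v => Finsupp.ext fun i => mul_left_comm _ _ _ }
  { val := f d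
    inv := f d⁻¹
    val_inv := LinearMap.ext fun v => Finsupp.ext fun i => Units.mul_inv_cancel_left (d i) (v i)
    inv_val := LinearMap.ext fun v => Finsupp.ext fun i => Units.inv_mul_cancel_left (d i) (v i) }

theorem diagUnit_apply (d : ℕ → Kˣ) (v : ℕ →₀ K) (i : ℕ) : (diagUnit d).1 v i = d i * v i := rfl

theorem isBlock_diagUnit {d : ℕ → Kˣ} {N : ℕ} (hd : ∀ i, N ≤ i → d i = 1) : IsBlock N (diagUnit d) :=
  ⟨fun v i hi => by rw [diagUnit_apply, hd i hi, Units.val_one, one_mul],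
    fun v hv => Finsupp.ext fun i => by
      rw [diagUnit_apply]
      rcases lt_or_ge i N with h | h
      · rw [hv i h, mul_zero]
      · rw [hd i h, Units.val_one, one_mul]⟩

theorem diagUnit_conj_toMat (d : ℕ → Kˣ) (s : St K) :
    diagUnit d * toMat s * (diagUnit d)⁻¹ = toMat (diagEnd d s) := by
  rw [← toMat_diagEnd d (diagUnit d) (diagUnit_apply d), mul_inv_cancel_right]

end Steinberg

/-! ### The lift of the Steinberg group to the Haar extension. -/

namespace TwoDimLocalField

open Steinberg IsLocalRing
open scoped NNReal

variable {K : Type u} [Field K] (F : TwoDimLocalField K)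

/-- The residue field contains an element different from 0 and 1, namely a uniformizer of `F.O₁`.
For any lift of it, both the lift and the lift minus 1 are units. -/
theorem exists_unit_sub_one : ∃ w : Kˣ, (w : K) ∈ F.O ∧ ((w⁻¹ : Kˣ) : K) ∈ F.O ∧ (w : K) - 1 ≠ 0 ∧
    ((w : K) - 1)⁻¹ ∈ F.O := by
  have key : ∀ a : F.O, residue F.O a ≠ 0 → (a : K) ≠ 0 ∧ (a : K)⁻¹ ∈ F.O := fun a ha => by
    obtain ⟨b, hb⟩ := (residue_ne_zero_iff_isUnit a).1 ha
    have h1 : (a : K) * ((b⁻¹ : F.Oˣ) : F.O) = 1 := by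
      rw [← hb]
      exact congrArg Subtype.val b.mul_inv
    exact ⟨left_ne_zero_of_mul_eq_one h1, by rw [inv_eq_of_mul_eq_one_right h1]; exact ((b⁻¹ : F.Oˣ) : F.O).2⟩
  obtain ⟨p, hp⟩ := IsDiscreteValuationRing.exists_irreducible F.O₁
  obtain ⟨a, ha⟩ := residue_surjective (R := F.O) (p : ResidueField F.O)
  have h1 := key a (by
    rw [ha]
    exact fun h => hp.ne_zero (Subtype.ext h))
  have h2 := key (a - 1) (by
    rw [map_sub, ha, map_one, sub_ne_zero]
    exact fun h => hp.not_isUnit ((Subtype.ext h : p = 1) ▸ isUnit_one))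
  refine ⟨Units.mk0 a h1.1, a.2, ?_, h2.1, h2.2⟩
  rw [Units.val_inv_eq_inv_val]
  exact h1.2

theorem exists_unit_denom (a b : K) : ∃ c : Kˣ, (c : K) ∈ F.O ∧ c * a ∈ F.O ∧ c * b ∈ F.O := by
  obtain ⟨c, hc, h0, h⟩ := F.exists_denom (I := Fin 2) !![a, b; 0, 0]
  exact ⟨Units.mk0 c h0, hc, h 0 0, h 0 1⟩

/-- The lattice `∏ d_i O`. -/
def diagLattice (d : ℕ → Kˣ) : AddSubgroup (ℕ →₀ K) where
  carrier := {v | ∀ i, ((d i)⁻¹ : Kˣ) * v i ∈ F.O}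
  zero_mem' i := by
    change _ * (0 : K) ∈ _
    rw [mul_zero]
    exact zero_mem _
  add_mem' hv hw i := by
    have := add_mem (hv i) (hw i)
    rwa [← mul_add] at this
  neg_mem' hv i := by
    have := neg_mem (hv i)
    rwa [← mul_neg] at this

theorem diagLattice_mem {d : ℕ → Kˣ} {N : ℕ} (hd : ∀ i, N ≤ i → d i = 1) :
    F.diagLattice d ∈ F.infLattices := by
  refine ⟨⟨diagUnit d, N, isBlock_diagUnit hd⟩, ?_⟩
  ext v
  constructor
  · intro hv
    exact ⟨(diagUnit d⁻¹).1 v, hv, Finsupp.ext fun i => Units.mul_inv_cancel_left (d i) (v i)⟩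
  · rintro ⟨v, hv, rfl⟩ i
    exact (Units.inv_mul_cancel_left (d i) (v i)).symm ▸ hv i

variable {F} [TopologicalSpace K]

theorem smul_eq_of_le {Γ : Type u} [Group Γ] {V : Type v} [AddCommGroup V] [TopologicalSpace V]
    [IsTopologicalAddGroup V] (D : LatticeSystem Γ V) {g : Γ} {Λ : D.Lat} (h : ∀ x ∈ Λ.1, D.ρ g x ∈ Λ.1)
    (h' : ∀ x ∈ Λ.1, D.ρ g⁻¹ x ∈ Λ.1) : g • Λ = Λ := by
  refine Subtype.ext (le_antisymm ?_ fun x hx => ?_)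
  · rintro _ ⟨x, hx, rfl⟩
    exact h x hx
  · refine ⟨D.ρ g⁻¹ x, h' x hx, ?_⟩
    have := D.ρ_inv_apply g⁻¹ x
    rwa [inv_inv] at this

/-- The elementary matrix adds `a` times the j-th coordinate to the i-th one, and the hypothesis
says that this sends the j-th factor of the lattice into the i-th. The inverse has parameter `-a`
and satisfies the same condition. -/
theorem toFin_smul_diagLattice (hF : F.IsNaturalTopology) {d : ℕ → Kˣ} (hd : F.diagLattice d ∈ F.infLattices)
    {i j : ℕ} {a : K} (hij : i ≠ j) (ha : (((d i)⁻¹ : Kˣ) : K) * a * d j ∈ F.O) :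
    toFin K (x i j a) ∈ MulAction.stabilizer (finMat K) (⟨_, hd⟩ : (F.infLatticeSystem hF).Lat) := by
  have key : ∀ a : K, (((d i)⁻¹ : Kˣ) : K) * a * d j ∈ F.O → ∀ v ∈ F.diagLattice d,
      (toMat (x i j a)).1 v ∈ F.diagLattice d := fun a ha v hv k => by
    rw [toMat_x_apply hij, Finsupp.add_apply, mul_add]
    refine add_mem (hv k) ?_
    rw [Finsupp.single_apply]
    split_ifs with hk
    · subst hk
      have := mul_mem ha (hv j)
      have e : (d j : K) * ((d j)⁻¹ : Kˣ) = 1 := Units.mul_inv _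
      rwa [show ((((d i)⁻¹ : Kˣ) : K) * a * d j) * (((d j)⁻¹ : Kˣ) * v j) = ((d i)⁻¹ : Kˣ) * (a * v j) *
        (d j * ((d j)⁻¹ : Kˣ)) by ring, e, mul_one] at this
    · rw [mul_zero]
      exact zero_mem _
  have := isTopologicalAddGroup_finsupp hF
  refine smul_eq_of_le _ (key a ha) ?_
  have h2 : (toFin K (x i j a))⁻¹ = toFin K (x i j (-a)) := by rw [← map_inv, x_inv]
  rw [h2]
  refine key (-a) ?_
  rw [mul_neg, neg_mul]
  exact neg_mem ha

theorem diagUnit_smul_diagLattice (hF : F.IsNaturalTopology) {d : ℕ → Kˣ}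
    (hd : F.diagLattice d ∈ F.infLattices) {u : ℕ → Kˣ} (hu : ∀ i, (u i : K) ∈ F.O)
    (hu' : ∀ i, ((u⁻¹ : ℕ → Kˣ) i : K) ∈ F.O) (hu'' : diagUnit u ∈ finMat K) :
    (⟨diagUnit u, hu''⟩ : finMat K) ∈
      MulAction.stabilizer (finMat K) (⟨_, hd⟩ : (F.infLatticeSystem hF).Lat) := by
  have key : ∀ u : ℕ → Kˣ, (∀ i, (u i : K) ∈ F.O) → ∀ v ∈ F.diagLattice d,
      (diagUnit u).1 v ∈ F.diagLattice d := fun u hu v hv k => by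
    rw [diagUnit_apply, mul_left_comm]
    exact mul_mem (hu k) (hv k)
  have := isTopologicalAddGroup_finsupp hF
  exact smul_eq_of_le _ (key u hu) (key u⁻¹ hu')

/-- The torsors of Haar measures on the quotients of lattices in the space of finite sequences. -/
noncomputable def infTorsors (hF : F.IsNaturalTopology) :
    TorsorSystem.{u, 0, u, u} ℝ≥0ˣ (finMat K) (F.infLatticeSystem hF).Lat :=
  haveI := isTopologicalAddGroup_finsupp hF
  (F.infLatticeSystem hF).torsors

/-- The canonical lift of the Steinberg group to the central extension defined by Haar measures. -/
theorem exists_steinberg_lift (hF : F.IsNaturalTopology) :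
    ∃ Ψ : St K →* (infTorsors hF).ext (infBase hF), ∀ s, (infTorsors hF).extHom (infBase hF) (Ψ s) = toFin K s := by
  obtain ⟨w, hw, hw', hw1, hw2⟩ := F.exists_unit_sub_one
  have hm : ∀ i, diagUnit (Pi.mulSingle i w : ℕ → Kˣ) ∈ finMat K := fun i =>
    ⟨i + 1, isBlock_diagUnit fun j hj => by rw [Pi.mulSingle_eq_of_ne (show j ≠ i by lia)]⟩
  have hO : ∀ (w : Kˣ) (i j : ℕ), (w : K) ∈ F.O → (((Pi.mulSingle i w : ℕ → Kˣ) j : Kˣ) : K) ∈ F.O := fun w i j h => by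
    rcases eq_or_ne j i with rfl | hj
    · rwa [Pi.mulSingle_eq_same]
    · rw [Pi.mulSingle_eq_of_ne hj]
      exact one_mem _
  refine exists_lift_of_splittings ((infTorsors hF).extHom (infBase hF)) ((infTorsors hF).extHom_surjective _)
    ((infTorsors hF).extInl _) ((infTorsors hF).extInl_range _) ((infTorsors hF).extInl_comm _) (toFin K)
    (ι := {d : ℕ → Kˣ // F.diagLattice d ∈ F.infLattices})
    (fun d => MulAction.stabilizer (finMat K) (⟨_, d.2⟩ : (F.infLatticeSystem hF).Lat))
    (fun d => (infTorsors hF).stabilizerHom _ _) (fun d g => rfl)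
    (fun i => ⟨diagUnit (Pi.mulSingle i w), hm i⟩) w hw1 (fun i j a hij => Subtype.ext ?_)
    (fun d i => diagUnit_smul_diagLattice hF d.2 (fun j => hO w i j hw) (fun j => ?_) _)
    (fun d i j a hij h => toFin_smul_diagLattice hF d.2 hij ?_) (fun i j k l a b hij hkl h => ?_)
  · refine (diagUnit_conj_toMat _ _).trans ?_
    rw [diagEnd_x, Pi.mulSingle_eq_same, Pi.mulSingle_eq_of_ne hij.symm, inv_one, Units.val_one, mul_one]
    rfl
  · rw [← Pi.mulSingle_inv]
    exact hO _ i j hw'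
  -- Conversely, testing stability on the basis vector scaled by `d.1 j` returns the integrality
  -- condition on `a`; dividing `a` by the unit w - 1 preserves it.
  · have h1 : (toMat (x i j a)).1 (Finsupp.single j (d.1 j : K)) ∈ F.diagLattice d.1 := by
      have h2 : toFin K (x i j a) • (⟨_, d.2⟩ : (F.infLatticeSystem hF).Lat) = ⟨_, d.2⟩ := h
      have := isTopologicalAddGroup_finsupp hF
      refine (F.infLatticeSystem hF).le_comap h2 (x := Finsupp.single j (d.1 j : K)) (fun k => ?_)
      rw [Finsupp.single_apply]
      split_ifs with hk
      · subst hk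
        rw [Units.inv_mul]
        exact one_mem _
      · rw [mul_zero]
        exact zero_mem _
    have h2 := h1 i
    rw [toMat_x_apply hij, Finsupp.add_apply, Finsupp.single_eq_same, Finsupp.single_eq_same,
      Finsupp.single_eq_of_ne hij, zero_add] at h2
    have := mul_mem h2 hw2
    rwa [show ∀ c e f : K, c * (a * e) * f = c * (a / (w - 1)) * e * ((w - 1) * f) by
      intros; field_simp, mul_inv_cancel₀ hw1, mul_one] at this
  -- The lattice is diagonal with entries powers of `c`, an element of O that clears the
  -- denominators of `a` and `b`. A strict increase of the weight along an arrow supplies at least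
  -- one factor `c`, enough for integrality.
  · obtain ⟨n, N, hn, h1, h2⟩ := exists_weights hij hkl h
    obtain ⟨c, hc, ha, hb⟩ := F.exists_unit_denom a b
    refine ⟨⟨fun m => c ^ n m, F.diagLattice_mem (N := N) fun m hm => by rw [hn m hm, pow_zero]⟩,
      toFin_smul_diagLattice hF _ hij ?_, toFin_smul_diagLattice hF _ hkl ?_⟩
    · obtain ⟨r, hr⟩ := Nat.exists_eq_add_of_le h1
      have : ((((c ^ n i)⁻¹ : Kˣ) : K)) * a * (c ^ n j : Kˣ) = (c * a) * c ^ r := by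
        rw [hr]
        push_cast
        field_simp
        ring
      rw [this]
      exact mul_mem ha (pow_mem hc r)
    · obtain ⟨r, hr⟩ := Nat.exists_eq_add_of_le h2
      have : ((((c ^ n k)⁻¹ : Kˣ) : K)) * b * (c ^ n l : Kˣ) = (c * b) * c ^ r := by
        rw [hr]
        push_cast
        field_simp
        ring
      rw [this]
      exact mul_mem hb (pow_mem hc r)

end TwoDimLocalField

end TwoDim

namespace TwoDim

/-! ### From the lift to a morphism of extensions of GL_2(K). -/

namespace Steinberg

variable {K : Type u} [Field K] {A : Type v} [CommGroup A] {E₂ : Type v'} [Group E₂] {E : Type u'} [Group E]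
  {Γ : Type w} [Group Γ]

/-- A lift of the Steinberg group to a central extension of a group of infinite matrices defines a
morphism to the restriction of the extension to `GL₂(K)`. -/
theorem exists_hatHom (θ : E₂ →* GL (Fin 2) K) (hθ : Function.Surjective θ) (inl₂ : A →* E₂)
    (hinl₂ : Function.Injective inl₂) (hrange₂ : inl₂.range = θ.ker)
    (hcomm₂ : ∀ a x, inl₂ a * x = x * inl₂ a) (π : E →* Γ) (inl : A →* E)
    (hinl : Function.Injective inl) (hrange : inl.range = π.ker)
    (hcomm : ∀ a x, inl a * x = x * inl a) (Λ : E₂ →* E) (ι : GL (Fin 2) K →* Γ)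
    (hΛ : ∀ x, π (Λ x) = ι (θ x)) (hΛinl : ∀ a, Λ (inl₂ a) = inl a) (ξ : St K →* Γ)
    (hξ : ∀ p ∈ tildeSL₂ K, ξ p.1 = ι p.2)
    (hconj : ∀ u s, ι (corner u) * ξ s * (ι (corner u))⁻¹ = ξ (diagEnd (Pi.mulSingle 0 u) s))
    (Ψ : St K →* E) (hΨ : ∀ s, π (Ψ s) = ξ s) :
    ∃ (Φ : tildeSL₂ K ⋊[(hatData K).φ] Kˣ →* (Matrix.GeneralLinearGroup.det.comp θ).ker
        ⋊[(HatData.ofExtension θ hθ inl₂ hinl₂ hrange₂ hcomm₂).φ] Kˣ) (κ : K₂ K →* A),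
      (∀ k, Φ ((hatData K).ext.inl k) =
        (HatData.ofExtension θ hθ inl₂ hinl₂ hrange₂ hcomm₂).ext.inl (κ k)) ∧
      ∀ x, (HatData.ofExtension θ hθ inl₂ hinl₂ hrange₂ hcomm₂).ext.rightHom (Φ x) =
        (hatData K).ext.rightHom x := by
  -- Because `Λ` is the identity on `A`, the group `E₂` is the pull-back of `E` along `ι`: a
  -- compatible pair of elements comes from an element of `E₂`, adjusted by `A`.
  have hex : ∀ p : tildeSL₂ K, ∃ f, θ f = p.1.2 ∧ Λ f = Ψ p.1.1 := fun p => by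
    obtain ⟨f, hf⟩ := hθ p.1.2
    obtain ⟨a, ha⟩ : Ψ p.1.1 * (Λ f)⁻¹ ∈ inl.range := by
      rw [hrange, MonoidHom.mem_ker, map_mul, map_inv, hΨ, hΛ, hf, hξ _ p.2, mul_inv_cancel]
    have h1 : θ (inl₂ a) = 1 := by
      have : inl₂ a ∈ θ.ker := hrange₂ ▸ ⟨a, rfl⟩
      exact this
    exact ⟨inl₂ a * f, by rw [map_mul, h1, one_mul, hf], by rw [map_mul, hΛinl, ha, inv_mul_cancel_right]⟩
  -- The uniqueness half of the pull-back property; it makes the pointwise choice `ϕ` multiplicative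
  -- and equivariant.
  have huniq : ∀ f f', θ f = θ f' → Λ f = Λ f' → f = f' := fun f f' h h' => by
    obtain ⟨a, ha⟩ : f * f'⁻¹ ∈ inl₂.range := by
      rw [hrange₂, MonoidHom.mem_ker, map_mul, map_inv, h, mul_inv_cancel]
    have h1 : inl a = inl 1 := by rw [← hΛinl, ha, map_mul, map_inv, h', mul_inv_cancel, map_one]
    rw [hinl h1, map_one] at ha
    exact mul_inv_eq_one.1 ha.symm
  choose ϕ hϕ hϕ' using hex
  let ϕ₁ : tildeSL₂ K →* (Matrix.GeneralLinearGroup.det.comp θ).ker :=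
    MonoidHom.mk' (fun p => ⟨ϕ p, by
      rw [MonoidHom.mem_ker, MonoidHom.comp_apply, hϕ]
      exact p.2.2⟩) fun p p' => Subtype.ext (huniq _ _
        ((hϕ _).trans ((congrArg₂ (· * ·) (hϕ p) (hϕ p')).symm.trans (map_mul θ _ _).symm))
        ((hϕ' _).trans ((map_mul Ψ _ _).trans
          ((congrArg₂ (· * ·) (hϕ' p) (hϕ' p')).symm.trans (map_mul Λ _ _).symm))))
  have hequiv : ∀ u p, ϕ₁ ((hatData K).φ u p) =
      (HatData.ofExtension θ hθ inl₂ hinl₂ hrange₂ hcomm₂).φ u (ϕ₁ p) := fun u p => by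
    obtain ⟨e, he⟩ := hθ (corner u)
    refine Subtype.ext (Eq.trans ?_ (HatData.ofExtension_φ θ hθ inl₂ hinl₂ hrange₂ hcomm₂ he (ϕ₁ p)).symm)
    change ϕ ((hatData K).φ u p) = e * ϕ p * e⁻¹
    refine huniq _ _ ?_ ?_
    · rw [hϕ, map_mul, map_mul, map_inv, he, hϕ]
      rfl
    · rw [hϕ', map_mul, map_mul, map_inv, hϕ']
      -- Both sides are lifts of the same homomorphism from the Steinberg group to `Γ`, so
      -- uniqueness of such lifts gives equivariance.
      have h1 : Ψ.comp (diagEnd (Pi.mulSingle 0 u)) = (MulAut.conj (Λ e)).toMonoidHom.comp Ψ :=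
        hom_ext_of_central π inl hrange hcomm fun s => by
          change π (Ψ _) = π (Λ e * Ψ s * (Λ e)⁻¹)
          rw [map_mul, map_mul, map_inv, hΨ, hΨ, hΛ, he, hconj]
      exact DFunLike.congr_fun h1 p.1.1
  -- Elements of K_2 lie over the identity matrix, so their images are central; this defines `κ`.
  have hκ : ∀ k : K₂ K, ∃ a, inl₂ a = ϕ ((hatData K).inl k) := fun k => by
    have : ϕ ((hatData K).inl k) ∈ inl₂.range := by
      rw [hrange₂, MonoidHom.mem_ker, hϕ]
      rfl
    exact this
  choose κ hκ using hκ
  refine ⟨SemidirectProduct.map ϕ₁ (MonoidHom.id _) fun u => MonoidHom.ext (hequiv u),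
    MonoidHom.mk' κ fun k k' => hinl₂ ?_, fun k => ?_, fun x => ?_⟩
  · rw [map_mul, hκ, hκ, hκ, map_mul]
    exact congrArg Subtype.val (map_mul ϕ₁ _ _)
  · exact SemidirectProduct.ext (Subtype.ext (hκ k).symm) rfl
  · exact congrArg (· * corner x.right) (hϕ x.left)

end Steinberg

namespace TwoDimLocalField

open Steinberg
open scoped NNReal

variable {K : Type u} [Field K] {F : TwoDimLocalField K} [TopologicalSpace K] (hF : F.IsNaturalTopology)

/-- The homomorphism from the extension of `GL₂(K)` to the extension of the group of infinite
matrices. -/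
noncomputable def extToInf : (haarTorsors hF (Fin 2)).ext (baseLattice (Fin 2) hF) →*
    (infTorsors hF).ext (infBase hF) :=
  haveI := hF.isTopologicalAddGroup
  haveI := isTopologicalAddGroup_finsupp hF
  (infExtension hF).extMap (baseLattice (Fin 2) hF) (infBase hF) (infExtension_r hF)

theorem extToInf_extInl (a : ℝ≥0ˣ) :
    extToInf hF ((haarTorsors hF (Fin 2)).extInl _ a) = (infTorsors hF).extInl _ a :=
  haveI := hF.isTopologicalAddGroup
  haveI := isTopologicalAddGroup_finsupp hF
  (infExtension hF).extMap_extInl _ _ _ a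

theorem extHom_extToInf (x : (haarTorsors hF (Fin 2)).ext (baseLattice (Fin 2) hF)) :
    (infTorsors hF).extHom _ (extToInf hF x) = blockFin ((haarTorsors hF (Fin 2)).extHom _ x) := rfl

theorem blockFin_corner_conj (u : Kˣ) (s : St K) :
    blockFin (corner u) * toFin K s * (blockFin (corner u))⁻¹ = toFin K (diagEnd (Pi.mulSingle 0 u) s) := by
  refine Subtype.ext ?_
  have h := toMat_diagEnd (Pi.mulSingle 0 u) (block firstTwo (corner u))
    (block_diag firstTwo u 1 _ (Pi.mulSingle_eq_same _ _) (Pi.mulSingle_eq_of_ne one_ne_zero _)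
      fun i hi _ => Pi.mulSingle_eq_of_ne hi _) s
  change block firstTwo (corner u) * toMat s * (block firstTwo (corner u))⁻¹ = toMat _
  rw [← h, mul_inv_cancel_right]

/-- The morphism from the extension defined by the Steinberg group to the extension defined by Haar
measures. -/
theorem exists_steinbergHatHom :
    ∃ (Φ : tildeSL₂ K ⋊[(hatData K).φ] Kˣ →*
        (Matrix.GeneralLinearGroup.det.comp ((haarTorsors hF (Fin 2)).extHom (baseLattice (Fin 2) hF))).ker
          ⋊[(haarHatData hF).φ] Kˣ) (κ : K₂ K →* ℝ≥0ˣ),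
      (∀ k, Φ ((hatData K).ext.inl k) = (haarHatData hF).ext.inl (κ k)) ∧
      ∀ x, (haarHatData hF).ext.rightHom (Φ x) = (hatData K).ext.rightHom x := exists_hatHom ((haarTorsors hF (Fin 2)).extHom (baseLattice (Fin 2) hF))
    ((haarTorsors hF (Fin 2)).extHom_surjective _) ((haarTorsors hF (Fin 2)).extInl _)
    ((haarTorsors hF (Fin 2)).extInl_injective _) ((haarTorsors hF (Fin 2)).extInl_range _)
    ((haarTorsors hF (Fin 2)).extInl_comm _) ((infTorsors hF).extHom (infBase hF))
    ((infTorsors hF).extInl _) ((infTorsors hF).extInl_injective _) ((infTorsors hF).extInl_range _)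
    ((infTorsors hF).extInl_comm _) (extToInf hF) blockFin (extHom_extToInf hF) (extToInf_extInl hF)
    (toFin K) (fun p hp => Subtype.ext hp.1) blockFin_corner_conj
    (exists_steinberg_lift hF).choose (exists_steinberg_lift hF).choose_spec

end TwoDimLocalField

end TwoDim

namespace TwoDim

/-! ### The normalized valuation. -/

section Ord

open IsLocalRing IsDedekindDomain

variable {k : Type u} [Field k] (A : ValuationSubring k) [IsDiscreteValuationRing A]

theorem ord_mul {x y : k} (hx : x ≠ 0) (hy : y ≠ 0) : ord A (x * y) = ord A x + ord A y := by
  rw [ord, ord, ord, map_mul, WithZero.log_mul (by simpa using hx) (by simpa using hy), neg_add]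

theorem ord_zpow (x : k) (n : ℤ) : ord A (x ^ n) = n * ord A x := by
  rw [ord, ord, map_zpow₀, WithZero.log_zpow, zsmul_eq_mul, mul_neg, Int.cast_id]

theorem ord_unit (u : Aˣ) : ord A ((u : A) : k) = 0 := by
  have h := HeightOneSpectrum.valuation_of_algebraMap (K := k) (IsDiscreteValuationRing.maximalIdeal A) (u : A)
  have h2 : (IsDiscreteValuationRing.maximalIdeal A).intValuation (u : A) = 1 :=
    HeightOneSpectrum.intValuation_eq_one_iff.2 fun hu => (mem_maximalIdeal _).1 hu u.isUnit
  rw [h2] at h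
  rw [ord]
  change -WithZero.log (HeightOneSpectrum.valuation k _ (algebraMap A k u)) = 0
  rw [h, WithZero.log_one, neg_zero]

theorem ord_irreducible {p : A} (hp : Irreducible p) : ord A (p : k) = 1 := by
  have h := HeightOneSpectrum.valuation_of_algebraMap (K := k) (IsDiscreteValuationRing.maximalIdeal A) p
  rw [HeightOneSpectrum.intValuation_singleton _ hp.ne_zero hp.maximalIdeal_eq] at h
  rw [ord]
  change -WithZero.log (HeightOneSpectrum.valuation k _ (algebraMap A k p)) = 1
  rw [h, WithZero.log_exp, neg_neg]

/-- After division by the appropriate power of `p`, both the element and its inverse have valuation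
0, hence both lie in `A`. -/
theorem exists_eq_unit_mul_zpow {p : A} (hp : Irreducible p) {x : k} (hx : x ≠ 0) :
    ∃ u : Aˣ, x = (u : A) * (p : k) ^ ord A x := by
  have hp0 : (p : k) ≠ 0 := fun h => hp.ne_zero (Subtype.ext h)
  have key : ∀ y : k, y ≠ 0 → ord A y = 0 → y ∈ A := fun y hy h => by
    have h1 : (IsDiscreteValuationRing.maximalIdeal A).valuation k y ≤ 1 := by
      refine (WithZero.log_le_log (by simpa using hy) one_ne_zero).1 ?_
      rw [ord, neg_eq_zero] at h
      rw [h, WithZero.log_one]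
    obtain ⟨a, ha⟩ := IsDiscreteValuationRing.exists_lift_of_le_one h1
    rw [← ha]
    exact a.2
  have h0 : x * ((p : k) ^ ord A x)⁻¹ ≠ 0 := mul_ne_zero hx (inv_ne_zero (zpow_ne_zero _ hp0))
  have h1 : ord A (x * ((p : k) ^ ord A x)⁻¹) = 0 := by
    rw [← zpow_neg, ord_mul A hx (zpow_ne_zero _ hp0), ord_zpow, ord_irreducible A hp]
    ring
  have h2 : ord A (x * ((p : k) ^ ord A x)⁻¹)⁻¹ = 0 := by
    rw [← zpow_neg_one, ord_zpow, h1, mul_zero]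
  refine ⟨⟨⟨_, key _ h0 h1⟩, ⟨_, key _ (inv_ne_zero h0) h2⟩, Subtype.ext (mul_inv_cancel₀ h0),
    Subtype.ext (inv_mul_cancel₀ h0)⟩, ?_⟩
  change x = x * ((p : k) ^ ord A x)⁻¹ * _
  rw [inv_mul_cancel_right₀ (zpow_ne_zero _ hp0)]

end Ord

/-! ### The modulus of a discrete valuation field with finite residue field. -/

section Modulus

open IsLocalRing MeasureTheory
open scoped NNReal ENNReal

variable {k : Type u} [Field k] (A : ValuationSubring k) [IsDiscreteValuationRing A]
  {X : Type v} [AddCommGroup X] [TopologicalSpace X] [IsTopologicalAddGroup X]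
  [MeasurableSpace X] [BorelSpace X] (μ : Measure X) [μ.IsAddHaarMeasure]

/-- The modulus of a complete discrete valuation field with finite residue field. -/
theorem modulus_eq (hfin : Finite (ResidueField A)) (r : X →+ k) (hr : Function.Surjective r)
    (hopen : ∀ j : ℕ, IsOpen (r ⁻¹' {z | ∃ a ∈ maximalIdeal A ^ j, (a : k) = z}))
    (hcompact : ∃ (j : ℕ) (C : Set X), IsCompact C ∧ ∀ x, (∃ a ∈ maximalIdeal A ^ j, (a : k) = r x) → x ∈ C)
    (m : kˣ → ℝ≥0ˣ)
    (hm : ∀ (y : kˣ) (S : Set k), ((m y : ℝ≥0) : ℝ≥0∞) * μ (r ⁻¹' S) =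
      μ (r ⁻¹' {z | ((y⁻¹ : kˣ) : k) * z ∈ S})) (y : kˣ) :
    ((m y : ℝ≥0) : ℝ) = (Nat.card (ResidueField A) : ℝ) ^ (-ord A (y : k)) := by
  have hm0 : ∀ y, ((m y : ℝ≥0) : ℝ≥0∞) ≠ 0 := fun y => by
    rw [ne_eq, ENNReal.coe_eq_zero]
    exact (m y).ne_zero
  have hA : {z : k | ∃ a ∈ maximalIdeal A ^ 0, (a : k) = z} = A := by
    ext z
    rw [pow_zero]
    exact ⟨fun ⟨a, _, h⟩ => h ▸ a.2, fun h => ⟨⟨z, h⟩, by rw [Ideal.one_eq_top]; trivial, rfl⟩⟩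
  have h0 : μ (r ⁻¹' (A : Set k)) ≠ 0 := ((hA ▸ hopen 0).measure_pos μ ⟨0, by
    change r 0 ∈ A
    rw [map_zero]
    exact zero_mem _⟩).ne'
  obtain ⟨p, hp⟩ := IsDiscreteValuationRing.exists_irreducible A
  have hp0 : (p : k) ≠ 0 := fun h => hp.ne_zero (Subtype.ext h)
  -- Multiplication by a power of the uniformizer sends the valuation ring into a compact set and
  -- scales its measure by a nonzero finite factor.
  have htop : μ (r ⁻¹' (A : Set k)) ≠ ⊤ := by
    obtain ⟨j, C, hC, hjC⟩ := hcompact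
    have h1 := hm (Units.mk0 (p : k) hp0 ^ j) A
    intro h
    rw [h, ENNReal.mul_top (hm0 _)] at h1
    refine (lt_of_le_of_lt (measure_mono fun x hx => hjC x ?_) hC.measure_lt_top).ne h1.symm
    refine ⟨p ^ j * ⟨_, hx⟩, Ideal.mul_mem_right _ _ (Ideal.pow_mem_pow ?_ j), ?_⟩
    · exact (mem_maximalIdeal _).2 hp.not_isUnit
    · change (p : k) ^ j * ((((Units.mk0 (p : k) hp0 ^ j)⁻¹ : kˣ) : k) * r x) = r x
      have := Units.mul_inv_cancel_left (Units.mk0 (p : k) hp0 ^ j) (r x)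
      rwa [Units.val_pow_eq_pow_val (Units.mk0 (p : k) hp0)] at this
  -- The valuation ring has positive finite measure, so scaling factors can be compared on it.
  have hmul : ∀ y y', m (y * y') = m y * m y' := fun y y' => by
    have h1 := hm (y * y') A
    have h2 := hm y {z | ((y'⁻¹ : kˣ) : k) * z ∈ A}
    have h3 := hm y' A
    have h4 : {z : k | (((y * y')⁻¹ : kˣ) : k) * z ∈ (A : Set k)} =
        {z | ((y⁻¹ : kˣ) : k) * z ∈ {z | ((y'⁻¹ : kˣ) : k) * z ∈ A}} := by
      ext z
      simp only [Set.mem_ofPred_eq, mul_inv, Units.val_mul]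
      rw [mul_comm (((y⁻¹ : kˣ)) : k), mul_assoc]
      rfl
    rw [h4, ← h2] at h1
    change _ = _ * μ (r ⁻¹' {z | ((y'⁻¹ : kˣ) : k) * z ∈ (A : Set k)}) at h1
    rw [← h3, ← mul_assoc, ENNReal.mul_left_inj h0 htop, ← ENNReal.coe_mul, ENNReal.coe_inj] at h1
    exact Units.ext h1
  have hunit : ∀ u : Aˣ, m (Units.map A.subtype.toMonoidHom u) = 1 := fun u => by
    have h1 := hm (Units.map A.subtype.toMonoidHom u) A
    have h2 : {z : k | (((Units.map A.subtype.toMonoidHom u)⁻¹ : kˣ) : k) * z ∈ (A : Set k)} = A := by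
      ext z
      refine ⟨fun h => ?_, fun h => mul_mem ((u⁻¹ : Aˣ) : A).2 h⟩
      have := mul_mem (u : A).2 h
      change ((Units.map A.subtype.toMonoidHom u : kˣ) : k) * _ ∈ _ at this
      rwa [Units.mul_inv_cancel_left] at this
    rw [h2] at h1
    conv_rhs at h1 => rw [← one_mul (μ (r ⁻¹' (A : Set k)))]
    rw [ENNReal.mul_left_inj h0 htop, ← ENNReal.coe_one, ENNReal.coe_inj] at h1
    exact Units.ext h1
  -- The ring is the disjoint union of as many translates of its maximal ideal as the residue field
  -- has elements, and all translates have equal measure.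
  have hunif : ((m (Units.mk0 (p : k) hp0) : ℝ≥0) : ℝ) = (Nat.card (ResidueField A) : ℝ)⁻¹ := by
    have h1 := hm (Units.mk0 (p : k) hp0) A
    have h2 : {z : k | (((Units.mk0 (p : k) hp0)⁻¹ : kˣ) : k) * z ∈ (A : Set k)} =
        {z | ∃ a ∈ maximalIdeal A, (a : k) = z} := by
      ext z
      rw [Set.mem_ofPred_eq, Set.mem_ofPred_eq]
      constructor
      · intro h
        refine ⟨p * ⟨_, h⟩, Ideal.mul_mem_right _ _ ((mem_maximalIdeal _).2 hp.not_isUnit), ?_⟩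
        exact Units.mul_inv_cancel_left (Units.mk0 (p : k) hp0) z
      · rintro ⟨a, ha, rfl⟩
        rw [hp.maximalIdeal_eq, Ideal.mem_span_singleton] at ha
        obtain ⟨b, rfl⟩ := ha
        have := Units.inv_mul_cancel_left (Units.mk0 (p : k) hp0) b
        exact this.symm ▸ b.2
    rw [h2] at h1
    let s : ResidueField A → X := fun c => (hr ((residue_surjective (R := A) c).choose : A)).choose
    have hs : ∀ c, ∃ a : A, (a : k) = r (s c) ∧ residue A a = c := fun c =>
      ⟨_, (hr ((residue_surjective (R := A) c).choose : A)).choose_spec.symm,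
        (residue_surjective (R := A) c).choose_spec⟩
    have h3 : r ⁻¹' (A : Set k) =
        ⋃ c, (fun x => -s c + x) ⁻¹' (r ⁻¹' {z | ∃ a ∈ maximalIdeal A, (a : k) = z}) := by
      ext x
      rw [Set.mem_iUnion]
      constructor
      · intro hx
        obtain ⟨a, ha, ha'⟩ := hs (residue A ⟨_, hx⟩)
        refine ⟨residue A ⟨_, hx⟩, ⟨_, hx⟩ - a, ?_, ?_⟩
        · rw [← residue_eq_zero_iff, map_sub, ha', sub_self]
        · rw [map_add, map_neg, ← ha, neg_add_eq_sub]
          rfl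
      · rintro ⟨c, b, -, hb⟩
        obtain ⟨a, ha, ha'⟩ := hs c
        rw [map_add, map_neg, ← ha, eq_neg_add_iff_add_eq] at hb
        change r x ∈ A
        rw [← hb]
        exact add_mem a.2 b.2
    have hopen' : IsOpen (r ⁻¹' {z | ∃ a ∈ maximalIdeal A, (a : k) = z}) := by
      have := hopen 1
      rwa [pow_one] at this
    have := Fintype.ofFinite (ResidueField A)
    have h4 : μ (r ⁻¹' (A : Set k)) = Nat.card (ResidueField A) *
        μ (r ⁻¹' {z | ∃ a ∈ maximalIdeal A, (a : k) = z}) := by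
      conv_lhs => rw [h3]
      rw [measure_iUnion]
      · simp only [measure_preimage_add]
        rw [tsum_fintype, Finset.sum_const, Finset.card_univ, nsmul_eq_mul, Nat.card_eq_fintype_card]
      · intro c c' hcc
        refine Set.disjoint_left.2 ?_
        rintro x ⟨b, hb, e⟩ ⟨b', hb', e'⟩
        obtain ⟨a, ha, ha'⟩ := hs c
        obtain ⟨a', hha, hha'⟩ := hs c'
        refine hcc ?_
        rw [← ha', ← hha']
        rw [map_add, map_neg, ← ha, eq_neg_add_iff_add_eq] at e
        rw [map_add, map_neg, ← hha, eq_neg_add_iff_add_eq, ← e] at e'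
        have e'' : a' + b' = a + b := Subtype.ext e'
        have := congrArg (residue A) e''
        rw [map_add, map_add, (residue_eq_zero_iff _).2 hb, (residue_eq_zero_iff _).2 hb', add_zero, add_zero] at this
        exact this.symm
      · exact fun c => (hopen'.preimage (continuous_const_add _)).measurableSet
    rw [← h1, ← mul_assoc] at h4
    conv_lhs at h4 => rw [← one_mul (μ (r ⁻¹' (A : Set k)))]
    rw [ENNReal.mul_left_inj h0 htop] at h4
    have h5 := congrArg ENNReal.toReal h4
    rw [ENNReal.toReal_one, ENNReal.toReal_mul, ENNReal.toReal_natCast, ENNReal.coe_toReal] at h5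
    exact eq_inv_of_mul_eq_one_right h5.symm
  -- Units preserve the valuation ring and have factor 1, so only the power of the uniformizer
  -- counts.
  obtain ⟨u, hu⟩ := exists_eq_unit_mul_zpow A hp y.ne_zero
  have hy : y = Units.map A.subtype.toMonoidHom u * Units.mk0 (p : k) hp0 ^ ord A (y : k) := Units.ext (by
    rw [Units.val_mul, Units.val_zpow_eq_zpow_val]
    exact hu)
  have h1 := map_zpow (MonoidHom.mk' m hmul) (Units.mk0 (p : k) hp0) (ord A (y : k))
  change m (_ ^ _) = m _ ^ _ at h1
  rw [hy, hmul, hunit, one_mul, h1, ← hy]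
  rw [Units.val_zpow_eq_zpow_val, NNReal.coe_zpow, hunif, inv_zpow']

end Modulus

end TwoDim

namespace TwoDim

/-! ### Commutator pairings. -/

section Pairing

open scoped commutatorElement

variable {A : Type v} {E : Type u} {Γ : Type w} [CommGroup A] [Group E] [Group Γ]

/-- A commutator of a product involves a conjugate of the second commutator, and conjugation is
harmless when that commutator is central. -/
theorem commutator_mul_left_of_central {a : E} {e e' f : E} (h : ⁅e', f⁆ = a) (ha : ∀ x, a * x = x * a) :
    ⁅e * e', f⁆ = ⁅e, f⁆ * a := by
  rw [commutatorElement_def] at h ⊢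
  have h1 : e' * f = a * f * e' := by rw [← h]; group
  calc e * e' * f * (e * e')⁻¹ * f⁻¹ = e * (e' * f) * (e * e')⁻¹ * f⁻¹ := by group
    _ = e * (a * f * e') * (e * e')⁻¹ * f⁻¹ := by rw [h1]
    _ = (e * a) * f * e⁻¹ * f⁻¹ := by group
    _ = e * f * e⁻¹ * f⁻¹ * a := by rw [← ha, ← ha]; group

theorem commutator_mul_right_of_central {a : E} {e f f' : E} (h : ⁅e, f'⁆ = a) (ha : ∀ x, a * x = x * a) :
    ⁅e, f * f'⁆ = ⁅e, f⁆ * a := by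
  have h1 : ⁅f', e⁆ = a⁻¹ := by rw [← h, commutatorElement_inv]
  have h2 := commutator_mul_left_of_central (e := f) h1 fun x => by
    rw [inv_mul_eq_iff_eq_mul, ← mul_assoc, ha, mul_inv_cancel_right]
  rw [← commutatorElement_inv, h2, mul_inv_rev, inv_inv, commutatorElement_inv, ha]

/-- The commutator pairing of a central extension on a pair of commuting abelian groups. -/
theorem exists_pairing (θ : E →* Γ) (hθ : Function.Surjective θ) (inl : A →* E)
    (hinl : Function.Injective inl) (hrange : inl.range = θ.ker) (hcomm : ∀ a x, inl a * x = x * inl a)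
    {D D' : Type*} [CommGroup D] [CommGroup D'] (δ : D →* Γ) (δ' : D' →* Γ)
    (hδ : ∀ d d', δ d * δ' d' = δ' d' * δ d) :
    ∃ c : D →* D' →* A, ∀ d d' e f, θ e = δ d → θ f = δ' d' → inl (c d d') = ⁅e, f⁆ := by
  have hex : ∀ d d', ∃ a, ∀ e f, θ e = δ d → θ f = δ' d' → inl a = ⁅e, f⁆ := fun d d' => by
    obtain ⟨e, he⟩ := hθ (δ d)
    obtain ⟨f, hf⟩ := hθ (δ' d')
    obtain ⟨a, ha⟩ : ⁅e, f⁆ ∈ inl.range := by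
      rw [hrange, MonoidHom.mem_ker, map_commutatorElement, he, hf, commutatorElement_eq_one_iff_mul_comm, hδ]
    exact ⟨a, fun e' f' he' hf' => ha.trans (commutator_eq_of_map_eq θ inl hrange hcomm
      (he.trans he'.symm) (hf.trans hf'.symm))⟩
  choose c hc using hex
  refine ⟨MonoidHom.mk' (fun d => MonoidHom.mk' (c d) fun d₁ d₂ => hinl ?_) fun d₁ d₂ =>
    MonoidHom.ext fun d' => hinl ?_, hc⟩
  · obtain ⟨e, he⟩ := hθ (δ d)
    obtain ⟨f, hf⟩ := hθ (δ' d₁)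
    obtain ⟨f', hf'⟩ := hθ (δ' d₂)
    rw [hc d (d₁ * d₂) e (f * f') he (by rw [map_mul, map_mul, hf, hf']), map_mul, hc d d₁ e f he hf]
    exact commutator_mul_right_of_central (hc d d₂ e f' he hf').symm (hcomm _)
  · obtain ⟨e, he⟩ := hθ (δ d₁)
    obtain ⟨e', he'⟩ := hθ (δ d₂)
    obtain ⟨f, hf⟩ := hθ (δ' d')
    change inl (c (d₁ * d₂) d') = inl (c d₁ d' * c d₂ d')
    rw [hc (d₁ * d₂) d' (e * e') f (by rw [map_mul, map_mul, he, he']) hf, map_mul, hc d₁ d' e f he hf]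
    exact commutator_mul_left_of_central (hc d₂ d' e' f he' hf).symm (hcomm _)

end Pairing

/-! ### Symbols as commutators in the original extension. -/

section HatCommutator

open scoped commutatorElement

variable {K : Type u} [Field K] {A : Type v} [CommGroup A] {E : Type w} [Group E]

/-- In the semidirect product, diag(y, 1) lifts to the pair (1, y) and diag(1, x) to (b, x), where b
= f'f lies over diag(1/x, x). The commutator of these pairs is the action of y on b divided by b,
which is the commutator of e and b in `E`. -/
theorem HatData.inl_eq_commutator (θ : E →* GL (Fin 2) K) (hθ : Function.Surjective θ) (inl : A →* E)
    (hinl : Function.Injective inl) (hrange : inl.range = θ.ker)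
    (hcomm : ∀ a x, inl a * x = x * inl a) {x y : Kˣ}
    {X Y : (Matrix.GeneralLinearGroup.det.comp θ).ker ⋊[(HatData.ofExtension θ hθ inl hinl hrange hcomm).φ] Kˣ}
    (hX : (HatData.ofExtension θ hθ inl hinl hrange hcomm).ext.rightHom X = diagGL ![y, 1])
    (hY : (HatData.ofExtension θ hθ inl hinl hrange hcomm).ext.rightHom Y = diagGL ![1, x]) {a : A}
    (ha : (HatData.ofExtension θ hθ inl hinl hrange hcomm).ext.inl a = ⁅X, Y⁆) {e f f' : E}
    (he : θ e = corner y) (hf : θ f = corner x⁻¹) (hf' : θ f' = diagGL ![1, x]) :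
    inl a = ⁅e, f' * f⁆ := by
  have hdiag : Matrix.GeneralLinearGroup.det (diagGL ![1, x]) = x := Units.ext (by
    simp [diagGL, Matrix.det_diagonal])
  let b : (Matrix.GeneralLinearGroup.det.comp θ).ker := ⟨f' * f, by
    rw [MonoidHom.mem_ker, MonoidHom.comp_apply, map_mul, map_mul, hf, hf', det_corner, hdiag, mul_inv_cancel]⟩
  obtain ⟨H, hH⟩ : ∃ H, H = HatData.ofExtension θ hθ inl hinl hrange hcomm := ⟨_, rfl⟩
  have h1 := commutator_eq_of_map_eq (HatData.ofExtension θ hθ inl hinl hrange hcomm).ext.rightHom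
    (HatData.ofExtension θ hθ inl hinl hrange hcomm).ext.inl
    (HatData.ofExtension θ hθ inl hinl hrange hcomm).ext.range_inl_eq_ker_rightHom
    (HatData.ofExtension θ hθ inl hinl hrange hcomm).ext_comm (e := X) (f := Y)
    (e' := SemidirectProduct.inr y) (f' := ⟨b, x⟩) (hX.trans (by
      change _ = θ 1 * corner y
      rw [map_one, one_mul]
      rfl)) (by
      refine hY.trans ?_
      change _ = θ (f' * f) * corner x
      rw [map_mul, hf, hf', mul_assoc, ← map_mul, inv_mul_cancel, map_one, mul_one])
  have h2 := ha.trans h1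
  rw [commutatorElement_def, eq_mul_inv_iff_mul_eq, eq_mul_inv_iff_mul_eq] at h2
  have h3 := congrArg (fun z => z.left.1) h2
  simp only [SemidirectProduct.mul_left, SemidirectProduct.left_inr, SemidirectProduct.right_inr, map_one,
    mul_one, one_mul] at h3
  have h4 := HatData.ofExtension_φ θ hθ inl hinl hrange hcomm he b
  have h5 := h3.trans h4
  have h6 : inl a * (f' * f) = e * (f' * f) * e⁻¹ := by
    refine Eq.trans ?_ h5
    change _ = ((HatData.ofExtension θ hθ inl hinl hrange hcomm).ext.inl a).left.1 *
      ((HatData.ofExtension θ hθ inl hinl hrange hcomm).φ 1 b).1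
    rw [map_one]
    rfl
  rw [commutatorElement_def, ← h6, mul_inv_cancel_right]

end HatCommutator

/-! ### Commutators measured by the scaling of Haar measures. -/

namespace TorsorSystem

open scoped commutatorElement

variable {A : Type v} {Γ : Type u} {L : Type w} [CommGroup A] [Group Γ] [PartialOrder L]
  [MulAction Γ L] {T : TorsorSystem.{w, v, u, v'} A Γ L}

theorem ratio_le_refl (s' s : T.Triv) {N N' : L} (h : N ≤ N') (hN : N = N') : ratio s' s h = 1 := by
  subst hN
  exact mul_eq_left.1 (ratio_mul s' s h h)

/-- The image of `f` shrinks the base lattice, so the defining condition for `f`, taken with the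
shrunken lattice itself as auxiliary lattice, involves only one ratio. That ratio measures how the
inverse of `g` scales the measure on the quotient, and it is the commutator. -/
theorem commutator_stabHom {L₀ : L} (g : MulAction.stabilizer Γ L₀) (f : T.ext L₀)
    (hle : T.extHom L₀ f • L₀ ≤ L₀) (hc : (g : Γ) * T.extHom L₀ f = T.extHom L₀ f * g) (s : T.Triv) :
    ⁅T.stabHom L₀ g, f⁆ = T.extInl L₀ (ratio ((g : Γ)⁻¹ • s) s hle) := by
  rw [commutatorElement_def, mul_inv_eq_iff_eq_mul, mul_inv_eq_iff_eq_mul]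
  have key : ∀ s : T.Triv, f.1.left ((g : Γ)⁻¹ • s) = ratio ((g : Γ)⁻¹ • s) s hle * f.1.left s := fun s => by
    have e1 := f.2 s ((g : Γ)⁻¹ • s) _ hle le_rfl
    rw [mul_comm] at e1
    exact (e1.trans ((congrArg _ (ratio_le_refl _ _ _ rfl)).trans (mul_one _))).symm
  have hgf : (g : Γ) • T.extHom L₀ f • L₀ = T.extHom L₀ f • L₀ := by
    rw [smul_smul, hc, mul_smul]
    exact congrArg _ g.2
  -- The scaling factor is independent of the trivialization, as `g` stabilizes both lattices; this
  -- is needed for the commutator to be a constant function.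
  have hs : ∀ s' : T.Triv, ratio ((g : Γ)⁻¹ • s') s' hle = ratio ((g : Γ)⁻¹ • s) s hle := fun s' => by
    have e1 : ratio ((g : Γ)⁻¹ • s') ((g : Γ)⁻¹ • s) hle = ratio s' s hle :=
      (ratio_smul ..).trans (ratio_congr _ _ _ _ (by rw [inv_inv, hgf]) (by rw [inv_inv]; exact g.2))
    have e2 := ratio_trans ((g : Γ)⁻¹ • s') s' s hle
    have e3 := ratio_trans ((g : Γ)⁻¹ • s') ((g : Γ)⁻¹ • s) s hle
    rw [e1] at e3
    rw [← e2, mul_comm] at e3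
    exact (mul_right_cancel e3).symm
  refine Subtype.ext (SemidirectProduct.ext (funext fun s' => ?_) ?_)
  · change 1 * f.1.left ((g : Γ)⁻¹ • s') = ratio ((g : Γ)⁻¹ • s) s hle * (f.1.left ((1 : Γ)⁻¹ • s')) * 1
    rw [one_mul, mul_one, inv_one, one_smul, key, hs]
  · change (g : Γ) * f.1.right = 1 * f.1.right * g
    rw [one_mul]
    exact hc

end TorsorSystem

namespace LatticeSystem

open TorsorSystem MeasureTheory
open scoped NNReal ENNReal

variable {Γ : Type u} [Group Γ] {V : Type v} [AddCommGroup V] [TopologicalSpace V] [IsTopologicalAddGroup V]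
  (D : LatticeSystem Γ V)

/-- When both lattices are stable, the translated trivialization is the push-forward of the measure
under an automorphism of the quotient; its ratio to the original measure can be tested on any set.
-/
theorem ratio_smul_measure {u : Γ} {N Λ : D.Lat} (h : N ≤ Λ) (hN : u • N = N) (hΛ : u • Λ = Λ)
    (s : D.torsors.Triv) (S : Set (LQuot N.1 Λ.1)) :
    (((ratio (u • s) s h : ℝ≥0ˣ) : ℝ≥0) : ℝ≥0∞) * (s.1 h).1 S = (s.1 h).1 (D.equiv u hN hΛ ⁻¹' S) := by
  have e1 := ratio_spec (u • s) s h
  have e2 := s.map_congr u (D.torsors.smul_le u⁻¹ h) h h (smul_inv_smul _ _) (smul_inv_smul _ _) hN hΛ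
  have e3 := congrArg (fun μ : HaarMeas N.1 Λ.1 => μ.1 S) (e1.trans e2)
  refine Eq.trans ?_ (e3.trans ?_)
  · rfl
  · exact (D.equiv u hN hΛ).toHomeomorph.isClosedEmbedding.measurableEmbedding.map_apply _ _

end LatticeSystem

end TwoDim

namespace TwoDim

/-! ### The Haar measure on O^2 / diag(t, 1) O^2. -/

namespace TwoDimLocalField

open IsLocalRing TorsorSystem MeasureTheory Topology
open scoped NNReal ENNReal commutatorElement

variable {K : Type u} [Field K] (F : TwoDimLocalField K)

/-- The first coordinate of an element of `O²`. -/
def fstCoord : F.stdLattice (Fin 2) →+ F.O where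
  toFun x := ⟨x.1 0, x.2 0⟩
  map_zero' := rfl
  map_add' _ _ := rfl

/-- The embedding of `O` into `O²`. -/
def fstIncl : F.O →+ F.stdLattice (Fin 2) where
  toFun a := ⟨![a, 0], fun i => by
    fin_cases i
    exacts [a.2, zero_mem _]⟩
  map_zero' := Subtype.ext (funext fun i => by fin_cases i <;> rfl)
  map_add' a b := Subtype.ext (funext fun i => by
    fin_cases i
    exacts [rfl, (add_zero (0 : K)).symm])

theorem matAct_diagGL (d : Fin 2 → Kˣ) (x : Fin 2 → K) (i : Fin 2) :
    matAct (Fin 2) (diagGL d) x i = d i * x i := by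
  rw [matAct_apply]
  exact Matrix.mulVec_diagonal _ _ _

theorem matAct_corner_zero (u : Kˣ) (x : Fin 2 → K) : matAct (Fin 2) (corner u) x 0 = u * x 0 :=
  matAct_diagGL ![u, 1] x 0

theorem matAct_corner_one (u : Kˣ) (x : Fin 2 → K) : matAct (Fin 2) (corner u) x 1 = x 1 :=
  (matAct_diagGL ![u, 1] x 1).trans (one_mul _)

variable {F} {τ : F.O} (hτ : Irreducible τ) {t : Kˣ} (ht : (t : K) = τ)

theorem mem_corner_map_iff (hτ : Irreducible τ) (ht : (t : K) = τ) (x : F.stdLattice (Fin 2)) :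
    (x : Fin 2 → K) ∈ (F.stdLattice (Fin 2)).map (matAct (Fin 2) (corner t)) ↔
      residue F.O (F.fstCoord x) = 0 := by
  have e : ∀ x, ((t⁻¹ : Kˣ) : K) * (τ * x) = x := fun x => by
    rw [← ht, Units.inv_mul_cancel_left]
  rw [mem_map_iff, ← map_inv, residue_eq_zero_iff, hτ.maximalIdeal_eq, Ideal.mem_span_singleton]
  constructor
  · intro h
    have h0 := h 0
    rw [matAct_corner_zero] at h0
    refine ⟨⟨_, h0⟩, Subtype.ext ?_⟩
    change x.1 0 = τ * _
    rw [← ht, Units.mul_inv_cancel_left]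
  · rintro ⟨b, hb⟩ i
    fin_cases i
    · change matAct (Fin 2) (corner t⁻¹) x 0 ∈ F.O
      rw [matAct_corner_zero, show (x : Fin 2 → K) 0 = τ * b from congrArg Subtype.val hb, e]
      exact b.2
    · change matAct (Fin 2) (corner t⁻¹) x 1 ∈ F.O
      rw [matAct_corner_one]
      exact x.2 1

/-- The isomorphism between `O² / diag(t, 1) O²` and the residue field. -/
noncomputable def residueHom (hτ : Irreducible τ) (ht : (t : K) = τ) :
    LQuot ((F.stdLattice (Fin 2)).map (matAct (Fin 2) (corner t))) (F.stdLattice (Fin 2)) →+ ResidueField F.O :=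
  QuotientAddGroup.lift _ ((residue F.O).toAddMonoidHom.comp F.fstCoord) fun x hx =>
    (mem_corner_map_iff hτ ht x).1 hx

theorem residueHom_mk (x : F.stdLattice (Fin 2)) :
    residueHom hτ ht (LQuot.mk _ _ x) = residue F.O (F.fstCoord x) := rfl

theorem residueHom_surjective : Function.Surjective (residueHom hτ ht) := fun y => by
  obtain ⟨a, rfl⟩ := residue_surjective (R := F.O) y
  exact ⟨LQuot.mk _ _ (F.fstIncl a), rfl⟩

theorem residueHom_injective : Function.Injective (residueHom hτ ht) := by
  refine (injective_iff_map_eq_zero _).2 fun z hz => ?_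
  obtain ⟨x, rfl⟩ := QuotientAddGroup.mk'_surjective _ z
  exact (QuotientAddGroup.eq_zero_iff x).2 ((mem_corner_map_iff hτ ht x).2 hz)

variable [TopologicalSpace K] (hF : F.IsNaturalTopology)

theorem continuous_fstCoord : Continuous F.fstCoord :=
  ((continuous_apply 0).comp continuous_subtype_val).subtype_mk _

theorem continuous_fstIncl : Continuous F.fstIncl := by
  refine Continuous.subtype_mk (continuous_pi fun i => ?_) _
  fin_cases i
  exacts [continuous_subtype_val, continuous_const]

/-- The set is a subgroup, so a neighbourhood of 0 inside it suffices. The assumption on the residue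
topology provides one in O, and the open quotient map carries it over. -/
theorem isOpen_preimage_residueHom (hF : F.IsNaturalTopology) (j : ℕ) :
    IsOpen (residueHom hτ ht ⁻¹' {z | ∃ a ∈ maximalIdeal F.O₁ ^ j, (a : ResidueField F.O) = z}) := by
  have := hF.isTopologicalAddGroup
  let H : AddSubgroup (ResidueField F.O) :=
    (maximalIdeal F.O₁ ^ j).toAddSubgroup.map F.O₁.subtype.toAddMonoidHom
  refine (H.comap (residueHom hτ ht)).isOpen_of_mem_nhds (g := 0) ?_
  have h1 : {x : F.O | residue F.O x ∈ (H : Set (ResidueField F.O))} ∈ 𝓝 (0 : F.O) :=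
    (hF.residue _).2 ⟨j, fun y hy => ⟨y, hy, rfl⟩⟩
  have h2 : F.fstCoord ⁻¹' {x : F.O | residue F.O x ∈ (H : Set (ResidueField F.O))} ∈ 𝓝 0 := by
    refine continuous_fstCoord.continuousAt.preimage_mem_nhds ?_
    rwa [map_zero]
  have h3 := (LQuot.isOpenQuotientMap_mk ((F.stdLattice (Fin 2)).map (matAct (Fin 2) (corner t)))
    (F.stdLattice (Fin 2))).isOpenMap.image_mem_nhds h2
  rw [map_zero] at h3
  refine Filter.mem_of_superset h3 ?_
  rintro _ ⟨x, hx, rfl⟩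
  exact hx

/-- A compact neighbourhood of 0 in the quotient pulls back to a neighbourhood of 0 in O; by the
assumption on the residue topology it then covers a power of the maximal ideal of `F.O₁`. -/
theorem exists_compact_residueHom (hF : F.IsNaturalTopology)
    [LocallyCompactSpace (LQuot ((F.stdLattice (Fin 2)).map (matAct (Fin 2) (corner t))) (F.stdLattice (Fin 2)))] :
    ∃ (j : ℕ) (C : Set (LQuot ((F.stdLattice (Fin 2)).map (matAct (Fin 2) (corner t))) (F.stdLattice (Fin 2)))),
      IsCompact C ∧ ∀ x, (∃ a ∈ maximalIdeal F.O₁ ^ j, (a : ResidueField F.O) = residueHom hτ ht x) → x ∈ C := by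
  have := hF.isTopologicalAddGroup
  obtain ⟨C, hC, hC'⟩ := exists_compact_mem_nhds
    (0 : LQuot ((F.stdLattice (Fin 2)).map (matAct (Fin 2) (corner t))) (F.stdLattice (Fin 2)))
  obtain ⟨j, hj⟩ := (hF.residue {y | ∀ x, residueHom hτ ht x = y → x ∈ C}).1 (by
    have h1 : Continuous fun a => LQuot.mk ((F.stdLattice (Fin 2)).map (matAct (Fin 2) (corner t)))
        (F.stdLattice (Fin 2)) (F.fstIncl a) :=
      (LQuot.isOpenQuotientMap_mk _ _).continuous.comp continuous_fstIncl
    have h2 := h1.continuousAt (x := 0) |>.preimage_mem_nhds (t := C) (by rwa [map_zero, map_zero])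
    refine Filter.mem_of_superset h2 fun a ha x hx => ?_
    rwa [residueHom_injective hτ ht (hx.trans (residueHom_mk hτ ht (F.fstIncl a)).symm)])
  refine ⟨j, C, hC, ?_⟩
  rintro x ⟨a, ha, e⟩
  exact hj a ha x e.symm

theorem diagGL_mem_congr {d : Fin 2 → Kˣ} (hd : ∀ i, (d i : K) ∈ F.O) (hd' : ∀ i, (((d i)⁻¹ : Kˣ) : K) ∈ F.O) :
    diagGL d ∈ F.congr (Fin 2) 0 := by
  rw [mem_congr_zero]
  constructor
  · intro i j
    change Matrix.diagonal (fun i => (d i : K)) i j ∈ F.O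
    rw [Matrix.diagonal_apply]
    split_ifs
    exacts [hd i, zero_mem _]
  · intro i j
    change Matrix.diagonal (fun i => (((d i)⁻¹ : Kˣ) : K)) i j ∈ F.O
    rw [Matrix.diagonal_apply]
    split_ifs
    exacts [hd' i, zero_mem _]

theorem corner_mem_congr {v : Kˣ} (hv : (v : K) ∈ F.O) (hv' : ((v⁻¹ : Kˣ) : K) ∈ F.O) :
    corner v ∈ F.congr (Fin 2) 0 :=
  diagGL_mem_congr (Fin.forall_fin_two.2 ⟨hv, one_mem _⟩) (Fin.forall_fin_two.2 ⟨hv', by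
    change (((1 : Kˣ)⁻¹ : Kˣ) : K) ∈ F.O
    rw [inv_one]
    exact one_mem _⟩)

theorem corner_smul_le (hτ : Irreducible τ) (ht : (t : K) = τ) (hF : F.IsNaturalTopology) :
    corner t • baseLattice (Fin 2) hF ≤ baseLattice (Fin 2) hF := by
  rintro _ ⟨x, hx, rfl⟩ i
  fin_cases i
  · change matAct (Fin 2) (corner t) x 0 ∈ F.O
    rw [matAct_corner_zero, ht]
    exact mul_mem τ.2 (hx 0)
  · change matAct (Fin 2) (corner t) x 1 ∈ F.O
    rw [matAct_corner_one]
    exact hx 1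

theorem exists_unit_lift (y : (ResidueField F.O)ˣ) : ∃ (v : Kˣ) (hv : (v : K) ∈ F.O),
    ((v⁻¹ : Kˣ) : K) ∈ F.O ∧ residue F.O ⟨v, hv⟩ = y := by
  obtain ⟨a, ha⟩ := residue_surjective (R := F.O) (y : ResidueField F.O)
  obtain ⟨b, hb⟩ := (residue_ne_zero_iff_isUnit a).1 (ha.symm ▸ y.ne_zero)
  refine ⟨Units.map F.O.subtype.toMonoidHom b, (b : F.O).2, ((b⁻¹ : F.Oˣ) : F.O).2, ?_⟩
  rw [← ha, ← hb]
  rfl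

/-- The action of `diag(v, 1)` on the Haar measures of `O² / diag(t, 1) O²`. -/
theorem ratio_corner (hF : F.IsNaturalTopology) {v : Kˣ} (hv : (v : K) ∈ F.O) (hv' : ((v⁻¹ : Kˣ) : K) ∈ F.O)
    (s : (haarTorsors hF (Fin 2)).Triv) :
    (((ratio ((corner v)⁻¹ • s) s (corner_smul_le hτ ht hF) : ℝ≥0ˣ) : ℝ≥0) : ℝ) =
      (F.q : ℝ) ^ (-ord F.O₁ (residue F.O ⟨v, hv⟩)) := by
  have := hF.isTopologicalAddGroup
  have hle := corner_smul_le hτ ht hF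
  have : LocallyCompactSpace (LQuot ((F.stdLattice (Fin 2)).map (matAct (Fin 2) (corner t)))
    (F.stdLattice (Fin 2))) := (latticeSystem (Fin 2) hF).lc hle
  let μ : Measure (LQuot ((F.stdLattice (Fin 2)).map (matAct (Fin 2) (corner t))) (F.stdLattice (Fin 2))) :=
    (s.1 hle).1
  have : μ.IsAddHaarMeasure := (s.1 hle).2
  have hy : residue F.O ⟨v, hv⟩ ≠ 0 := (residue_ne_zero_iff_isUnit _).2
    ⟨⟨⟨v, hv⟩, ⟨_, hv'⟩, Subtype.ext v.mul_inv, Subtype.ext v.inv_mul⟩, rfl⟩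
  -- The modulus lemma wants a scaling factor for every unit of the residue field, so lifts are
  -- chosen for all of them, with `v` itself as the lift of its own residue.
  have hex : ∀ y : (ResidueField F.O)ˣ, ∃ (w : Kˣ) (hw : (w : K) ∈ F.O), ((w⁻¹ : Kˣ) : K) ∈ F.O ∧
      residue F.O ⟨w, hw⟩ = y ∧ (y = Units.mk0 _ hy → w = v) := fun y => by
    by_cases h : y = Units.mk0 _ hy
    · exact ⟨v, hv, hv', h ▸ rfl, fun _ => rfl⟩
    · obtain ⟨w, hw, hw', e⟩ := F.exists_unit_lift y
      exact ⟨w, hw, hw', e, fun h' => absurd h' h⟩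
  choose w hw hw' hwy hwv using hex
  -- Under the identification with the residue field, the inverse of diag(v, 1) becomes
  -- multiplication by the inverse of the residue of v.
  have key : ∀ (v : Kˣ) (hv : (v : K) ∈ F.O) (hv' : ((v⁻¹ : Kˣ) : K) ∈ F.O) (y : (ResidueField F.O)ˣ)
      (hy : residue F.O ⟨v, hv⟩ = y) (S : Set (ResidueField F.O)),
      (((ratio ((corner v)⁻¹ • s) s hle : ℝ≥0ˣ) : ℝ≥0) : ℝ≥0∞) * (s.1 hle).1 (residueHom hτ ht ⁻¹' S) =
        (s.1 hle).1 (residueHom hτ ht ⁻¹' {z | ((y⁻¹ : (ResidueField F.O)ˣ) : ResidueField F.O) * z ∈ S}) := by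
    intro v hv hv' y hy S
    have hu : (corner v)⁻¹ • baseLattice (Fin 2) hF = baseLattice (Fin 2) hF :=
      smul_baseLattice hF (inv_mem (corner_mem_congr hv hv'))
    have hN : (corner v)⁻¹ • corner t • baseLattice (Fin 2) hF = corner t • baseLattice (Fin 2) hF := by
      rw [smul_smul, ← map_inv, ← _root_.map_mul, mul_comm, _root_.map_mul, mul_smul, map_inv, hu]
    refine ((latticeSystem (Fin 2) hF).ratio_smul_measure hle hN hu s _).trans ?_
    refine congrArg _ (Set.ext fun z => ?_)
    obtain ⟨x, rfl⟩ := LQuot.mk_surjective _ _ z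
    have e1 : residue F.O (⟨_, hv'⟩ * F.fstCoord x) =
        ((y⁻¹ : (ResidueField F.O)ˣ) : ResidueField F.O) * residue F.O (F.fstCoord x) := by
      rw [_root_.map_mul]
      congr 1
      refine Eq.trans (eq_inv_of_mul_eq_one_left ?_) (Units.val_inv_eq_inv_val y).symm
      rw [← hy, ← _root_.map_mul, ← map_one (residue F.O)]
      exact congrArg _ (Subtype.ext v.inv_mul)
    have e2 : residueHom hτ ht ((latticeSystem (Fin 2) hF).equiv (corner v)⁻¹ hN hu (LQuot.mk _ _ x)) =
        residue F.O (⟨_, hv'⟩ * F.fstCoord x) := by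
      refine congrArg (residue F.O) (Subtype.ext ?_)
      change matAct (Fin 2) (corner v)⁻¹ x 0 = _
      rw [← map_inv, matAct_corner_zero]
      rfl
    change residueHom hτ ht _ ∈ S ↔ _ * residue F.O (F.fstCoord x) ∈ S
    rw [e2, e1]
  have h1 := modulus_eq F.O₁ μ F.finite (residueHom hτ ht) (residueHom_surjective hτ ht)
    (isOpen_preimage_residueHom hτ ht hF) (exists_compact_residueHom hτ ht hF)
    (fun y => ratio ((corner (w y))⁻¹ • s) s hle) (fun y S => key _ (hw y) (hw' y) y (hwy y) S)
    (Units.mk0 _ hy)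
  simp only [hwv _ rfl] at h1
  exact h1

end TwoDimLocalField

end TwoDim

/-! ### Evaluation of the symbol and the unramified character. -/

namespace TwoDim

/-- The embedding `Kˣ → GL₂(K)` in the lower right corner. -/
def corner₂ {K : Type u} [Field K] : Kˣ →* GL (Fin 2) K where
  toFun u := diagGL ![1, u]
  map_one' := by ext i j; fin_cases i <;> fin_cases j <;> simp [diagGL]
  map_mul' u v := by ext i j; fin_cases i <;> fin_cases j <;> simp [diagGL]

theorem diagGL_comm {K : Type u} [Field K] (d d' : Fin 2 → Kˣ) : diagGL d * diagGL d' = diagGL d' * diagGL d := by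
  refine Units.ext ?_
  change Matrix.diagonal _ * Matrix.diagonal _ = Matrix.diagonal _ * Matrix.diagonal _
  rw [Matrix.diagonal_mul_diagonal, Matrix.diagonal_mul_diagonal]
  simp only [mul_comm]

/-- The permutation matrix which exchanges the coordinates. -/
def swapGL (K : Type u) [Field K] : GL (Fin 2) K where
  val := !![0, 1; 1, 0]
  inv := !![0, 1; 1, 0]
  val_inv := by ext i j; fin_cases i <;> fin_cases j <;> simp
  inv_val := by ext i j; fin_cases i <;> fin_cases j <;> simp

theorem swapGL_conj {K : Type u} [Field K] (a b : Kˣ) :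
    swapGL K * diagGL ![a, b] * (swapGL K)⁻¹ = diagGL ![b, a] := by
  rw [mul_inv_eq_iff_eq_mul]
  refine Units.ext ?_
  change !![0, 1; 1, 0] * Matrix.diagonal _ = Matrix.diagonal _ * !![0, 1; 1, 0]
  ext i j
  fin_cases i <;> fin_cases j <;> simp

theorem pairing_mul_zpow {M A : Type*} [CommGroup M] [CommGroup A] (c : M →* M →* A) (u v t : M) (i j : ℤ) :
    c (v * t ^ j) (u * t ^ i) = c v u * c v t ^ i * (c t u * c t t ^ i) ^ j := by
  have h : ∀ x y, c x y = c.flip y x := fun _ _ => rfl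
  rw [h, map_mul, map_zpow, ← h, ← h, map_mul, map_mul, map_zpow, map_zpow]

open scoped commutatorElement in
/-- A homomorphism of central extensions maps a commutator of lifts to one of lifts. -/
theorem HatData.map_inl_eq_commutator {K : Type u} [Field K] {A₀ : Type*} [CommGroup A₀] {T₀ : Type*} [Group T₀] (H : HatData A₀ T₀ K)
    {A E : Type*} [CommGroup A] [Group E] (θ : E →* GL (Fin 2) K) (hθ : Function.Surjective θ) (inl : A →* E)
    (hinl : Function.Injective inl) (hrange : inl.range = θ.ker) (hcomm : ∀ a x, inl a * x = x * inl a)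
    (Φ : T₀ ⋊[H.φ] Kˣ →* (Matrix.GeneralLinearGroup.det.comp θ).ker
      ⋊[(HatData.ofExtension θ hθ inl hinl hrange hcomm).φ] Kˣ) (κ : A₀ →* A)
    (h1 : ∀ k, Φ (H.ext.inl k) = (HatData.ofExtension θ hθ inl hinl hrange hcomm).ext.inl (κ k))
    (h2 : ∀ x, (HatData.ofExtension θ hθ inl hinl hrange hcomm).ext.rightHom (Φ x) = H.ext.rightHom x)
    {x y : Kˣ} {X Y : T₀ ⋊[H.φ] Kˣ} {k : A₀} (hX : H.ext.rightHom X = diagGL ![y, 1])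
    (hY : H.ext.rightHom Y = diagGL ![1, x]) (hk : H.ext.inl k = X * Y * X⁻¹ * Y⁻¹) {e f f' : E}
    (he : θ e = corner y) (hf : θ f = corner x⁻¹) (hf' : θ f' = diagGL ![1, x]) :
    inl (κ k) = ⁅e, f' * f⁆ := by
  refine HatData.inl_eq_commutator θ hθ inl hinl hrange hcomm ((h2 X).trans hX) ((h2 Y).trans hY)
    (((h1 k).symm.trans (congrArg Φ hk)).trans ?_) he hf hf'
  exact map_commutatorElement Φ X Y

namespace TwoDimLocalField

open IsLocalRing
open scoped NNReal commutatorElement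

variable {K : Type u} [Field K] {F : TwoDimLocalField K}

/-- The embedding of the units of `O`. -/
def unitHom (F : TwoDimLocalField K) : (F.O)ˣ →* Kˣ := Units.map F.O.subtype.toMonoidHom

/-- The powers of `t` cancel in the quotient that defines `F.nu`, leaving the residue of the j-th
power of u divided by the i-th power of v. -/
theorem nu_eq {τ : F.O} (hτ : Irreducible τ) {t : Kˣ} (ht : (t : K) = τ) (u v : F.Oˣ) (i j : ℤ) :
    F.nu (F.unitHom u * t ^ i) (F.unitHom v * t ^ j) =
      j * ord F.O₁ (residue F.O u) - i * ord F.O₁ (residue F.O v) := by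
  have h1 : ∀ (u : F.Oˣ) (i : ℤ), ord F.O ((F.unitHom u * t ^ i : Kˣ) : K) = i := fun u i => by
    rw [Units.val_mul, Units.val_zpow_eq_zpow_val, ord_mul _ (Units.ne_zero _) (zpow_ne_zero _ t.ne_zero), ord_zpow,
      ht, ord_irreducible _ hτ, mul_one]
    change ord F.O ((u : F.O) : K) + i = i
    rw [ord_unit, zero_add]
  have h2 : (((F.unitHom u * t ^ i : Kˣ) : K) ^ j / ((F.unitHom v * t ^ j : Kˣ) : K) ^ i) =
      ((u ^ j * (v ^ i)⁻¹ : F.Oˣ) : F.O) := by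
    rw [← Units.val_zpow_eq_zpow_val, ← Units.val_zpow_eq_zpow_val, ← Units.val_div_eq_div_val]
    change _ = ((F.unitHom (u ^ j * (v ^ i)⁻¹) : Kˣ) : K)
    refine congrArg Units.val ?_
    rw [map_mul, map_inv, map_zpow, map_zpow, mul_zpow, mul_zpow, ← zpow_mul, ← zpow_mul, mul_comm j i,
      mul_div_mul_right_eq_div, div_eq_mul_inv]
  have h3 : F.res (((u ^ j * (v ^ i)⁻¹ : F.Oˣ) : F.O) : K) =
      ((Units.map (residue F.O).toMonoidHom u ^ j * (Units.map (residue F.O).toMonoidHom v ^ i)⁻¹ :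
        (ResidueField F.O)ˣ) : ResidueField F.O) := by
    refine (dif_pos (Subtype.coe_prop _)).trans ?_
    rw [← map_zpow, ← map_zpow, ← map_inv, ← map_mul]
    rfl
  rw [nu, h1, h1, h2, h3, Units.val_mul, ← zpow_neg, Units.val_zpow_eq_zpow_val, Units.val_zpow_eq_zpow_val,
    ord_mul _ (zpow_ne_zero _ (Units.ne_zero _)) (zpow_ne_zero _ (Units.ne_zero _)), ord_zpow, ord_zpow]
  change j * ord F.O₁ (residue F.O u) + -i * ord F.O₁ (residue F.O v) = _
  ring

theorem q_ne_zero : (F.q : ℝ≥0) ≠ 0 := by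
  have := F.finite
  exact Nat.cast_ne_zero.2 Nat.card_pos.ne'

variable [TopologicalSpace K] (hF : F.IsNaturalTopology)

theorem exists_unitHom_mul_zpow {τ : F.O} (hτ : Irreducible τ) {t : Kˣ} (ht : (t : K) = τ) (x : Kˣ) :
    ∃ (u : F.Oˣ) (i : ℤ), x = F.unitHom u * t ^ i := by
  obtain ⟨u, hu⟩ := exists_eq_unit_mul_zpow F.O hτ x.ne_zero
  refine ⟨u, ord F.O (x : K), Units.ext (hu.trans ?_)⟩
  rw [Units.val_mul, Units.val_zpow_eq_zpow_val, ht]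
  rfl

theorem corner₂_smul_le {τ : F.O} {t : Kˣ} (ht : (t : K) = τ) :
    corner₂ t • baseLattice (Fin 2) hF ≤ baseLattice (Fin 2) hF := by
  rintro _ ⟨x, hx, rfl⟩ i
  change matAct (Fin 2) (diagGL ![1, t]) x i ∈ F.O
  rw [matAct_diagGL]
  refine mul_mem ?_ (hx i)
  fin_cases i
  · exact one_mem _
  · exact ht ▸ τ.2

/-- Here diag(v, 1) changes only the first coordinate, by an element of O, while the quotient by
diag(1, t) O^2 sees only the second; the action on the quotient is trivial. -/
theorem ratio_corner₂ {τ : F.O} {t : Kˣ} (ht : (t : K) = τ) {v : Kˣ} (hv : (v : K) ∈ F.O)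
    (hv' : ((v⁻¹ : Kˣ) : K) ∈ F.O) (s : (haarTorsors hF (Fin 2)).Triv) :
    TorsorSystem.ratio ((corner v)⁻¹ • s) s (corner₂_smul_le hF ht) = 1 := by
  have := hF.isTopologicalAddGroup
  have key : ∀ w : Kˣ, (w : K) ∈ F.O → ∀ x ∈ (baseLattice (Fin 2) hF).1,
      matAct (Fin 2) (corner w) x - x ∈ (corner₂ t • baseLattice (Fin 2) hF).1 := fun w hw x hx => by
    refine (F.mem_map_iff (Fin 2) (corner₂ t) _).2 fun i => ?_
    rw [← map_inv]
    refine (matAct_diagGL ![1, t⁻¹] (matAct (Fin 2) (corner w) x - x) i).symm ▸ ?_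
    fin_cases i
    · change (1 : K) * (matAct (Fin 2) (corner w) x 0 - x 0) ∈ F.O
      rw [one_mul, matAct_corner_zero]
      exact sub_mem (mul_mem hw (hx 0)) (hx 0)
    · change ((t⁻¹ : Kˣ) : K) * (matAct (Fin 2) (corner w) x 1 - x 1) ∈ F.O
      rw [matAct_corner_one, sub_self, mul_zero]
      exact zero_mem _
  refine (latticeSystem (Fin 2) hF).ratio_smul_eq_one _ ?_ ?_ s
  · rw [← map_inv]
    exact key _ hv'
  · rw [inv_inv]
    exact key _ hv

/-- Commutators of lifts of diagonal matrices. -/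
theorem extInl_eq_commutator (hF : F.IsNaturalTopology) {x y : Kˣ} {a : ℝ≥0ˣ}
    {e f f' : (haarTorsors hF (Fin 2)).ext (baseLattice (Fin 2) hF)}
    (he : (haarTorsors hF (Fin 2)).extHom _ e = corner y) (hf : (haarTorsors hF (Fin 2)).extHom _ f = corner x⁻¹)
    (hf' : (haarTorsors hF (Fin 2)).extHom _ f' = corner₂ x)
    (ha : (haarTorsors hF (Fin 2)).extInl _ a = ⁅e, f' * f⁆) :
    a = (Units.mk0 (F.q : ℝ≥0) q_ne_zero) ^ (-F.nu x y) := by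
  obtain ⟨τ, hτ⟩ := IsDiscreteValuationRing.exists_irreducible F.O
  obtain ⟨t, ht⟩ : ∃ t : Kˣ, (t : K) = τ := ⟨Units.mk0 τ fun h => hτ.ne_zero (Subtype.ext h), rfl⟩
  have hinj := (haarTorsors hF (Fin 2)).extInl_injective (baseLattice (Fin 2) hF)
  have hsurj := (haarTorsors hF (Fin 2)).extHom_surjective (baseLattice (Fin 2) hF)
  have hcomm := (haarTorsors hF (Fin 2)).extInl_comm (baseLattice (Fin 2) hF)
  -- The pairing `c` takes both arguments in the upper left corner; `b` below takes the second one
  -- in the lower right corner.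
  obtain ⟨c, hc⟩ := exists_pairing ((haarTorsors hF (Fin 2)).extHom (baseLattice (Fin 2) hF)) hsurj
    ((haarTorsors hF (Fin 2)).extInl _) hinj ((haarTorsors hF (Fin 2)).extInl_range _) hcomm
    (corner (K := K)) corner fun d d' => diagGL_comm _ _
  obtain ⟨b, hb⟩ := exists_pairing ((haarTorsors hF (Fin 2)).extHom (baseLattice (Fin 2) hF)) hsurj
    ((haarTorsors hF (Fin 2)).extInl _) hinj ((haarTorsors hF (Fin 2)).extInl_range _) hcomm
    (corner (K := K)) corner₂ fun d d' => diagGL_comm _ _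
  -- The second entry of the commutator is a product of lifts of diag(1, x) and diag(1/x, 1), and
  -- the pairing is multiplicative in it.
  have ha' : a = b y x * (c y x)⁻¹ := hinj (by
    rw [ha, map_mul, hb y x e f' he hf', ← map_inv (c y), hc y x⁻¹ e f he hf]
    exact commutator_mul_right_of_central rfl (by rw [← hc y x⁻¹ e f he hf]; exact hcomm _))
  have hstab : ∀ u : F.Oˣ, corner (F.unitHom u) ∈ MulAction.stabilizer (GL (Fin 2) K) (baseLattice (Fin 2) hF) :=
    fun u => smul_baseLattice hF (corner_mem_congr (u : F.O).2 ((u⁻¹ : F.Oˣ) : F.O).2)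
  have hstab₂ : ∀ u : F.Oˣ, corner₂ (F.unitHom u) ∈ MulAction.stabilizer (GL (Fin 2) K) (baseLattice (Fin 2) hF) :=
    fun u => smul_baseLattice hF (diagGL_mem_congr (Fin.forall_fin_two.2 ⟨one_mem _, (u : F.O).2⟩)
      (Fin.forall_fin_two.2 ⟨by
        change (((1 : Kˣ)⁻¹ : Kˣ) : K) ∈ F.O
        rw [inv_one]
        exact one_mem _, ((u⁻¹ : F.Oˣ) : F.O).2⟩))
  have hcomm_stab : ∀ g g' : MulAction.stabilizer (GL (Fin 2) K) (baseLattice (Fin 2) hF), g * g' = g' * g →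
      ⁅(haarTorsors hF (Fin 2)).stabHom _ g, (haarTorsors hF (Fin 2)).stabHom _ g'⁆ = 1 := fun g g' h => by
    rw [← map_commutatorElement, commutatorElement_eq_one_iff_mul_comm.2 h, map_one]
  have c_unit : ∀ u v, c (F.unitHom v) (F.unitHom u) = 1 := fun u v => hinj (by
    rw [hc _ _ (TorsorSystem.stabHom _ _ ⟨_, hstab v⟩) (TorsorSystem.stabHom _ _ ⟨_, hstab u⟩) rfl rfl, map_one]
    exact hcomm_stab _ _ (Subtype.ext (diagGL_comm _ _)))
  have b_unit : ∀ u v, b (F.unitHom v) (F.unitHom u) = 1 := fun u v => hinj (by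
    rw [hb _ _ (TorsorSystem.stabHom _ _ ⟨_, hstab v⟩) (TorsorSystem.stabHom _ _ ⟨_, hstab₂ u⟩) rfl rfl, map_one]
    exact hcomm_stab _ _ (Subtype.ext (diagGL_comm _ _)))
  have c_self : ∀ y, c y y = 1 := fun y => hinj (by
    obtain ⟨e, he⟩ := hsurj (corner y)
    rw [hc y y e e he he, commutatorElement_self, map_one])
  have c_symm : ∀ x y, c x y = (c y x)⁻¹ := fun x y => hinj (by
    obtain ⟨e, he⟩ := hsurj (corner y)
    obtain ⟨f, hf⟩ := hsurj (corner x)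
    rw [map_inv, hc x y f e hf he, hc y x e f he hf, commutatorElement_inv])
  -- Conjugation by a lift of the permutation matrix interchanges the two corners and fixes the
  -- central commutator.
  have b_symm : ∀ x y, b x y = (b y x)⁻¹ := fun x y => hinj (by
    obtain ⟨e, he⟩ := hsurj (corner x)
    obtain ⟨f, hf⟩ := hsurj (corner₂ y)
    obtain ⟨w, hw⟩ := hsurj (swapGL K)
    have h1 := hb y x (w * f * w⁻¹) (w * e * w⁻¹)
      (by rw [map_mul, map_mul, map_inv, hw, hf]; exact swapGL_conj _ _)
      (by rw [map_mul, map_mul, map_inv, hw, he]; exact swapGL_conj _ _)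
    rw [map_inv, h1, commutatorElement_inv]
    have h2 : ⁅w * e * w⁻¹, w * f * w⁻¹⁆ = w * ⁅e, f⁆ * w⁻¹ := by
      rw [commutatorElement_def, commutatorElement_def]; group
    rw [h2, ← hb x y e f he hf, ← hcomm, mul_inv_cancel_right])
  have hstabcomm : ∀ (u : F.Oˣ) (g : GL (Fin 2) K) (hg : g • baseLattice (Fin 2) hF ≤ baseLattice (Fin 2) hF)
      (hug : corner (F.unitHom u) * g = g * corner (F.unitHom u))
      (f : (haarTorsors hF (Fin 2)).ext (baseLattice (Fin 2) hF)), (haarTorsors hF (Fin 2)).extHom _ f = g →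
      ∀ s : (haarTorsors hF (Fin 2)).Triv, ⁅(haarTorsors hF (Fin 2)).stabHom (baseLattice (Fin 2) hF) ⟨_, hstab u⟩, f⁆ =
        (haarTorsors hF (Fin 2)).extInl _ (TorsorSystem.ratio ((corner (F.unitHom u))⁻¹ • s) s hg) := by
    rintro u g hg hug f rfl s
    exact TorsorSystem.commutator_stabHom ⟨_, hstab u⟩ f hg hug s
  have : Nonempty (latticeSystem (Fin 2) hF).Lat := ⟨baseLattice (Fin 2) hF⟩
  obtain ⟨s⟩ := (haarTorsors hF (Fin 2)).nonempty_triv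
  have b_t : ∀ u, b (F.unitHom u) t = 1 := fun u => hinj (by
    obtain ⟨f, hf⟩ := hsurj (corner₂ t)
    rw [hb _ _ (TorsorSystem.stabHom _ _ ⟨_, hstab u⟩) f rfl hf,
      hstabcomm u _ (corner₂_smul_le hF ht) (diagGL_comm _ _) f hf s]
    exact congrArg _ (ratio_corner₂ hF ht (u : F.O).2 ((u⁻¹ : F.Oˣ) : F.O).2 s))
  -- The only nontrivial value: the commutator with a lift of diag(t, 1) is the modulus computed in
  -- `ratio_corner`.
  have c_t : ∀ u, c (F.unitHom u) t = (Units.mk0 (F.q : ℝ≥0) q_ne_zero) ^ (-ord F.O₁ (residue F.O (u : F.O))) :=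
      fun u => hinj (by
    obtain ⟨f, hf⟩ := hsurj (corner t)
    rw [hc _ _ (TorsorSystem.stabHom _ _ ⟨_, hstab u⟩) f rfl hf,
      hstabcomm u _ (corner_smul_le hτ ht hF) (diagGL_comm _ _) f hf s]
    refine congrArg _ (Units.ext (NNReal.coe_injective ?_))
    rw [Units.val_zpow_eq_zpow_val, NNReal.coe_zpow]
    exact ratio_corner hτ ht hF (u : F.O).2 ((u⁻¹ : F.Oˣ) : F.O).2 s)
  -- Antisymmetry only says that the square is 1; positivity of the values excludes -1.
  have b_tt : b t t = 1 := by
    have h1 : b t t * b t t = 1 := mul_eq_one_iff_eq_inv.2 (b_symm t t)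
    refine Units.ext ((pow_eq_one_iff_of_nonneg (zero_le) two_ne_zero).1 ?_)
    rw [sq]
    exact congrArg Units.val h1
  -- With both arguments split into a unit and a power of `t`, only the values of `c` on a unit and
  -- `t` survive, and their exponents combine to minus `F.nu`.
  obtain ⟨u, i, rfl⟩ := exists_unitHom_mul_zpow hτ ht x
  obtain ⟨v, j, rfl⟩ := exists_unitHom_mul_zpow hτ ht y
  rw [ha', pairing_mul_zpow, pairing_mul_zpow, b_unit, b_t, b_symm t, b_t, b_tt, c_unit, c_t, c_symm t, c_t, c_self,
    nu_eq hτ ht]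
  simp only [one_zpow, inv_one, mul_one, one_mul, ← zpow_neg, ← zpow_mul, ← zpow_add]
  congr 1
  ring

/-- The character of `K₂(K)` defined by Haar measures is unramified. -/
theorem isUnramifiedCharacter_of_hatHom (a : ℂ)
    (Φ : Steinberg.tildeSL₂ K ⋊[(Steinberg.hatData K).φ] Kˣ →*
      (Matrix.GeneralLinearGroup.det.comp ((haarTorsors hF (Fin 2)).extHom (baseLattice (Fin 2) hF))).ker
        ⋊[(haarHatData hF).φ] Kˣ)
    (κ : Steinberg.K₂ K →* ℝ≥0ˣ)
    (h1 : ∀ k, Φ ((Steinberg.hatData K).ext.inl k) = (haarHatData hF).ext.inl (κ k))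
    (h2 : ∀ x, (haarHatData hF).ext.rightHom (Φ x) = (Steinberg.hatData K).ext.rightHom x) :
    IsUnramifiedCharacter F a ((cpowHom a).comp κ) := by
  intro x y A B k hA hB hk
  obtain ⟨e, he⟩ := (haarTorsors hF (Fin 2)).extHom_surjective (baseLattice (Fin 2) hF) (corner y)
  obtain ⟨f, hf⟩ := (haarTorsors hF (Fin 2)).extHom_surjective (baseLattice (Fin 2) hF) (corner x⁻¹)
  obtain ⟨f', hf'⟩ := (haarTorsors hF (Fin 2)).extHom_surjective (baseLattice (Fin 2) hF) (corner₂ x)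
  have h4 := HatData.map_inl_eq_commutator (Steinberg.hatData K)
    ((haarTorsors hF (Fin 2)).extHom (baseLattice (Fin 2) hF)) ((haarTorsors hF (Fin 2)).extHom_surjective _)
    ((haarTorsors hF (Fin 2)).extInl _) ((haarTorsors hF (Fin 2)).extInl_injective _)
    ((haarTorsors hF (Fin 2)).extInl_range _) ((haarTorsors hF (Fin 2)).extInl_comm _) Φ κ h1 h2 hA hB hk he hf hf'
  -- So `κ` maps the symbol to the power of q with exponent minus `F.nu x y`; raising to the power
  -- `a` gives the prescribed value.
  have h5 := extInl_eq_commutator hF he hf hf' h4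
  change ((cpowHom a (κ k) : ℂˣ) : ℂ) = _
  rw [h5, map_zpow, Units.val_zpow_eq_zpow_val, zpow_neg, ← inv_zpow, Complex.cpow_neg]
  rfl

end TwoDimLocalField

end TwoDim

theorem theorem2 {K : Type u} [Field K] [TopologicalSpace K] (F : TwoDim.TwoDimLocalField K)
    (hF : F.IsNaturalTopology) :
    (∀ (n : ℕ), 1 ≤ n → ∀ a : Fin n → ℂ,
      (TwoDim.IsAbelianCat (TwoDim.TwoDimLocalField.PrincipalSeries hF a) ∧
        TwoDim.IsSmoothAction (F.filtration (Fin n × Fin 2))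
          (TwoDim.TwoDimLocalField.principalSeriesAction hF a)) ∧
      (TwoDim.IsAbelianCat ((TwoDim.TwoDimLocalField.principalSeriesAction hF a).comap
          (F.congr (Fin n × Fin 2) 0).subtype).Equivariant ∧
        TwoDim.ContainsVect ℂ ((TwoDim.TwoDimLocalField.principalSeriesAction hF a).comap
          (F.congr (Fin n × Fin 2) 0).subtype).Equivariant)) ∧
    (∀ a : ℂ, ∃ χ : TwoDim.Steinberg.K₂ K →* ℂˣ, TwoDim.IsUnramifiedCharacter F a χ ∧
      ∃ T : TwoDim.GLinearFunctor (TwoDim.steinbergAction χ)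
          ((TwoDim.TwoDimLocalField.principalSeriesAction hF (fun _ : Fin 1 => a)).comap
            (TwoDim.oneBlock K)),
        T.T.Full ∧ T.T.Faithful) := by
  refine ⟨fun n _ a => ?_, fun a => ?_⟩
  · have h := TwoDim.isAbelianCat_ind (F.filtration (Fin n × Fin 2))
      (TwoDim.TwoDimLocalField.parabolicAction hF a)
    exact ⟨⟨h, TwoDim.Ind.isSmoothAction _ _⟩, TwoDim.GAction.isAbelianCat_equivariant _ h,
      TwoDim.containsVect_of_splitting (TwoDim.cpowProd a) _ (F.filtration (Fin n × Fin 2))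
        ⟨TwoDim.TwoDimLocalField.parabolicSplitting hF n⟩⟩
  -- One morphism of extensions serves both claims: its restriction κ to the kernels defines the
  -- character, and the morphism itself defines the functor.
  · obtain ⟨Φ, κ, h1, h2⟩ := TwoDim.TwoDimLocalField.exists_steinbergHatHom hF
    exact ⟨(TwoDim.cpowHom a).comp κ,
      TwoDim.TwoDimLocalField.isUnramifiedCharacter_of_hatHom hF a Φ κ h1 h2,
      TwoDim.TwoDimLocalField.exists_gLinearFunctor hF a Φ κ h1 h2⟩
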